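/- Let $F\subset\mathbb C$ be a subfield, let $g_2,g_3\in F$ with $g_2^3-27g_3^2\neq 0$, let $E: y^2=4x^3-g_2x-g_3$, $U=E\setminus[0]$, $\omega=dx/y$, $\eta=x\,dx/y$, and let $\Gamma\subset\mathbb C$ be the period lattice of $(E,\omega)$, that is $g_2(\Gamma)=g_2$ and $g_3(\Gamma)=g_3$, so that $z\mapsto(\wp(z),\wp'(z))$ uniformizes $E(\mathbb C)$. *Connection functions.* Let $\sigma$ be the Weierstrass sigma function of $\Gamma$, $\zeta=\sigma'/\sigma$, $e_2^*=\lim_{u\to+0}\sum_{\gamma\in\Gamma\setminus 0}\gamma^{-2}|\gamma|^{-2u}$, $\theta(z)=\exp(-e_2^*z^2/2)\sigma(z)$, $\Theta(z,w)=\theta(z+w)/(\theta(z)\theta(w))$, $F_1(z)=\lim_{w\to0}(\Theta(z,w)-w^{-1})$, $\Xi(z,w)=\exp(-F_1(z)w)\Theta(z,w)$, and define $L_n(z)$, for $z\notin\Gamma$, by the Laurent expansion $\Xi(z,w)=\sum_{n\ge0}L_n(z)w^{n-1}$ at $w=0$. *The logarithm sheaf.* Let $H^1_{dR}(E)$ be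 the space of differentials of the second kind on $E$ modulo exact ones, $\underline\omega,\underline\eta$ the classes of $\omega,\eta$, $\mathcal H=H^1_{dR}(E)^\vee$, and $\mathcal H_U=\mathcal H\otimes\mathcal O_U$ with the trivial connection. Fix an affine open covering $(U_i)$ of $E$ and functions $u_i\in\Gamma(U_i,\mathcal O_E([0]))$ such that $\eta_i:=\eta+du_i\in\Gamma(U_i,\Omega^1_E)$, $u_{ij}:=u_j-u_i\in\Gamma(U_i\cap U_j,\mathcal O_E)$, and $(\zeta-u_i)(0)=0$ if $[0]\in U_i$. The sheaf $\mathcal{L}og^{(1)}$ is obtained by pasting $\mathcal O_{U_i}e_i\oplus\mathcal H_{U_i}$, with $\nabla(e_i)=\underline\omega^\vee\otimes\omega+\underline\eta^\vee\otimes\eta_i$, by $e_i=e_j-u_{ij}\underline\eta^\vee$, and $\mathcal{L}og^N=\mathrm{Sym}^N\mathcal{L}og^{(1)}$. On $U$ it is $\mathrm{Sym}^N(\mathcal O_Ue\oplus\mathcal H_U)$ with $e=e_i-u_i\underline\eta^\vee$ and $\nabla(e)=\underline\omega^\vee\otimes\omega+\underline\eta^\vee\otimes\eta$; put $\underline\omega^{m,n}=e^{a}(\underline\omega^{\vee})^m(\underline\eta^{\vee})^n/a!$,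 $a=N-m-n$. The projections $\mathcal{L}og^{N+1}\to\mathcal{L}og^N$ send $\underline\omega^{m,n}$ to $\underline\omega^{m,n}$ if $m+n\le N$ and to $0$ if $m+n=N+1$. The $e_i$ with $[0]\in U_i$ have the same value $e_{[0]}$ at $[0]$, and the fibre of $\mathcal{L}og^N$ at $[0]$ is identified with $\prod_{j=0}^N\mathrm{Sym}^j\mathcal H$ by $e_{[0]}^a(\underline\omega^{\vee})^m(\underline\eta^{\vee})^n/a!\mapsto(\underline\omega^{\vee})^m(\underline\eta^{\vee})^n$. The residue of a class in $H^1_{dR}(U,\mathcal{L}og^N)$ is defined by representing it by a Čech cocycle $(\xi_i,\alpha_{ij})$ with $\xi_i\in\Gamma(U_i,\mathcal{L}og^N\otimes\Omega^1_E(\log[0]))$ and $\alpha_{ij}\in\Gamma(U_i\cap U_j,\mathcal{L}og^N)$, and taking the residue of $\xi_i$ at $[0]$ for any $i$ with $[0]\in U_i$. A *polylogarithm class* is a system of classes $\mathrm{pol}^N\in H^1_{dR}(U,\mathcal H_U^\vee\otimes\mathcal{L}og^N)=\mathcal H^\vee\otimes H^1_{dR}(U,\mathcal{L}og^N)$, compatible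 with the projections, whose residue is the identity in $\mathcal H^\vee\otimes\mathcal H\subset\mathcal H^\vee\otimes\prod_{j\ge0}\mathrm{Sym}^j\mathcal H$ (its component at level $N$ is the one in degrees $j\le N$, which is $0$ for $N=0$). A *polylogarithm sheaf* is a system of extensions $0\to\mathcal{L}og^N_U\to\mathcal P^N\to\mathcal H_U\to0$ of locally free modules of finite rank with connection on $U$ whose extension classes are the components $\mathrm{pol}^N$ of a polylogarithm class. **Theorem.** (a) For every $n\ge0$ there is a unique function $L_n\in\Gamma(U,\mathcal O_U)$, defined over $F$, whose pull-back by the uniformization is $L_n(z)$; and $\underline\omega,\underline\eta$ form a basis of $H^1_{dR}(E)$ (whose dual basis is $\underline\omega^\vee,\underline\eta^\vee$). (b) Let $$\boldsymbol\omega^\vee=\underline\omega^{0,0}\otimes\eta-\sum_{n=1}^N(-1)^nL_n\,\underline\omega^{1,n-1}\otimes\omega,\qquad \boldsymbol\eta^\vee=-\sum_{n=0}^N(-1)^nL_n\,\underline\omega^{0,n}\otimes\omega$$ in $\Gamma(U,\mathcal{L}og^N\otimes\Omega^1_U)$, and $\boldsymbol p^N=\underline\omega\otimes[\boldsymbol\omega^\vee]+\underline\eta\otimes[\boldsymbol\eta^\vee]\in\mathcal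 H^\vee\otimes H^1_{dR}(U,\mathcal{L}og^N)$. For every $N$ the residue of $\boldsymbol p^N$ is well defined and is the identity $\underline\omega\otimes\underline\omega^\vee+\underline\eta\otimes\underline\eta^\vee$ (for $N=0$: it is $0$). The system $(\boldsymbol p^N)_N$ is the polylogarithm class, and it is the only one. (c) The modules $\mathcal H_U\oplus\mathcal{L}og^N_U$, with the connection which is the one of $\mathcal{L}og^N$ on the second summand and satisfies $\nabla(\underline\omega^\vee)=\boldsymbol\omega^\vee$, $\nabla(\underline\eta^\vee)=\boldsymbol\eta^\vee$ on the first, are a polylogarithm sheaf, and every polylogarithm sheaf is isomorphic to it, as an extension of modules with connection, for every $N$. -/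

import Mathlib

open scoped TensorProduct Topology Nat
open Filter

universe u v w

noncomputable section

/-! ### The Kronecker theta function and the connection functions of a lattice -/

namespace KroneckerTheta

variable (L : PeriodPair)

/-- The Weierstrass sigma function of the lattice. -/
def sigma (z : ℂ) : ℂ :=
  z * ∏' γ : {γ : L.lattice // γ ≠ 0},
    ((1 - z / (γ : ℂ)) * Complex.exp (z / (γ : ℂ) + z ^ 2 / (2 * (γ : ℂ) ^ 2)))

/-- The Weierstrass zeta function `σ' / σ`. -/
def zeta (z : ℂ) : ℂ := deriv (sigma L) z / sigma L z

/-- The number `e₂^* = lim_{u → +0} ∑_{γ ≠ 0} γ⁻² |γ|^{-2u}`. -/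
def eTwoStar : ℂ :=
  limUnder (𝓝[>] (0 : ℝ)) fun t : ℝ =>
    ∑' γ : {γ : L.lattice // γ ≠ 0}, ((γ : ℂ) ^ 2)⁻¹ * ((‖(γ : ℂ)‖ ^ (-2 * t) : ℝ) : ℂ)

/-- The reduced theta function of the divisor `[0]`, normalized by `θ'(0) = 1`. -/
def theta (z : ℂ) : ℂ := Complex.exp (-eTwoStar L * z ^ 2 / 2) * sigma L z

/-- The Kronecker theta function `Θ(z,w)`. -/
def Theta (z w : ℂ) : ℂ := theta L (z + w) / (theta L z * theta L w)

/-- `F₁(z) = lim_{w → 0} (Θ(z,w) - w⁻¹)`. -/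
def FOne (z : ℂ) : ℂ := limUnder (𝓝[≠] (0 : ℂ)) fun w => Theta L z w - w⁻¹

/-- `Ξ(z,w) = exp(-F₁(z) w) Θ(z,w)`. -/
def Xi (z w : ℂ) : ℂ := Complex.exp (-FOne L z * w) * Theta L z w

/-- The connection function `L_n(z)`: the coefficient of `w ^ (n - 1)` in the Laurent expansion
of `Ξ(z,w)` at `w = 0`, that is, the coefficient of `w ^ n` in the Taylor expansion of `w Ξ(z,w)`,
a function which extends holomorphically to `w = 0` with value `1`. -/
def connFun (n : ℕ) (z : ℂ) : ℂ :=
  iteratedDeriv n (Function.update (fun w => w * Xi L z w) 0 1) 0 / (n ! : ℂ)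

end KroneckerTheta

namespace EllPolylog

/-! ### The elliptic curve `E : y² = 4x³ - g₂x - g₃` and its function field -/

section Curve

variable {k : Type u} [Field k] (g₂ g₃ : k)

/-- The curve `y² = 4x³ - g₂x - g₃` in the coordinates `x`, `Y = y/2`. -/
def curve : WeierstrassCurve.Affine k := ⟨0, 0, 0, -g₂ / 4, -g₃ / 4⟩

/-- The coordinate ring of the affine curve `U = E \ [0]`. -/
abbrev CoordRing : Type u := (curve g₂ g₃).CoordinateRing

/-- The function field of `E`. -/
abbrev FunField : Type u := (curve g₂ g₃).FunctionField

/-- The coordinate `x`. -/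
def x : CoordRing g₂ g₃ := WeierstrassCurve.Affine.CoordinateRing.mk _ (Polynomial.C Polynomial.X)

/-- The coordinate `y`, which is `2Y`. -/
def y : CoordRing g₂ g₃ := 2 * WeierstrassCurve.Affine.CoordinateRing.mk _ Polynomial.X

/-- The invariant differential `ω = dx/y`, as a differential on `U`. Since `y` is not invertible on
`U`, it is written through `(27g₃ - 18g₂x) f + 3(2g₂x² - 3g₃x - g₂²/3) f' = g₂³ - 27g₃²`
where `f = 4x³ - g₂x - g₃`; see `y_smul_omega`. -/
def omega : Ω[CoordRing g₂ g₃⁄k] :=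
  (g₂ ^ 3 - 27 * g₃ ^ 2)⁻¹ •
    (((27 * algebraMap k _ g₃ - 18 * algebraMap k _ g₂ * x g₂ g₃) * y g₂ g₃) •
        KaehlerDifferential.D k (CoordRing g₂ g₃) (x g₂ g₃) +
      (2 * (6 * algebraMap k _ g₂ * x g₂ g₃ ^ 2 - 9 * algebraMap k _ g₃ * x g₂ g₃
          - algebraMap k _ g₂ ^ 2)) •
        KaehlerDifferential.D k (CoordRing g₂ g₃) (y g₂ g₃))

/-- The differential of the second kind `η = x dx/y`. -/
def eta : Ω[CoordRing g₂ g₃⁄k] := x g₂ g₃ • omega g₂ g₃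

theorem y_sq [CharZero k] : y g₂ g₃ ^ 2 =
    4 * x g₂ g₃ ^ 3 - algebraMap k _ g₂ * x g₂ g₃ - algebraMap k _ g₃ := by
  have h := AdjoinRoot.mk_self (f := (curve g₂ g₃).polynomial)
  have h4 : (algebraMap k (CoordRing g₂ g₃) 4) = 4 := map_ofNat _ 4
  have e₂ : 4 * algebraMap k (CoordRing g₂ g₃) (-g₂ / 4) = -algebraMap k _ g₂ := by
    rw [← h4, ← map_mul, ← map_neg]; congr 1; field_simp
  have e₃ : 4 * algebraMap k (CoordRing g₂ g₃) (-g₃ / 4) = -algebraMap k _ g₃ := by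
    rw [← h4, ← map_mul, ← map_neg]; congr 1; field_simp
  have hc (c : k) : WeierstrassCurve.Affine.CoordinateRing.mk (curve g₂ g₃)
      (Polynomial.C (Polynomial.C c)) = algebraMap k _ c := rfl
  have h' : WeierstrassCurve.Affine.CoordinateRing.mk (curve g₂ g₃) Polynomial.X ^ 2 -
      (x g₂ g₃ ^ 3 + algebraMap k _ (-g₂ / 4) * x g₂ g₃ + algebraMap k _ (-g₃ / 4)) = 0 := by
    have hp : (curve g₂ g₃).polynomial = Polynomial.X ^ 2 - (Polynomial.C Polynomial.X ^ 3 +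
        Polynomial.C (Polynomial.C (-g₂ / 4)) * Polynomial.C Polynomial.X +
          Polynomial.C (Polynomial.C (-g₃ / 4))) := by
      simp [WeierstrassCurve.Affine.polynomial, curve]
    rw [← hc, ← hc, ← h]
    refine Eq.trans ?_ (congrArg (AdjoinRoot.mk (curve g₂ g₃).polynomial) hp).symm
    simp only [map_sub, map_add, map_mul, map_pow]
    rfl
  have h'' := sub_eq_zero.mp h'
  rw [y, mul_pow, h'']
  linear_combination x g₂ g₃ * e₂ + e₃

theorem smul_aux {A : Type v} [CommRing A] [Algebra k A] (c₂ c₃ : k) {X Y : A}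
    (hy : Y ^ 2 = 4 * X ^ 3 - algebraMap k A c₂ * X - algebraMap k A c₃) :
    Y • (((27 * algebraMap k A c₃ - 18 * algebraMap k A c₂ * X) * Y) • KaehlerDifferential.D k A X +
      (2 * (6 * algebraMap k A c₂ * X ^ 2 - 9 * algebraMap k A c₃ * X
          - algebraMap k A c₂ ^ 2)) • KaehlerDifferential.D k A Y) =
      (c₂ ^ 3 - 27 * c₃ ^ 2) • KaehlerDifferential.D k A X := by
  have hd : (2 * Y) • KaehlerDifferential.D k A Y =
      (12 * X ^ 2 - algebraMap k A c₂) • KaehlerDifferential.D k A X := by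
    have h₁ := congrArg (KaehlerDifferential.D k A) hy
    have h4 : KaehlerDifferential.D k A 4 = 0 := by
      simpa using (KaehlerDifferential.D k A).map_natCast 4
    simp only [map_sub, Derivation.leibniz, Derivation.leibniz_pow, Derivation.map_algebraMap,
      h4, smul_zero, add_zero, sub_zero, ← Nat.cast_smul_eq_nsmul A, smul_smul,
      ← sub_smul] at h₁
    convert h₁ using 2 <;> push_cast <;> ring
  have e : Y • (2 * (6 * algebraMap k A c₂ * X ^ 2 - 9 * algebraMap k A c₃ * X
          - algebraMap k A c₂ ^ 2)) • KaehlerDifferential.D k A Y =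
        (6 * algebraMap k A c₂ * X ^ 2 - 9 * algebraMap k A c₃ * X
          - algebraMap k A c₂ ^ 2) • (2 * Y) • KaehlerDifferential.D k A Y := by
    rw [smul_smul, smul_smul]; congr 1; ring
  rw [smul_add, e, hd, smul_smul, smul_smul, ← add_smul, ← algebraMap_smul A (c₂ ^ 3 - 27 * c₃ ^ 2)]
  congr 1
  simp only [map_sub, map_mul, map_pow, map_ofNat]
  linear_combination (27 * algebraMap k A c₃ - 18 * algebraMap k A c₂ * X) * hy

theorem y_smul_omega [CharZero k] (h : g₂ ^ 3 - 27 * g₃ ^ 2 ≠ 0) :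
    y g₂ g₃ • omega g₂ g₃ = KaehlerDifferential.D k (CoordRing g₂ g₃) (x g₂ g₃) := by
  have e := smul_aux g₂ g₃ (y_sq g₂ g₃)
  rw [omega, smul_comm, e, smul_smul, inv_mul_cancel₀ h, one_smul]

/-- The closed points of `E`: the point `[0]` (`none`) and the maximal ideals of the coordinate
ring of `U = E \ [0]`. -/
abbrev Pt : Type u := Option (MaximalSpectrum (CoordRing g₂ g₃))

variable {g₂ g₃}

/-- The order of the pole at `[0]` of a nonzero function `r` on `U`: the degree of its norm to the
ring `k[x]`. For instance it is `2` for `x` and `3` for `y`. -/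
def poleOrder (r : CoordRing g₂ g₃) : ℕ := (Algebra.norm (Polynomial k) r).natDegree

/-- `f` has a pole of order at most `n` at `[0]`. -/
def PoleLE (f : FunField g₂ g₃) (n : ℕ) : Prop :=
  ∃ a b : CoordRing g₂ g₃, b ≠ 0 ∧ f * algebraMap _ _ b = algebraMap _ _ a ∧
    poleOrder a ≤ poleOrder b + n

/-- `f` is regular at `[0]` and vanishes there. -/
def VanishesAtZero (f : FunField g₂ g₃) : Prop :=
  ∃ a b : CoordRing g₂ g₃, b ≠ 0 ∧ f * algebraMap _ _ b = algebraMap _ _ a ∧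
    poleOrder a < poleOrder b

/-- `t` is a local parameter at `[0]`. -/
def IsLocalParameter (t : FunField g₂ g₃) : Prop :=
  ∃ a b : CoordRing g₂ g₃, a ≠ 0 ∧ b ≠ 0 ∧ t * algebraMap _ _ b = algebraMap _ _ a ∧
    poleOrder b = poleOrder a + 1

/-- `f` lies in the local ring `𝒪_{E,P}`. -/
def RegularAt : Pt g₂ g₃ → FunField g₂ g₃ → Prop
  | none, f => PoleLE f 0
  | some m, f => ∃ a b : CoordRing g₂ g₃, b ∉ m.asIdeal ∧ f * algebraMap _ _ b = algebraMap _ _ a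

variable (g₂ g₃) in
/-- The rational differentials on `E`. -/
abbrev RatForm : Type u := Ω[FunField g₂ g₃⁄k]

variable (k) in
/-- The differential `d` on rational functions. -/
def dRat : FunField g₂ g₃ →ₗ[k] RatForm g₂ g₃ :=
  (KaehlerDifferential.D k (FunField g₂ g₃)).toLinearMap

/-- The restriction of a differential on `U` to the generic point. -/
def ratForm : Ω[CoordRing g₂ g₃⁄k] →ₗ[CoordRing g₂ g₃] RatForm g₂ g₃ :=
  KaehlerDifferential.map k k (CoordRing g₂ g₃) (FunField g₂ g₃)

/-- The stalk `Ω¹_{E,P}`: the sums of `f dg` with `f`, `g` in `𝒪_{E,P}`. -/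
def stalkForm (P : Pt g₂ g₃) : Submodule k (RatForm g₂ g₃) :=
  Submodule.span k {ξ | ∃ f g, RegularAt P f ∧ RegularAt P g ∧ ξ = f • dRat k g}

/-- The rational form `ξ` equals `f dlog t` with `t` a local parameter at `[0]` and `f` regular at
`[0]`, and its residue `f(0)` is `c`. -/
def HasLogResidue (ξ : RatForm g₂ g₃) (c : k) : Prop :=
  ∃ t f : FunField g₂ g₃, IsLocalParameter t ∧ RegularAt none f ∧
    ξ = (f * t⁻¹) • dRat k t ∧ VanishesAtZero (f - algebraMap k _ c)

variable (g₂ g₃)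

/-! ### The first de Rham cohomology of `E` -/

/-- The differentials of the second kind: the rational differentials which at every closed point
are the sum of a regular differential and of the differential of a rational function. -/
def secondKind : Submodule k (RatForm g₂ g₃) :=
  ⨅ P : Pt g₂ g₃, stalkForm P ⊔ LinearMap.range (dRat k (g₂ := g₂) (g₃ := g₃))

/-- `H¹_dR(E)`: the differentials of the second kind modulo the exact ones. -/
def H1dR : Submodule k (RatForm g₂ g₃ ⧸ LinearMap.range (dRat k (g₂ := g₂) (g₃ := g₃))) :=
  (secondKind g₂ g₃).map (Submodule.mkQ _)

/-- The class of a rational differential modulo exact differentials. -/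
def formClass (ξ : Ω[CoordRing g₂ g₃⁄k]) :
    RatForm g₂ g₃ ⧸ LinearMap.range (dRat k (g₂ := g₂) (g₃ := g₃)) :=
  Submodule.mkQ _ (ratForm ξ)

/-- `ℋ`, the dual of `H¹_dR(E)`. -/
abbrev H : Type u := Module.Dual k (H1dR g₂ g₃)

end Curve

/-! ### Symmetric powers of a rank three bundle with connection -/

section Sym

variable {k : Type u} [Field k] (B : Type v) [CommRing B] [Algebra k B]

/-- The symmetric algebra on the free module with basis `e`, `ω^∨`, `η^∨`
(the variables `0`, `1`, `2`). -/
abbrev SymAlg3 : Type v := MvPolynomial (Fin 3) B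

/-- The `N`-th symmetric power of the free module with basis `e`, `ω^∨`, `η^∨`. -/
def SymPow (N : ℕ) : Type v := ↥(MvPolynomial.homogeneousSubmodule (Fin 3) B N)

instance (N : ℕ) : AddCommGroup (SymPow B N) :=
  inferInstanceAs (AddCommGroup ↥(MvPolynomial.homogeneousSubmodule (Fin 3) B N))

instance {S : Type w} [CommRing S] [Algebra S B] (N : ℕ) : Module S (SymPow B N) :=
  inferInstanceAs (Module S ↥(MvPolynomial.homogeneousSubmodule (Fin 3) B N))

instance {S : Type w} [CommRing S] [Algebra S B] (N : ℕ) : IsScalarTower S B (SymPow B N) :=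
  inferInstanceAs (IsScalarTower S B ↥(MvPolynomial.homogeneousSubmodule (Fin 3) B N))

/-- The inclusion of the `N`-th symmetric power in the symmetric algebra. -/
def ofSymPow (N : ℕ) : SymPow B N →ₗ[B] SymAlg3 B :=
  (MvPolynomial.homogeneousSubmodule (Fin 3) B N).subtype

/-- The projection of the symmetric algebra to its part of degree `N`. -/
def toSymPow (N : ℕ) : SymAlg3 B →ₗ[B] SymPow B N :=
  (MvPolynomial.homogeneousComponent N).codRestrict (MvPolynomial.homogeneousSubmodule (Fin 3) B N)
    fun p => MvPolynomial.homogeneousComponent_mem N p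

variable (k) in
/-- The element `ω^{m,n} = e^a (ω^∨)^m (η^∨)^n / a!` of the `N`-th symmetric power, where
`a = N - m - n`; it is `0` if `m + n > N`. -/
def wBasis (N m n : ℕ) : SymPow B N :=
  toSymPow B N (MvPolynomial.C (algebraMap k B ((N - m - n)! : k)⁻¹) *
    (MvPolynomial.X 0 ^ (N - m - n) * MvPolynomial.X 1 ^ m * MvPolynomial.X 2 ^ n))

/-- The projection from the symmetric power `N + 1` to the symmetric power `N` which is induced by
the augmentation `e ↦ 1`, `ω^∨ ↦ 0`, `η^∨ ↦ 0`. It is the part of degree `N` in `e`, `ω^∨`, `η^∨`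
and of degree `1` in `T` of the substitution `e ↦ e + T`, which is the derivative with respect to
`e`; it sends `ω^{m,n}` to `ω^{m,n}`, or to `0` if `m + n = N + 1`. -/
def symProj (N : ℕ) : SymPow B (N + 1) →ₗ[B] SymPow B N :=
  toSymPow B N ∘ₗ (MvPolynomial.pderiv (0 : Fin 3)).toLinearMap ∘ₗ ofSymPow B (N + 1)

variable {B}

/-- The connection on the symmetric algebra for which `∇(ω^∨) = ∇(η^∨) = 0` and
`∇(e) = ω^∨ ⊗ ω + η^∨ ⊗ η`: the sum of `d` on the coefficients and of `∂/∂e` times `∇(e)`. -/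
def symConn (ω η : Ω[B⁄k]) : SymAlg3 B →ₗ[k] SymAlg3 B ⊗[B] Ω[B⁄k] :=
  (Finsupp.lsum k fun s : Fin 3 →₀ ℕ =>
      ((TensorProduct.mk B (SymAlg3 B) Ω[B⁄k] (MvPolynomial.monomial s 1)).restrictScalars k) ∘ₗ
        (KaehlerDifferential.D k B).toLinearMap) ∘ₗ
    ((MvPolynomial.basisMonomials (Fin 3) B).repr.toLinearMap.restrictScalars k) +
  ((((TensorProduct.mk B (SymAlg3 B) Ω[B⁄k]).flip ω) ∘ₗ
      LinearMap.mulRight B (MvPolynomial.X 1) +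
    ((TensorProduct.mk B (SymAlg3 B) Ω[B⁄k]).flip η) ∘ₗ
      LinearMap.mulRight B (MvPolynomial.X 2)) ∘ₗ
    (MvPolynomial.pderiv (0 : Fin 3)).toLinearMap).restrictScalars k

/-- The connection on the `N`-th symmetric power. -/
def symPowConn (ω η : Ω[B⁄k]) (N : ℕ) : SymPow B N →ₗ[k] SymPow B N ⊗[B] Ω[B⁄k] :=
  ((toSymPow B N).rTensor Ω[B⁄k]).restrictScalars k ∘ₗ symConn ω η ∘ₗ
    (ofSymPow B N).restrictScalars k

theorem symConn_monomial (ω η : Ω[B⁄k]) (s : Fin 3 →₀ ℕ) (b : B) :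
    symConn (k := k) ω η (MvPolynomial.monomial s b) =
      MvPolynomial.monomial s 1 ⊗ₜ KaehlerDifferential.D k B b +
      ((MvPolynomial.pderiv 0 (MvPolynomial.monomial s b) * MvPolynomial.X 1) ⊗ₜ ω +
        (MvPolynomial.pderiv 0 (MvPolynomial.monomial s b) * MvPolynomial.X 2) ⊗ₜ η) := by
  have : (MvPolynomial.basisMonomials (Fin 3) B).repr (MvPolynomial.monomial s b) =
      Finsupp.single s b := by
    rw [← mul_one b, ← smul_eq_mul, ← MvPolynomial.smul_monomial, map_smul,
      ← congrFun (MvPolynomial.coe_basisMonomials (Fin 3) B) s, Module.Basis.repr_self, Finsupp.smul_single]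
  simp [symConn, this]

theorem symConn_pderiv (ω η : Ω[B⁄k]) (p : SymAlg3 B) :
    (MvPolynomial.pderiv (0 : Fin 3)).toLinearMap.rTensor Ω[B⁄k] (symConn (k := k) ω η p) =
      symConn (k := k) ω η (MvPolynomial.pderiv 0 p) := by
  induction p using MvPolynomial.induction_on' with
  | add p q hp hq => simp only [map_add, hp, hq]
  | monomial s b =>
    have h (q : SymAlg3 B) (i : Fin 3) (hi : i ≠ 0) :
        MvPolynomial.pderiv 0 (q * MvPolynomial.X i) =
          MvPolynomial.pderiv 0 q * MvPolynomial.X i := by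
      rw [MvPolynomial.pderiv_mul, MvPolynomial.pderiv_X_of_ne hi, mul_zero, add_zero]
    have e : (MvPolynomial.pderiv (0 : Fin 3) (MvPolynomial.monomial s (1 : B))) ⊗ₜ[B]
        KaehlerDifferential.D k B b = (MvPolynomial.monomial (s - Finsupp.single 0 1) (1 : B)) ⊗ₜ[B]
          KaehlerDifferential.D k B (b * (s 0 : B)) := by
      rw [MvPolynomial.pderiv_monomial, one_mul, Derivation.leibniz, Derivation.map_natCast,
        smul_zero, zero_add, TensorProduct.tmul_smul, TensorProduct.smul_tmul',
        MvPolynomial.smul_monomial, smul_eq_mul, mul_one]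
    rw [symConn_monomial]
    simp only [map_add, LinearMap.rTensor_tmul, Derivation.coeFn_coe,
      h _ 1 (by decide), h _ 2 (by decide), e]
    conv_rhs => rw [MvPolynomial.pderiv_monomial, symConn_monomial, ← MvPolynomial.pderiv_monomial]

theorem symProj_toSymPow (N : ℕ) :
    symProj B N ∘ₗ toSymPow B (N + 1) =
      toSymPow B N ∘ₗ (MvPolynomial.pderiv (0 : Fin 3)).toLinearMap := by
  refine LinearMap.ext fun p => Subtype.ext ?_
  change MvPolynomial.homogeneousComponent N (MvPolynomial.pderiv 0
    (MvPolynomial.homogeneousComponent (N + 1) p)) =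
      MvPolynomial.homogeneousComponent N (MvPolynomial.pderiv 0 p)
  induction p using MvPolynomial.induction_on' with
  | add p q hp hq => simp only [map_add, hp, hq]
  | monomial s b =>
    have hs : (MvPolynomial.monomial s b).IsHomogeneous s.degree :=
      MvPolynomial.isHomogeneous_monomial b rfl
    rw [MvPolynomial.homogeneousComponent_of_mem hs]
    split_ifs with hN
    · rfl
    · rw [map_zero, map_zero]
      rcases Nat.eq_zero_or_pos s.degree with h0 | h0
      · rw [MvPolynomial.pderiv_monomial]
        have : s 0 = 0 := by rw [(Finsupp.degree_eq_zero_iff s).mp h0]; rfl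
        simp [this]
      · rw [MvPolynomial.homogeneousComponent_of_mem hs.pderiv, if_neg (by omega)]

theorem symPowConn_proj (ω η : Ω[B⁄k]) (N : ℕ) :
    ((symProj B N).rTensor Ω[B⁄k]).restrictScalars k ∘ₗ symPowConn ω η (N + 1) =
      symPowConn ω η N ∘ₗ (symProj B N).restrictScalars k := by
  refine LinearMap.ext fun s => ?_
  have h₁ : ofSymPow B N (symProj B N s) = MvPolynomial.pderiv 0 (ofSymPow B (N + 1) s) := by
    have h := (MvPolynomial.IsHomogeneous.pderiv (i := (0 : Fin 3))
      ((MvPolynomial.mem_homogeneousSubmodule (N + 1) s.1).mp s.2))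
    exact (MvPolynomial.homogeneousComponent_of_mem h).trans (if_pos (by omega))
  change (symProj B N).rTensor Ω[B⁄k] ((toSymPow B (N + 1)).rTensor Ω[B⁄k]
      (symConn ω η (ofSymPow B (N + 1) s))) =
    (toSymPow B N).rTensor Ω[B⁄k] (symConn ω η (ofSymPow B N (symProj B N s)))
  rw [h₁, ← symConn_pderiv, ← LinearMap.comp_apply, ← LinearMap.comp_apply,
    ← LinearMap.rTensor_comp, ← LinearMap.rTensor_comp, symProj_toSymPow]

end Sym

/-! ### The logarithm sheaf -/

section Log

variable {k : Type u} [Field k] (g₂ g₃ : k)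

/-- The restriction to `U` of the `N`-th logarithm sheaf: the `N`-th symmetric power of
`𝒪_U e ⊕ ℋ_U`. -/
abbrev LogU (N : ℕ) : Type u := SymPow (CoordRing g₂ g₃) N

/-- Sections over `U` of the logarithm sheaf tensor `Ω¹`. -/
abbrev LogUForm (N : ℕ) : Type u := LogU g₂ g₃ N ⊗[CoordRing g₂ g₃] Ω[CoordRing g₂ g₃⁄k]

/-- The connection of the logarithm sheaf on `U`, with `∇(e) = ω^∨ ⊗ ω + η^∨ ⊗ η`. -/
def logConn (N : ℕ) : LogU g₂ g₃ N →ₗ[k] LogUForm g₂ g₃ N :=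
  symPowConn (omega g₂ g₃) (eta g₂ g₃) N

/-- `H¹_dR(U, Log^N)`; as `U` is affine, it is computed by global sections over `U`. -/
abbrev H1Log (N : ℕ) : Type u := LogUForm g₂ g₃ N ⧸ LinearMap.range (logConn g₂ g₃ N)

/-- The map from `H¹_dR(U, Log^(N+1))` to `H¹_dR(U, Log^N)` induced by the projection. -/
def h1Proj (N : ℕ) : H1Log g₂ g₃ (N + 1) →ₗ[k] H1Log g₂ g₃ N :=
  Submodule.mapQ _ _ (((symProj (CoordRing g₂ g₃) N).rTensor Ω[CoordRing g₂ g₃⁄k]).restrictScalars k) (by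
    rintro _ ⟨s, rfl⟩
    exact ⟨symProj _ N s, (LinearMap.congr_fun (symPowConn_proj (omega g₂ g₃) (eta g₂ g₃) N) s).symm⟩)

/-- Rational sections of the symmetric algebra of the first logarithm sheaf, written in the
trivialization `e`, `ω^∨`, `η^∨` over `U`. -/
abbrev RatLog : Type u := SymAlg3 (FunField g₂ g₃)

/-- Rational sections of the symmetric algebra of the first logarithm sheaf tensor `Ω¹`. -/
abbrev RatLogForm : Type u := RatLog g₂ g₃ ⊗[FunField g₂ g₃] RatForm g₂ g₃

variable {g₂ g₃}

/-- The restriction of a section over `U` of `Log^N ⊗ Ω¹` to the generic point. -/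
def ratLogForm (N : ℕ) : LogUForm g₂ g₃ N →ₗ[CoordRing g₂ g₃] RatLogForm g₂ g₃ :=
  TensorProduct.lift (LinearMap.mk₂ (CoordRing g₂ g₃)
    (fun s ξ => MvPolynomial.map (algebraMap (CoordRing g₂ g₃) (FunField g₂ g₃)) (ofSymPow _ N s) ⊗ₜ ratForm ξ)
    (fun s s' ξ => by rw [map_add, map_add, TensorProduct.add_tmul])
    (fun r s ξ => by
      rw [map_smul, MvPolynomial.smul_eq_C_mul, map_mul, MvPolynomial.map_C,
        ← MvPolynomial.smul_eq_C_mul, algebraMap_smul, TensorProduct.smul_tmul'])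
    (fun s ξ ξ' => by rw [map_add, TensorProduct.tmul_add])
    (fun r s ξ => by
      rw [map_smul, ← algebraMap_smul (FunField g₂ g₃) r (ratForm ξ), TensorProduct.tmul_smul,
        algebraMap_smul]))

/-- The connection of the logarithm sheaf on rational sections. -/
def ratConn : RatLog g₂ g₃ →ₗ[k] RatLogForm g₂ g₃ :=
  symConn (ratForm (omega g₂ g₃)) (ratForm (eta g₂ g₃))

/-- The change of trivialization from `e`, `ω^∨`, `η^∨` to `e_i`, `ω^∨`, `η^∨`, where
`e = e_i - u_i η^∨`. -/
def toChart (f : FunField g₂ g₃) : RatLog g₂ g₃ →ₐ[FunField g₂ g₃] RatLog g₂ g₃ :=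
  MvPolynomial.aeval ![MvPolynomial.X 0 - MvPolynomial.C f * MvPolynomial.X 2,
    MvPolynomial.X 1, MvPolynomial.X 2]

/-- The coefficients, which are rational differentials, of a rational section of `Log^N ⊗ Ω¹` in
the trivialization `e_i`, `ω^∨`, `η^∨`. -/
def chartForm (f : FunField g₂ g₃) (s : Fin 3 →₀ ℕ) :
    RatLogForm g₂ g₃ →ₗ[FunField g₂ g₃] RatForm g₂ g₃ :=
  (TensorProduct.lid _ _).toLinearMap ∘ₗ
    (MvPolynomial.lcoeff (FunField g₂ g₃) s ∘ₗ (toChart f).toLinearMap).rTensor (RatForm g₂ g₃)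

/-- The rational section `s` lies in the stalk at `P` of the sheaf with basis the monomials in
`e_i`, `ω^∨`, `η^∨`. -/
def LogRegularAt (f : FunField g₂ g₃) (P : Pt g₂ g₃) (s : RatLog g₂ g₃) : Prop :=
  ∀ m, RegularAt P ((toChart f s).coeff m)

end Log

/-! ### Complex uniformization and local trivializations of the logarithm sheaf -/

section Residue

variable {k : Type u} [Field k] {g₂ g₃ : k} [Algebra k ℂ] (L : PeriodPair)

/-- The pull-back of a function on `U` by the uniformization `z ↦ (℘(z), ℘'(z))`: the function
`p(x) + q(x) Y`, with `Y = y/2`, becomes `p(℘(z)) + q(℘(z)) ℘'(z)/2`. -/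
def pullback (r : CoordRing g₂ g₃) (z : ℂ) : ℂ :=
  Polynomial.aeval (L.weierstrassP z)
      ((WeierstrassCurve.Affine.CoordinateRing.basis (curve g₂ g₃)).repr r 0) +
    Polynomial.aeval (L.weierstrassP z)
        ((WeierstrassCurve.Affine.CoordinateRing.basis (curve g₂ g₃)).repr r 1) *
      (L.derivWeierstrassP z / 2)

/-- The pull-back of a rational function, written as a quotient of functions on `U`. -/
def pullbackRat (f : FunField g₂ g₃) (z : ℂ) : ℂ :=
  pullback L (IsLocalization.sec (nonZeroDivisors (CoordRing g₂ g₃)) f).1 z /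
    pullback L (IsLocalization.sec (nonZeroDivisors (CoordRing g₂ g₃)) f).2.1 z

variable (g₂ g₃) in
/-- An affine open covering `(U_i)` of `E` with functions `u_i ∈ Γ(U_i, 𝒪_E([0]))` such that
`η_i = η + du_i ∈ Γ(U_i, Ω¹)` and `u_{ij} = u_j - u_i ∈ Γ(U_i ∩ U_j, 𝒪)`; then `(η_i, u_{ij})` is a
cocycle which represents the class of `η` in `H¹_dR(E)`. They are normalized so that `ζ - u_i`
vanishes at `0` if `[0] ∈ U_i`. The open set `U_i` is the complement of a finite set of closed
points, and it is affine if and only if this set is not empty. -/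
structure LogCover (I : Type w) where
  /-- The complement of `U_i`. -/
  compl : I → Finset (Pt g₂ g₃)
  affine : ∀ i, (compl i).Nonempty
  covers : ∀ P, ∃ i, P ∉ compl i
  /-- The function `u_i`. -/
  u : I → FunField g₂ g₃
  u_regular : ∀ i, ∀ P ∉ compl i, P ≠ none → RegularAt P (u i)
  u_pole : ∀ i, none ∉ compl i → PoleLE (u i) 1
  eta_regular : ∀ i, ∀ P ∉ compl i, ratForm (eta g₂ g₃) + dRat k (u i) ∈ stalkForm P
  u_sub_regular : ∀ i j, ∀ P ∉ compl i, P ∉ compl j → RegularAt P (u j - u i)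
  normalized : ∀ i, none ∉ compl i →
    Tendsto (fun z => KroneckerTheta.zeta L z - pullbackRat L (u i) z) (𝓝[≠] 0) (𝓝 0)

variable {L} {I : Type w}

/-- The `N`-th logarithm sheaf on `E` is obtained by pasting the free modules on the `U_i` with
basis the monomials of degree `N` in `e_i`, `ω^∨`, `η^∨` by `e_i = e_j - u_{ij} η^∨`; its rational
sections are written in terms of `e = e_i - u_i η^∨`. The class `c ∈ H¹_dR(U, Log^N)` has residue `r`
if it is the restriction of a class of logarithmic de Rham cohomology of `E` given by a Čech
cocycle `(ξ_i, α_{ij})`, with `ξ_i ∈ Γ(U_i, Log^N ⊗ Ω¹(log [0]))` of residue `r` at `[0]` and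
`α_{ij} ∈ Γ(U_i ∩ U_j, Log^N)`. Thus there are a form `ξ` on `U` of class `c` and sections
`α_i ∈ Γ(U_i ∖ [0], Log^N)` with `ξ_i = ξ + ∇(α_i)` and `α_{ij} = α_j - α_i`. The residue is written
in the basis of monomials in `e_[0]`, `ω^∨`, `η^∨` of the fibre at `[0]`, where `e_[0]` is the common
value at `[0]` of the `e_i` with `[0] ∈ U_i`. -/
def HasResidue (𝔘 : LogCover g₂ g₃ L I) (N : ℕ) (c : H1Log g₂ g₃ N) (r : SymPow k N) : Prop :=
  ∃ (ξ : LogUForm g₂ g₃ N) (α : I → RatLog g₂ g₃),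
    Submodule.Quotient.mk ξ = c ∧
    (∀ i, (α i).IsHomogeneous N) ∧
    (∀ i, ∀ P ∉ 𝔘.compl i, P ≠ none → LogRegularAt (𝔘.u i) P (α i)) ∧
    (∀ i j, ∀ P ∉ 𝔘.compl i, P ∉ 𝔘.compl j → LogRegularAt (𝔘.u i) P (α j - α i)) ∧
    (∀ i, ∀ P ∉ 𝔘.compl i, P ≠ none → ∀ m,
      chartForm (𝔘.u i) m (ratLogForm N ξ + ratConn (α i)) ∈ stalkForm P) ∧
    ∀ i, none ∉ 𝔘.compl i → ∀ m,
      HasLogResidue (chartForm (𝔘.u i) m (ratLogForm N ξ + ratConn (α i)))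
        ((ofSymPow k N r).coeff m)

/-- The splitting of the fibre at `[0]` of `Log^N` as the sum of the `Sym^j ℋ` for `j ≤ N`, which
sends `ω^{m,n} = e_[0]^a (ω^∨)^m (η^∨)^n / a!` to `(ω^∨)^m (η^∨)^n`; here `b` is the basis
`ω`, `η` of `H¹_dR(E)`, with dual basis `ω^∨`, `η^∨`. -/
def splitting (b : Module.Basis (Fin 2) k (H1dR g₂ g₃)) (N : ℕ) (r : SymPow k N) :
    SymmetricAlgebra k (H g₂ g₃) :=
  ∑ m ∈ (ofSymPow k N r).support, ((ofSymPow k N r).coeff m * ((m 0)! : k)) •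
    (SymmetricAlgebra.ι k (H g₂ g₃) (b.coord 0) ^ m 1 *
      SymmetricAlgebra.ι k (H g₂ g₃) (b.coord 1) ^ m 2)

/-- The class `c` has one and only one residue, and its image by the splitting is `t`. -/
def ResidueEq (𝔘 : LogCover g₂ g₃ L I) (b : Module.Basis (Fin 2) k (H1dR g₂ g₃)) (N : ℕ)
    (c : H1Log g₂ g₃ N) (t : SymmetricAlgebra k (H g₂ g₃)) : Prop :=
  ∃ r, (∀ r', HasResidue 𝔘 N c r' ↔ r' = r) ∧ splitting b N r = t

variable (g₂ g₃) in
/-- The component in degrees `j ≤ N` of the inclusion of `ℋ` in the symmetric algebra of `ℋ`: it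
is `0` for `N = 0`. -/
def identityUpTo (N : ℕ) : H g₂ g₃ →ₗ[k] SymmetricAlgebra k (H g₂ g₃) :=
  if N = 0 then 0 else SymmetricAlgebra.ι k (H g₂ g₃)

/-- The polylogarithm class: a compatible system of classes in
`H¹_dR(U, ℋ^∨ ⊗ Log^N) = Hom(ℋ, H¹_dR(U, Log^N))` whose residue is the identity of `ℋ`. -/
def IsPolylogClass (𝔘 : LogCover g₂ g₃ L I) (b : Module.Basis (Fin 2) k (H1dR g₂ g₃))
    (c : ∀ N, H g₂ g₃ →ₗ[k] H1Log g₂ g₃ N) : Prop :=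
  (∀ N, h1Proj g₂ g₃ N ∘ₗ c (N + 1) = c N) ∧
    ∀ N h, ResidueEq 𝔘 b N (c N h) (identityUpTo g₂ g₃ N h)

end Residue

/-! ### Extensions of modules with connection -/

section Extensions

variable {k : Type u} [Field k] (B : Type u) [CommRing B] [Algebra k B]

/-- The connection on `B ⊗ V`, for a vector space `V`, for which the elements of `V` are
horizontal. -/
def constConn (V : Type u) [AddCommGroup V] [Module k V] :
    B ⊗[k] V →ₗ[k] (B ⊗[k] V) ⊗[B] Ω[B⁄k] :=
  TensorProduct.lift (LinearMap.mk₂ k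
    (fun r h => ((1 : B) ⊗ₜ[k] h) ⊗ₜ[B] KaehlerDifferential.D k B r)
    (fun r r' h => by rw [map_add, TensorProduct.tmul_add])
    (fun c r h => by rw [Derivation.map_smul, TensorProduct.tmul_smul])
    (fun r h h' => by rw [TensorProduct.tmul_add, TensorProduct.add_tmul])
    (fun c r h => by rw [TensorProduct.tmul_smul]; rfl))

variable (k) in
/-- The data of an extension of `Q` by `M`, for modules with connection over `B`: a module with an
additive map `∇` and the two maps of the extension. -/
structure ExtData (M Q : Type u) [AddCommGroup M] [Module B M] [AddCommGroup Q] [Module B Q] where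
  /-- The underlying module. -/
  carrier : Type v
  [addCommGroup : AddCommGroup carrier]
  [module : Module B carrier]
  /-- The connection. -/
  conn : carrier →+ carrier ⊗[B] Ω[B⁄k]
  /-- The inclusion of `M`. -/
  incl : M →ₗ[B] carrier
  /-- The projection to `Q`. -/
  proj : carrier →ₗ[B] Q

attribute [instance] ExtData.addCommGroup ExtData.module

variable {B} {M Q : Type u} [AddCommGroup M] [Module B M] [AddCommGroup Q] [Module B Q]

/-- `0 → M → P → Q → 0` is an exact sequence of modules with connection, and `P` is locally free
of finite rank. -/
structure ExtData.IsExtension (P : ExtData.{u, v} k B M Q)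
    (connM : M → M ⊗[B] Ω[B⁄k]) (connQ : Q → Q ⊗[B] Ω[B⁄k]) : Prop where
  finite : Module.Finite B P.carrier
  projective : Module.Projective B P.carrier
  leibniz : ∀ (r : B) (p : P.carrier),
    P.conn (r • p) = r • P.conn p + p ⊗ₜ KaehlerDifferential.D k B r
  incl_injective : Function.Injective P.incl
  exact : Function.Exact P.incl P.proj
  proj_surjective : Function.Surjective P.proj
  incl_horizontal : ∀ s, P.conn (P.incl s) = P.incl.rTensor Ω[B⁄k] (connM s)
  proj_horizontal : ∀ p, connQ (P.proj p) = P.proj.rTensor Ω[B⁄k] (P.conn p)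

/-- `P` and `P'` are isomorphic as extensions of modules with connection. -/
def ExtData.Isomorphic (P : ExtData.{u, v} k B M Q) (P' : ExtData.{u, w} k B M Q) : Prop :=
  ∃ e : P.carrier ≃ₗ[B] P'.carrier,
    (∀ s, e (P.incl s) = P'.incl s) ∧ (∀ p, P'.proj (e p) = P.proj p) ∧
      ∀ p, P'.conn (e p) = e.toLinearMap.rTensor Ω[B⁄k] (P.conn p)

/-- The extension of `B ⊗ V` by `M` with underlying module `(B ⊗ V) ⊕ M` and with the connection
which extends the one of `M` and satisfies `∇(h) = f(h)` for `h ∈ V`. -/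
def twistedSum (V : Type u) [AddCommGroup V] [Module k V] [Module k M] [IsScalarTower k B M]
    (connM : M →ₗ[k] M ⊗[B] Ω[B⁄k]) (f : V →ₗ[k] M ⊗[B] Ω[B⁄k]) :
    ExtData.{u, u} k B M (B ⊗[k] V) where
  carrier := (B ⊗[k] V) × M
  conn :=
    ((LinearMap.inl B (B ⊗[k] V) M).rTensor Ω[B⁄k]).toAddMonoidHom.comp
        ((constConn B V).toAddMonoidHom.comp (AddMonoidHom.fst _ _)) +
      ((LinearMap.inr B (B ⊗[k] V) M).rTensor Ω[B⁄k]).toAddMonoidHom.comp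
        ((f.liftBaseChange B).toAddMonoidHom.comp (AddMonoidHom.fst _ _) +
          connM.toAddMonoidHom.comp (AddMonoidHom.snd _ _))
  incl := LinearMap.inr _ _ _
  proj := LinearMap.fst _ _ _

end Extensions

/-! ### The polylogarithm sheaf -/

section Polylog

variable {k : Type u} [Field k] {g₂ g₃ : k}

variable (g₂ g₃) in
/-- `ℋ_U`. -/
abbrev HU : Type u := CoordRing g₂ g₃ ⊗[k] H g₂ g₃

variable (g₂ g₃) in
/-- The data of an extension of `ℋ_U` by `Log^N` on `U`. -/
abbrev PolylogData (N : ℕ) : Type (max u (v + 1)) :=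
  ExtData.{u, v} k (CoordRing g₂ g₃) (LogU g₂ g₃ N) (HU g₂ g₃)

/-- The extension class of `P` in `Hom(ℋ, H¹_dR(U, Log^N)) = H¹_dR(U, ℋ^∨ ⊗ Log^N)` is `c`. The
class is the boundary map: if `p` lifts `h ∈ ℋ`, then `∇(p)` is a section of `Log^N ⊗ Ω¹`, and its
class is `c(h)`. -/
def HasClass {N : ℕ} (P : PolylogData.{u, v} g₂ g₃ N)
    (c : H g₂ g₃ →ₗ[k] H1Log g₂ g₃ N) : Prop :=
  ∀ h : H g₂ g₃, ∃ (p : P.carrier) (ξ : LogUForm g₂ g₃ N),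
    P.proj p = 1 ⊗ₜ h ∧ P.conn p = P.incl.rTensor Ω[CoordRing g₂ g₃⁄k] ξ ∧
      Submodule.Quotient.mk ξ = c h

/-- The polylogarithm sheaf: a system of extensions of `ℋ_U` by the `Log^N` whose extension classes
are the components of the polylogarithm class. -/
def IsPolylogSheaf [Algebra k ℂ] {L : PeriodPair} {I : Type w} (𝔘 : LogCover g₂ g₃ L I)
    (b : Module.Basis (Fin 2) k (H1dR g₂ g₃)) (P : ∀ N, PolylogData.{u, v} g₂ g₃ N) : Prop :=
  ∃ c, IsPolylogClass 𝔘 b c ∧ ∀ N,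
    (P N).IsExtension (logConn g₂ g₃ N) (constConn (CoordRing g₂ g₃) (H g₂ g₃)) ∧
      HasClass (P N) (c N)

/-! ### The classes and the sheaf given by the connection functions -/

variable (ℓ : ℕ → CoordRing g₂ g₃) (b : Module.Basis (Fin 2) k (H1dR g₂ g₃)) (N : ℕ)

/-- The section `ω^{0,0} ⊗ η - ∑_{1 ≤ n ≤ N} (-1)^n L_n ω^{1,n-1} ⊗ ω`. -/
def boldOmega : LogUForm g₂ g₃ N :=
  wBasis k (CoordRing g₂ g₃) N 0 0 ⊗ₜ eta g₂ g₃ -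
    ∑ n ∈ Finset.Icc 1 N, ((-1) ^ n * ℓ n) •
      (wBasis k (CoordRing g₂ g₃) N 1 (n - 1) ⊗ₜ[CoordRing g₂ g₃] omega g₂ g₃)

/-- The section `- ∑_{0 ≤ n ≤ N} (-1)^n L_n ω^{0,n} ⊗ ω`. -/
def boldEta : LogUForm g₂ g₃ N :=
  -∑ n ∈ Finset.range (N + 1), ((-1) ^ n * ℓ n) •
    (wBasis k (CoordRing g₂ g₃) N 0 n ⊗ₜ[CoordRing g₂ g₃] omega g₂ g₃)

/-- The element `ω ⊗ boldOmega + η ⊗ boldEta` of `ℋ^∨ ⊗ Γ(U, Log^N ⊗ Ω¹)`, as a linear map on `ℋ`: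
it sends `ω^∨` to `boldOmega` and `η^∨` to `boldEta`. Here `b` is the basis `ω`, `η` of
`H¹_dR(E) = ℋ^∨`. -/
def polylogForm : H g₂ g₃ →ₗ[k] LogUForm g₂ g₃ N :=
  (Module.Dual.eval k _ (b 0)).smulRight (boldOmega ℓ N) +
    (Module.Dual.eval k _ (b 1)).smulRight (boldEta ℓ N)

/-- The class `p^N = ω ⊗ [boldOmega] + η ⊗ [boldEta]`. -/
def polylogClass : H g₂ g₃ →ₗ[k] H1Log g₂ g₃ N :=
  Submodule.mkQ _ ∘ₗ polylogForm ℓ b N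

/-- The module `ℋ_U ⊕ Log^N` with the connection which is the one of `Log^N` on the second summand
and which satisfies `∇(ω^∨) = boldOmega` and `∇(η^∨) = boldEta`. -/
def polylogExt : PolylogData.{u, u} g₂ g₃ N :=
  twistedSum (H g₂ g₃) (logConn g₂ g₃ N) (polylogForm ℓ b N)

end Polylog

end EllPolylog

end

/-! Two models carry the proof. Laurent expansion at z = 0 of the pull-back along z ↦ (℘(z), ℘'(z))
embeds the functions on U and the rational functions on E in ℂ((z)) (`laurentR`, `laurent`), so that
pole orders, residues and the derivation d/dz = d/ω are read off from coefficients. And Ω¹ is free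
on ω, both over U and at the generic point (`formGen_omega`, `formGen_omegaK`), so the connection of
the logarithm sheaf becomes the derivation `nabla` of a polynomial ring in e, ω^∨, η^∨, with e ↦ ω^∨
+ x η^∨.

Rationality of L_n. Since F₁(z) = ζ(z) − e₂^* z, the number e₂^* cancels and wΞ(z,w) = e^{−ζ(z)w}
σ(z+w) / (σ(z) · σ(w)/w). The second logarithmic derivative in w is (℘(w) − w⁻²) − ℘(z+w). The
Taylor coefficients of the first term lie in the base field by the differential equation of ℘
(`coeff_pReg_mem`), those of the second are the functions (d/dz)ⁿ x / n!. Integrating twice over the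
coordinate ring gives `connSeries`, which specializes to the L_n(z) (`pullback_coeff_connSeries`).

Residues. In the frame e_i = e + u_i η^∨ the series ∑ (−1)ⁿ L_n wⁿ is multiplied by exp(−u_i w)
(`shift_etPoly`). Near [0] the function u_i agrees with ζ up to order 1, and e^{ζ(z)w} ∑ L_n wⁿ =
σ(z+w) / (σ(z) · σ(w)/w) has a simple pole at z = 0 with residue w, so that only n = 1 contributes
(`coeff_conn_mul_exp`). This settles `boldEta`. The other form is reduced to it by the identity η^∨
· ω-form = ∇(e^{N+1}/(N+1)!) + ω^∨ · η-form (`X_two_mul_omPoly`), which also produces the Čech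
correction α_i. The residue depends on the class only, because e − zω^∨ + ζη^∨ is horizontal over
ℂ((z)) and differs from e_i by terms vanishing at 0: residues in the horizontal frame kill exact
forms and agree with residues in the charts (`resR_eq_of_chart`).

Uniqueness. Every function on U is a + bx plus a derivative. For a section whose residues all
vanish, this and the four residues of z, ζ, z℘, ζ℘ show that its part of highest degree in e is
exact modulo lower degree (`exists_lowX_sub_nabla`). Descending, the section becomes cohomologous to
one without e, which the projection to the previous level kills (`h1Proj_omegaClass_eq_zero`). Hence
the residue at level N + 1 determines a compatible system at level N.

Cohomology of E and the sheaf. The polar parts of a form of the second kind at the points of U have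
primitives which can be glued (`exists_eq_add_dK`), so the form is a function on U times ω up to an
exact form, and reduces to aω + bη. Independence holds because a rational function with derivative a
+ bx is regular on U and has too small a pole at [0] not to be constant. An extension with a given
class is recovered by lifting a basis of ℋ with prescribed ∇
(`ExtData.IsExtension.isomorphic_twistedSum`). -/

noncomputable section

/-! ### Weierstrass products: σ, ζ and their logarithmic derivatives. -/

namespace KroneckerTheta

variable (L : PeriodPair)

/-- The function `σ(z) / z`, extended by `1` to `z = 0`. -/
def sigmaQuot (z : ℂ) : ℂ :=
  ∏' γ : {γ : L.lattice // γ ≠ 0},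
    ((1 - z / (γ : ℂ)) * Complex.exp (z / (γ : ℂ) + z ^ 2 / (2 * (γ : ℂ) ^ 2)))

theorem sigma_eq (z : ℂ) : sigma L z = z * sigmaQuot L z := rfl

/-- The function `ζ(z) - z⁻¹`, extended by `0` to `z = 0`. -/
def zetaReg (z : ℂ) : ℂ :=
  ∑' l : L.lattice, if l.1 = 0 then 0 else (1 / (z - l) + 1 / l + z / (l : ℂ) ^ 2)

open PeriodPair

/-- The exponential cancels the first two terms of log(1 − t), so the derivative is −t² exp(t +
t²/2). The cubic bound is the mean value inequality on the disc of radius ‖t‖, and e² comes from |t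
+ t²/2| ≤ 2. -/
theorem norm_weierstrassFactor_sub_one_le {t : ℂ} (ht : ‖t‖ ≤ 1) :
    ‖(1 - t) * Complex.exp (t + t ^ 2 / 2) - 1‖ ≤ Real.exp 2 * ‖t‖ ^ 3 := by
  have hd (x : ℂ) : HasDerivAt (fun t => (1 - t) * Complex.exp (t + t ^ 2 / 2))
      (-(x ^ 2 * Complex.exp (x + x ^ 2 / 2))) x := by
    have h₁ : HasDerivAt (fun t : ℂ => t + t ^ 2 / 2) (1 + x) x := by
      refine ((hasDerivAt_id x).add ((hasDerivAt_pow 2 x).div_const 2)).congr_deriv ?_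
      simp
    refine (((hasDerivAt_id x).const_sub 1).mul h₁.cexp).congr_deriv ?_
    simp only [id]
    ring
  have h := (convex_closedBall (0 : ℂ) ‖t‖).norm_image_sub_le_of_norm_hasDerivWithin_le
    (fun x _ => (hd x).hasDerivWithinAt) (C := Real.exp 2 * ‖t‖ ^ 2) (x := 0) (y := t) ?_
    (by simp) (by simp)
  · simpa [pow_succ, mul_assoc] using h
  · intro x hx
    have hx' : ‖x‖ ≤ ‖t‖ := by simpa using hx
    have hx1 : ‖x‖ ≤ 1 := hx'.trans ht
    rw [norm_neg, norm_mul, norm_pow, mul_comm]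
    gcongr
    rw [Complex.norm_exp]
    gcongr
    refine (Complex.re_le_norm _).trans ((norm_add_le _ _).trans ?_)
    have : ‖x ^ 2 / 2‖ ≤ 1 := by
      rw [norm_div, norm_pow]
      simp only [Complex.norm_ofNat]
      nlinarith [norm_nonneg x]
    linarith

theorem summable_norm_rpow_neg_three :
    Summable fun γ : {γ : L.lattice // γ ≠ 0} => ‖(γ : ℂ)‖ ^ (-3 : ℝ) :=
  (ZLattice.summable_norm_rpow L.lattice (-3) (by simp; norm_num)).comp_injective
    Subtype.val_injective

theorem finite_norm_lt (r : ℝ) : {γ : {γ : L.lattice // γ ≠ 0} | ¬ r ≤ ‖(γ : ℂ)‖}.Finite := by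
  refine Set.Finite.of_finite_image (f := Subtype.val) ?_ Subtype.val_injective.injOn
  refine (isCompact_iff_finite.mp (isCompact_closedBall (0 : L.lattice) r)).subset ?_
  rintro _ ⟨γ, hγ, rfl⟩
  have : ‖(γ : ℂ)‖ < r := not_le.mp hγ
  simpa using this.le

theorem norm_sigmaFactor_sub_one_le {r : ℝ} {z γ : ℂ} (hz : ‖z‖ < r) (h : r ≤ ‖γ‖) :
    ‖(1 - z / γ) * Complex.exp (z / γ + z ^ 2 / (2 * γ ^ 2)) - 1‖ ≤
      Real.exp 2 * r ^ 3 * ‖γ‖ ^ (-3 : ℝ) := by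
  have hr : 0 < r := (norm_nonneg z).trans_lt hz
  have hγ : 0 < ‖γ‖ := hr.trans_le h
  have e : z ^ 2 / (2 * γ ^ 2) = (z / γ) ^ 2 / 2 := by rw [div_pow, mul_comm, div_div]
  have h1 : ‖z / γ‖ ≤ 1 := by
    rw [norm_div]; exact div_le_one_of_le₀ (hz.le.trans h) hγ.le
  rw [e]
  refine (norm_weierstrassFactor_sub_one_le h1).trans ?_
  rw [mul_assoc]
  gcongr
  rw [norm_div, div_pow, Real.rpow_neg hγ.le, div_eq_mul_inv]
  norm_cast
  gcongr

theorem hasProdLocallyUniformlyOn_sigmaQuot (r : ℝ) :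
    HasProdLocallyUniformlyOn (fun (γ : {γ : L.lattice // γ ≠ 0}) (z : ℂ) =>
      (1 - z / (γ : ℂ)) * Complex.exp (z / (γ : ℂ) + z ^ 2 / (2 * (γ : ℂ) ^ 2)))
      (sigmaQuot L) (Metric.ball 0 r) := by
  have h := Summable.hasProdLocallyUniformlyOn_one_add (K := Metric.ball (0 : ℂ) r)
    (f := fun (γ : {γ : L.lattice // γ ≠ 0}) (z : ℂ) =>
      (1 - z / (γ : ℂ)) * Complex.exp (z / (γ : ℂ) + z ^ 2 / (2 * (γ : ℂ) ^ 2)) - 1)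
    Metric.isOpen_ball ((summable_norm_rpow_neg_three L).mul_left (Real.exp 2 * r ^ 3)) ?_
    (fun γ => by fun_prop)
  · simpa only [add_sub_cancel] using! h
  -- Only the finitely many lattice points of norm less than r escape the cubic bound.
  · refine (finite_norm_lt L r).subset fun γ hγ h => hγ fun z hz =>
      norm_sigmaFactor_sub_one_le (by simpa using hz) h

theorem differentiable_sigmaQuot : Differentiable ℂ (sigmaQuot L) := fun z =>
  ((hasProdLocallyUniformlyOn_sigmaQuot L (‖z‖ + 1)).differentiableOn
    (.of_forall fun _ => by
      simpa [Finset.prod_fn] using DifferentiableOn.fun_finsetProd fun _ _ => by fun_prop)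
    Metric.isOpen_ball).differentiableAt (Metric.isOpen_ball.mem_nhds (by simp))

theorem sigmaFactor_ne_zero {z : ℂ} (hz : z ∉ (L.lattice \ {0} : Set ℂ))
    (γ : {γ : L.lattice // γ ≠ 0}) :
    (1 - z / (γ : ℂ)) * Complex.exp (z / (γ : ℂ) + z ^ 2 / (2 * (γ : ℂ) ^ 2)) ≠ 0 := by
  have hγ : (γ : ℂ) ≠ 0 := by simpa using γ.2
  refine mul_ne_zero ?_ (Complex.exp_ne_zero _)
  rw [sub_ne_zero, ne_comm, ne_eq, div_eq_one_iff_eq hγ]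
  rintro rfl
  exact hz ⟨γ.1.2, hγ⟩

/-- A product whose factors differ from 1 by a summable family vanishes only if one of its factors
does. -/
theorem sigmaQuot_ne_zero {z : ℂ} (hz : z ∉ (L.lattice \ {0} : Set ℂ)) : sigmaQuot L z ≠ 0 := by
  have h := tprod_one_add_ne_zero_of_summable (f := fun γ : {γ : L.lattice // γ ≠ 0} =>
      (1 - z / (γ : ℂ)) * Complex.exp (z / (γ : ℂ) + z ^ 2 / (2 * (γ : ℂ) ^ 2)) - 1)
      (fun γ => by simpa only [add_sub_cancel] using sigmaFactor_ne_zero L hz γ) ?_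
  · simpa only [add_sub_cancel] using! h
  · refine Summable.of_norm_bounded_eventually
      ((summable_norm_rpow_neg_three L).mul_left (Real.exp 2 * (‖z‖ + 1) ^ 3)) ?_
    refine (finite_norm_lt L (‖z‖ + 1)).subset fun γ hγ h => hγ ?_
    simpa using norm_sigmaFactor_sub_one_le (by simp) h

theorem sigmaQuot_zero : sigmaQuot L 0 = 1 := by simp [sigmaQuot]

theorem zetaReg_zero : zetaReg L 0 = 0 := by
  refine (tsum_congr fun l => ?_).trans tsum_zero
  split_ifs with h
  · rfl
  · field_simp; simp

/-- The summand equals z² / (γ² (z − γ)), and ‖z − γ‖ ≥ ‖γ‖/2. -/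
theorem norm_zetaSummand_le {r : ℝ} {z γ : ℂ} (hz : ‖z‖ < r) (h : 2 * r ≤ ‖γ‖) :
    ‖1 / (z - γ) + 1 / γ + z / γ ^ 2‖ ≤ 2 * r ^ 2 * ‖γ‖ ^ (-3 : ℝ) := by
  have hr : 0 < r := (norm_nonneg z).trans_lt hz
  have hγ : 0 < ‖γ‖ := by linarith
  have hγ0 : γ ≠ 0 := norm_pos_iff.mp hγ
  have hzγ : ‖γ‖ / 2 ≤ ‖z - γ‖ := by
    rw [norm_sub_rev]; refine le_trans ?_ (norm_sub_norm_le _ _); linarith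
  have h0 : z - γ ≠ 0 := norm_pos_iff.mp (by linarith)
  have e : 1 / (z - γ) + 1 / γ + z / γ ^ 2 = z ^ 2 / (γ ^ 2 * (z - γ)) := by
    field_simp; ring
  rw [e, norm_div, norm_mul, norm_pow, norm_pow, Real.rpow_neg hγ.le]
  norm_cast
  calc ‖z‖ ^ 2 / (‖γ‖ ^ 2 * ‖z - γ‖) ≤ r ^ 2 / (‖γ‖ ^ 2 * (‖γ‖ / 2)) := by gcongr
    _ = _ := by field_simp

theorem hasSumLocallyUniformly_zetaReg :
    HasSumLocallyUniformly (fun (l : L.lattice) (z : ℂ) =>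
      if l.1 = 0 then 0 else (1 / (z - l) + 1 / l + z / (l : ℂ) ^ 2)) (zetaReg L) := by
  refine L.hasSumLocallyUniformly_aux (u := (2 * · ^ 2 * ‖·‖ ^ (-3 : ℝ))) _
    (fun _ _ ↦ (ZLattice.summable_norm_rpow _ _ (by simp; norm_num)).mul_left _) fun r hr ↦
    Filter.eventually_atTop.mpr ⟨2 * r, ?_⟩
  rintro _ h s hs l rfl
  split_ifs
  · simp only [norm_zero]; positivity
  · exact norm_zetaSummand_le hs h

theorem hasDerivAt_zetaSummand {z : ℂ} (hz : z ∉ (L.lattice \ {0} : Set ℂ)) (l : L.lattice) :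
    HasDerivAt (fun z : ℂ => if l.1 = 0 then 0 else (1 / (z - l) + 1 / l + z / (l : ℂ) ^ 2))
      (-(if l.1 = 0 then 0 else (1 / (z - l) ^ 2 - 1 / (l : ℂ) ^ 2))) z := by
  split_ifs with h
  · simpa using hasDerivAt_const z (0 : ℂ)
  · have h0 : z - l ≠ 0 := by
      rw [sub_ne_zero]; rintro rfl; exact hz ⟨l.2, h⟩
    refine (((((hasDerivAt_id z).sub_const (l : ℂ)).fun_inv h0).add_const (1 / (l : ℂ))).add
      ((hasDerivAt_id z).div_const ((l : ℂ) ^ 2))).congr_of_eventuallyEq ?_ |>.congr_deriv ?_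
    · exact .of_forall fun x => by simp
    · simp only [id]; field_simp; ring

/-- Termwise differentiation of a locally uniformly convergent series of holomorphic functions gives
the series of ℘ − z⁻². The point 0 is allowed, since its pole has been removed. -/
theorem hasDerivAt_zetaReg {z : ℂ} (hz : z ∉ (L.lattice \ {0} : Set ℂ)) :
    HasDerivAt (zetaReg L) (-L.weierstrassPExcept 0 z) z := by
  have ho := L.isOpen_compl_lattice_sdiff (s := {0})
  have hd : DifferentiableOn ℂ (zetaReg L) (L.lattice \ {0})ᶜ :=
    (hasSumLocallyUniformly_zetaReg L).hasSumLocallyUniformlyOn.differentiableOn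
      (.of_forall fun s ↦ .fun_sum fun i hi x hx ↦
        (hasDerivAt_zetaSummand L hx i).differentiableAt.differentiableWithinAt) ho
  have h := ((hasSumLocallyUniformly_zetaReg L).tendstoLocallyUniformlyOn.deriv
    (.of_forall fun s ↦ .fun_sum fun i hi x hx ↦
        (hasDerivAt_zetaSummand L hx i).differentiableAt.differentiableWithinAt) ho).tendsto_at hz
  have h' : Tendsto (fun s : Finset L.lattice => ∑ l ∈ s,
      -(if l.1 = 0 then 0 else (1 / (z - l) ^ 2 - 1 / (l : ℂ) ^ 2))) atTop
      (𝓝 (-L.weierstrassPExcept 0 z)) := by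
    exact (L.hasSum_weierstrassPExcept 0 z).neg
  have e : deriv (zetaReg L) z = -L.weierstrassPExcept 0 z := by
    refine tendsto_nhds_unique h (h'.congr fun s => ?_)
    exact (HasDerivAt.fun_sum fun l _ => hasDerivAt_zetaSummand L hz l).deriv.symm
  rw [← e]
  exact (hd.differentiableAt (ho.mem_nhds hz)).hasDerivAt

theorem logDeriv_sigmaFactor {z : ℂ} (hz : z ∉ (L.lattice \ {0} : Set ℂ))
    (γ : {γ : L.lattice // γ ≠ 0}) :
    logDeriv (fun z => (1 - z / (γ : ℂ)) * Complex.exp (z / (γ : ℂ) + z ^ 2 / (2 * (γ : ℂ) ^ 2))) z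
      = 1 / (z - γ) + 1 / γ + z / (γ : ℂ) ^ 2 := by
  have hγ : (γ : ℂ) ≠ 0 := by simpa using γ.2
  have h0 : z - γ ≠ 0 := by
    rw [sub_ne_zero]; rintro rfl; exact hz ⟨γ.1.2, hγ⟩
  have h0' : (γ : ℂ) - z ≠ 0 := by rwa [← neg_sub, neg_ne_zero]
  have h₁ : HasDerivAt (fun z : ℂ => z / (γ : ℂ) + z ^ 2 / (2 * (γ : ℂ) ^ 2))
      (1 / γ + z / (γ : ℂ) ^ 2) z := by
    refine (((hasDerivAt_id z).div_const (γ : ℂ)).add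
      ((hasDerivAt_pow 2 z).div_const (2 * (γ : ℂ) ^ 2))).congr_deriv ?_
    field_simp; simp; ring
  have h₂ := (((hasDerivAt_id z).div_const (γ : ℂ)).const_sub 1).mul h₁.cexp
  rw [logDeriv_apply]
  have h₃ := h₂.deriv
  simp only [id] at h₃
  refine (congrArg (· / _) h₃).trans ?_
  rw [div_eq_iff (sigmaFactor_ne_zero L hz γ)]
  field_simp
  ring

/-- The logarithmic derivative of the product is the sum of those of the factors. It is the series
`zetaReg`, which also runs over the lattice point 0 but with a zero term there. -/
theorem hasDerivAt_sigmaQuot {z : ℂ} (hz : z ∉ (L.lattice \ {0} : Set ℂ)) :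
    HasDerivAt (sigmaQuot L) (zetaReg L z * sigmaQuot L z) z := by
  have hs := (hasSumLocallyUniformly_zetaReg L).hasSum (x := z)
  have hi : Function.Injective (Subtype.val : {γ : L.lattice // γ ≠ 0} → L.lattice) :=
    Subtype.val_injective
  have hs' : HasSum (fun γ : {γ : L.lattice // γ ≠ 0} =>
      logDeriv (fun z => (1 - z / (γ : ℂ)) *
        Complex.exp (z / (γ : ℂ) + z ^ 2 / (2 * (γ : ℂ) ^ 2))) z) (zetaReg L z) := by
    have := (hi.hasSum_iff (f := fun l : L.lattice => if l.1 = 0 then 0 else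
      (1 / (z - l) + 1 / l + z / (l : ℂ) ^ 2)) (a := zetaReg L z) fun l hl => by
        have : l = 0 := by simpa using hl
        simp [this]).mpr hs
    refine this.congr_fun fun γ => ?_
    rw [logDeriv_sigmaFactor L hz γ]
    have hγ : (γ : ℂ) ≠ 0 := by simpa using γ.2
    rw [Function.comp_apply, if_neg hγ]
  have h := logDeriv_tprod_eq_tsum (x := z) (s := Metric.ball 0 (‖z‖ + 1)) Metric.isOpen_ball
    (by simp) (sigmaFactor_ne_zero L hz) (fun γ => by fun_prop) hs'.summable
    (hasProdLocallyUniformlyOn_sigmaQuot L _).multipliableLocallyUniformlyOn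
    (sigmaQuot_ne_zero L hz)
  rw [hs'.tsum_eq] at h
  have h' : deriv (sigmaQuot L) z / sigmaQuot L z = zetaReg L z := h
  rw [div_eq_iff (sigmaQuot_ne_zero L hz)] at h'
  rw [← h']
  exact (differentiable_sigmaQuot L z).hasDerivAt

theorem zeta_eq {z : ℂ} (hz : z ∉ L.lattice) : zeta L z = z⁻¹ + zetaReg L z := by
  have hz' : z ∉ (L.lattice \ {0} : Set ℂ) := fun h => hz h.1
  have h0 : z ≠ 0 := by rintro rfl; exact hz (zero_mem _)
  have h := ((hasDerivAt_id z).mul (hasDerivAt_sigmaQuot L hz')).deriv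
  have e : deriv (sigma L) z = sigmaQuot L z + z * (zetaReg L z * sigmaQuot L z) := by
    refine h.trans ?_
    simp
  have h1 := sigmaQuot_ne_zero L hz'
  rw [zeta, e, sigma_eq]
  field_simp

theorem weierstrassP_eq (z : ℂ) :
    L.weierstrassP z = (z ^ 2)⁻¹ + L.weierstrassPExcept 0 z := by
  have := L.weierstrassPExcept_add 0 z
  simp at this
  rw [← this]; ring

theorem isOpen_compl_lattice : IsOpen (L.lattice : Set ℂ)ᶜ := L.isClosed_lattice.isOpen_compl

theorem sigma_ne_zero {z : ℂ} (hz : z ∉ L.lattice) : sigma L z ≠ 0 :=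
  mul_ne_zero (by rintro rfl; exact hz (zero_mem _)) (sigmaQuot_ne_zero L fun h => hz h.1)

theorem hasDerivAt_sigma {z : ℂ} (hz : z ∉ L.lattice) :
    HasDerivAt (sigma L) (zeta L z * sigma L z) z := by
  have : DifferentiableAt ℂ (sigma L) z := differentiableAt_id.mul (differentiable_sigmaQuot L z)
  rw [zeta, div_mul_cancel₀ _ (sigma_ne_zero L hz)]
  exact this.hasDerivAt

theorem hasDerivAt_zeta {z : ℂ} (hz : z ∉ L.lattice) :
    HasDerivAt (zeta L) (-L.weierstrassP z) z := by
  have h0 : z ≠ 0 := by rintro rfl; exact hz (zero_mem _)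
  refine (((hasDerivAt_id z).inv h0).add
    (hasDerivAt_zetaReg L fun h => hz h.1)).congr_of_eventuallyEq ?_ |>.congr_deriv ?_
  · filter_upwards [(isOpen_compl_lattice L).mem_nhds hz] with x hx using zeta_eq L hx
  · rw [weierstrassP_eq]; simp only [id]; field_simp; ring

end KroneckerTheta

/-! ### Formal linear differential equations -/

namespace PowerSeries

variable {k : Type*} [Field k] [CharZero k] {S : Type*} [CommRing S] [Algebra k S]

variable (k) in
/-- The coefficients of the solution `Y` with constant coefficient `1` of `Y' = A Y`. -/
def odeCoeff (A : PowerSeries S) : ℕ → S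
  | 0 => 1
  | n + 1 => algebraMap k S ((n : k) + 1)⁻¹ *
      ∑ i : Fin (n + 1), coeff (n - i) A * odeCoeff A i
  decreasing_by exact i.2

variable (k) in
/-- The solution `Y` with constant coefficient `1` of `Y' = A Y`. -/
def odeSol (A : PowerSeries S) : PowerSeries S := mk (odeCoeff k A)

theorem algebraMap_inv_mul_cast (n : ℕ) :
    algebraMap k S ((n : k) + 1)⁻¹ * ((n : S) + 1) = 1 := by
  have h : ((n : S) + 1) = algebraMap k S ((n : k) + 1) := by simp
  rw [h, ← map_mul, inv_mul_cancel₀ (Nat.cast_add_one_ne_zero n), map_one]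

variable (k) in
omit [CharZero k] in
theorem constantCoeff_odeSol (A : PowerSeries S) : constantCoeff (odeSol k A) = 1 := by
  rw [← coeff_zero_eq_constantCoeff_apply, odeSol, coeff_mk, odeCoeff]

variable (k) in
theorem derivative_odeSol (A : PowerSeries S) :
    derivative S (odeSol k A) = A * odeSol k A := by
  ext n
  rw [coeff_derivative, odeSol, coeff_mk, odeCoeff, mul_comm A, coeff_mul,
    Finset.Nat.sum_antidiagonal_eq_sum_range_succ_mk, Finset.sum_range, mul_right_comm,
    algebraMap_inv_mul_cast, one_mul]
  exact Finset.sum_congr rfl fun i _ => by rw [coeff_mk, mul_comm]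

include k in
theorem eq_of_derivative_eq {Y Z : PowerSeries S} (h : derivative S Y = derivative S Z)
    (h0 : constantCoeff Y = constantCoeff Z) : Y = Z := by
  ext n
  cases n with
  | zero => simpa using h0
  | succ n =>
    have := congrArg (coeff n) h
    rw [coeff_derivative, coeff_derivative] at this
    have e := congrArg (· * algebraMap k S ((n : k) + 1)⁻¹) this
    simpa only [mul_assoc, mul_comm ((n : S) + 1), algebraMap_inv_mul_cast, mul_one] using e

include k in
-- The coefficient of index n + 1 of a solution is determined by the earlier ones, since n + 1 is
-- invertible. The multiplicative identities between generating series are proved by comparing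
-- differential equations and constant terms.
theorem ode_unique {A Y Z : PowerSeries S} (hY : derivative S Y = A * Y)
    (hZ : derivative S Z = A * Z) (h0 : constantCoeff Y = constantCoeff Z) : Y = Z := by
  ext n
  induction n using Nat.strong_induction_on with
  | _ n ih =>
    cases n with
    | zero => simpa using h0
    | succ n =>
      have : coeff n (derivative S Y) = coeff n (derivative S Z) := by
        rw [hY, hZ, coeff_mul, coeff_mul]
        refine Finset.sum_congr rfl fun i hi => ?_
        rw [ih i.2 (by have := Finset.HasAntidiagonal.mem_antidiagonal.mp hi; omega)]
      rw [coeff_derivative, coeff_derivative] at this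
      have e := congrArg (· * algebraMap k S ((n : k) + 1)⁻¹) this
      simpa only [mul_assoc, mul_comm ((n : S) + 1), algebraMap_inv_mul_cast, mul_one] using e

theorem derivative_map {S T : Type*} [CommRing S] [CommRing T] (f : S →+* T) (A : PowerSeries S) :
    derivative T (map f A) = map f (derivative S A) := by
  ext n; simp [coeff_derivative]

/-! ### Taylor series at `0` -/

/-- The Taylor series at `0`. -/
def taylor (f : ℂ → ℂ) : PowerSeries ℂ := mk fun n => iteratedDeriv n f 0 / (n ! : ℂ)

theorem taylor_mul {f g : ℂ → ℂ} (hf : AnalyticAt ℂ f 0) (hg : AnalyticAt ℂ g 0) :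
    taylor (fun z => f z * g z) = taylor f * taylor g := by
  ext m
  simp only [taylor, coeff_mk, iteratedDeriv_fun_mul hf.contDiffAt hg.contDiffAt, coeff_mul,
    Finset.Nat.sum_antidiagonal_eq_sum_range_succ_mk, Finset.sum_div]
  refine Finset.sum_congr rfl fun i hi ↦ ?_
  rw [Nat.cast_choose _ (by grind)]
  field_simp [Nat.factorial_ne_zero]

theorem taylor_add {f g : ℂ → ℂ} (hf : AnalyticAt ℂ f 0) (hg : AnalyticAt ℂ g 0) :
    taylor (fun z => f z + g z) = taylor f + taylor g := by
  ext m
  simp only [taylor, coeff_mk, map_add, iteratedDeriv_fun_add hf.contDiffAt hg.contDiffAt, add_div]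

theorem taylor_congr {f g : ℂ → ℂ} (h : f =ᶠ[𝓝 0] g) : taylor f = taylor g := by
  ext m
  simp only [taylor, coeff_mk, h.iteratedDeriv_eq m]

theorem taylor_deriv (f : ℂ → ℂ) : taylor (deriv f) = derivative ℂ (taylor f) := by
  ext m
  simp only [taylor, coeff_mk, coeff_derivative, ← iteratedDeriv_succ', Nat.factorial_succ]
  have := Nat.factorial_ne_zero m
  push_cast
  field_simp

theorem taylor_const (c : ℂ) : taylor (fun _ => c) = C c := by
  ext m
  simp only [taylor, coeff_mk, coeff_C, iteratedDeriv_const]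
  split_ifs with h <;> simp [h]

theorem taylor_neg (f : ℂ → ℂ) : taylor (fun z => -f z) = -taylor f := by
  ext m
  simp only [taylor, coeff_mk, map_neg, iteratedDeriv_fun_neg, neg_div]

theorem taylor_sub {f g : ℂ → ℂ} (hf : AnalyticAt ℂ f 0) (hg : AnalyticAt ℂ g 0) :
    taylor (fun z => f z - g z) = taylor f - taylor g := by
  simp only [sub_eq_add_neg]
  rw [taylor_add hf hg.fun_neg, taylor_neg]

theorem taylor_id_pow (m : ℕ) : taylor (fun z => z ^ m) = X ^ m := by
  ext n
  simp only [taylor, coeff_mk, coeff_X_pow, iteratedDeriv_fun_pow_zero]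
  split_ifs with h
  · rw [h]; exact div_self (by exact_mod_cast Nat.factorial_ne_zero m)
  · simp

theorem constantCoeff_taylor (f : ℂ → ℂ) : constantCoeff (taylor f) = f 0 := by
  rw [← coeff_zero_eq_constantCoeff_apply, taylor, coeff_mk]; simp

end PowerSeries

/-! ### Laurent series -/

namespace LaurentSeries

open HahnSeries

/-- The derivative of a Laurent series. -/
def derivFun (g : LaurentSeries ℂ) : LaurentSeries ℂ := hasseDeriv ℂ 1 g

theorem coeff_derivFun (g : LaurentSeries ℂ) (n : ℤ) :
    (derivFun g).coeff n = (n + 1) * g.coeff (n + 1) := by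
  simp [derivFun, hasseDeriv_coeff]

/-- The variable. -/
def z : LaurentSeries ℂ := single 1 1

theorem coeff_z_mul (g : LaurentSeries ℂ) (n : ℤ) : (z * g).coeff n = g.coeff (n - 1) := by
  have := coeff_single_mul_add (Γ := ℤ) (r := (1 : ℂ)) (x := g) (a := n - 1) (b := 1)
  simpa [z] using this

theorem z_ne_zero : z ≠ 0 := by simp [z]

theorem coeff_z_mul_derivFun (g : LaurentSeries ℂ) (n : ℤ) :
    (z * derivFun g).coeff n = n * g.coeff n := by
  rw [coeff_z_mul, coeff_derivFun]; simp

/-- The operator z d/dz multiplies the coefficient of index n by n, and for it the Leibniz rule is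
the equality n = i + j in the convolution. Hence the initial multiplication by z. -/
theorem derivFun_mul (f g : LaurentSeries ℂ) :
    derivFun (f * g) = f * derivFun g + g * derivFun f := by
  apply mul_left_cancel₀ z_ne_zero
  have hsub (f : LaurentSeries ℂ) : (z * derivFun f).support ⊆ f.support := fun n hn h0 => hn <| by
    rw [coeff_z_mul_derivFun, h0, mul_zero]
  ext n
  have e : z * (f * derivFun g + g * derivFun f) = f * (z * derivFun g) + (z * derivFun f) * g := by
    ring
  rw [e, coeff_z_mul_derivFun, coeff_add, coeff_mul, coeff_mul_left' f.isPWO_support (hsub f),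
    coeff_mul_right' g.isPWO_support (hsub g), ← Finset.sum_add_distrib, Finset.mul_sum]
  refine Finset.sum_congr rfl fun ij hij => ?_
  have h := (Finset.mem_antidiagonal.mp hij).2.2
  rw [coeff_z_mul_derivFun, coeff_z_mul_derivFun, ← h]
  push_cast
  ring

theorem algebraMap_eq_C {K : Type*} [Field K] [Algebra K ℂ] (c : K) :
    algebraMap K (LaurentSeries ℂ) c = HahnSeries.C (algebraMap K ℂ c) := by
  rw [HahnSeries.algebraMap_apply', PowerSeries.algebraMap_apply, ofPowerSeries_C]

theorem derivFun_C (c : ℂ) : derivFun (HahnSeries.C c) = 0 := by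
  ext n
  rw [coeff_derivFun, C_apply, coeff_single]
  split_ifs with h
  · have : (n : ℂ) + 1 = 0 := by exact_mod_cast h
    simp [this]
  · simp

/-- The derivation `d/dz` of the field of Laurent series. -/
def deriv : Derivation ℂ (LaurentSeries ℂ) (LaurentSeries ℂ) where
  toFun := derivFun
  map_add' f g := by simp [derivFun]
  map_smul' c f := by
    rw [Algebra.smul_def, algebraMap_eq_C, Algebra.algebraMap_self_apply, derivFun_mul,
      derivFun_C, mul_zero, add_zero, RingHom.id_apply, C_mul_eq_smul]
  map_one_eq_zero' := by
    have h := derivFun_C 1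
    rwa [map_one] at h
  leibniz' f g := by
    rw [smul_eq_mul, smul_eq_mul]
    exact derivFun_mul f g

attribute [-instance] HahnSeries.instModule in
/-- The derivation `d/dz`, for the module structure which comes from the algebra structure. -/
def derivAlg : Derivation ℂ (LaurentSeries ℂ) (LaurentSeries ℂ) where
  toFun := derivFun
  map_add' f g := by simp [derivFun]
  map_smul' c f := by
    rw [Algebra.smul_def, Algebra.smul_def, algebraMap_eq_C, Algebra.algebraMap_self_apply,
      derivFun_mul, derivFun_C, mul_zero, add_zero, RingHom.id_apply]
    exact congrArg (· * derivFun f) (algebraMap_eq_C c).symm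
  map_one_eq_zero' := by
    have h := derivFun_C 1
    rwa [map_one] at h
  leibniz' f g := by
    rw [smul_eq_mul, smul_eq_mul]
    exact derivFun_mul f g

theorem coeff_deriv (g : LaurentSeries ℂ) (n : ℤ) :
    (deriv g).coeff n = (n + 1) * g.coeff (n + 1) := coeff_derivFun g n

theorem coeff_neg_one_deriv (g : LaurentSeries ℂ) : (deriv g).coeff (-1) = 0 := by
  simp [coeff_deriv]

theorem deriv_ofPowerSeries (p : PowerSeries ℂ) :
    deriv (ofPowerSeries ℤ ℂ p) = ofPowerSeries ℤ ℂ (PowerSeries.derivative ℂ p) := by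
  ext n
  rw [coeff_deriv, PowerSeries.coeff_coe, PowerSeries.coeff_coe]
  split_ifs with h1 h2 h2
  · simp
  · omega
  · have : n = -1 := by omega
    simp [this]
  · rw [PowerSeries.coeff_derivative, mul_comm]
    have e : (n + 1).natAbs = n.natAbs + 1 := by omega
    have e' : (n : ℂ) = (n.natAbs : ℂ) := by
      have : ((n.natAbs : ℤ) : ℂ) = n := congrArg _ (by omega)
      rw [← this, Int.cast_natCast]
    rw [e, e']

theorem deriv_z : deriv z = 1 := by
  have : z = ofPowerSeries ℤ ℂ PowerSeries.X := by simp [z]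
  rw [this, deriv_ofPowerSeries, PowerSeries.derivative_X, map_one]

/-- The order of `g` is at least `m`. -/
def OrdGE (m : ℤ) (g : LaurentSeries ℂ) : Prop := ∀ n < m, g.coeff n = 0

theorem ordGE_iff {m : ℤ} {g : LaurentSeries ℂ} : OrdGE m g ↔ (m : WithTop ℤ) ≤ g.orderTop := by
  constructor
  · intro h
    by_contra! hlt
    have hg : g ≠ 0 := by rintro rfl; simp at hlt
    rw [← order_eq_orderTop_of_ne_zero hg] at hlt
    have hlt' : g.order < m := by exact_mod_cast hlt
    exact (coeff_order_eq_zero.not.mpr hg) (h _ hlt')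
  · intro h n hn
    exact coeff_eq_zero_of_lt_orderTop (lt_of_lt_of_le (by exact_mod_cast hn) h)

theorem OrdGE.mono {m m' : ℤ} {g : LaurentSeries ℂ} (h : OrdGE m g) (hm : m' ≤ m) : OrdGE m' g :=
  fun n hn => h n (hn.trans_le hm)

theorem ordGE_zero (m : ℤ) : OrdGE m 0 := fun _ _ => rfl

theorem OrdGE.add {m : ℤ} {f g : LaurentSeries ℂ} (hf : OrdGE m f) (hg : OrdGE m g) :
    OrdGE m (f + g) := fun n hn => by simp [hf n hn, hg n hn]

theorem OrdGE.neg {m : ℤ} {f : LaurentSeries ℂ} (hf : OrdGE m f) : OrdGE m (-f) :=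
  fun n hn => by simp [hf n hn]

theorem OrdGE.sub {m : ℤ} {f g : LaurentSeries ℂ} (hf : OrdGE m f) (hg : OrdGE m g) :
    OrdGE m (f - g) := fun n hn => by simp [hf n hn, hg n hn]

theorem OrdGE.sum {ι : Type*} {m : ℤ} {s : Finset ι} {f : ι → LaurentSeries ℂ}
    (h : ∀ i ∈ s, OrdGE m (f i)) : OrdGE m (∑ i ∈ s, f i) := fun n hn => by
  rw [coeff_sum]; exact Finset.sum_eq_zero fun i hi => h i hi n hn

theorem OrdGE.mul {m m' : ℤ} {f g : LaurentSeries ℂ} (hf : OrdGE m f) (hg : OrdGE m' g) :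
    OrdGE (m + m') (f * g) := by
  rw [ordGE_iff] at *
  rw [orderTop_mul]
  push_cast
  exact add_le_add hf hg

theorem OrdGE.deriv {m : ℤ} {f : LaurentSeries ℂ} (hf : OrdGE m f) :
    OrdGE (m - 1) (LaurentSeries.deriv f) := fun n hn => by
  rw [coeff_deriv, hf _ (by omega), mul_zero]

theorem ordGE_C (c : ℂ) : OrdGE 0 (HahnSeries.C c) := fun n hn => by
  rw [C_apply, coeff_single_of_ne hn.ne]

/-- At order 0 the bound of `OrdGE.deriv` improves by one, because the constant term is killed. -/
theorem ordGE_zero_deriv {f : LaurentSeries ℂ} (hf : OrdGE 0 f) :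
    OrdGE 0 (LaurentSeries.deriv f) := fun n hn => by
  rw [coeff_deriv]
  rcases eq_or_ne n (-1) with rfl | h
  · simp
  · rw [hf _ (by omega), mul_zero]

theorem ordGE_zero_iff {g : LaurentSeries ℂ} :
    OrdGE 0 g ↔ ∃ p, g = ofPowerSeries ℤ ℂ p := by
  constructor
  · intro h
    refine ⟨PowerSeries.mk fun n => g.coeff n, ?_⟩
    ext n
    rw [PowerSeries.coeff_coe]
    split_ifs with hn
    · exact h n hn
    · rw [PowerSeries.coeff_mk]
      congr 1
      omega
  · rintro ⟨p, rfl⟩ n hn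
    rw [PowerSeries.coeff_coe, if_pos hn]

theorem coeff_zero_ofPowerSeries (p : PowerSeries ℂ) :
    (ofPowerSeries ℤ ℂ p).coeff 0 = PowerSeries.constantCoeff p := by
  rw [PowerSeries.coeff_coe]; simp

/-- The coefficient of lowest degree is multiplicative. -/
theorem coeff_mul_of_ordGE {m m' : ℤ} {f g : LaurentSeries ℂ} (hf : OrdGE m f) (hg : OrdGE m' g) :
    (f * g).coeff (m + m') = f.coeff m * g.coeff m' := by
  rw [coeff_mul]
  rcases eq_or_ne (f.coeff m * g.coeff m') 0 with h0 | h0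
  · rw [h0]
    refine Finset.sum_eq_zero fun ij hij => ?_
    have h := (Finset.mem_antidiagonal.mp hij).2.2
    rcases lt_trichotomy ij.1 m with h1 | h1 | h1
    · rw [hf _ h1, zero_mul]
    · have : ij.2 = m' := by omega
      rw [h1, this, h0]
    · rw [hg _ (by omega), mul_zero]
  · rw [Finset.sum_eq_single (m, m')]
    · intro ij hij hne
      have h := (Finset.mem_antidiagonal.mp hij).2.2
      rcases lt_trichotomy ij.1 m with h1 | h1 | h1
      · rw [hf _ h1, zero_mul]
      · exact absurd (Prod.ext h1 (by simp; omega)) hne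
      · rw [hg _ (by omega), mul_zero]
    · intro h
      refine absurd (Finset.mem_antidiagonal.mpr ⟨?_, ?_, rfl⟩) h
      · exact left_ne_zero_of_mul h0
      · exact right_ne_zero_of_mul h0

/-- `g` is the Laurent series at `0` of the function `f`. -/
def HasLaurent (f : ℂ → ℂ) (g : LaurentSeries ℂ) : Prop :=
  ∃ (m : ℕ) (G : ℂ → ℂ), AnalyticAt ℂ G 0 ∧ (∀ᶠ x in 𝓝[≠] 0, x ^ m * f x = G x) ∧
    z ^ m * g = ofPowerSeries ℤ ℂ (PowerSeries.taylor G)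

theorem ofPowerSeries_taylor_pow_mul (m : ℕ) {G : ℂ → ℂ} (hG : AnalyticAt ℂ G 0) :
    ofPowerSeries ℤ ℂ (PowerSeries.taylor fun x => x ^ m * G x) =
      z ^ m * ofPowerSeries ℤ ℂ (PowerSeries.taylor G) := by
  rw [PowerSeries.taylor_mul (by fun_prop) hG, map_mul, PowerSeries.taylor_id_pow, map_pow]
  congr 2
  simp [z]

theorem HasLaurent.of_analyticAt {f G : ℂ → ℂ} (hG : AnalyticAt ℂ G 0)
    (h : ∀ᶠ x in 𝓝[≠] 0, f x = G x) : HasLaurent f (ofPowerSeries ℤ ℂ (PowerSeries.taylor G)) :=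
  ⟨0, G, hG, by simpa using h, by simp⟩

theorem hasLaurent_const (c : ℂ) : HasLaurent (fun _ => c) (HahnSeries.C c) := by
  have := HasLaurent.of_analyticAt (f := fun _ => c) (analyticAt_const (v := c)) (.of_forall fun _ => rfl)
  rwa [PowerSeries.taylor_const, ofPowerSeries_C] at this

theorem HasLaurent.mul {f f' : ℂ → ℂ} {g g' : LaurentSeries ℂ} (h : HasLaurent f g)
    (h' : HasLaurent f' g') : HasLaurent (fun x => f x * f' x) (g * g') := by
  obtain ⟨m, G, hG, hf, hg⟩ := h
  obtain ⟨m', G', hG', hf', hg'⟩ := h'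
  refine ⟨m + m', fun x => G x * G' x, hG.fun_mul hG', ?_, ?_⟩
  · filter_upwards [hf, hf'] with x hx hx'
    rw [← hx, ← hx']; ring
  · rw [PowerSeries.taylor_mul hG hG', map_mul, ← hg, ← hg']; ring

theorem HasLaurent.add {f f' : ℂ → ℂ} {g g' : LaurentSeries ℂ} (h : HasLaurent f g)
    (h' : HasLaurent f' g') : HasLaurent (fun x => f x + f' x) (g + g') := by
  obtain ⟨m, G, hG, hf, hg⟩ := h
  obtain ⟨m', G', hG', hf', hg'⟩ := h'
  refine ⟨m + m', fun x => x ^ m' * G x + x ^ m * G' x, by fun_prop, ?_, ?_⟩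
  · filter_upwards [hf, hf'] with x hx hx'
    rw [← hx, ← hx']; ring
  · rw [PowerSeries.taylor_add (by fun_prop) (by fun_prop), map_add,
      ofPowerSeries_taylor_pow_mul _ hG, ofPowerSeries_taylor_pow_mul _ hG', ← hg, ← hg']
    ring

/-- After multiplication by powers of the variable both functions are analytic at 0, and the
identity theorem applies. Through this lemma identities between functions become identities in
ℂ((z)). -/
theorem HasLaurent.unique {f f' : ℂ → ℂ} {g g' : LaurentSeries ℂ} (h : HasLaurent f g)
    (h' : HasLaurent f' g') (hff' : ∀ᶠ x in 𝓝[≠] 0, f x = f' x) : g = g' := by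
  obtain ⟨m, G, hG, hf, hg⟩ := h
  obtain ⟨m', G', hG', hf', hg'⟩ := h'
  have e : (fun x => x ^ m' * G x) =ᶠ[𝓝 0] fun x => x ^ m * G' x := by
    refine (AnalyticAt.frequently_eq_iff_eventually_eq (by fun_prop) (by fun_prop)).mp
      (Eventually.frequently ?_)
    filter_upwards [hf, hf', hff'] with x hx hx' hxx'
    rw [← hx, ← hx', hxx']; ring
  have e' := congrArg (ofPowerSeries ℤ ℂ) (PowerSeries.taylor_congr e)
  rw [ofPowerSeries_taylor_pow_mul _ hG, ofPowerSeries_taylor_pow_mul _ hG', ← hg, ← hg'] at e'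
  refine mul_left_cancel₀ (pow_ne_zero (m + m') z_ne_zero) ?_
  linear_combination e'

end LaurentSeries

namespace EllPolylog

open Polynomial LaurentSeries

/-! ### The coordinate ring as a quadratic extension of the ring of polynomials in `x` -/

section Coord

variable {k : Type u} [Field k] {g₂ g₃ : k}

theorem aeval_x (p : k[X]) : aeval (x g₂ g₃) p =
    WeierstrassCurve.Affine.CoordinateRing.mk (curve g₂ g₃) (C p) := by
  induction p using Polynomial.induction_on' with
  | add p q hp hq => simp only [map_add, hp, hq]
  | monomial n a =>
    rw [← C_mul_X_pow_eq_monomial, map_mul, aeval_C, map_pow, aeval_X]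
    simp only [map_mul, map_pow]
    rfl

theorem smul_one_add_smul_Y [CharZero k] (p q : k[X]) :
    aeval (x g₂ g₃) p + aeval (x g₂ g₃) q * y g₂ g₃ =
      p • (1 : CoordRing g₂ g₃) + (2 * q) • WeierstrassCurve.Affine.CoordinateRing.mk _ X := by
  rw [aeval_x, aeval_x, WeierstrassCurve.Affine.CoordinateRing.smul,
    WeierstrassCurve.Affine.CoordinateRing.smul, y, mul_one]
  simp only [map_mul, map_ofNat]
  ring

theorem exists_eq_add_mul_y [CharZero k] (r : CoordRing g₂ g₃) :
    ∃ p q : k[X], r = aeval (x g₂ g₃) p + aeval (x g₂ g₃) q * y g₂ g₃ := by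
  obtain ⟨p, q, rfl⟩ := WeierstrassCurve.Affine.CoordinateRing.exists_smul_basis_eq r
  refine ⟨p, C 2⁻¹ * q, ?_⟩
  have h2 : (2 : k[X]) = C 2 := rfl
  rw [smul_one_add_smul_Y, ← mul_assoc, h2, ← C_mul, mul_inv_cancel₀ two_ne_zero, C_1, one_mul]

theorem add_mul_y_eq_zero [CharZero k] {p q : k[X]}
    (h : aeval (x g₂ g₃) p + aeval (x g₂ g₃) q * y g₂ g₃ = 0) : p = 0 ∧ q = 0 := by
  rw [smul_one_add_smul_Y] at h
  obtain ⟨h₁, h₂⟩ := WeierstrassCurve.Affine.CoordinateRing.smul_basis_eq_zero h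
  exact ⟨h₁, by simpa using h₂⟩

theorem degree_norm_add_mul_y [CharZero k] (p q : k[X]) :
    (Algebra.norm k[X] (aeval (x g₂ g₃) p + aeval (x g₂ g₃) q * y g₂ g₃)).degree =
      max (2 • p.degree) (2 • q.degree + 3) := by
  have h2 : (2 : k[X]) = C 2 := rfl
  rw [smul_one_add_smul_Y, WeierstrassCurve.Affine.CoordinateRing.degree_norm_smul_basis, h2,
    degree_C_mul two_ne_zero]

/-- The homomorphism `x ↦ a`, `y ↦ b` for a solution `(a, b)` of the equation of the curve. -/
def evalHom [CharZero k] {S : Type*} [CommRing S] [Algebra k S] (a b : S)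
    (h : b ^ 2 = 4 * a ^ 3 - algebraMap k S g₂ * a - algebraMap k S g₃) :
    CoordRing g₂ g₃ →ₐ[k] S :=
  -- The adjoined root is Y = y/2, hence the factor 2⁻¹.
  AdjoinRoot.liftAlgHom _ (aeval a) (algebraMap k S 2⁻¹ * b) (by
    have h4 : algebraMap k S 4⁻¹ * 4 = 1 := by
      rw [← map_ofNat (algebraMap k S) 4, ← map_mul, inv_mul_cancel₀ (by norm_num), map_one]
    have h2 : algebraMap k S 2⁻¹ ^ 2 = algebraMap k S 4⁻¹ := by
      rw [← map_pow]; norm_num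
    simp only [WeierstrassCurve.Affine.polynomial, curve, map_zero, eval₂_sub, eval₂_add, eval₂_neg,
      eval₂_mul, eval₂_pow, eval₂_X, eval₂_C, RingHom.coe_coe, map_add, map_mul, map_pow,
      aeval_X, aeval_C, zero_mul, add_zero, mul_pow, h, h2, div_eq_mul_inv, map_neg]
    linear_combination a ^ 3 * h4)

section evalHom

variable [CharZero k] {S : Type*} [CommRing S] [Algebra k S] {a b : S}
    (h : b ^ 2 = 4 * a ^ 3 - algebraMap k S g₂ * a - algebraMap k S g₃)

theorem evalHom_x : evalHom (g₂ := g₂) (g₃ := g₃) a b h (x g₂ g₃) = a := by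
  exact (AdjoinRoot.liftAlgHom_of ..).trans (aeval_X a)

theorem evalHom_y : evalHom (g₂ := g₂) (g₃ := g₃) a b h (y g₂ g₃) = b := by
  rw [y, map_mul]
  refine (congrArg _ (AdjoinRoot.liftAlgHom_root ..)).trans ?_
  rw [← mul_assoc, map_ofNat, ← map_ofNat (algebraMap k S) 2, ← map_mul,
    mul_inv_cancel₀ two_ne_zero, map_one, one_mul]

theorem evalHom_add_mul_y (p q : k[X]) :
    evalHom (g₂ := g₂) (g₃ := g₃) a b h (aeval (x g₂ g₃) p + aeval (x g₂ g₃) q * y g₂ g₃) =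
      aeval a p + aeval a q * b := by
  rw [map_add, map_mul, ← aeval_algHom_apply, ← aeval_algHom_apply, evalHom_x, evalHom_y]

end evalHom

/-- Lets statements about pull-backs, Laurent series and derivations be checked on constants, x and
y. -/
theorem induction_x_y [CharZero k] {P : CoordRing g₂ g₃ → Prop}
    (hC : ∀ c : k, P (algebraMap k _ c)) (hx : P (x g₂ g₃)) (hy : P (y g₂ g₃))
    (hadd : ∀ r s, P r → P s → P (r + s)) (hmul : ∀ r s, P r → P s → P (r * s))
    (r : CoordRing g₂ g₃) : P r := by
  have hp (p : k[X]) : P (aeval (x g₂ g₃) p) := by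
    induction p using Polynomial.induction_on with
    | C a => simpa using hC a
    | add p q hp hq => rw [map_add]; exact hadd _ _ hp hq
    | monomial n a ih => rw [pow_succ, ← mul_assoc, map_mul _ _ X, aeval_X]; exact hmul _ _ ih hx
  obtain ⟨p, q, rfl⟩ := exists_eq_add_mul_y r
  exact hadd _ _ (hp p) (hmul _ _ (hp q) hy)

end Coord

/-- The lattice `L` uniformizes the curve with invariants `g₂`, `g₃`. -/
structure Uniformizes {k : Type u} [Field k] [Algebra k ℂ] (L : PeriodPair) (g₂ g₃ : k) : Prop where
  disc_ne_zero : g₂ ^ 3 - 27 * g₃ ^ 2 ≠ 0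
  g₂_eq : L.g₂ = algebraMap k ℂ g₂
  g₃_eq : L.g₃ = algebraMap k ℂ g₃

/-! ### The Laurent series of `℘` and of the functions on the curve -/

section Laurent

variable (L : PeriodPair)

theorem analyticAt_weierstrassPExcept_zero : AnalyticAt ℂ (L.weierstrassPExcept 0) 0 :=
  L.analyticAt_weierstrassPExcept 0

/-- The Taylor series of `℘ - z⁻²`. -/
def pReg : PowerSeries ℂ := PowerSeries.taylor (L.weierstrassPExcept 0)

/-- The Laurent series of `℘`. -/
def pHat : LaurentSeries ℂ := (z ^ 2)⁻¹ + HahnSeries.ofPowerSeries ℤ ℂ (pReg L)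

theorem eventually_notMem_lattice : ∀ᶠ t in 𝓝[≠] (0 : ℂ), t ∉ L.lattice := by
  have := (L.compl_lattice_sdiff_singleton_mem_nhds 0)
  filter_upwards [nhdsWithin_le_nhds this, self_mem_nhdsWithin] with t ht h0 hL
  exact ht ⟨hL, h0⟩

theorem hasLaurent_inv_pow (n : ℕ) : HasLaurent (fun t => (t ^ n)⁻¹) (z ^ n)⁻¹ := by
  refine ⟨n, fun _ => 1, analyticAt_const, ?_, ?_⟩
  · filter_upwards [self_mem_nhdsWithin] with t (ht : t ≠ 0)
    exact mul_inv_cancel₀ (pow_ne_zero n ht)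
  · rw [mul_inv_cancel₀ (pow_ne_zero n z_ne_zero), PowerSeries.taylor_const, map_one, map_one]

theorem hasLaurent_weierstrassP : HasLaurent L.weierstrassP (pHat L) := by
  have h := (hasLaurent_inv_pow 2).add (HasLaurent.of_analyticAt
    (analyticAt_weierstrassPExcept_zero L) (.of_forall fun _ => rfl))
  have e : L.weierstrassP = fun t => (t ^ 2)⁻¹ + L.weierstrassPExcept 0 t :=
    funext (KroneckerTheta.weierstrassP_eq L)
  rwa [e]

theorem deriv_inv_z_sq : LaurentSeries.deriv (z ^ 2)⁻¹ = -2 * (z ^ 3)⁻¹ := by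
  rw [Derivation.leibniz_inv, Derivation.leibniz_pow, deriv_z]
  have := z_ne_zero
  simp only [smul_eq_mul, nsmul_eq_mul]
  field_simp
  push_cast
  ring

theorem deriv_pHat : LaurentSeries.deriv (pHat L) =
    -2 * (z ^ 3)⁻¹ + HahnSeries.ofPowerSeries ℤ ℂ (PowerSeries.derivative ℂ (pReg L)) := by
  rw [pHat, map_add, deriv_inv_z_sq, deriv_ofPowerSeries]

theorem hasLaurent_derivWeierstrassP :
    HasLaurent L.derivWeierstrassP (LaurentSeries.deriv (pHat L)) := by
  have h := ((hasLaurent_const (-2)).mul (hasLaurent_inv_pow 3)).add (HasLaurent.of_analyticAt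
    (analyticAt_weierstrassPExcept_zero L).deriv (.of_forall fun _ => rfl))
  have e : ∀ᶠ t in 𝓝[≠] (0 : ℂ), L.derivWeierstrassP t =
      -2 * (t ^ 3)⁻¹ + deriv (L.weierstrassPExcept 0) t := by
    have h0 := (L.compl_lattice_sdiff_singleton_mem_nhds 0)
    filter_upwards [self_mem_nhdsWithin, nhdsWithin_le_nhds
      (analyticAt_weierstrassPExcept_zero L).eventually_analyticAt] with t (ht : t ≠ 0) hP
    have e : L.weierstrassP = fun t => (t ^ 2)⁻¹ + L.weierstrassPExcept 0 t :=
      funext (KroneckerTheta.weierstrassP_eq L)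
    rw [← L.deriv_weierstrassP, e]
    have h1 := ((hasDerivAt_pow 2 t).inv (pow_ne_zero 2 ht)).add hP.differentiableAt.hasDerivAt
    refine h1.deriv.trans ?_
    field_simp
    ring
  rw [deriv_pHat]
  obtain ⟨m, G, hG, hf, hg⟩ := h
  refine ⟨m, G, hG, ?_, ?_⟩
  · filter_upwards [hf, e] with t ht he
    rw [he, ht]
  · rw [← hg, pReg, PowerSeries.taylor_deriv, map_neg, map_ofNat]

/-- The analytic differential equation of ℘ off the lattice, transferred by the uniqueness of
Laurent series. -/
theorem deriv_pHat_sq : LaurentSeries.deriv (pHat L) ^ 2 =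
    4 * pHat L ^ 3 - HahnSeries.C L.g₂ * pHat L - HahnSeries.C L.g₃ := by
  have hp := hasLaurent_weierstrassP L
  have hd := hasLaurent_derivWeierstrassP L
  have h := (hd.mul hd).unique ((((hasLaurent_const 4).mul (hp.mul (hp.mul hp))).add
    ((hasLaurent_const (-L.g₂)).mul hp)).add (hasLaurent_const (-L.g₃))) (by
      filter_upwards [eventually_notMem_lattice L] with t ht
      linear_combination L.derivWeierstrassP_sq t ht)
  simp only [map_neg, map_ofNat] at h
  linear_combination h

theorem ordGE_z_pow_inv (n : ℕ) : OrdGE (-n) (z ^ n)⁻¹ := by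
  have : (z ^ n)⁻¹ = HahnSeries.single (-n : ℤ) (1 : ℂ) := by
    rw [inv_eq_iff_eq_inv, HahnSeries.inv_single, z, HahnSeries.single_pow]; simp
  rw [this]
  intro m hm
  exact HahnSeries.coeff_single_of_ne hm.ne

theorem coeff_z_pow_inv (n : ℕ) : ((z ^ n)⁻¹).coeff (-n) = 1 := by
  have : (z ^ n)⁻¹ = HahnSeries.single (-n : ℤ) (1 : ℂ) := by
    rw [inv_eq_iff_eq_inv, HahnSeries.inv_single, z, HahnSeries.single_pow]; simp
  rw [this, HahnSeries.coeff_single_same]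

theorem ordGE_ofPowerSeries (p : PowerSeries ℂ) : OrdGE 0 (HahnSeries.ofPowerSeries ℤ ℂ p) :=
  ordGE_zero_iff.mpr ⟨p, rfl⟩

theorem ordGE_pHat : OrdGE (-2) (pHat L) :=
  (ordGE_z_pow_inv 2).add ((ordGE_ofPowerSeries _).mono (by norm_num))

theorem coeff_pHat : (pHat L).coeff (-2) = 1 := by
  have := coeff_z_pow_inv 2
  rw [pHat, HahnSeries.coeff_add, ordGE_ofPowerSeries _ (-2) (by norm_num), add_zero]
  exact_mod_cast this

theorem coeff_deriv_pHat : (LaurentSeries.deriv (pHat L)).coeff (-3) = -2 := by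
  have := coeff_pHat L
  rw [coeff_deriv]
  norm_num [this]

theorem orderTop_eq_of_ordGE {m : ℤ} {g : LaurentSeries ℂ} (h : OrdGE m g) (h0 : g.coeff m ≠ 0) :
    g.orderTop = m :=
  le_antisymm (HahnSeries.orderTop_le_of_coeff_ne_zero h0) (ordGE_iff.mp h)

theorem orderTop_pHat : (pHat L).orderTop = (-2 : ℤ) :=
  orderTop_eq_of_ordGE (ordGE_pHat L) (by simp [coeff_pHat])

theorem orderTop_deriv_pHat : (LaurentSeries.deriv (pHat L)).orderTop = (-3 : ℤ) :=
  orderTop_eq_of_ordGE (ordGE_pHat L).deriv (by simp [coeff_deriv_pHat])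

end Laurent

end EllPolylog

namespace EllPolylog

open Polynomial LaurentSeries

section Laurent

variable {k : Type u} [Field k] [CharZero k] [Algebra k ℂ] {g₂ g₃ : k} {L : PeriodPair}

instance : CharZero (LaurentSeries ℂ) :=
  charZero_of_injective_algebraMap (algebraMap ℂ (LaurentSeries ℂ)).injective

theorem ordGE_pow {m : ℤ} {f : LaurentSeries ℂ} (hf : OrdGE m f) (n : ℕ) :
    OrdGE (n * m) (f ^ n) ∧ (f ^ n).coeff (n * m) = f.coeff m ^ n := by
  induction n with
  | zero =>
    rw [pow_zero, ← map_one HahnSeries.C, Nat.cast_zero, zero_mul]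
    exact ⟨ordGE_C 1, by simp⟩
  | succ n ih =>
    have e : ((n + 1 : ℕ) : ℤ) * m = n * m + m := by push_cast; ring
    rw [e, pow_succ, pow_succ, coeff_mul_of_ordGE ih.1 hf, ih.2]
    exact ⟨ih.1.mul hf, rfl⟩

-- Only the leading monomial of p reaches the order −2 deg p.
variable (L) in
omit [CharZero k] in
theorem ordGE_aeval_pHat (p : k[X]) : OrdGE (-2 * p.natDegree) (aeval (pHat L) p) ∧
    (aeval (pHat L) p).coeff (-2 * p.natDegree) = algebraMap k ℂ p.leadingCoeff := by
  have h (i : ℕ) (c : k) : OrdGE (-2 * i) (algebraMap k _ c * pHat L ^ i) ∧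
      (algebraMap k _ c * pHat L ^ i).coeff (-2 * i) = algebraMap k ℂ c := by
    have h := ordGE_pow (ordGE_pHat L) i
    rw [coeff_pHat, one_pow, mul_comm (i : ℤ)] at h
    rw [algebraMap_eq_C]
    have e : (-2 * i : ℤ) = 0 + -2 * i := by ring
    refine ⟨e ▸ (ordGE_C _).mul h.1, ?_⟩
    conv_lhs => rw [e, coeff_mul_of_ordGE (ordGE_C _) h.1, h.2]
    simp
  rw [aeval_eq_sum_range]
  simp only [Algebra.smul_def]
  refine ⟨.sum fun i hi => ((h i _).1.mono ?_), ?_⟩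
  · have := Finset.mem_range.mp hi; omega
  · rw [HahnSeries.coeff_sum, Finset.sum_range_succ, (h _ _).2, Finset.sum_eq_zero, zero_add]
    · rfl
    · intro i hi
      exact (h i _).1 _ (by have := Finset.mem_range.mp hi; omega)

variable (L) in
omit [CharZero k] in
theorem orderTop_aeval_pHat {p : k[X]} (hp : p ≠ 0) :
    (aeval (pHat L) p).orderTop = ((-2 * p.natDegree : ℤ) : WithTop ℤ) :=
  orderTop_eq_of_ordGE (ordGE_aeval_pHat L p).1 (by
    rw [(ordGE_aeval_pHat L p).2]
    simpa using hp)

variable (H : Uniformizes L g₂ g₃)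

/-- The Laurent series of a function on `U`. -/
def laurentR : CoordRing g₂ g₃ →ₐ[k] LaurentSeries ℂ :=
  evalHom (pHat L) (LaurentSeries.deriv (pHat L)) (by
    rw [deriv_pHat_sq, algebraMap_eq_C, algebraMap_eq_C, H.g₂_eq, H.g₃_eq])

theorem laurentR_x : laurentR H (x g₂ g₃) = pHat L := evalHom_x _
theorem laurentR_y : laurentR H (y g₂ g₃) = LaurentSeries.deriv (pHat L) := evalHom_y _

/-- For r = p(x) + q(x)y the two summands have orders −2 deg p and −(2 deg q + 3), of different
parity, so nothing cancels. The degree of the norm of r is the maximum of the same two numbers. -/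
theorem orderTop_laurentR {r : CoordRing g₂ g₃} (hr : r ≠ 0) :
    (laurentR H r).orderTop = ((-poleOrder r : ℤ) : WithTop ℤ) := by
  obtain ⟨p, q, rfl⟩ := exists_eq_add_mul_y r
  have hdeg := degree_norm_add_mul_y (g₂ := g₂) (g₃ := g₃) p q
  have hq : q ≠ 0 → (aeval (pHat L) q * LaurentSeries.deriv (pHat L)).orderTop =
      ((-(2 * q.natDegree + 3) : ℤ) : WithTop ℤ) := fun hq => by
    rw [HahnSeries.orderTop_mul, orderTop_aeval_pHat L hq, orderTop_deriv_pHat]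
    rw [← WithTop.coe_add]
    congr 1; ring
  have e2 (n : ℕ) : (2 • (n : WithBot ℕ)) = ((2 * n : ℕ) : WithBot ℕ) := by
    rw [two_nsmul, two_mul]; rfl
  have e3 (n : ℕ) : (2 • (n : WithBot ℕ) + 3) = ((2 * n + 3 : ℕ) : WithBot ℕ) := by
    rw [e2]; rfl
  have hpo : ∀ n : ℕ, (Algebra.norm k[X] (aeval (x g₂ g₃) p + aeval (x g₂ g₃) q * y g₂ g₃)).degree =
      (n : WithBot ℕ) → poleOrder (aeval (x g₂ g₃) p + aeval (x g₂ g₃) q * y g₂ g₃) = n :=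
    fun n hn => natDegree_eq_of_degree_eq_some hn
  rw [laurentR, evalHom_add_mul_y]
  rcases eq_or_ne p 0 with rfl | hp0
  · rcases eq_or_ne q 0 with rfl | hq0
    · simp at hr
    · rw [hpo (2 * q.natDegree + 3), map_zero, zero_add, hq hq0]
      · norm_cast
      · rw [hdeg, degree_eq_natDegree hq0, e3, degree_zero]
        exact max_eq_right bot_le
  · rcases eq_or_ne q 0 with rfl | hq0
    · rw [hpo (2 * p.natDegree), map_zero, zero_mul, add_zero, orderTop_aeval_pHat L hp0]
      · push_cast; rfl
      · rw [hdeg, degree_eq_natDegree hp0, e2, degree_zero]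
        exact max_eq_left bot_le
    · rw [degree_eq_natDegree hp0, degree_eq_natDegree hq0, e2, e3] at hdeg
      rcases lt_or_gt_of_ne (show 2 * p.natDegree ≠ 2 * q.natDegree + 3 by omega) with h | h
      · rw [hpo (2 * q.natDegree + 3), HahnSeries.orderTop_add_eq_right, hq hq0]
        · norm_cast
        · rw [hq hq0, orderTop_aeval_pHat L hp0]
          norm_cast; omega
        · rw [hdeg]; exact max_eq_right (by exact_mod_cast h.le)
      · rw [hpo (2 * p.natDegree), HahnSeries.orderTop_add_eq_left, orderTop_aeval_pHat L hp0]
        · push_cast; rfl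
        · rw [hq hq0, orderTop_aeval_pHat L hp0]
          norm_cast; omega
        · rw [hdeg]; exact max_eq_left (by exact_mod_cast h.le)

theorem laurentR_injective : Function.Injective (laurentR H) :=
  (injective_iff_map_eq_zero _).mpr fun r hr => by
    by_contra h
    have := orderTop_laurentR H h
    rw [hr, HahnSeries.orderTop_zero] at this
    exact WithTop.top_ne_coe this

/-- The Laurent series of a rational function. -/
def laurent : FunField g₂ g₃ →ₐ[k] LaurentSeries ℂ :=
  IsFractionRing.liftAlgHom (g := laurentR H) (laurentR_injective H)

theorem laurent_algebraMap (r : CoordRing g₂ g₃) :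
    laurent H (algebraMap _ _ r) = laurentR H r :=
  IsFractionRing.lift_algebraMap (laurentR_injective H) r

theorem laurent_injective : Function.Injective (laurent H) := (laurent H).toRingHom.injective

theorem laurent_const (c : k) :
    laurent H (algebraMap _ _ c) = HahnSeries.C (algebraMap k ℂ c) := by
  rw [AlgHom.commutes, algebraMap_eq_C]

omit [CharZero k] [Algebra k ℂ] in
theorem exists_mul_eq (f : FunField g₂ g₃) : ∃ a b : CoordRing g₂ g₃, b ≠ 0 ∧
    f * algebraMap _ _ b = algebraMap _ _ a := by
  obtain ⟨⟨a, b⟩, h⟩ := IsLocalization.surj (nonZeroDivisors (CoordRing g₂ g₃)) f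
  exact ⟨a, b, nonZeroDivisors.ne_zero b.2, h⟩

theorem laurent_mul_eq {f : FunField g₂ g₃} {a b : CoordRing g₂ g₃}
    (h : f * algebraMap _ _ b = algebraMap _ _ a) :
    laurent H f * laurentR H b = laurentR H a := by
  rw [← laurent_algebraMap, ← laurent_algebraMap, ← map_mul, h]

theorem ordGE_laurent_iff {f : FunField g₂ g₃} {a b : CoordRing g₂ g₃} (hb : b ≠ 0) (ha : a ≠ 0)
    (h : f * algebraMap _ _ b = algebraMap _ _ a) (m : ℤ) :
    OrdGE m (laurent H f) ↔ m + poleOrder a ≤ poleOrder b := by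
  have e := congrArg HahnSeries.orderTop (laurent_mul_eq H h)
  rw [HahnSeries.orderTop_mul, orderTop_laurentR H hb, orderTop_laurentR H ha] at e
  rw [ordGE_iff]
  generalize (laurent H f).orderTop = t at e
  cases t with
  | top => exact absurd e (WithTop.top_ne_coe (a := -(poleOrder a : ℤ)))
  | coe t =>
    have e' : t + -(poleOrder b : ℤ) = -(poleOrder a : ℤ) := by exact_mod_cast e
    rw [WithTop.coe_le_coe]
    omega

omit [CharZero k] [Algebra k ℂ] in
theorem eq_zero_of_mul_eq {f : FunField g₂ g₃} {b : CoordRing g₂ g₃} (hb : b ≠ 0)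
    (h : f * algebraMap _ _ b = algebraMap _ (FunField g₂ g₃) (0 : CoordRing g₂ g₃)) : f = 0 := by
  rw [map_zero] at h
  exact (mul_eq_zero.mp h).resolve_right
    ((map_ne_zero_iff _ (IsFractionRing.injective _ (FunField g₂ g₃))).mpr hb)

omit [Algebra k ℂ] in
theorem poleOrder_zero : poleOrder (0 : CoordRing g₂ g₃) = 0 := by
  have h := degree_norm_add_mul_y (g₂ := g₂) (g₃ := g₃) 0 0
  rw [map_zero, zero_mul, add_zero, degree_zero] at h
  have h' : (Algebra.norm k[X] (0 : CoordRing g₂ g₃)).degree = ⊥ := h.trans rfl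
  rw [poleOrder, degree_eq_bot.mp h', natDegree_zero]

/-- All representations of f as a quotient give the same difference of pole orders, namely the order
of its Laurent series. So the existential in the definition does not depend on the quotient chosen.
-/
theorem poleLE_iff {f : FunField g₂ g₃} {n : ℕ} : PoleLE f n ↔ OrdGE (-n) (laurent H f) := by
  constructor
  · rintro ⟨a, b, hb, h, hle⟩
    rcases eq_or_ne a 0 with rfl | ha
    · rw [eq_zero_of_mul_eq hb h, map_zero]; exact ordGE_zero _
    · rw [ordGE_laurent_iff H hb ha h]; omega
  · intro hf
    obtain ⟨a, b, hb, h⟩ := exists_mul_eq f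
    refine ⟨a, b, hb, h, ?_⟩
    rcases eq_or_ne a 0 with rfl | ha
    · simp [poleOrder_zero]
    · rw [ordGE_laurent_iff H hb ha h] at hf; omega

theorem regularAt_none_iff {f : FunField g₂ g₃} :
    RegularAt none f ↔ OrdGE 0 (laurent H f) := poleLE_iff H (n := 0)

omit [Algebra k ℂ] in
theorem poleOrder_x : poleOrder (x g₂ g₃) = 2 := by
  have h := degree_norm_add_mul_y (g₂ := g₂) (g₃ := g₃) X 0
  rw [aeval_X, map_zero, zero_mul, add_zero, degree_X, degree_zero] at h
  exact natDegree_eq_of_degree_eq_some (h.trans rfl)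

omit [Algebra k ℂ] in
theorem poleOrder_y : poleOrder (y g₂ g₃) = 3 := by
  have h := degree_norm_add_mul_y (g₂ := g₂) (g₃ := g₃) 0 1
  rw [map_one, map_zero, zero_add, one_mul, degree_one, degree_zero] at h
  exact natDegree_eq_of_degree_eq_some (h.trans rfl)

omit [Algebra k ℂ] in
theorem x_ne_zero : x g₂ g₃ ≠ 0 := fun h => by
  have := poleOrder_x (g₂ := g₂) (g₃ := g₃)
  rw [h, poleOrder_zero] at this; simp at this

omit [Algebra k ℂ] in
theorem y_ne_zero : y g₂ g₃ ≠ 0 := fun h => by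
  have := poleOrder_y (g₂ := g₂) (g₃ := g₃)
  rw [h, poleOrder_zero] at this; simp at this

theorem vanishesAtZero_iff {f : FunField g₂ g₃} :
    VanishesAtZero f ↔ OrdGE 1 (laurent H f) := by
  constructor
  · rintro ⟨a, b, hb, h, hlt⟩
    rcases eq_or_ne a 0 with rfl | ha
    · rw [eq_zero_of_mul_eq hb h, map_zero]; exact ordGE_zero _
    · rw [ordGE_laurent_iff H hb ha h]; omega
  · intro hf
    obtain ⟨a, b, hb, h⟩ := exists_mul_eq f
    rcases eq_or_ne a 0 with rfl | ha
    -- For the zero function a given denominator may have pole order 0, which violates the strict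
    -- inequality. The denominator x has pole order 2.
    · refine ⟨0, x g₂ g₃, x_ne_zero, by rw [eq_zero_of_mul_eq hb h]; simp, ?_⟩
      rw [poleOrder_x, poleOrder_zero]; norm_num
    · refine ⟨a, b, hb, h, ?_⟩
      rw [ordGE_laurent_iff H hb ha h] at hf; omega

theorem isLocalParameter_iff {t : FunField g₂ g₃} :
    IsLocalParameter t ↔ OrdGE 1 (laurent H t) ∧ (laurent H t).coeff 1 ≠ 0 := by
  have key : ∀ a b : CoordRing g₂ g₃, b ≠ 0 → a ≠ 0 →
      t * algebraMap _ _ b = algebraMap _ _ a →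
      ((OrdGE 1 (laurent H t) ∧ (laurent H t).coeff 1 ≠ 0) ↔ poleOrder b = poleOrder a + 1) := by
    intro a b hb ha h
    have h1 := ordGE_laurent_iff H hb ha h 1
    have h2 := ordGE_laurent_iff H hb ha h 2
    constructor
    · rintro ⟨ho, hc⟩
      have : ¬ OrdGE 2 (laurent H t) := fun h => hc (h 1 (by norm_num))
      rw [h1] at ho; rw [h2] at this; omega
    · intro e
      have ho := h1.mpr (by omega)
      refine ⟨ho, fun hc => ?_⟩
      have : OrdGE 2 (laurent H t) := fun n hn => by
        rcases eq_or_ne n 1 with rfl | hne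
        · exact hc
        · exact ho n (by omega)
      rw [h2] at this; omega
  constructor
  · rintro ⟨a, b, ha, hb, h, e⟩
    exact (key a b hb ha h).mpr e
  · rintro ht
    obtain ⟨a, b, hb, h⟩ := exists_mul_eq t
    have ha : a ≠ 0 := by
      rintro rfl
      rw [eq_zero_of_mul_eq hb h, map_zero] at ht
      exact ht.2 rfl
    exact ⟨a, b, ha, hb, h, (key a b hb ha h).mp ht⟩

/-! ### The derivation `d/dz` on rational functions -/

theorem two_mul_deriv_deriv_pHat : 2 * LaurentSeries.deriv (LaurentSeries.deriv (pHat L)) =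
    12 * pHat L ^ 2 - HahnSeries.C L.g₂ := by
  have h := congrArg LaurentSeries.deriv (deriv_pHat_sq L)
  have hC (c : ℂ) : LaurentSeries.deriv (HahnSeries.C c) = 0 := derivFun_C c
  have h4 : LaurentSeries.deriv 4 = 0 := by
    have := hC 4
    rwa [map_ofNat] at this
  simp only [map_sub, Derivation.leibniz, Derivation.leibniz_pow, hC, h4, smul_eq_mul,
    nsmul_eq_mul, mul_zero, add_zero, sub_zero] at h
  have h0 : LaurentSeries.deriv (pHat L) ≠ 0 := by
    intro h; have := coeff_deriv_pHat L; rw [h] at this; simp at this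
  apply mul_left_cancel₀ h0
  push_cast at h
  linear_combination h

/-- The image of the coordinate ring is stable under d/dz because ℘'' = 6℘² − g₂/2 is a polynomial
in ℘. As the embedding is injective, d/dz can be transported back, with all its properties. -/
theorem exists_laurentR_eq_deriv (r : CoordRing g₂ g₃) :
    ∃ s, laurentR H s = LaurentSeries.deriv (laurentR H r) := by
  refine induction_x_y (P := fun r => ∃ s, laurentR H s = LaurentSeries.deriv (laurentR H r))
    (fun c => ?_) ?_ ?_ ?_ ?_ r
  · refine ⟨0, ?_⟩
    rw [AlgHom.commutes, algebraMap_eq_C, map_zero]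
    exact (derivFun_C _).symm
  · exact ⟨y g₂ g₃, by rw [laurentR_y, laurentR_x]⟩
  · refine ⟨6 * x g₂ g₃ ^ 2 - algebraMap k _ (g₂ / 2), ?_⟩
    have h2 : (HahnSeries.C (algebraMap k ℂ (g₂ / 2)) : LaurentSeries ℂ) = HahnSeries.C L.g₂ / 2 := by
      rw [H.g₂_eq, map_div₀, map_div₀, map_ofNat, map_ofNat]
    rw [map_sub, map_mul, map_pow, AlgHom.commutes, algebraMap_eq_C, laurentR_x, laurentR_y,
      map_ofNat, h2]
    linear_combination -(1 / 2) * two_mul_deriv_deriv_pHat (L := L)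
  · rintro r s ⟨r', hr⟩ ⟨s', hs⟩
    exact ⟨r' + s', by rw [map_add, map_add, map_add, hr, hs]⟩
  · rintro r s ⟨r', hr⟩ ⟨s', hs⟩
    refine ⟨r * s' + s * r', ?_⟩
    rw [map_add, map_mul, map_mul, map_mul, hr, hs, Derivation.leibniz, smul_eq_mul, smul_eq_mul]

omit [CharZero k] in
theorem deriv_algebraMap_mul (c : k) (g : LaurentSeries ℂ) :
    LaurentSeries.deriv (algebraMap k (LaurentSeries ℂ) c * g) =
      algebraMap k (LaurentSeries ℂ) c * LaurentSeries.deriv g := by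
  rw [algebraMap_eq_C, Derivation.leibniz, smul_eq_mul, smul_eq_mul]
  have : LaurentSeries.deriv (HahnSeries.C (algebraMap k ℂ c)) = 0 := derivFun_C _
  rw [this, mul_zero, add_zero]

/-- The derivation of an algebra of Laurent series which is stable under `d/dz`. -/
def derivationOfInjective {A : Type*} [CommRing A] [Algebra k A] (ψ : A →ₐ[k] LaurentSeries ℂ)
    (hψ : Function.Injective ψ) (D : A → A) (hD : ∀ a, ψ (D a) = LaurentSeries.deriv (ψ a)) :
    Derivation k A A :=
  Derivation.mk'
    { toFun := D
      map_add' := fun r s => hψ (by rw [map_add, hD, hD, hD, map_add, map_add])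
      map_smul' := fun c r => hψ (by
        rw [hD, RingHom.id_apply, Algebra.smul_def, Algebra.smul_def, map_mul, map_mul ψ, hD,
          AlgHom.commutes, deriv_algebraMap_mul]) }
    fun r s => hψ (by
      change ψ (D (r * s)) = ψ (r * D s + s * D r)
      rw [map_add, map_mul, map_mul, hD, hD, hD, map_mul, Derivation.leibniz, smul_eq_mul,
        smul_eq_mul])

/-- The derivation `d/dz` on functions on `U`. -/
def dR : Derivation k (CoordRing g₂ g₃) (CoordRing g₂ g₃) :=
  derivationOfInjective (laurentR H) (laurentR_injective H) _
    fun r => (exists_laurentR_eq_deriv H r).choose_spec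

theorem laurentR_dR (r : CoordRing g₂ g₃) :
    laurentR H (dR H r) = LaurentSeries.deriv (laurentR H r) :=
  (exists_laurentR_eq_deriv H r).choose_spec

theorem dR_x : dR H (x g₂ g₃) = y g₂ g₃ :=
  laurentR_injective H (by rw [laurentR_dR, laurentR_x, laurentR_y])

theorem dR_y : dR H (y g₂ g₃) = 6 * x g₂ g₃ ^ 2 - algebraMap k _ (g₂ / 2) :=
  laurentR_injective H (by
    have h2 : (HahnSeries.C (algebraMap k ℂ (g₂ / 2)) : LaurentSeries ℂ) = HahnSeries.C L.g₂ / 2 := by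
      rw [H.g₂_eq, map_div₀, map_div₀, map_ofNat, map_ofNat]
    rw [laurentR_dR, map_sub, map_mul, map_pow, AlgHom.commutes, algebraMap_eq_C, laurentR_x,
      laurentR_y, map_ofNat, h2]
    linear_combination (1 / 2) * two_mul_deriv_deriv_pHat (L := L))

theorem exists_laurent_eq_deriv (f : FunField g₂ g₃) :
    ∃ g, laurent H g = LaurentSeries.deriv (laurent H f) := by
  obtain ⟨a, b, hb, h⟩ := exists_mul_eq f
  have e := laurent_mul_eq H h
  have hb' : laurentR H b ≠ 0 := (map_ne_zero_iff _ (laurentR_injective H)).mpr hb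
  refine ⟨(algebraMap _ _ (dR H a) - f * algebraMap _ _ (dR H b)) / algebraMap _ _ b, ?_⟩
  have e' := congrArg LaurentSeries.deriv e
  rw [Derivation.leibniz, smul_eq_mul, smul_eq_mul] at e'
  rw [map_div₀, map_sub, map_mul, laurent_algebraMap, laurent_algebraMap, laurent_algebraMap,
    laurentR_dR, laurentR_dR, div_eq_iff hb']
  linear_combination -e'

/-- The derivation `d/dz` on rational functions. -/
def dK : Derivation k (FunField g₂ g₃) (FunField g₂ g₃) :=
  derivationOfInjective (laurent H) (laurent_injective H) _
    fun r => (exists_laurent_eq_deriv H r).choose_spec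

theorem laurent_dK (f : FunField g₂ g₃) :
    laurent H (dK H f) = LaurentSeries.deriv (laurent H f) :=
  (exists_laurent_eq_deriv H f).choose_spec

theorem dK_algebraMap (r : CoordRing g₂ g₃) :
    dK H (algebraMap _ _ r) = algebraMap _ _ (dR H r) :=
  laurent_injective H (by
    rw [laurent_dK, laurent_algebraMap, laurent_algebraMap, laurentR_dR])

/-! ### Evaluation at a point of the uniformization -/

/-- The pull-back of functions on `U`, evaluated at a point. -/
def pullbackHom (t : ℂ) (ht : t ∉ L.lattice) : CoordRing g₂ g₃ →ₐ[k] ℂ :=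
  evalHom (L.weierstrassP t) (L.derivWeierstrassP t) (by
    rw [L.derivWeierstrassP_sq t ht, H.g₂_eq, H.g₃_eq])

variable (L) in
theorem pullback_add_mul_y (p q : k[X]) (t : ℂ) :
    pullback L (aeval (x g₂ g₃) p + aeval (x g₂ g₃) q * y g₂ g₃) t =
      aeval (L.weierstrassP t) p + aeval (L.weierstrassP t) q * L.derivWeierstrassP t := by
  have e : aeval (x g₂ g₃) p + aeval (x g₂ g₃) q * y g₂ g₃ =
      p • WeierstrassCurve.Affine.CoordinateRing.basis (curve g₂ g₃) 0 +
        (2 * q) • WeierstrassCurve.Affine.CoordinateRing.basis (curve g₂ g₃) 1 := by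
    rw [smul_one_add_smul_Y, WeierstrassCurve.Affine.CoordinateRing.basis_zero,
      WeierstrassCurve.Affine.CoordinateRing.basis_one]
  rw [pullback, e]
  simp only [map_add, map_smul, Module.Basis.repr_self, Finsupp.add_apply, Finsupp.smul_apply,
    Finsupp.single_eq_same, smul_eq_mul, mul_one, map_mul, map_ofNat]
  simp
  ring

theorem pullback_eq (r : CoordRing g₂ g₃) (t : ℂ) (ht : t ∉ L.lattice) :
    pullback L r t = pullbackHom H t ht r := by
  obtain ⟨p, q, rfl⟩ := exists_eq_add_mul_y r
  rw [pullback_add_mul_y, pullbackHom, evalHom_add_mul_y]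

end Laurent

end EllPolylog

/-! ### The expansion of wΞ(t,w) in w and its differential equation. -/

namespace KroneckerTheta

variable (L : PeriodPair)

/-- The function `w Θ(t,w)`, extended to `w = 0`. -/
def thetaReg (t w : ℂ) : ℂ :=
  Complex.exp (-(eTwoStar L * t * w)) * sigma L (t + w) / (sigma L t * sigmaQuot L w)

/-- As (t + w)² − t² − w² = 2tw, the Gaussian factors of the three theta functions leave only
exp(−e₂^* t w). -/
theorem Theta_eq (t w : ℂ) : Theta L t w = thetaReg L t w / w := by
  have he : Complex.exp (-eTwoStar L * (t + w) ^ 2 / 2) =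
      Complex.exp (-(eTwoStar L * t * w)) *
        (Complex.exp (-eTwoStar L * t ^ 2 / 2) * Complex.exp (-eTwoStar L * w ^ 2 / 2)) := by
    rw [← Complex.exp_add, ← Complex.exp_add]; congr 1; ring
  have h1 := Complex.exp_ne_zero (-eTwoStar L * t ^ 2 / 2)
  have h2 := Complex.exp_ne_zero (-eTwoStar L * w ^ 2 / 2)
  rw [Theta, theta, theta, theta, thetaReg, he, sigma_eq L w]
  generalize Complex.exp (-eTwoStar L * t ^ 2 / 2) = a at *
  generalize Complex.exp (-eTwoStar L * w ^ 2 / 2) = b at *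
  rw [div_div, show a * sigma L t * (b * (w * sigmaQuot L w)) =
    (a * b) * (sigma L t * sigmaQuot L w * w) by ring, mul_comm _ (a * b), mul_assoc (a * b),
    mul_div_mul_left _ _ (mul_ne_zero h1 h2)]

variable {L} {t : ℂ}

theorem thetaReg_zero (ht : t ∉ L.lattice) : thetaReg L t 0 = 1 := by
  simp [thetaReg, sigmaQuot_zero, sigma_ne_zero L ht]

theorem hasDerivAt_thetaReg (ht : t ∉ L.lattice) {w : ℂ} (htw : t + w ∉ L.lattice)
    (hw : w ∉ (L.lattice \ {0} : Set ℂ)) :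
    HasDerivAt (thetaReg L t)
      ((-(eTwoStar L * t) + zeta L (t + w) - zetaReg L w) * thetaReg L t w) w := by
  have h1 : HasDerivAt (fun w => Complex.exp (-(eTwoStar L * t * w)))
      (Complex.exp (-(eTwoStar L * t * w)) * -(eTwoStar L * t * 1)) w :=
    ((hasDerivAt_id w).const_mul (eTwoStar L * t)).neg.cexp
  have h2 : HasDerivAt (fun w => sigma L (t + w)) (zeta L (t + w) * sigma L (t + w)) w :=
    (hasDerivAt_sigma L htw).comp_const_add t w
  have hs := sigmaQuot_ne_zero L hw
  have hσ := sigma_ne_zero L ht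
  have h3 : HasDerivAt (fun w => sigma L t * sigmaQuot L w)
      (sigma L t * (zetaReg L w * sigmaQuot L w)) w := (hasDerivAt_sigmaQuot L hw).const_mul _
  refine ((h1.mul h2).div h3 (mul_ne_zero hσ hs)).congr_deriv ?_
  simp only [Pi.mul_apply]
  rw [thetaReg]
  field_simp

theorem zero_notMem_lattice_diff : (0 : ℂ) ∉ (L.lattice \ {0} : Set ℂ) := fun h => h.2 rfl

/-- The function wΘ(t,w) takes the value 1 at w = 0, so the limit is its derivative there. -/
theorem FOne_eq (ht : t ∉ L.lattice) : FOne L t = zeta L t - eTwoStar L * t := by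
  have h := hasDerivAt_thetaReg ht (w := 0) (by simpa using ht) zero_notMem_lattice_diff
  rw [thetaReg_zero ht, add_zero, zetaReg_zero, sub_zero, mul_one] at h
  have h' := hasDerivAt_iff_tendsto_slope.mp h
  refine Tendsto.limUnder_eq ?_
  rw [show zeta L t - eTwoStar L * t = -(eTwoStar L * t) + zeta L t by ring]
  refine h'.congr' ?_
  filter_upwards [self_mem_nhdsWithin] with w (hw : w ≠ 0)
  rw [slope_def_field, thetaReg_zero ht, Theta_eq L t w]
  field_simp
  simp

/-- The function `w Ξ(t,w)`, extended to `w = 0`. -/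
def xiReg (L : PeriodPair) (t w : ℂ) : ℂ := Complex.exp (-FOne L t * w) * thetaReg L t w

theorem update_Xi (ht : t ∉ L.lattice) :
    Function.update (fun w => w * Xi L t w) 0 1 = xiReg L t := by
  ext w
  rcases eq_or_ne w 0 with rfl | hw
  · simp [xiReg, thetaReg_zero ht]
  · rw [Function.update_of_ne hw, Xi, Theta_eq L t w, xiReg]
    field_simp

/-- The term −e₂^* t in the logarithmic derivative of wΘ is cancelled by the one in F₁. From here on
the value of e₂^* plays no role. -/
theorem hasDerivAt_xiReg (ht : t ∉ L.lattice) {w : ℂ} (htw : t + w ∉ L.lattice)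
    (hw : w ∉ (L.lattice \ {0} : Set ℂ)) :
    HasDerivAt (xiReg L t) ((zeta L (t + w) - zeta L t - zetaReg L w) * xiReg L t w) w := by
  have h1 : HasDerivAt (fun w => Complex.exp (-FOne L t * w))
      (Complex.exp (-FOne L t * w) * (-FOne L t * 1)) w :=
    ((hasDerivAt_id w).const_mul (-FOne L t)).cexp
  refine (h1.mul (hasDerivAt_thetaReg ht htw hw)).congr_deriv ?_
  rw [xiReg, FOne_eq ht]
  ring

theorem eventually_add_notMem (ht : t ∉ L.lattice) : ∀ᶠ w in 𝓝 (0 : ℂ), t + w ∉ L.lattice := by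
  have hc : ContinuousAt (fun w : ℂ => t + w) 0 := by fun_prop
  exact hc.eventually_mem ((isOpen_compl_lattice L).mem_nhds (by simpa using ht))

theorem eventually_notMem_diff : ∀ᶠ w in 𝓝 (0 : ℂ), w ∉ (L.lattice \ {0} : Set ℂ) :=
  L.compl_lattice_sdiff_singleton_mem_nhds 0

theorem analyticAt_zero_of_eventually {f : ℂ → ℂ} (h : ∀ᶠ w in 𝓝 (0 : ℂ), DifferentiableAt ℂ f w) :
    AnalyticAt ℂ f 0 :=
  Complex.analyticAt_iff_eventually_differentiableAt.mpr h

theorem analyticAt_xiReg (ht : t ∉ L.lattice) : AnalyticAt ℂ (xiReg L t) 0 :=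
  analyticAt_zero_of_eventually (by
    filter_upwards [eventually_add_notMem ht, eventually_notMem_diff] with w h1 h2
    exact (hasDerivAt_xiReg ht h1 h2).differentiableAt)

theorem hasDerivAt_logDeriv_xiReg {w : ℂ} (htw : t + w ∉ L.lattice)
    (hw : w ∉ (L.lattice \ {0} : Set ℂ)) :
    HasDerivAt (fun w => zeta L (t + w) - zeta L t - zetaReg L w)
      (L.weierstrassPExcept 0 w - L.weierstrassP (t + w)) w := by
  refine ((((hasDerivAt_zeta L htw).comp_const_add t w).sub_const (zeta L t)).sub
    (hasDerivAt_zetaReg L hw)).congr_deriv (by ring)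

theorem analyticAt_logDeriv_xiReg (ht : t ∉ L.lattice) :
    AnalyticAt ℂ (fun w => zeta L (t + w) - zeta L t - zetaReg L w) 0 :=
  analyticAt_zero_of_eventually (by
    filter_upwards [eventually_add_notMem ht, eventually_notMem_diff] with w h1 h2
    exact (hasDerivAt_logDeriv_xiReg h1 h2).differentiableAt)

theorem derivative_taylor_xiReg (ht : t ∉ L.lattice) :
    PowerSeries.derivative ℂ (PowerSeries.taylor (xiReg L t)) =
      PowerSeries.taylor (fun w => zeta L (t + w) - zeta L t - zetaReg L w) *
        PowerSeries.taylor (xiReg L t) := by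
  rw [← PowerSeries.taylor_deriv, ← PowerSeries.taylor_mul (analyticAt_logDeriv_xiReg ht)
    (analyticAt_xiReg ht)]
  refine PowerSeries.taylor_congr ?_
  filter_upwards [eventually_add_notMem ht, eventually_notMem_diff] with w h1 h2
  exact (hasDerivAt_xiReg ht h1 h2).deriv

theorem analyticAt_weierstrassP_add (ht : t ∉ L.lattice) :
    AnalyticAt ℂ (fun w => L.weierstrassP (t + w)) 0 := by
  have : AnalyticAt ℂ L.weierstrassP (t + 0) := by
    rw [add_zero]; exact L.analyticOnNhd_weierstrassP t ht
  exact this.comp (f := fun w => t + w) (by fun_prop)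

/-- One more derivative replaces ζ, which is not elliptic, by ℘. This is what makes the coefficients
functions on the curve. -/
theorem derivative_taylor_logDeriv_xiReg (ht : t ∉ L.lattice) :
    PowerSeries.derivative ℂ
      (PowerSeries.taylor (fun w => zeta L (t + w) - zeta L t - zetaReg L w)) =
      PowerSeries.taylor (L.weierstrassPExcept 0) -
        PowerSeries.taylor (fun w => L.weierstrassP (t + w)) := by
  rw [← PowerSeries.taylor_deriv, ← PowerSeries.taylor_sub (L.analyticAt_weierstrassPExcept 0)
    (analyticAt_weierstrassP_add ht)]
  refine PowerSeries.taylor_congr ?_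
  filter_upwards [eventually_add_notMem ht, eventually_notMem_diff] with w h1 h2
  exact (hasDerivAt_logDeriv_xiReg h1 h2).deriv

theorem connFun_eq (ht : t ∉ L.lattice) (n : ℕ) :
    connFun L n t = PowerSeries.coeff n (PowerSeries.taylor (xiReg L t)) := by
  rw [connFun, update_Xi ht, PowerSeries.taylor, PowerSeries.coeff_mk]

end KroneckerTheta

/-! ### The exponential of a derivation -/

namespace PowerSeries

variable {k : Type*} [Field k] [CharZero k] {A : Type*} [CommRing A] [Algebra k A]

/-- The series `∑ Dⁿ(a) wⁿ / n!`. -/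
def flow (D : Derivation k A A) (a : A) : PowerSeries A :=
  mk fun n => algebraMap k A (n ! : k)⁻¹ * D^[n] a

variable (D : Derivation k A A)

theorem derivative_flow (a : A) : derivative A (flow D a) = flow D (D a) := by
  ext n
  rw [coeff_derivative, flow, flow, coeff_mk, coeff_mk, Function.iterate_succ_apply,
    mul_right_comm]
  congr 1
  have h : ((n : A) + 1) = algebraMap k A ((n : k) + 1) := by simp
  rw [h, ← map_mul]
  congr 1
  rw [Nat.factorial_succ]
  have h1 : (n ! : k) ≠ 0 := by exact_mod_cast n.factorial_ne_zero
  have h2 : ((n : k) + 1) ≠ 0 := Nat.cast_add_one_ne_zero n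
  push_cast
  field_simp

omit [CharZero k] in
theorem constantCoeff_flow (a : A) : constantCoeff (flow D a) = a := by
  rw [← coeff_zero_eq_constantCoeff_apply, flow, coeff_mk]; simp

omit [CharZero k] in
theorem flow_add (a b : A) : flow D (a + b) = flow D a + flow D b := by
  ext n
  simp [flow, mul_add]

/-- By the Leibniz rule d/dw of either side is a sum of expressions of the same shape, so the
coefficients agree by induction, simultaneously for all pairs. -/
theorem flow_mul (a b : A) : flow D (a * b) = flow D a * flow D b := by
  ext n
  induction n generalizing a b with
  | zero => simp [constantCoeff_flow]
  | succ n ih =>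
    have h1 : coeff n (derivative A (flow D (a * b))) =
        coeff n (derivative A (flow D a * flow D b)) := by
      rw [derivative_flow, Derivation.leibniz, Derivation.leibniz, derivative_flow,
        derivative_flow, flow_add]
      simp only [smul_eq_mul, map_add]
      rw [ih, ih]
    rw [coeff_derivative, coeff_derivative] at h1
    have e := congrArg (· * algebraMap k A ((n : k) + 1)⁻¹) h1
    simpa only [mul_assoc, mul_comm ((n : A) + 1), algebraMap_inv_mul_cast, mul_one] using e

omit [CharZero k] in
theorem map_flow {B : Type*} [CommRing B] [Algebra k B] {k' : Type*} [Field k'] [Algebra k' B]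
    [Algebra k k'] [IsScalarTower k k' B] (D' : Derivation k' B B) (f : A →ₐ[k] B)
    (h : ∀ a, f (D a) = D' (f a)) (a : A) :
    map (f : A →+* B) (flow D a) = flow D' (f a) := by
  ext n
  have e : f (D^[n] a) = D'^[n] (f a) := Function.Semiconj.iterate_right (f := f) h n a
  have e' : algebraMap k' B (n ! : k')⁻¹ = algebraMap k B (n ! : k)⁻¹ := by
    rw [IsScalarTower.algebraMap_apply k k' B, map_inv₀ (algebraMap k k'), map_natCast]
  simp [flow, e, e']

end PowerSeries

namespace EllPolylog

open PowerSeries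
open LaurentSeries hiding derivative

variable {k : Type u} [Field k] [CharZero k] [Algebra k ℂ] {g₂ g₃ : k} {L : PeriodPair}

/-! ### Rationality of the Laurent coefficients of `℘` -/

-- This is 2℘'' = 12℘² − g₂ for ℘ = z⁻² + p. The terms in z⁻⁴ cancel, and the cross term 24 z⁻² p of
-- 12℘² is the right side.
variable (L) in
theorem X_sq_mul_pReg :
    X ^ 2 * (2 * derivative ℂ (derivative ℂ (pReg L)) - 12 * pReg L ^ 2 + C L.g₂) =
      24 * pReg L := by
  apply HahnSeries.ofPowerSeries_injective (Γ := ℤ)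
  have h := two_mul_deriv_deriv_pHat (L := L)
  have hz := z_ne_zero
  have h3 : LaurentSeries.deriv (z ^ 3)⁻¹ = -3 * (z ^ 4)⁻¹ := by
    rw [Derivation.leibniz_inv, Derivation.leibniz_pow, deriv_z]
    simp only [smul_eq_mul, nsmul_eq_mul]
    field_simp
    push_cast
    ring
  have h2 : LaurentSeries.deriv (-2) = 0 := by
    have : (-2 : LaurentSeries ℂ) = HahnSeries.C (-2) := by rw [map_neg, map_ofNat]
    rw [this]; exact derivFun_C _
  have hX : HahnSeries.ofPowerSeries ℤ ℂ X = z := by simp [z]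
  rw [deriv_pHat, map_add, Derivation.leibniz, h2, h3, deriv_ofPowerSeries, pHat] at h
  simp only [map_mul, map_add, map_sub, map_pow, hX, map_ofNat, HahnSeries.ofPowerSeries_C]
  simp only [smul_eq_mul] at h
  field_simp at h
  apply mul_left_cancel₀ (pow_ne_zero 2 hz)
  linear_combination h

theorem coeff_four_pReg : coeff 4 (pReg L) = L.g₃ / 28 := by
  rw [pReg, taylor, coeff_mk, L.iteratedDeriv_weierstrassPExcept_self, if_neg (by norm_num),
    L.sumInvPow_zero, PeriodPair.g₃]
  norm_num [Nat.factorial]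
  ring

/-- The equation is a recursion in which the coefficient of index n + 2 appears with the factor
2(n+2)(n+1) − 24 = 2(n−2)(n+5). It determines every coefficient except the one of index 4, which is
g₃/28 by the Eisenstein series. -/
theorem coeff_pReg_mem (H : Uniformizes L g₂ g₃) (n : ℕ) :
    coeff n (pReg L) ∈ (algebraMap k ℂ).range := by
  induction n using Nat.strong_induction_on with
  | _ n ih =>
    have h := congrArg (coeff n) (X_sq_mul_pReg L)
    have h24 : (24 : PowerSeries ℂ) = C 24 := rfl
    have h12 : (12 : PowerSeries ℂ) = C 12 := rfl
    have h2 : (2 : PowerSeries ℂ) = C 2 := rfl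
    rw [h24, coeff_C_mul] at h
    match n, ih, h with
    | 0, _, h =>
      have : coeff 0 (pReg L) = 0 := by simpa using h.symm
      rw [this]; exact zero_mem _
    | 1, _, h =>
      have : coeff 1 (pReg L) = 0 := by simpa [coeff_X_pow_mul'] using h.symm
      rw [this]; exact zero_mem _
    | n + 2, ih, h =>
      rcases eq_or_ne n 2 with rfl | hn
      · exact ⟨g₃ / 28, by rw [coeff_four_pReg, H.g₃_eq, map_div₀, map_ofNat]⟩
      · rw [coeff_X_pow_mul, map_add, map_sub, h2, h12, coeff_C_mul, coeff_C_mul,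
          coeff_derivative, coeff_derivative, pow_two, coeff_mul, coeff_C] at h
        have hne : (2 * ((n + 1 : ℕ) + 1) * ((n : ℂ) + 1) - 24 : ℂ) ≠ 0 := by
          have : (2 * ((n + 1 : ℕ) + 1) * ((n : ℂ) + 1) - 24 : ℂ) =
              ((2 * ((n - 2) * (n + 5)) : ℤ) : ℂ) := by push_cast; ring
          rw [this]
          have h2 : (n : ℤ) - 2 ≠ 0 := by omega
          have h5 : (n : ℤ) + 5 ≠ 0 := by omega
          exact_mod_cast mul_ne_zero two_ne_zero (mul_ne_zero h2 h5)
        have e : coeff (n + 2) (pReg L) =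
            (12 * (∑ p ∈ Finset.HasAntidiagonal.antidiagonal n, coeff p.1 (pReg L) * coeff p.2 (pReg L)) -
              (if n = 0 then L.g₂ else 0)) / (2 * ((n + 1 : ℕ) + 1) * ((n : ℂ) + 1) - 24 : ℂ) := by
          rw [eq_div_iff hne]
          linear_combination h
        have hs : ∑ p ∈ Finset.HasAntidiagonal.antidiagonal n, coeff p.1 (pReg L) * coeff p.2 (pReg L) ∈
            (algebraMap k ℂ).range := by
          refine sum_mem fun p hp => ?_
          have := Finset.HasAntidiagonal.mem_antidiagonal.mp hp
          exact mul_mem (ih _ (by omega)) (ih _ (by omega))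
        obtain ⟨c, hc⟩ := hs
        refine ⟨(12 * c - (if n = 0 then g₂ else 0)) / (2 * ((n + 1 : ℕ) + 1) * ((n : k) + 1) - 24),
          ?_⟩
        rw [e, ← hc, H.g₂_eq]
        simp only [map_div₀, map_sub, map_mul, map_add, map_ofNat, map_natCast, map_one]
        split_ifs <;> simp

variable (H : Uniformizes L g₂ g₃)

/-- The series `℘ - z⁻²` with coefficients in `k`. -/
def pRegK : PowerSeries k := mk fun n => (coeff_pReg_mem H n).choose

theorem map_pRegK : map (algebraMap k ℂ) (pRegK H) = pReg L := by
  ext n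
  rw [coeff_map, pRegK, coeff_mk, (coeff_pReg_mem H n).choose_spec]

/-! ### The generating series of the connection functions -/

/-- The logarithmic derivative of the generating series of the connection functions. -/
def connLog : PowerSeries (CoordRing g₂ g₃) :=
  mk fun
    | 0 => 0
    | n + 1 => algebraMap k _ ((n : k) + 1)⁻¹ *
        coeff n (map (algebraMap k (CoordRing g₂ g₃)) (pRegK H) - flow (dR H) (x g₂ g₃))

theorem derivative_connLog : derivative _ (connLog H) =
    map (algebraMap k (CoordRing g₂ g₃)) (pRegK H) - flow (dR H) (x g₂ g₃) := by
  ext n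
  rw [coeff_derivative, connLog, coeff_mk]
  simp only
  rw [mul_right_comm, algebraMap_inv_mul_cast, one_mul]

theorem constantCoeff_connLog : constantCoeff (connLog H) = 0 := by
  rw [← coeff_zero_eq_constantCoeff_apply, connLog, coeff_mk]

/-- The generating series of the connection functions. -/
def connSeries : PowerSeries (CoordRing g₂ g₃) := odeSol k (connLog H)

include H in
theorem pullback_add (r s : CoordRing g₂ g₃) {t : ℂ} (ht : t ∉ L.lattice) :
    pullback L (r + s) t = pullback L r t + pullback L s t := by
  simp only [pullback_eq H _ t ht, map_add]

include H in
theorem pullback_mul (r s : CoordRing g₂ g₃) {t : ℂ} (ht : t ∉ L.lattice) :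
    pullback L (r * s) t = pullback L r t * pullback L s t := by
  simp only [pullback_eq H _ t ht, map_mul]

include H in
theorem pullback_x {t : ℂ} (ht : t ∉ L.lattice) : pullback L (x g₂ g₃) t = L.weierstrassP t := by
  rw [pullback_eq H _ t ht, pullbackHom, evalHom_x]

include H in
theorem pullback_y {t : ℂ} (ht : t ∉ L.lattice) :
    pullback L (y g₂ g₃) t = L.derivWeierstrassP t := by
  rw [pullback_eq H _ t ht, pullbackHom, evalHom_y]

include H in
theorem pullback_const (c : k) {t : ℂ} (ht : t ∉ L.lattice) :
    pullback L (algebraMap k (CoordRing g₂ g₃) c) t = algebraMap k ℂ c := by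
  rw [pullback_eq H _ t ht, AlgHom.commutes]

theorem _root_.LaurentSeries.HasLaurent.congr {f f' : ℂ → ℂ} {g : LaurentSeries ℂ} (h : HasLaurent f g)
    (h' : ∀ᶠ x in 𝓝[≠] 0, f' x = f x) : HasLaurent f' g := by
  obtain ⟨m, G, hG, hf, hg⟩ := h
  refine ⟨m, G, hG, ?_, hg⟩
  filter_upwards [hf, h'] with x hx hx'
  rw [hx', hx]

theorem hasLaurent_pullback (r : CoordRing g₂ g₃) :
    HasLaurent (pullback L r) (laurentR H r) := by
  have hev := eventually_notMem_lattice L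
  refine induction_x_y (P := fun r => HasLaurent (pullback L r) (laurentR H r))
    (fun c => ?_) ?_ ?_ (fun r s hr hs => ?_) (fun r s hr hs => ?_) r
  · rw [AlgHom.commutes, algebraMap_eq_C]
    exact (hasLaurent_const _).congr (hev.mono fun t ht => pullback_const H c ht)
  · rw [laurentR_x]
    exact (hasLaurent_weierstrassP L).congr (hev.mono fun t ht => pullback_x H ht)
  · rw [laurentR_y]
    exact (hasLaurent_derivWeierstrassP L).congr (hev.mono fun t ht => pullback_y H ht)
  · rw [map_add]
    exact (hr.add hs).congr (hev.mono fun t ht => pullback_add H r s ht)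
  · rw [map_mul]
    exact (hr.mul hs).congr (hev.mono fun t ht => pullback_mul H r s ht)

-- A function on U is determined by its Laurent series, hence by its pull-back near 0.
include H in
theorem eq_of_pullback_eq {r s : CoordRing g₂ g₃}
    (h : ∀ t ∉ L.lattice, pullback L r t = pullback L s t) : r = s :=
  laurentR_injective H ((hasLaurent_pullback H r).unique (hasLaurent_pullback H s)
    ((eventually_notMem_lattice L).mono h))

theorem hasDerivAt_weierstrassP {t : ℂ} (ht : t ∉ L.lattice) :
    HasDerivAt L.weierstrassP (L.derivWeierstrassP t) t := by
  rw [← L.deriv_weierstrassP]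
  exact (L.analyticOnNhd_weierstrassP t ht).differentiableAt.hasDerivAt

/-- Differentiating the equation of ℘'² gives the claim multiplied by ℘'. Either ℘' has no zeros in
some punctured neighbourhood and can be cancelled there, the value at t following by continuation;
or it vanishes near t, hence on the whole complement of the lattice, which is connected as the
complement of a countable set, against the coefficient −2 of z⁻³. -/
theorem hasDerivAt_derivWeierstrassP (L : PeriodPair) {t : ℂ} (ht : t ∉ L.lattice) :
    HasDerivAt L.derivWeierstrassP (6 * L.weierstrassP t ^ 2 - L.g₂ / 2) t := by
  have hd {t : ℂ} (ht : t ∉ L.lattice) := L.analyticOnNhd_derivWeierstrassP t ht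
  have ho := KroneckerTheta.isOpen_compl_lattice L
  have e {t : ℂ} (ht : t ∉ L.lattice) : L.derivWeierstrassP t *
      (deriv L.derivWeierstrassP t - (6 * L.weierstrassP t ^ 2 - L.g₂ / 2)) = 0 := by
    have h1 := (hd ht).differentiableAt.hasDerivAt.pow 2
    have hp := hasDerivAt_weierstrassP ht
    have h2 := (((hp.pow 3).const_mul 4).sub (hp.const_mul L.g₂)).sub_const L.g₃
    have h := h1.unique (h2.congr_of_eventuallyEq (by
      filter_upwards [ho.mem_nhds ht] with s hs using L.derivWeierstrassP_sq s hs))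
    push_cast at h
    linear_combination (1 / 2) * h
  have hD : deriv L.derivWeierstrassP t - (6 * L.weierstrassP t ^ 2 - L.g₂ / 2) = 0 := by
    rcases (hd ht).eventually_eq_zero_or_eventually_ne_zero with h | h
    · exfalso
      have hc : IsPreconnected (L.lattice : Set ℂ)ᶜ := by
        refine (Set.Countable.isPathConnected_compl_of_one_lt_rank ?_ ?_).isConnected.isPreconnected
        · simp
        · exact (Set.countable_coe_iff (s := (L.lattice : Set ℂ))).mp
            (L.latticeEquivProd.toEquiv.countable_iff.mpr inferInstance)
      have hz := (L.analyticOnNhd_derivWeierstrassP).eqOn_of_preconnected_of_eventuallyEq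
        (g := fun _ => 0) analyticOnNhd_const hc ht h
      have h0 := (hasLaurent_derivWeierstrassP L).unique (hasLaurent_const 0)
        ((eventually_notMem_lattice L).mono fun s hs => hz hs)
      have := coeff_deriv_pHat L
      rw [h0] at this
      simp at this
    · have ha : AnalyticAt ℂ (fun t => deriv L.derivWeierstrassP t -
          (6 * L.weierstrassP t ^ 2 - L.g₂ / 2)) t := by
        have := (hd ht).deriv
        have := L.analyticOnNhd_weierstrassP t ht
        fun_prop
      have hev : (fun t => deriv L.derivWeierstrassP t -
          (6 * L.weierstrassP t ^ 2 - L.g₂ / 2)) =ᶠ[𝓝[≠] t] fun _ => 0 := by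
        filter_upwards [h, nhdsWithin_le_nhds (ho.mem_nhds ht)] with s hs hs'
        exact (mul_eq_zero.mp (e hs')).resolve_left hs
      exact ((ha.frequently_eq_iff_eventually_eq analyticAt_const).mp hev.frequently).self_of_nhds
  rw [← sub_eq_zero.mp hD]
  exact (hd ht).differentiableAt.hasDerivAt

theorem hasDerivAt_pullback (r : CoordRing g₂ g₃) {t : ℂ} (ht : t ∉ L.lattice) :
    HasDerivAt (pullback L r) (pullback L (dR H r) t) t := by
  have hev : ∀ᶠ t in 𝓝 t, t ∉ L.lattice := (KroneckerTheta.isOpen_compl_lattice L).mem_nhds ht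
  refine induction_x_y (P := fun r => HasDerivAt (pullback L r) (pullback L (dR H r) t) t)
    (fun c => ?_) ?_ ?_ (fun r s hr hs => ?_) (fun r s hr hs => ?_) r
  · have h0 : pullback L (dR H (algebraMap k (CoordRing g₂ g₃) c)) t = 0 := by
      rw [Derivation.map_algebraMap, pullback_eq H _ t ht, map_zero]
    rw [h0]
    exact (hasDerivAt_const t _).congr_of_eventuallyEq
      (hev.mono fun t ht => pullback_const H c ht)
  · rw [dR_x, pullback_y H ht]
    exact (hasDerivAt_weierstrassP ht).congr_of_eventuallyEq
      (hev.mono fun t ht => pullback_x H ht)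
  · have h6 : pullback L (dR H (y g₂ g₃)) t = 6 * L.weierstrassP t ^ 2 - L.g₂ / 2 := by
      rw [dR_y, pullback_eq H _ t ht, map_sub, map_mul, map_pow, map_ofNat, AlgHom.commutes,
        ← pullback_eq H _ t ht, pullback_x H ht, H.g₂_eq, map_div₀, map_ofNat]
    rw [h6]
    exact (hasDerivAt_derivWeierstrassP L ht).congr_of_eventuallyEq
      (hev.mono fun t ht => pullback_y H ht)
  · rw [map_add, pullback_add H _ _ ht]
    exact (hr.add hs).congr_of_eventuallyEq (hev.mono fun t ht => pullback_add H r s ht)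
  · rw [Derivation.leibniz, smul_eq_mul, smul_eq_mul, pullback_add H _ _ ht,
      pullback_mul H _ _ ht, pullback_mul H _ _ ht]
    refine ((hr.mul hs).congr_of_eventuallyEq
      (hev.mono fun t ht => pullback_mul H r s ht)).congr_deriv (by ring)

theorem iteratedDeriv_weierstrassP (n : ℕ) {t : ℂ} (ht : t ∉ L.lattice) :
    iteratedDeriv n L.weierstrassP t = pullback L ((dR H)^[n] (x g₂ g₃)) t := by
  induction n generalizing t with
  | zero => rw [iteratedDeriv_zero, Function.iterate_zero, id, pullback_x H ht]
  | succ n ih =>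
    have hev : ∀ᶠ t in 𝓝 t, t ∉ L.lattice := (KroneckerTheta.isOpen_compl_lattice L).mem_nhds ht
    rw [iteratedDeriv_succ, Function.iterate_succ_apply']
    exact ((hasDerivAt_pullback H _ ht).congr_of_eventuallyEq (hev.mono fun t ht => ih ht)).deriv

/-- Thus the flow of x is the algebraic model of ℘(t + w). -/
theorem taylor_weierstrassP_add {t : ℂ} (ht : t ∉ L.lattice) :
    taylor (fun w => L.weierstrassP (t + w)) =
      map (pullbackHom H t ht : CoordRing g₂ g₃ →+* ℂ) (flow (dR H) (x g₂ g₃)) := by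
  ext n
  rw [taylor, coeff_mk, coeff_map, flow, coeff_mk, iteratedDeriv_comp_const_add]
  simp only [add_zero, iteratedDeriv_weierstrassP H n ht, pullback_eq H _ t ht, RingHom.coe_coe,
    map_mul, AlgHom.commutes, map_inv₀, map_natCast]
  rw [div_eq_inv_mul]

theorem map_connLog {t : ℂ} (ht : t ∉ L.lattice) :
    map (pullbackHom H t ht : CoordRing g₂ g₃ →+* ℂ) (connLog H) =
      taylor (fun w => KroneckerTheta.zeta L (t + w) - KroneckerTheta.zeta L t -
        KroneckerTheta.zetaReg L w) := by
  refine eq_of_derivative_eq (k := ℂ) ?_ ?_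
  · rw [derivative_map, derivative_connLog, KroneckerTheta.derivative_taylor_logDeriv_xiReg ht,
      map_sub, taylor_weierstrassP_add H ht, ← pReg, ← map_pRegK H]
    congr 1
    ext n
    simp
  · rw [constantCoeff_taylor, ← coeff_zero_eq_constantCoeff_apply, coeff_map,
      coeff_zero_eq_constantCoeff_apply, constantCoeff_connLog]
    simp [KroneckerTheta.zetaReg_zero]

/-- Evaluation at the point t turns the formal equation over the coordinate ring into the analytic
equation of wΞ(t,w), and both solutions start with 1. -/
theorem map_connSeries {t : ℂ} (ht : t ∉ L.lattice) :
    map (pullbackHom H t ht : CoordRing g₂ g₃ →+* ℂ) (connSeries H) =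
      taylor (KroneckerTheta.xiReg L t) := by
  refine ode_unique (k := ℂ) (A := map (pullbackHom H t ht : CoordRing g₂ g₃ →+* ℂ) (connLog H))
    ?_ ?_ ?_
  · rw [derivative_map, connSeries, derivative_odeSol, map_mul]
  · rw [map_connLog, KroneckerTheta.derivative_taylor_xiReg ht]
  · rw [constantCoeff_taylor, ← coeff_zero_eq_constantCoeff_apply, coeff_map,
      coeff_zero_eq_constantCoeff_apply, connSeries, constantCoeff_odeSol, map_one]
    simp [KroneckerTheta.xiReg, KroneckerTheta.thetaReg_zero ht]

theorem pullback_coeff_connSeries (n : ℕ) {t : ℂ} (ht : t ∉ L.lattice) :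
    pullback L (coeff n (connSeries H)) t = KroneckerTheta.connFun L n t := by
  rw [KroneckerTheta.connFun_eq ht, ← map_connSeries H ht, coeff_map, pullback_eq H _ t ht]
  rfl

theorem eq_coeff_connSeries {l : ℕ → CoordRing g₂ g₃}
    (hl : ∀ n, ∀ t ∉ L.lattice, pullback L (l n) t = KroneckerTheta.connFun L n t) :
    l = fun n => coeff n (connSeries H) :=
  funext fun n => eq_of_pullback_eq H fun t ht => by
    rw [hl n t ht, pullback_coeff_connSeries H n ht]

end EllPolylog

namespace EllPolylog

open MvPolynomial

/-! ### Derivations of polynomial rings -/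

section Nabla

variable {k : Type*} [CommRing k] {A : Type*} [CommRing A] [Algebra k A] {σ : Type*}
  (d : Derivation k A A)

/-- The map which applies the derivation `d` to the coefficients of a polynomial. -/
def coeffMap : MvPolynomial σ A →ₗ[k] MvPolynomial σ A :=
  (Finsupp.lsum k fun s : σ →₀ ℕ =>
      ((monomial s : A →ₗ[A] MvPolynomial σ A).restrictScalars k) ∘ₗ d.toLinearMap) ∘ₗ
    ((basisMonomials σ A).repr.toLinearMap.restrictScalars k)

theorem coeffMap_monomial (s : σ →₀ ℕ) (a : A) : coeffMap d (monomial s a) = monomial s (d a) := by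
  have : (basisMonomials σ A).repr (monomial s a) = Finsupp.single s a := by
    rw [← mul_one a, ← smul_eq_mul, ← smul_monomial, map_smul,
      ← congrFun (coe_basisMonomials σ A) s, Module.Basis.repr_self, Finsupp.smul_single]
  simp [coeffMap, this]

theorem coeff_coeffMap (p : MvPolynomial σ A) (m : σ →₀ ℕ) :
    (coeffMap d p).coeff m = d (p.coeff m) := by
  classical
  induction p using MvPolynomial.induction_on' with
  | add p q hp hq => simp only [map_add, coeff_add, hp, hq]
  | monomial s a =>
    rw [coeffMap_monomial, coeff_monomial, coeff_monomial]
    split_ifs <;> simp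

/-- The derivation of the polynomial ring which extends `d` and kills the variables. -/
def coeffDer : Derivation k (MvPolynomial σ A) (MvPolynomial σ A) :=
  Derivation.mk' (coeffMap d) fun p q => by
    induction p using MvPolynomial.induction_on' with
    | add p p' hp hp' => rw [add_mul, map_add, hp, hp', map_add]; simp only [smul_eq_mul]; ring
    | monomial s a =>
      induction q using MvPolynomial.induction_on' with
      | add q q' hq hq' => rw [mul_add, map_add, hq, hq', map_add]; simp only [smul_eq_mul]; ring
      | monomial t b =>
        rw [monomial_mul, coeffMap_monomial, coeffMap_monomial, coeffMap_monomial, d.leibniz,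
          map_add, smul_eq_mul, smul_eq_mul, smul_eq_mul, smul_eq_mul, monomial_mul, monomial_mul,
          add_comm t s]

theorem coeff_coeffDer (p : MvPolynomial σ A) (m : σ →₀ ℕ) :
    (coeffDer d p).coeff m = d (p.coeff m) := coeff_coeffMap d p m

theorem coeffDer_monomial (s : σ →₀ ℕ) (a : A) : coeffDer d (monomial s a) = monomial s (d a) :=
  coeffMap_monomial d s a

theorem coeffDer_C (a : A) : coeffDer d (C a : MvPolynomial σ A) = C (d a) :=
  coeffDer_monomial d 0 a

theorem coeffDer_X (i : σ) : coeffDer d (X i : MvPolynomial σ A) = 0 := by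
  rw [X, coeffDer_monomial, d.map_one_eq_zero, map_zero]

/-- The derivation which extends `d`, kills `X 1` and `X 2`, and sends `X 0` to `X 1 + a X 2`. -/
def nabla (a : A) : Derivation k (SymAlg3 A) (SymAlg3 A) :=
  coeffDer d + ((X 1 + C a * X 2 : SymAlg3 A) • pderiv (0 : Fin 3)).restrictScalars k

theorem nabla_apply (a : A) (p : SymAlg3 A) :
    nabla d a p = coeffDer d p + (X 1 + C a * X 2) * pderiv 0 p := rfl

theorem nabla_X_zero (a : A) : nabla d a (X 0) = X 1 + C a * X 2 := by
  rw [nabla_apply, coeffDer_X, pderiv_X_self, mul_one, zero_add]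

theorem nabla_X_of_ne (a : A) {i : Fin 3} (hi : i ≠ 0) : nabla d a (X i) = 0 := by
  rw [nabla_apply, coeffDer_X, pderiv_X_of_ne hi, mul_zero, zero_add]

theorem nabla_C (a b : A) : nabla d a (C b) = C (d b) := by
  rw [nabla_apply, coeffDer_C, pderiv_C, mul_zero, add_zero]

theorem map_nabla {k' : Type*} [CommRing k'] {A' : Type*} [CommRing A'] [Algebra k' A']
    (d' : Derivation k' A' A') (f : A →+* A') (h : ∀ a, f (d a) = d' (f a)) (a : A)
    (p : SymAlg3 A) : map f (nabla d a p) = nabla d' (f a) (map f p) := by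
  rw [nabla_apply, nabla_apply, map_add, map_mul, map_add, map_mul, map_X, map_X, map_C,
    pderiv_map]
  congr 1
  ext m
  rw [coeff_map, coeff_coeffDer, coeff_coeffDer, coeff_map, h]

theorem isHomogeneous_nabla (a : A) {p : SymAlg3 A} {N : ℕ} (hp : p.IsHomogeneous N) :
    (nabla d a p).IsHomogeneous N := by
  rw [nabla_apply]
  refine IsHomogeneous.add (fun m hm => hp fun h => hm ?_) ?_
  · rw [coeff_coeffDer, h, map_zero]
  · have h1 : (X 1 + C a * X 2 : SymAlg3 A).IsHomogeneous 1 :=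
      (isHomogeneous_X A 1).add (by simpa using (isHomogeneous_C (Fin 3) a).mul (isHomogeneous_X A 2))
    rcases N with _ | N
    · have : pderiv 0 p = 0 := by
        rw [totalDegree_eq_zero_iff_eq_C.mp ((totalDegree_zero_iff_isHomogeneous ..).mpr hp), pderiv_C]
      rw [this, mul_zero]
      exact isHomogeneous_zero _ _ _
    · have := h1.mul (hp.pderiv (i := 0))
      rwa [Nat.add_sub_cancel, add_comm 1 N] at this

end Nabla

/-! ### Modules of differentials which are free with one generator -/

section FormGen

variable {k : Type u} [Field k] {B : Type v} [CommRing B] [Algebra k B]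

/-- The differential `w` generates `Ω[B⁄k]`, and `d` is the derivation with `D b = d b • w`. -/
structure FormGen (d : Derivation k B B) (w : Ω[B⁄k]) : Prop where
  D_eq : ∀ b, KaehlerDifferential.D k B b = d b • w
  lift_eq : d.liftKaehlerDifferential w = 1

namespace FormGen

variable {d : Derivation k B B} {w : Ω[B⁄k]} (h : FormGen d w)

include h in
-- The composite Ω → B → Ω through the coefficient of w fixes every D b, hence is the identity. So w
-- is a free generator, and an element of M ⊗ Ω is m ⊗ w for exactly one m.
theorem lift_smul (x : Ω[B⁄k]) : d.liftKaehlerDifferential x • w = x := by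
  have : (LinearMap.toSpanSingleton B _ w) ∘ₗ d.liftKaehlerDifferential = LinearMap.id := by
    refine Derivation.liftKaehlerDifferential_unique _ _ (Derivation.ext fun b => ?_)
    simp [h.D_eq b, h.lift_eq]
  exact LinearMap.congr_fun this x

variable (d) in
/-- The coefficient `m` of `m ⊗ w`. -/
def tensorCoef (M : Type*) [AddCommGroup M] [Module B M] : M ⊗[B] Ω[B⁄k] →ₗ[B] M :=
  (TensorProduct.rid B M).toLinearMap ∘ₗ d.liftKaehlerDifferential.lTensor M

variable {M : Type*} [AddCommGroup M] [Module B M]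

theorem tensorCoef_tmul (m : M) (x : Ω[B⁄k]) :
    tensorCoef d M (m ⊗ₜ x) = d.liftKaehlerDifferential x • m := by
  simp [tensorCoef]

include h in
theorem tensorCoef_tmul_self (m : M) : tensorCoef d M (m ⊗ₜ w) = m := by
  rw [tensorCoef_tmul, h.lift_eq, one_smul]

include h in
theorem tmul_tensorCoef (t : M ⊗[B] Ω[B⁄k]) : tensorCoef d M t ⊗ₜ w = t := by
  induction t using TensorProduct.induction_on with
  | zero => rw [map_zero, TensorProduct.zero_tmul]
  | tmul m x => rw [tensorCoef_tmul, TensorProduct.smul_tmul, h.lift_smul]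
  | add t s ht hs => rw [map_add, TensorProduct.add_tmul, ht, hs]

include h in
theorem exists_eq_tmul (t : M ⊗[B] Ω[B⁄k]) : ∃ m, t = m ⊗ₜ w := ⟨_, (h.tmul_tensorCoef t).symm⟩

include h in
theorem tmul_injective {m m' : M} (e : m ⊗ₜ[B] w = m' ⊗ₜ w) : m = m' := by
  rw [← h.tensorCoef_tmul_self m, e, h.tensorCoef_tmul_self]

include h in
theorem smul_injective {b b' : B} (e : b • w = b' • w) : b = b' := by
  have := congrArg d.liftKaehlerDifferential e
  simpa [h.lift_eq] using this

-- Replacing the connection by `nabla` makes it a derivation, so the Leibniz rule for products of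
-- sections becomes available.
include h in
theorem symConn_eq (a : B) (p : SymAlg3 B) : symConn (k := k) w (a • w) p = nabla d a p ⊗ₜ w := by
  induction p using MvPolynomial.induction_on' with
  | add p q hp hq => rw [map_add, hp, hq, map_add, TensorProduct.add_tmul]
  | monomial s b =>
    rw [symConn_monomial, nabla_apply, coeffDer_monomial, h.D_eq, TensorProduct.tmul_smul,
      TensorProduct.tmul_smul, TensorProduct.smul_tmul', TensorProduct.smul_tmul',
      ← TensorProduct.add_tmul, ← TensorProduct.add_tmul, smul_monomial, smul_eq_mul, mul_one,
      MvPolynomial.smul_eq_C_mul]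
    congr 2
    ring

end FormGen

end FormGen

/-! ### Differentials on the elliptic curve -/

variable {k : Type u} [Field k] [CharZero k] [Algebra k ℂ] {g₂ g₃ : k} {L : PeriodPair}
  (H : Uniformizes L g₂ g₃)

-- The relation 2y dy = (12x² − g₂) dx cannot be divided by y. The identity (27g₃ − 18g₂x) y² +
-- 2(6g₂x² − 9g₃x − g₂²)(6x² − g₂/2) = g₂³ − 27g₃², on which the definition of `omega` rests,
-- replaces the division.
include H in
theorem D_y_eq : KaehlerDifferential.D k (CoordRing g₂ g₃) (y g₂ g₃) =
    (6 * x g₂ g₃ ^ 2 - algebraMap k _ (g₂ / 2)) • omega g₂ g₃ := by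
  have hd : (2 * y g₂ g₃) • KaehlerDifferential.D k (CoordRing g₂ g₃) (y g₂ g₃) =
      (12 * x g₂ g₃ ^ 2 - algebraMap k _ g₂) • KaehlerDifferential.D k _ (x g₂ g₃) := by
    have h₁ := congrArg (KaehlerDifferential.D k (CoordRing g₂ g₃)) (y_sq g₂ g₃)
    have h4 : KaehlerDifferential.D k (CoordRing g₂ g₃) 4 = 0 := by
      simpa using (KaehlerDifferential.D k (CoordRing g₂ g₃)).map_natCast 4
    simp only [map_sub, Derivation.leibniz, Derivation.leibniz_pow, Derivation.map_algebraMap,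
      h4, smul_zero, add_zero, sub_zero, ← Nat.cast_smul_eq_nsmul (CoordRing g₂ g₃), smul_smul,
      ← sub_smul] at h₁
    convert h₁ using 2 <;> push_cast <;> ring
  have hh : algebraMap k (CoordRing g₂ g₃) (g₂ / 2) * 2 = algebraMap k _ g₂ := by
    rw [← map_ofNat (algebraMap k (CoordRing g₂ g₃)) 2, ← map_mul]; congr 1; field_simp
  set c := algebraMap k (CoordRing g₂ g₃) (g₂ / 2) with hc
  rw [omega, smul_comm, smul_add, smul_smul, smul_smul,
    show (6 * x g₂ g₃ ^ 2 - c) * ((27 * algebraMap k _ g₃ - 18 * algebraMap k _ g₂ * x g₂ g₃) *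
      y g₂ g₃) = ((27 * algebraMap k _ g₃ - 18 * algebraMap k _ g₂ * x g₂ g₃) * y g₂ g₃ *
        algebraMap k _ 2⁻¹) * (12 * x g₂ g₃ ^ 2 - algebraMap k _ g₂) by
      have h2 : algebraMap k (CoordRing g₂ g₃) 2⁻¹ * 2 = 1 := by
        rw [← map_ofNat (algebraMap k (CoordRing g₂ g₃)) 2, ← map_mul, inv_mul_cancel₀ two_ne_zero,
          map_one]
      linear_combination (-1 : CoordRing g₂ g₃) * (27 * algebraMap k _ g₃ -
        18 * algebraMap k _ g₂ * x g₂ g₃) * y g₂ g₃ *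
          ((6 * x g₂ g₃ ^ 2 - c) * h2 + algebraMap k _ 2⁻¹ * hh), mul_smul, ← hd, smul_smul, ← add_smul]
  have e : (27 * algebraMap k (CoordRing g₂ g₃) g₃ - 18 * algebraMap k _ g₂ * x g₂ g₃) * y g₂ g₃ *
        algebraMap k _ 2⁻¹ * (2 * y g₂ g₃) + (6 * x g₂ g₃ ^ 2 - c) *
        (2 * (6 * algebraMap k _ g₂ * x g₂ g₃ ^ 2 - 9 * algebraMap k _ g₃ * x g₂ g₃ -
          algebraMap k _ g₂ ^ 2)) = algebraMap k _ (g₂ ^ 3 - 27 * g₃ ^ 2) := by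
    have h2 : algebraMap k (CoordRing g₂ g₃) 2⁻¹ * 2 = 1 := by
      rw [← map_ofNat (algebraMap k (CoordRing g₂ g₃)) 2, ← map_mul, inv_mul_cancel₀ two_ne_zero,
        map_one]
    rw [map_sub, map_mul, map_pow, map_pow, map_ofNat]
    linear_combination (27 * algebraMap k (CoordRing g₂ g₃) g₃ -
        18 * algebraMap k _ g₂ * x g₂ g₃) * (y g₂ g₃ ^ 2 * h2 + y_sq g₂ g₃) -
      (6 * algebraMap k _ g₂ * x g₂ g₃ ^ 2 - 9 * algebraMap k _ g₃ * x g₂ g₃ -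
          algebraMap k _ g₂ ^ 2) * hh
  rw [e, algebraMap_smul, smul_smul, inv_mul_cancel₀ H.disc_ne_zero, one_smul]

theorem formGen_omega : FormGen (dR H) (omega g₂ g₃) where
  D_eq := by
    refine induction_x_y (fun c => ?_) ?_ ?_ (fun r s hr hs => ?_) (fun r s hr hs => ?_)
    · rw [Derivation.map_algebraMap, Derivation.map_algebraMap, zero_smul]
    · rw [dR_x, y_smul_omega _ _ H.disc_ne_zero]
    · rw [dR_y, D_y_eq H]
    · rw [map_add, map_add, hr, hs, add_smul]
    · rw [Derivation.leibniz, Derivation.leibniz, hr, hs, add_smul, smul_smul, smul_smul,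
        smul_eq_mul, smul_eq_mul]
  lift_eq := by
    have h := congrArg (dR H).liftKaehlerDifferential (y_smul_omega g₂ g₃ H.disc_ne_zero)
    rw [Derivation.liftKaehlerDifferential_comp_D, dR_x, map_smul, smul_eq_mul] at h
    exact mul_left_cancel₀ y_ne_zero (h.trans (mul_one _).symm)

/-- The differential `ω` as a rational differential. -/
abbrev omegaK (g₂ g₃ : k) : RatForm g₂ g₃ := ratForm (omega g₂ g₃)

omit [CharZero k] [Algebra k ℂ] in
theorem ratForm_smul (r : CoordRing g₂ g₃) (ξ : Ω[CoordRing g₂ g₃⁄k]) :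
    ratForm (r • ξ) = algebraMap (CoordRing g₂ g₃) (FunField g₂ g₃) r • ratForm ξ := by
  rw [map_smul, algebraMap_smul]

theorem formGen_omegaK : FormGen (dK H) (omegaK g₂ g₃) where
  D_eq f := by
    have hR (r : CoordRing g₂ g₃) : KaehlerDifferential.D k (FunField g₂ g₃) (algebraMap _ _ r) =
        dK H (algebraMap _ _ r) • omegaK g₂ g₃ := by
      rw [dK_algebraMap, ← ratForm_smul, ← (formGen_omega H).D_eq]
      exact (KaehlerDifferential.map_D k k (CoordRing g₂ g₃) (FunField g₂ g₃) r).symm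
    obtain ⟨a, b, hb, h⟩ := exists_mul_eq f
    have hb' : algebraMap (CoordRing g₂ g₃) (FunField g₂ g₃) b ≠ 0 :=
      (map_ne_zero_iff _ (IsFractionRing.injective _ (FunField g₂ g₃))).mpr hb
    have h1 := congrArg (KaehlerDifferential.D k (FunField g₂ g₃)) h
    have h2 := congrArg (dK H) h
    rw [Derivation.leibniz, hR, hR] at h1
    rw [Derivation.leibniz, smul_eq_mul, smul_eq_mul] at h2
    rw [← h2, add_smul, mul_smul, mul_smul] at h1
    exact smul_right_injective _ hb' (add_left_cancel h1)
  lift_eq := by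
    have h := congrArg (dK H).liftKaehlerDifferential
      (congrArg ratForm (y_smul_omega g₂ g₃ H.disc_ne_zero))
    have e : ratForm (KaehlerDifferential.D k (CoordRing g₂ g₃) (x g₂ g₃)) =
        KaehlerDifferential.D k (FunField g₂ g₃) (algebraMap _ _ (x g₂ g₃)) :=
      KaehlerDifferential.map_D k k (CoordRing g₂ g₃) (FunField g₂ g₃) _
    rw [e, ratForm_smul, Derivation.liftKaehlerDifferential_comp_D, dK_algebraMap, dR_x, map_smul,
      smul_eq_mul] at h
    exact mul_left_cancel₀ ((map_ne_zero_iff _ (IsFractionRing.injective _ (FunField g₂ g₃))).mpr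
      (y_ne_zero (g₂ := g₂) (g₃ := g₃))) (h.trans (mul_one _).symm)

end EllPolylog

namespace EllPolylog

open MvPolynomial LaurentSeries

variable {k : Type u} [Field k] [CharZero k] [Algebra k ℂ] {g₂ g₃ : k} {L : PeriodPair}
  (H : Uniformizes L g₂ g₃)

/-! ### Local rings and regular differentials -/

include H in
theorem regularAt_add (P : Pt g₂ g₃) {f g : FunField g₂ g₃} (hf : RegularAt P f)
    (hg : RegularAt P g) : RegularAt P (f + g) := by
  match P with
  | none =>
    rw [regularAt_none_iff H] at *
    rw [map_add]; exact hf.add hg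
  | some m =>
    obtain ⟨a, b, hb, h⟩ := hf
    obtain ⟨a', b', hb', h'⟩ := hg
    refine ⟨a * b' + a' * b, b * b', fun h => (m.isMaximal.isPrime.mem_or_mem h).elim hb hb', ?_⟩
    rw [map_add, map_mul, map_mul, map_mul, ← h, ← h']
    ring

include H in
theorem regularAt_mul (P : Pt g₂ g₃) {f g : FunField g₂ g₃} (hf : RegularAt P f)
    (hg : RegularAt P g) : RegularAt P (f * g) := by
  match P with
  | none =>
    rw [regularAt_none_iff H] at *
    rw [map_mul]
    exact hf.mul hg
  | some m =>
    obtain ⟨a, b, hb, h⟩ := hf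
    obtain ⟨a', b', hb', h'⟩ := hg
    refine ⟨a * a', b * b', fun h => (m.isMaximal.isPrime.mem_or_mem h).elim hb hb', ?_⟩
    rw [map_mul, map_mul, ← h, ← h']
    ring

omit [CharZero k] [Algebra k ℂ] in
theorem regularAt_some_algebraMap (m : MaximalSpectrum (CoordRing g₂ g₃)) (r : CoordRing g₂ g₃) :
    RegularAt (some m) (algebraMap _ (FunField g₂ g₃) r) :=
  ⟨r, 1, fun h => m.isMaximal.ne_top ((Ideal.eq_top_iff_one _).mpr h), by rw [map_one, mul_one]⟩

include H in
theorem regularAt_algebraMap (P : Pt g₂ g₃) (c : k) :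
    RegularAt P (algebraMap k (FunField g₂ g₃) c) := by
  match P with
  | none =>
    rw [regularAt_none_iff H, laurent_const]
    exact ordGE_C _
  | some m =>
    rw [IsScalarTower.algebraMap_apply k (CoordRing g₂ g₃) (FunField g₂ g₃)]
    exact regularAt_some_algebraMap m _

/-- The local ring of the curve at a closed point. -/
def localRing (P : Pt g₂ g₃) : Subalgebra k (FunField g₂ g₃) where
  carrier := {f | RegularAt P f}
  mul_mem' := regularAt_mul H P
  add_mem' := regularAt_add H P
  algebraMap_mem' := regularAt_algebraMap H P

theorem mem_localRing {P : Pt g₂ g₃} {f : FunField g₂ g₃} : f ∈ localRing H P ↔ RegularAt P f :=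
  Iff.rfl

theorem regularAt_dK (P : Pt g₂ g₃) {f : FunField g₂ g₃} (hf : RegularAt P f) :
    RegularAt P (dK H f) := by
  match P with
  | none =>
    rw [regularAt_none_iff H] at *
    rw [laurent_dK]
    exact ordGE_zero_deriv hf
  | some m =>
    obtain ⟨a, b, hb, h⟩ := hf
    refine ⟨dR H a * b - a * dR H b, b * b,
      fun h => (m.isMaximal.isPrime.mem_or_mem h).elim hb hb, ?_⟩
    have h2 := congrArg (dK H) h
    rw [Derivation.leibniz, smul_eq_mul, smul_eq_mul, dK_algebraMap, dK_algebraMap] at h2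
    rw [map_sub, map_mul, map_mul, map_mul, ← h2, ← h]
    ring

/-- The function `x / y`, a local parameter at `[0]`. -/
def localParam (g₂ g₃ : k) : FunField g₂ g₃ :=
  algebraMap (CoordRing g₂ g₃) _ (x g₂ g₃) / algebraMap (CoordRing g₂ g₃) _ (y g₂ g₃)

omit [Algebra k ℂ] in
theorem localParam_mul : localParam g₂ g₃ * algebraMap (CoordRing g₂ g₃) _ (y g₂ g₃) =
    algebraMap _ _ (x g₂ g₃) :=
  div_mul_cancel₀ _ ((map_ne_zero_iff _ (IsFractionRing.injective _ (FunField g₂ g₃))).mpr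
    y_ne_zero)

omit [Algebra k ℂ] in
theorem isLocalParameter_localParam : IsLocalParameter (localParam g₂ g₃) :=
  ⟨_, _, x_ne_zero, y_ne_zero, localParam_mul, by rw [poleOrder_x, poleOrder_y]⟩

theorem isLocalParameter_dK {t : FunField g₂ g₃} (ht : IsLocalParameter t) :
    OrdGE 0 (laurent H (dK H t)) ∧
      (laurent H (dK H t)).coeff 0 = (laurent H t).coeff 1 := by
  have h := (isLocalParameter_iff H).mp ht
  rw [laurent_dK]
  exact ⟨h.1.deriv, by simp [coeff_deriv]⟩

theorem ordGE_inv {f : LaurentSeries ℂ} {m : ℤ} (hf : OrdGE m f) (h0 : f.coeff m ≠ 0) :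
    OrdGE (-m) f⁻¹ ∧ f⁻¹.coeff (-m) = (f.coeff m)⁻¹ := by
  have hne : f ≠ 0 := fun h => h0 (by rw [h]; rfl)
  have e := congrArg HahnSeries.orderTop (mul_inv_cancel₀ hne)
  rw [HahnSeries.orderTop_mul, orderTop_eq_of_ordGE hf h0, HahnSeries.orderTop_one] at e
  have h1 : OrdGE (-m) f⁻¹ := by
    rw [ordGE_iff]
    rcases hi : (f⁻¹).orderTop with _ | n
    · exact le_top
    · have : ((m + n : ℤ) : WithTop ℤ) = (0 : ℤ) := by rw [hi] at e; exact e
      have : m + n = 0 := WithTop.coe_injective this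
      refine WithTop.coe_le_coe.mpr (by omega)
  refine ⟨h1, ?_⟩
  have h2 := coeff_mul_of_ordGE hf h1
  rw [mul_inv_cancel₀ hne, add_neg_cancel] at h2
  have h3 : (1 : LaurentSeries ℂ).coeff 0 = 1 := by simp
  rw [h3] at h2
  exact eq_inv_of_mul_eq_one_right h2.symm

-- A regular form has a regular coefficient because the local ring is stable under d/ω. Conversely,
-- at [0] the function t = x/y has dt/ω of order 0, so that ω = (dt/ω)⁻¹ dt. At the points of U the
-- form ω is by definition a combination of dx and dy with coefficients in the coordinate ring.
include H in
theorem smul_mem_stalkForm_iff (P : Pt g₂ g₃) (g : FunField g₂ g₃) :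
    g • omegaK g₂ g₃ ∈ stalkForm P ↔ RegularAt P g := by
  have hω := formGen_omegaK H
  constructor
  · suffices ∀ ξ ∈ stalkForm P, RegularAt P ((dK H).liftKaehlerDifferential ξ) by
      intro h
      have := this _ h
      rwa [map_smul, hω.lift_eq, smul_eq_mul, mul_one] at this
    intro ξ hξ
    refine Submodule.span_induction (p := fun ξ _ => RegularAt P ((dK H).liftKaehlerDifferential ξ)) ?_ ?_ ?_ ?_ hξ
    · rintro _ ⟨f, h, hf, hh, rfl⟩
      rw [map_smul, dRat]
      exact regularAt_mul H P hf (by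
        rw [Derivation.coeFn_coe, Derivation.liftKaehlerDifferential_comp_D]
        exact regularAt_dK H P hh)
    · rw [map_zero]
      exact (localRing H P).zero_mem
    · intro ξ ξ' _ _ h h'
      rw [map_add]
      exact regularAt_add H P h h'
    · intro c ξ _ h
      rw [← algebraMap_smul (FunField g₂ g₃) c ξ, map_smul]
      exact regularAt_mul H P (regularAt_algebraMap H P c) h
  · intro hg
    match P with
    | none =>
      have ht := isLocalParameter_localParam (g₂ := g₂) (g₃ := g₃)
      obtain ⟨h0, h1⟩ := isLocalParameter_dK H ht
      have h := (isLocalParameter_iff H).mp ht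
      rw [← h1] at h
      have hne : dK H (localParam g₂ g₃) ≠ 0 := fun e => h.2 (by rw [e, map_zero]; rfl)
      refine Submodule.subset_span ⟨g * (dK H (localParam g₂ g₃))⁻¹, localParam g₂ g₃, ?_, ?_, ?_⟩
      · rw [regularAt_none_iff H] at *
        rw [map_mul, map_inv₀]
        exact hg.mul (ordGE_inv h0 h.2).1
      · rw [regularAt_none_iff H]
        exact h.1.mono zero_le_one
      · rw [dRat, Derivation.coeFn_coe, hω.D_eq, smul_smul, inv_mul_cancel_right₀ hne]
    | some m =>
      have key (a r : CoordRing g₂ g₃) : g • ratForm (a • KaehlerDifferential.D k _ r) ∈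
          stalkForm (some m) := by
        refine Submodule.subset_span ⟨g * algebraMap _ _ a, algebraMap _ _ r,
          regularAt_mul H _ hg (regularAt_some_algebraMap m a), regularAt_some_algebraMap m r, ?_⟩
        rw [ratForm_smul, smul_smul]
        congr 1
        exact KaehlerDifferential.map_D k k (CoordRing g₂ g₃) (FunField g₂ g₃) r
      rw [omegaK, omega, LinearMap.map_smul_of_tower, smul_comm, map_add, smul_add]
      exact Submodule.smul_mem _ _ (Submodule.add_mem _ (key _ _) (key _ _))

/-- The coefficient of f dlog t is f t'/t, and t'/t = z⁻¹ + ⋯ for every local parameter t. So f(0)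
is the coefficient of z⁻¹, whatever t is. -/
theorem hasLogResidue_iff (g : FunField g₂ g₃) (c : k) :
    HasLogResidue (g • omegaK g₂ g₃) c ↔
      OrdGE (-1) (laurent H g) ∧ (laurent H g).coeff (-1) = algebraMap k ℂ c := by
  have hω := formGen_omegaK H
  have hC {f : FunField g₂ g₃} (hf : OrdGE 0 (laurent H f)) :
      VanishesAtZero (f - algebraMap k _ c) ↔ (laurent H f).coeff 0 = algebraMap k ℂ c := by
    rw [vanishesAtZero_iff H, map_sub, laurent_const]
    constructor
    · intro h
      have := h 0 zero_lt_one
      rwa [HahnSeries.coeff_sub, HahnSeries.C_apply, HahnSeries.coeff_single_same,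
        sub_eq_zero] at this
    · intro h n hn
      rcases (Int.lt_add_one_iff.mp (show n < 0 + 1 by omega)).lt_or_eq with hn | rfl
      · exact (hf.sub (ordGE_C _)) n hn
      · rw [HahnSeries.coeff_sub, HahnSeries.C_apply, HahnSeries.coeff_single_same, h, sub_self]
  constructor
  · rintro ⟨t, f, ht, hf, h, hv⟩
    rw [dRat, Derivation.coeFn_coe, hω.D_eq, smul_smul] at h
    have e := hω.smul_injective h
    rw [regularAt_none_iff H] at hf
    rw [hC hf] at hv
    obtain ⟨h0, h1⟩ := isLocalParameter_dK H ht
    obtain ⟨h2, h3⟩ := (isLocalParameter_iff H).mp ht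
    obtain ⟨h4, h5⟩ := ordGE_inv h2 h3
    have h6 := hf.mul h4
    have h7 := coeff_mul_of_ordGE hf h4
    have h8 := h6.mul h0
    have h9 := coeff_mul_of_ordGE h6 h0
    rw [e, map_mul, map_mul, map_inv₀]
    simp only [zero_add, add_zero] at h6 h7 h8 h9
    refine ⟨h8, ?_⟩
    rw [h9, h7, h5, h1, hv, inv_mul_cancel_right₀ h3]
  · rintro ⟨hg, hc⟩
    have ht := isLocalParameter_localParam (g₂ := g₂) (g₃ := g₃)
    obtain ⟨h0, h1⟩ := isLocalParameter_dK H ht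
    obtain ⟨h2, h3⟩ := (isLocalParameter_iff H).mp ht
    have h3' := h3
    rw [← h1] at h3'
    obtain ⟨h4, h5⟩ := ordGE_inv h0 h3'
    have hne : dK H (localParam g₂ g₃) ≠ 0 := fun e => h3' (by rw [e, map_zero]; rfl)
    have hne' : localParam g₂ g₃ ≠ 0 := fun e => h3 (by rw [e, map_zero]; rfl)
    have h6 := hg.mul h2
    have h7 := coeff_mul_of_ordGE hg h2
    have h8 := h6.mul h4
    have h9 := coeff_mul_of_ordGE h6 h4
    simp only [neg_add_cancel, neg_zero, add_zero] at h5 h6 h7 h8 h9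
    have hf : OrdGE 0 (laurent H (g * localParam g₂ g₃ * (dK H (localParam g₂ g₃))⁻¹)) := by
      rw [map_mul, map_mul, map_inv₀]; exact h8
    refine ⟨localParam g₂ g₃, g * localParam g₂ g₃ * (dK H (localParam g₂ g₃))⁻¹, ht,
      (regularAt_none_iff H).mpr hf, ?_, ?_⟩
    · rw [dRat, Derivation.coeFn_coe, hω.D_eq, smul_smul]
      congr 1
      field_simp
    · rw [hC hf, map_mul, map_mul, map_inv₀, h9, h7, h5, h1, mul_inv_cancel_right₀ h3, hc]

/-! ### Residues in terms of coefficients -/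

omit [CharZero k] [Algebra k ℂ] in
theorem eta_eq : ratForm (eta g₂ g₃) =
    algebraMap (CoordRing g₂ g₃) (FunField g₂ g₃) (x g₂ g₃) • omegaK g₂ g₃ := by
  rw [eta, ratForm_smul]

theorem ratConn_eq (p : RatLog g₂ g₃) :
    ratConn p = nabla (dK H) (algebraMap (CoordRing g₂ g₃) _ (x g₂ g₃)) p ⊗ₜ omegaK g₂ g₃ := by
  rw [ratConn, eta_eq, (formGen_omegaK H).symConn_eq]

omit [CharZero k] [Algebra k ℂ] in
theorem chartForm_tmul (f : FunField g₂ g₃) (m : Fin 3 →₀ ℕ) (p : RatLog g₂ g₃) :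
    chartForm f m (p ⊗ₜ omegaK g₂ g₃) = (toChart f p).coeff m • omegaK g₂ g₃ := by
  simp [chartForm]

/-- The inclusion of the symmetric algebra over `U` in the rational sections. -/
abbrev ratMap (g₂ g₃ : k) : SymAlg3 (CoordRing g₂ g₃) →+* RatLog g₂ g₃ :=
  map (algebraMap (CoordRing g₂ g₃) (FunField g₂ g₃))

omit [CharZero k] [Algebra k ℂ] in
theorem ratLogForm_tmul (N : ℕ) (p : LogU g₂ g₃ N) :
    ratLogForm N (p ⊗ₜ omega g₂ g₃) = ratMap g₂ g₃ (ofSymPow _ N p) ⊗ₜ omegaK g₂ g₃ := rfl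

/-- The connection on rational sections, in terms of coefficients. -/
abbrev nablaK : Derivation k (RatLog g₂ g₃) (RatLog g₂ g₃) :=
  nabla (dK H) (algebraMap (CoordRing g₂ g₃) _ (x g₂ g₃))

/-- The connection on sections over `U`, in terms of coefficients. -/
abbrev nablaR : Derivation k (SymAlg3 (CoordRing g₂ g₃)) (SymAlg3 (CoordRing g₂ g₃)) :=
  nabla (dR H) (x g₂ g₃)

theorem ratMap_nablaR (p : SymAlg3 (CoordRing g₂ g₃)) :
    ratMap g₂ g₃ (nablaR H p) = nablaK H (ratMap g₂ g₃ p) :=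
  map_nabla _ _ _ (fun r => (dK_algebraMap H r).symm) _ _

/-- The class of `p ⊗ ω`. -/
def omegaClass (g₂ g₃ : k) (N : ℕ) : LogU g₂ g₃ N →ₗ[k] H1Log g₂ g₃ N :=
  Submodule.mkQ _ ∘ₗ
    ((TensorProduct.mk (CoordRing g₂ g₃) (LogU g₂ g₃ N) Ω[CoordRing g₂ g₃⁄k]).flip
      (omega g₂ g₃)).restrictScalars k

omit [CharZero k] [Algebra k ℂ] in
theorem omegaClass_apply (N : ℕ) (p : LogU g₂ g₃ N) :
    omegaClass g₂ g₃ N p = Submodule.Quotient.mk (p ⊗ₜ omega g₂ g₃) := rfl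

variable {I : Type w}

/-- With ω as generator all conditions on forms become conditions on polynomials: regular
coefficients away from [0], and simple poles with given residues at [0]. -/
theorem hasResidue_iff (𝔘 : LogCover g₂ g₃ L I) (N : ℕ) (c : H1Log g₂ g₃ N) (r : SymPow k N) :
    HasResidue 𝔘 N c r ↔ ∃ (p : LogU g₂ g₃ N) (α : I → RatLog g₂ g₃),
      omegaClass g₂ g₃ N p = c ∧
      (∀ i, (α i).IsHomogeneous N) ∧
      (∀ i, ∀ P ∉ 𝔘.compl i, P ≠ none → LogRegularAt (𝔘.u i) P (α i)) ∧
      (∀ i j, ∀ P ∉ 𝔘.compl i, P ∉ 𝔘.compl j → LogRegularAt (𝔘.u i) P (α j - α i)) ∧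
      (∀ i, ∀ P ∉ 𝔘.compl i, P ≠ none →
        LogRegularAt (𝔘.u i) P (ratMap g₂ g₃ (ofSymPow _ N p) + nablaK H (α i))) ∧
      ∀ i, none ∉ 𝔘.compl i → ∀ m,
        OrdGE (-1) (laurent H
          ((toChart (𝔘.u i) (ratMap g₂ g₃ (ofSymPow _ N p) + nablaK H (α i))).coeff m)) ∧
        (laurent H ((toChart (𝔘.u i)
          (ratMap g₂ g₃ (ofSymPow _ N p) + nablaK H (α i))).coeff m)).coeff (-1) =
            algebraMap k ℂ ((ofSymPow k N r).coeff m) := by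
  have e (p : LogU g₂ g₃ N) (α : RatLog g₂ g₃) (f m) :
      chartForm f m (ratLogForm N (p ⊗ₜ omega g₂ g₃) + ratConn α) =
        (toChart f (ratMap g₂ g₃ (ofSymPow _ N p) + nablaK H α)).coeff m • omegaK g₂ g₃ := by
    rw [ratLogForm_tmul, ratConn_eq H, ← TensorProduct.add_tmul, chartForm_tmul]
  constructor
  · rintro ⟨ξ, α, h1, h2, h3, h4, h5, h6⟩
    obtain ⟨p, rfl⟩ := (formGen_omega H).exists_eq_tmul ξ
    simp only [e, smul_mem_stalkForm_iff H, hasLogResidue_iff H] at h5 h6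
    exact ⟨p, α, h1, h2, h3, h4, h5, h6⟩
  · rintro ⟨p, α, h1, h2, h3, h4, h5, h6⟩
    refine ⟨p ⊗ₜ omega g₂ g₃, α, h1, h2, h3, h4, ?_, ?_⟩
    · simp only [e, smul_mem_stalkForm_iff H]
      exact h5
    · simp only [e, hasLogResidue_iff H]
      exact h6

end EllPolylog

namespace LaurentSeries

/-! ### Leading terms of Laurent expansions -/

theorem HasLaurent.exists_eq_zpow_mul {f : ℂ → ℂ} {g : LaurentSeries ℂ} (h : HasLaurent f g)
    (hg : g ≠ 0) : ∃ (n : ℤ) (G : ℂ → ℂ), AnalyticAt ℂ G 0 ∧ G 0 ≠ 0 ∧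
      (∀ᶠ t in 𝓝[≠] 0, f t = t ^ n * G t) ∧
      g = z ^ n * HahnSeries.ofPowerSeries ℤ ℂ (PowerSeries.taylor G) := by
  obtain ⟨m, G, hG, hf, hgG⟩ := h
  have hz := z_ne_zero
  by_cases h0 : ∀ᶠ t in 𝓝 (0 : ℂ), G t = 0
  · exfalso
    rw [PowerSeries.taylor_congr h0, PowerSeries.taylor_const, map_zero, map_zero] at hgG
    exact (mul_ne_zero (pow_ne_zero m hz) hg) hgG
  obtain ⟨n, G₁, hG₁, hne, he⟩ := hG.exists_eventuallyEq_pow_smul_nonzero_iff.mpr h0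
  simp only [sub_zero, smul_eq_mul] at he
  refine ⟨n - m, G₁, hG₁, hne, ?_, ?_⟩
  · filter_upwards [hf, nhdsWithin_le_nhds he, self_mem_nhdsWithin] with t ht ht' (h0 : t ≠ 0)
    rw [zpow_sub₀ h0, zpow_natCast, zpow_natCast]
    field_simp
    rw [mul_comm, ht, ht']
  · rw [PowerSeries.taylor_congr he, ofPowerSeries_taylor_pow_mul _ hG₁] at hgG
    rw [zpow_sub₀ hz, zpow_natCast, zpow_natCast]
    field_simp
    rw [mul_comm, hgG]

theorem ordGE_z_zpow (n : ℤ) : OrdGE n (z ^ n) := by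
  have : (z ^ n : LaurentSeries ℂ) = HahnSeries.single n 1 := by
    rcases n with n | n
    · rw [Int.ofNat_eq_natCast, zpow_natCast, z, HahnSeries.single_pow]; simp
    · rw [zpow_negSucc, inv_eq_iff_eq_inv, HahnSeries.inv_single, z, HahnSeries.single_pow]
      simp [Int.negSucc_eq]
  rw [this]
  exact fun m hm => HahnSeries.coeff_single_of_ne hm.ne

/-- Here f is known only as the quotient h/b. Write b = tⁿG and h = tᵐF with G and F nonzero at 0.
If m ≤ n then F = t^{n−m} G f tends to 0, a contradiction. -/
theorem HasLaurent.ordGE_one_of_tendsto {f b h : ℂ → ℂ} {gb gh : LaurentSeries ℂ}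
    (hb : HasLaurent b gb) (hh : HasLaurent h gh) (hgb : gb ≠ 0)
    (hf : ∀ᶠ t in 𝓝[≠] 0, b t * f t = h t) (h0 : Tendsto f (𝓝[≠] 0) (𝓝 0)) :
    OrdGE 1 (gh * gb⁻¹) := by
  rcases eq_or_ne gh 0 with rfl | hgh
  · rw [zero_mul]; exact ordGE_zero _
  obtain ⟨n, G, hG, hG0, hbn, rfl⟩ := hb.exists_eq_zpow_mul hgb
  obtain ⟨m, F, hF, hF0, hhm, rfl⟩ := hh.exists_eq_zpow_mul hgh
  have hlt : n < m := by
    by_contra hle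
    obtain ⟨j, hj⟩ : ∃ j : ℕ, n - m = j := ⟨(n - m).toNat, by omega⟩
    have h1 : Tendsto (fun t : ℂ => t ^ j * G t * f t) (𝓝[≠] 0) (𝓝 (0 ^ j * G 0 * 0)) :=
      ((tendsto_nhdsWithin_of_tendsto_nhds (continuousAt_id.pow j)).mul
        (tendsto_nhdsWithin_of_tendsto_nhds hG.continuousAt)).mul h0
    have h2 : Tendsto F (𝓝[≠] 0) (𝓝 (F 0)) := tendsto_nhdsWithin_of_tendsto_nhds hF.continuousAt
    rw [mul_zero] at h1
    refine hF0 (tendsto_nhds_unique (h2.congr' ?_) h1)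
    filter_upwards [hf, hbn, hhm, self_mem_nhdsWithin] with t h1 h2 h3 (ht : t ≠ 0)
    rw [h2, h3, show n = m + j by omega, zpow_add₀ ht, zpow_natCast] at h1
    refine mul_left_cancel₀ (zpow_ne_zero m ht) ?_
    rw [← h1]
    ring
  have e : z ^ m * HahnSeries.ofPowerSeries ℤ ℂ (PowerSeries.taylor F) *
      (z ^ n * HahnSeries.ofPowerSeries ℤ ℂ (PowerSeries.taylor G))⁻¹ =
      z ^ (m - n) * (HahnSeries.ofPowerSeries ℤ ℂ (PowerSeries.taylor F) *
        (HahnSeries.ofPowerSeries ℤ ℂ (PowerSeries.taylor G))⁻¹) := by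
    rw [zpow_sub₀ z_ne_zero, mul_inv]; ring
  have hi := (EllPolylog.ordGE_inv (EllPolylog.ordGE_ofPowerSeries (PowerSeries.taylor G)) (by
    rw [coeff_zero_ofPowerSeries, PowerSeries.constantCoeff_taylor]; exact hG0)).1
  rw [e]
  refine ((ordGE_z_zpow (m - n)).mul ((EllPolylog.ordGE_ofPowerSeries _).mul hi)).mono (by omega)

end LaurentSeries

namespace EllPolylog

open MvPolynomial LaurentSeries

/-! ### Changes of frame -/

section Shift

variable {A : Type*} [CommRing A]

/-- The substitution `X 0 ↦ X 0 + a X 1 + b X 2`. -/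
def shift (a b : A) : SymAlg3 A →ₐ[A] SymAlg3 A := aeval ![X 0 + C a * X 1 + C b * X 2, X 1, X 2]

theorem shift_X_zero (a b : A) : shift a b (X 0) = X 0 + C a * X 1 + C b * X 2 := by
  simp [shift]

theorem shift_X_one (a b : A) : shift a b (X 1) = X 1 := by simp [shift]

theorem shift_X_two (a b : A) : shift a b (X 2) = X 2 := by simp [shift]

theorem shift_C (a b c : A) : shift a b (C c) = C c := (shift a b).commutes c

theorem shift_shift (a b a' b' : A) (p : SymAlg3 A) :
    shift a b (shift a' b' p) = shift (a + a') (b + b') p := by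
  have : (shift a b).comp (shift a' b') = shift (a + a') (b + b') := by
    refine MvPolynomial.algHom_ext fun i => ?_
    fin_cases i
    · simp only [AlgHom.comp_apply, Fin.zero_eta, shift_X_zero, map_add, map_mul, shift_C,
        shift_X_one, shift_X_two]
      ring
    · simp only [AlgHom.comp_apply, Fin.mk_one, shift_X_one]
    · simp only [AlgHom.comp_apply, Fin.reduceFinMk, shift_X_two]
  exact DFunLike.congr_fun this p

theorem map_shift {A' : Type*} [CommRing A'] (f : A →+* A') (a b : A) (p : SymAlg3 A) :
    map f (shift a b p) = shift (f a) (f b) (map f p) := by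
  induction p using MvPolynomial.induction_on with
  | C c => simp
  | add p q hp hq => simp only [map_add, hp, hq]
  | mul_X p i hp =>
    rw [map_mul, map_mul, map_mul, map_mul, hp, map_X]
    congr 1
    fin_cases i
    · simp only [Fin.zero_eta, shift_X_zero, map_add, map_mul, map_C, map_X]
    · simp only [Fin.mk_one, shift_X_one, map_X]
    · simp only [Fin.reduceFinMk, shift_X_two, map_X]

/-- Both sides are derivations along the homomorphism `shift a b`, so it suffices to compare them on
constants and on the variables. The function e measures what remains of the connection in the new
frame. -/
theorem shift_nabla {k : Type*} [CommRing k] [Algebra k A] (d : Derivation k A A) {a b c c' e : A}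
    (ha : d a + e = 1) (hb : d b + e * c' = c) (p : SymAlg3 A) :
    shift a b (nabla d c p) = coeffDer d (shift a b p) +
      C e * (X 1 + C c' * X 2) * pderiv 0 (shift a b p) := by
  induction p using MvPolynomial.induction_on with
  | C s => simp [nabla_C, coeffDer_C]
  | add p q hp hq => simp only [map_add, hp, hq]; ring
  | mul_X p i hp =>
    have key : shift a b (nabla d c (X i)) = coeffDer d (shift a b (X i)) +
        C e * (X 1 + C c' * X 2) * pderiv 0 (shift a b (X i)) := by
      fin_cases i
      · simp only [Fin.zero_eta, shift_X_zero, nabla_X_zero, map_add, map_mul, shift_C, shift_X_one,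
          shift_X_two, Derivation.leibniz, coeffDer_X, coeffDer_C, pderiv_X_self, pderiv_C,
          zero_add, smul_eq_mul, mul_zero, add_zero,
          pderiv_X_of_ne (show (1 : Fin 3) ≠ 0 by decide),
          pderiv_X_of_ne (show (2 : Fin 3) ≠ 0 by decide)]
        rw [← hb, map_add, map_mul]
        have : (C (d a) + C e : SymAlg3 A) = 1 := by rw [← map_add, ha, map_one]
        linear_combination -(X 1 : SymAlg3 A) * this
      · simp [shift_X_one, nabla_X_of_ne, coeffDer_X,
          pderiv_X_of_ne (show (1 : Fin 3) ≠ 0 by decide)]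
      · simp [shift_X_two, nabla_X_of_ne, coeffDer_X,
          pderiv_X_of_ne (show (2 : Fin 3) ≠ 0 by decide)]
    simp only [Derivation.leibniz, smul_eq_mul, map_add, map_mul, hp, key]
    ring

/-- The section e − aω^∨ − bη^∨ is horizontal when da = 1 and db = c. In a frame containing it, ∇ is
d on the coefficients. -/
theorem shift_nabla_eq_coeffDer {k : Type*} [CommRing k] [Algebra k A] (d : Derivation k A A)
    {a b c : A} (ha : d a = 1) (hb : d b = c) (p : SymAlg3 A) :
    shift a b (nabla d c p) = coeffDer d (shift a b p) := by
  have := shift_nabla d (a := a) (b := b) (c := c) (c' := 0) (e := 0) (by simp [ha]) (by simp [hb]) p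
  simpa using this

theorem toChart_eq_shift {k : Type u} [Field k] {g₂ g₃ : k} (f : FunField g₂ g₃) :
    toChart f = shift 0 (-f) := by
  rw [toChart, shift]
  congr 1
  ext i
  fin_cases i <;> simp [sub_eq_add_neg]

end Shift

/-! ### Polynomials with Laurent series as coefficients -/

section PolyGE

/-- All coefficients of `p` have order at least `m`. -/
def PolyGE (m : ℤ) (p : SymAlg3 (LaurentSeries ℂ)) : Prop := ∀ s, OrdGE m (p.coeff s)

variable {m m' : ℤ} {p q : SymAlg3 (LaurentSeries ℂ)}

theorem PolyGE.add (hp : PolyGE m p) (hq : PolyGE m q) : PolyGE m (p + q) := fun s => by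
  rw [coeff_add]; exact (hp s).add (hq s)

theorem PolyGE.mul (hp : PolyGE m p) (hq : PolyGE m' q) : PolyGE (m + m') (p * q) := fun s => by
  classical
  rw [coeff_mul]
  exact OrdGE.sum fun _ _ => (hp _).mul (hq _)

theorem PolyGE.sum {ι : Type*} {s : Finset ι} {f : ι → SymAlg3 (LaurentSeries ℂ)}
    (h : ∀ i ∈ s, PolyGE m (f i)) : PolyGE m (∑ i ∈ s, f i) := fun t => by
  rw [coeff_sum]
  exact OrdGE.sum fun i hi => h i hi t

theorem polyGE_monomial {c : LaurentSeries ℂ} (hc : OrdGE m c) (s : Fin 3 →₀ ℕ) :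
    PolyGE m (monomial s c) := fun t => by
  classical
  rw [coeff_monomial]
  split_ifs
  · exact hc
  · exact ordGE_zero _

theorem ordGE_one : OrdGE 0 (1 : LaurentSeries ℂ) := by
  rw [← map_one HahnSeries.C]; exact ordGE_C _

theorem polyGE_X (i : Fin 3) : PolyGE 0 (X i) := polyGE_monomial ordGE_one _

theorem PolyGE.mono (hp : PolyGE m p) (h : m' ≤ m) : PolyGE m' p := fun s => (hp s).mono h

variable {a b : LaurentSeries ℂ}

theorem polyGE_shift_X_sub (ha : OrdGE 1 a) (hb : OrdGE 1 b) (i : Fin 3) :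
    PolyGE 1 (shift a b (X i) - X i) := by
  have h (c : LaurentSeries ℂ) (hc : OrdGE 1 c) (j : Fin 3) : PolyGE 1 (C c * X j) :=
    (polyGE_monomial hc 0).mul (polyGE_X j)
  fin_cases i
  · simp only [Fin.zero_eta, shift_X_zero]
    rw [add_assoc, add_sub_cancel_left]
    exact (h a ha 1).add (h b hb 2)
  · simp only [Fin.mk_one, shift_X_one, sub_self]
    exact fun _ => ordGE_zero _
  · simp only [Fin.reduceFinMk, shift_X_two, sub_self]
    exact fun _ => ordGE_zero _

theorem polyGE_shift_monomial_sub (ha : OrdGE 1 a) (hb : OrdGE 1 b) (s : Fin 3 →₀ ℕ) :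
    PolyGE 1 (shift a b (monomial s 1) - monomial s 1) := by
  induction s using Finsupp.induction_linear with
  | zero =>
    have : shift a b (monomial 0 1) - monomial 0 1 = 0 := by
      rw [monomial_zero', map_one, map_one, sub_self]
    rw [this]; exact fun _ => ordGE_zero _
  | add s t hs ht =>
    have e : shift a b (monomial (s + t) 1) - monomial (s + t) 1 =
        (shift a b (monomial s 1) - monomial s 1) * (shift a b (monomial t 1) - monomial t 1) +
        ((shift a b (monomial s 1) - monomial s 1) * monomial t 1 +
        monomial s 1 * (shift a b (monomial t 1) - monomial t 1)) := by
      rw [← mul_one (1 : LaurentSeries ℂ), ← monomial_mul, map_mul, mul_one]; ring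
    rw [e]
    have h1 := hs.mul (polyGE_monomial ordGE_one t)
    have h2 := (polyGE_monomial ordGE_one s).mul ht
    have h3 := (hs.mul ht).mono (m' := 1) (by norm_num)
    rw [zero_add] at h2
    rw [add_zero] at h1
    exact h3.add (h1.add h2)
  | single i n =>
    rw [← X_pow_eq_monomial, map_pow]
    induction n with
    | zero => rw [pow_zero, pow_zero, sub_self]; exact fun _ => ordGE_zero _
    | succ n ih =>
      have e : shift a b (X i) ^ (n + 1) - X i ^ (n + 1) =
          (shift a b (X i) ^ n - X i ^ n) * (shift a b (X i) - X i) +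
          ((shift a b (X i) ^ n - X i ^ n) * X i + X i ^ n * (shift a b (X i) - X i)) := by ring
      rw [e]
      have hX := polyGE_shift_X_sub ha hb i
      have h1 := ih.mul (polyGE_X i)
      have h2 := (polyGE_monomial ordGE_one (Finsupp.single i n)).mul hX
      rw [← X_pow_eq_monomial, zero_add] at h2
      rw [add_zero] at h1
      exact ((ih.mul hX).mono (by norm_num)).add (h1.add h2)

/-- Each monomial changes only by terms containing a or b, so one order is gained. -/
theorem polyGE_shift_sub (ha : OrdGE 1 a) (hb : OrdGE 1 b) (hp : PolyGE m p) :
    PolyGE (m + 1) (shift a b p - p) := by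
  have e : shift a b p - p = ∑ s ∈ p.support, C (p.coeff s) *
      (shift a b (monomial s 1) - monomial s 1) := by
    conv_lhs => rw [← support_sum_monomial_coeff p]
    rw [map_sum, ← Finset.sum_sub_distrib]
    refine Finset.sum_congr rfl fun s _ => ?_
    rw [← mul_one (p.coeff s), ← smul_eq_mul, ← smul_monomial, MvPolynomial.smul_eq_C_mul, map_mul,
      shift_C, smul_eq_mul, mul_one]
    ring
  rw [e]
  exact PolyGE.sum fun s _ => (polyGE_monomial (hp s) 0).mul (polyGE_shift_monomial_sub ha hb s)

/-- For a logarithmic pole, a change of frame which is the identity at [0] does not change the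
residue. -/
theorem coeff_neg_one_shift (ha : OrdGE 1 a) (hb : OrdGE 1 b) (hp : PolyGE (-1) p)
    (s : Fin 3 →₀ ℕ) : ((shift a b p).coeff s).coeff (-1) = (p.coeff s).coeff (-1) := by
  have h := polyGE_shift_sub ha hb hp s (-1) (by norm_num)
  rwa [coeff_sub, HahnSeries.coeff_sub, sub_eq_zero] at h

end PolyGE

/-! ### Residues -/

variable {k : Type u} [Field k] [CharZero k] [Algebra k ℂ] {g₂ g₃ : k} {L : PeriodPair}

variable (L) in
/-- The Laurent series of the Weierstrass zeta function. -/
def zetaHat : LaurentSeries ℂ :=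
  z⁻¹ + HahnSeries.ofPowerSeries ℤ ℂ (PowerSeries.taylor (KroneckerTheta.zetaReg L))

variable (L) in
theorem analyticAt_zetaReg : AnalyticAt ℂ (KroneckerTheta.zetaReg L) 0 :=
  Complex.analyticAt_iff_eventually_differentiableAt.mpr (by
    filter_upwards [KroneckerTheta.eventually_notMem_diff (L := L)] with t ht
    exact (KroneckerTheta.hasDerivAt_zetaReg L ht).differentiableAt)

variable (L) in
theorem derivative_taylor_zetaReg :
    PowerSeries.derivative ℂ (PowerSeries.taylor (KroneckerTheta.zetaReg L)) = -pReg L := by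
  rw [← PowerSeries.taylor_deriv, pReg, ← PowerSeries.taylor_neg]
  refine PowerSeries.taylor_congr ?_
  filter_upwards [KroneckerTheta.eventually_notMem_diff (L := L)] with t ht
  exact (KroneckerTheta.hasDerivAt_zetaReg L ht).deriv

variable (L) in
theorem deriv_zetaHat : LaurentSeries.deriv (zetaHat L) = -pHat L := by
  rw [zetaHat, map_add, deriv_ofPowerSeries, derivative_taylor_zetaReg, Derivation.leibniz_inv,
    deriv_z, pHat, map_neg, smul_eq_mul, mul_one, ← inv_pow]
  ring

variable (L) in
theorem hasLaurent_zeta : HasLaurent (KroneckerTheta.zeta L) (zetaHat L) := by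
  have h := (hasLaurent_inv_pow 1).add (HasLaurent.of_analyticAt (analyticAt_zetaReg L)
    (.of_forall fun _ => rfl))
  simp only [pow_one] at h
  exact h.congr ((eventually_notMem_lattice L).mono fun t ht => KroneckerTheta.zeta_eq L ht)

variable (H : Uniformizes L g₂ g₃)

/-- The normalization of u_i is a limit of complex functions. It is used below only in this form,
about Laurent series. -/
theorem ordGE_one_of_normalized {f : FunField g₂ g₃}
    (h : Tendsto (fun t => KroneckerTheta.zeta L t - pullbackRat L f t) (𝓝[≠] 0) (𝓝 0)) :
    OrdGE 1 (laurent H f - zetaHat L) := by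
  set a := (IsLocalization.sec (nonZeroDivisors (CoordRing g₂ g₃)) f).1
  set b := (IsLocalization.sec (nonZeroDivisors (CoordRing g₂ g₃)) f).2.1
  have hb : b ≠ 0 := nonZeroDivisors.ne_zero (IsLocalization.sec _ f).2.2
  have hb' : laurentR H b ≠ 0 := (map_ne_zero_iff _ (laurentR_injective H)).mpr hb
  have e : f * algebraMap _ _ b = algebraMap _ _ a :=
    IsLocalization.sec_spec (nonZeroDivisors (CoordRing g₂ g₃)) f
  have e' := laurent_mul_eq H e
  have hB := hasLaurent_pullback H b
  have hA := hasLaurent_pullback H a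
  have hh := (hB.mul (hasLaurent_zeta L)).add ((hasLaurent_const (-1)).mul hA)
  have hne : ∀ᶠ t in 𝓝[≠] 0, pullback L b t ≠ 0 := by
    obtain ⟨n, G, hG, hG0, hbn, -⟩ := hB.exists_eq_zpow_mul hb'
    filter_upwards [hbn, self_mem_nhdsWithin, nhdsWithin_le_nhds (hG.continuousAt.eventually_ne hG0)]
      with t h1 (h2 : t ≠ 0) h3
    rw [h1]
    exact mul_ne_zero (zpow_ne_zero _ h2) h3
  have := hB.ordGE_one_of_tendsto hh hb' (f := fun t => KroneckerTheta.zeta L t - pullbackRat L f t)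
    (by
      filter_upwards [hne] with t ht
      have : pullbackRat L f t = pullback L a t / pullback L b t := rfl
      rw [this]
      field_simp
      ring) h
  have e2 : (laurentR H b * zetaHat L + HahnSeries.C (-1) * laurentR H a) * (laurentR H b)⁻¹ =
      -(laurent H f - zetaHat L) := by
    rw [← e', map_neg, map_one]
    field_simp
    ring
  rw [e2] at this
  simpa using this.neg

theorem ordGE_z : OrdGE 1 z := by simpa using ordGE_z_zpow 1

/-- The residue at `[0]` of the coefficients of a section in the horizontal frame. -/
def horRes (s : Fin 3 →₀ ℕ) : SymAlg3 (LaurentSeries ℂ) →+ ℂ where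
  toFun p := ((shift z (-zetaHat L) p).coeff s).coeff (-1)
  map_zero' := by simp
  map_add' p q := by simp

/-- In the horizontal frame the coefficients of an exact form are derivatives, and a derivative has
no term in z⁻¹. -/
theorem horRes_nabla (s : Fin 3 →₀ ℕ) (p : SymAlg3 (LaurentSeries ℂ)) :
    horRes (L := L) s (nabla (k := ℂ) derivAlg (pHat L) p) = 0 := by
  change ((shift z (-zetaHat L) _).coeff s).coeff (-1) = 0
  have h : LaurentSeries.deriv (-zetaHat L) = pHat L := by rw [map_neg, deriv_zetaHat, neg_neg]
  rw [shift_nabla_eq_coeffDer (k := ℂ) derivAlg (a := z) (b := -zetaHat L) (by exact deriv_z) (by exact h),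
    coeff_coeffDer]
  exact coeff_neg_one_deriv _

theorem map_laurent_ratMap (p : SymAlg3 (CoordRing g₂ g₃)) :
    MvPolynomial.map (laurent H : FunField g₂ g₃ →+* LaurentSeries ℂ) (ratMap g₂ g₃ p) = MvPolynomial.map (laurentR H : CoordRing g₂ g₃ →+* LaurentSeries ℂ) p := by
  rw [ratMap, MvPolynomial.map_map]
  congr 1
  exact congrArg _ (RingHom.ext fun r => laurent_algebraMap H r)

theorem map_laurent_nablaK (p : RatLog g₂ g₃) :
    MvPolynomial.map (laurent H : FunField g₂ g₃ →+* LaurentSeries ℂ) (nablaK H p) =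
      nabla (k := ℂ) derivAlg (pHat L) (MvPolynomial.map (laurent H : FunField g₂ g₃ →+* LaurentSeries ℂ) p) := by
  have := map_nabla (k' := ℂ) (dK H) derivAlg (laurent H : FunField g₂ g₃ →+* LaurentSeries ℂ)
    (fun f => laurent_dK H f) (algebraMap _ _ (x g₂ g₃)) p
  rw [this]
  congr 2
  exact (laurent_algebraMap H _).trans (laurentR_x H)

theorem map_laurentR_nablaR (p : SymAlg3 (CoordRing g₂ g₃)) :
    MvPolynomial.map (laurentR H : CoordRing g₂ g₃ →+* LaurentSeries ℂ) (nablaR H p) =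
      nabla (k := ℂ) derivAlg (pHat L) (MvPolynomial.map (laurentR H : CoordRing g₂ g₃ →+* LaurentSeries ℂ) p) := by
  rw [← map_laurent_ratMap, ratMap_nablaR, map_laurent_nablaK, map_laurent_ratMap]

/-- The residue of `p ⊗ ω` in the horizontal frame. -/
def resR (s : Fin 3 →₀ ℕ) : SymAlg3 (CoordRing g₂ g₃) →+ ℂ :=
  (horRes (L := L) s).comp (MvPolynomial.map (laurentR H : CoordRing g₂ g₃ →+* LaurentSeries ℂ)).toAddMonoidHom

theorem resR_nablaR (s : Fin 3 →₀ ℕ) (p : SymAlg3 (CoordRing g₂ g₃)) :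
    resR H s (nablaR H p) = 0 := by
  change horRes s (MvPolynomial.map (laurentR H : CoordRing g₂ g₃ →+* LaurentSeries ℂ) (nablaR H p)) = 0
  rw [map_laurentR_nablaR, horRes_nabla]

/-- The chart frame and the horizontal frame differ by z and by u − ζ, both of order at least 1, so
the residues in the two frames agree. In the horizontal frame the correction ∇α contributes nothing.
-/
theorem resR_eq_of_chart {f : FunField g₂ g₃} (hf : OrdGE 1 (laurent H f - zetaHat L))
    (p : SymAlg3 (CoordRing g₂ g₃)) (α : RatLog g₂ g₃) {r : (Fin 3 →₀ ℕ) → ℂ}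
    (h : ∀ s, OrdGE (-1) (laurent H ((toChart f (ratMap g₂ g₃ p + nablaK H α)).coeff s)) ∧
      (laurent H ((toChart f (ratMap g₂ g₃ p + nablaK H α)).coeff s)).coeff (-1) = r s)
    (s : Fin 3 →₀ ℕ) : resR H s p = r s := by
  set q := toChart f (ratMap g₂ g₃ p + nablaK H α) with hq
  set q' := MvPolynomial.map (laurent H : FunField g₂ g₃ →+* LaurentSeries ℂ) q with hq'
  have hp : PolyGE (-1) q' := fun s => by rw [hq', coeff_map]; exact (h s).1
  have e : shift z (laurent H f - zetaHat L) q' = shift z (-zetaHat L)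
      (MvPolynomial.map (laurent H : FunField g₂ g₃ →+* LaurentSeries ℂ) (ratMap g₂ g₃ p + nablaK H α)) := by
    rw [hq', hq, toChart_eq_shift, map_shift, shift_shift]
    simp only [map_neg, map_zero, add_zero, RingHom.coe_coe]
    congr 2
    ring
  have h1 := coeff_neg_one_shift ordGE_z hf hp s
  rw [e, map_add, map_laurent_nablaK, map_laurent_ratMap, hq', coeff_map] at h1
  have h2 := horRes_nabla (L := L) s (MvPolynomial.map (laurent H : FunField g₂ g₃ →+* LaurentSeries ℂ) α)
  change horRes s _ = _ at h1
  rw [map_add, h2, add_zero] at h1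
  exact h1.trans (h s).2

end EllPolylog

/-! ### Formal exponentials. -/

namespace PowerSeries

section Exp

variable {k : Type*} [Field k] [CharZero k] {A : Type*} [CommRing A] [Algebra k A]

variable (k) in
/-- The series `exp(a w)`. -/
abbrev expS (a : A) : PowerSeries A := odeSol k (C a)

theorem coeff_expS (a : A) (n : ℕ) : coeff n (expS k a) = algebraMap k A (n ! : k)⁻¹ * a ^ n := by
  have : expS k a = mk fun n => algebraMap k A (n ! : k)⁻¹ * a ^ n := by
    refine ode_unique (k := k) (A := C a) (derivative_odeSol k _) ?_ ?_
    · ext n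
      have h := algebraMap_inv_mul_cast (k := k) (S := A) n
      rw [coeff_derivative, coeff_C_mul, coeff_mk, coeff_mk, Nat.factorial_succ, Nat.cast_mul,
        mul_inv, map_mul, pow_succ, Nat.cast_succ]
      linear_combination algebraMap k A (n ! : k)⁻¹ * a ^ n * a * h
    · rw [constantCoeff_odeSol, ← coeff_zero_eq_constantCoeff_apply, coeff_mk]; simp
  rw [this, coeff_mk]

theorem odeSol_add (A₁ A₂ : PowerSeries A) : odeSol k (A₁ + A₂) = odeSol k A₁ * odeSol k A₂ := by
  refine ode_unique (k := k) (A := A₁ + A₂) (derivative_odeSol k _) ?_ ?_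
  · rw [Derivation.leibniz, derivative_odeSol, derivative_odeSol, smul_eq_mul, smul_eq_mul]; ring
  · rw [map_mul, constantCoeff_odeSol, constantCoeff_odeSol, constantCoeff_odeSol, mul_one]

theorem expS_add (a b : A) : expS k (a + b) = expS k a * expS k b := by
  rw [expS, map_add, odeSol_add]

omit [CharZero k] [Algebra k A] in
theorem constantCoeff_map {B : Type*} [CommRing B] (f : A →+* B) (a : PowerSeries A) :
    constantCoeff (map f a) = f (constantCoeff a) := by
  rw [← coeff_zero_eq_constantCoeff_apply, coeff_map, coeff_zero_eq_constantCoeff_apply]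

omit [CharZero k] [Algebra k A] in
theorem map_map {B D : Type*} [CommRing B] [CommRing D] (f : A →+* B) (g : B →+* D)
    (a : PowerSeries A) : map g (map f a) = map (g.comp f) a := by
  ext n
  rw [coeff_map, coeff_map, coeff_map, RingHom.comp_apply]

theorem map_odeSol {k' : Type*} [Field k'] [CharZero k'] {B : Type*} [CommRing B] [Algebra k' B]
    (f : A →+* B) (a : PowerSeries A) : map f (odeSol k a) = odeSol k' (map f a) := by
  refine ode_unique (k := k') (A := map f a) ?_ (derivative_odeSol k' _) ?_
  · rw [derivative_map, derivative_odeSol, map_mul]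
  · rw [constantCoeff_odeSol, constantCoeff_map, constantCoeff_odeSol, map_one]

theorem map_expS {k' : Type*} [Field k'] [CharZero k'] {B : Type*} [CommRing B] [Algebra k' B]
    (f : A →+* B) (a : A) : map f (expS k a) = expS k' (f a) := by
  rw [expS, map_odeSol (k' := k'), map_C]

theorem rescale_expS (a b : A) : rescale b (expS k a) = expS k (b * a) := by
  ext n
  rw [coeff_rescale, coeff_expS, coeff_expS, mul_pow]; ring

omit [CharZero k] in
theorem flow_neg (D : Derivation k A A) (a : A) : flow D (-a) = -flow D a :=
  eq_neg_of_add_eq_zero_left (by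
    rw [← flow_add, neg_add_cancel]
    ext n
    simp [flow])

end Exp

end PowerSeries

/-! ### The pole at [0] of the generating series of the connection functions. -/

namespace EllPolylog

section Pole

open PowerSeries
open LaurentSeries hiding derivative

variable {k : Type u} [Field k] [CharZero k] [Algebra k ℂ] {g₂ g₃ : k} {L : PeriodPair}

/-- Taylor's formula: the flow of p is p(z + w), and its value at z = 0 is p(w). -/
theorem coeff_flow_ofPowerSeries (p : PowerSeries ℂ) (n : ℕ) :
    OrdGE 0 (coeff n (flow (k := ℂ) derivAlg (HahnSeries.ofPowerSeries ℤ ℂ p))) ∧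
      (coeff n (flow (k := ℂ) derivAlg (HahnSeries.ofPowerSeries ℤ ℂ p))).coeff 0 = coeff n p := by
  have h : derivFun^[n] (HahnSeries.ofPowerSeries ℤ ℂ p) =
      HahnSeries.ofPowerSeries ℤ ℂ ((derivative ℂ)^[n] p) := by
    induction n with
    | zero => rfl
    | succ n ih =>
      rw [Function.iterate_succ_apply', ih, Function.iterate_succ_apply']
      exact deriv_ofPowerSeries _
  have e : coeff n (flow (k := ℂ) derivAlg (HahnSeries.ofPowerSeries ℤ ℂ p)) =
      HahnSeries.ofPowerSeries ℤ ℂ (C ((n ! : ℂ)⁻¹) * (derivative ℂ)^[n] p) := by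
    rw [map_mul, ← h, flow, coeff_mk, algebraMap_eq_C, HahnSeries.ofPowerSeries_C]
    rfl
  rw [e, coeff_zero_ofPowerSeries]
  refine ⟨ordGE_ofPowerSeries _, ?_⟩
  rw [map_mul, constantCoeff_iterate_derivative, constantCoeff_C, ← mul_assoc,
    inv_mul_cancel₀ (by exact_mod_cast n.factorial_ne_zero), one_mul]

variable (L) in
/-- The series `σ(w) / w`. -/
def sigmaQuotSeries : PowerSeries ℂ := odeSol ℂ (taylor (KroneckerTheta.zetaReg L))

variable (L) in
/-- The series of `σ`, as a Laurent series. -/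
def sigmaHat : LaurentSeries ℂ := HahnSeries.ofPowerSeries ℤ ℂ (X * sigmaQuotSeries L)

theorem sigmaHat_eq : sigmaHat L = z * HahnSeries.ofPowerSeries ℤ ℂ (sigmaQuotSeries L) := by
  rw [sigmaHat, map_mul]; congr 1; simp [z]

theorem deriv_sigmaHat : LaurentSeries.deriv (sigmaHat L) = zetaHat L * sigmaHat L := by
  have hz := z_ne_zero
  rw [sigmaHat_eq, Derivation.leibniz, deriv_z, deriv_ofPowerSeries, sigmaQuotSeries,
    derivative_odeSol, map_mul, zetaHat, smul_eq_mul, smul_eq_mul, mul_one, add_mul,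
    inv_mul_cancel_left₀ hz]
  ring

theorem ordGE_sigmaHat : OrdGE 1 (sigmaHat L) ∧ (sigmaHat L).coeff 1 = 1 := by
  have h := coeff_mul_of_ordGE ordGE_z (ordGE_ofPowerSeries (sigmaQuotSeries L))
  have h' := ordGE_z.mul (ordGE_ofPowerSeries (sigmaQuotSeries L))
  rw [add_zero, ← sigmaHat_eq] at h h'
  refine ⟨h', ?_⟩
  rw [h, coeff_zero_ofPowerSeries, sigmaQuotSeries, constantCoeff_odeSol, z,
    HahnSeries.coeff_single_same, mul_one]

variable (H : Uniformizes L g₂ g₃)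

/-- The formal version of ζ(z+w) = (ζ(z+w) − ζ(z) − ζ_reg(w)) + ζ(z) + ζ_reg(w), where ζ_reg(w) =
ζ(w) − w⁻¹. Both sides have the same derivative in w and the same value at w = 0. -/
theorem flow_zetaHat : flow (k := ℂ) derivAlg (zetaHat L) =
    map (laurentR H : CoordRing g₂ g₃ →+* LaurentSeries ℂ) (connLog H) + C (zetaHat L) +
      map HahnSeries.C (taylor (KroneckerTheta.zetaReg L)) := by
  refine eq_of_derivative_eq (k := ℂ) ?_ ?_
  · have h2 : map (laurentR H : CoordRing g₂ g₃ →+* LaurentSeries ℂ)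
        (map (algebraMap k (CoordRing g₂ g₃)) (pRegK H)) = map HahnSeries.C (pReg L) := by
      rw [← map_pRegK H, PowerSeries.map_map, PowerSeries.map_map]
      congr 1
      refine congrArg _ (RingHom.ext fun c => ?_)
      exact ((laurentR H).commutes c).trans (algebraMap_eq_C c)
    have h3 : map (laurentR H : CoordRing g₂ g₃ →+* LaurentSeries ℂ) (flow (dR H) (x g₂ g₃)) =
        flow (k := ℂ) derivAlg (pHat L) := by
      have := IsScalarTower.of_algebraMap_eq (R := k) (S := ℂ) (A := LaurentSeries ℂ) fun c => by
        rw [algebraMap_eq_C, algebraMap_eq_C]; rfl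
      rw [map_flow (k' := ℂ) (dR H) derivAlg (laurentR H) (fun a => laurentR_dR H a), laurentR_x]
    rw [derivative_flow, map_add, map_add, derivative_map, derivative_connLog, derivative_map,
      derivative_taylor_zetaReg, map_sub, h2, h3, derivative_C, map_neg]
    refine (congrArg (flow (k := ℂ) derivAlg) (show _ = -pHat L from deriv_zetaHat L)).trans ?_
    rw [flow_neg]
    ring
  · rw [constantCoeff_flow, map_add, map_add, constantCoeff_map, constantCoeff_connLog,
      constantCoeff_map, constantCoeff_taylor, constantCoeff_C, KroneckerTheta.zetaReg_zero]
    simp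

/-- The formal version of wΞ(z,w) e^{ζ(z)w} σ(z) · σ(w)/w = σ(z + w). Both sides solve Y' = ζ(z+w) Y
in the variable w, with initial value σ(z). -/
theorem conn_mul_exp_eq : map (laurentR H : CoordRing g₂ g₃ →+* LaurentSeries ℂ) (connSeries H) *
    expS ℂ (zetaHat L) * C (sigmaHat L) * map HahnSeries.C (sigmaQuotSeries L) =
      flow (k := ℂ) derivAlg (sigmaHat L) := by
  refine ode_unique (k := ℂ) (A := flow (k := ℂ) derivAlg (zetaHat L)) ?_ ?_ ?_
  · rw [flow_zetaHat H]
    simp only [Derivation.leibniz, smul_eq_mul, derivative_map, connSeries, sigmaQuotSeries,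
      derivative_odeSol, derivative_C, map_mul]
    ring
  · rw [derivative_flow]
    refine Eq.trans (congrArg _ (show _ = zetaHat L * sigmaHat L from deriv_sigmaHat)) ?_
    rw [flow_mul]
  · rw [constantCoeff_flow, map_mul, map_mul, map_mul, constantCoeff_map, constantCoeff_map,
      connSeries, sigmaQuotSeries, constantCoeff_odeSol, constantCoeff_odeSol, constantCoeff_odeSol,
      constantCoeff_C]
    simp

/-- Divide by σ(z) · σ(w)/w. The numerator σ(z+w) is regular at z = 0 with value σ(w), and σ(z) has
a simple zero with derivative 1, so the residue is σ(w) / (σ(w)/w) = w. This is why n = 1 is singled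
out. -/
theorem coeff_conn_mul_exp (n : ℕ) :
    OrdGE (-1) (coeff n (map (laurentR H : CoordRing g₂ g₃ →+* LaurentSeries ℂ) (connSeries H) *
      expS ℂ (zetaHat L))) ∧
    (coeff n (map (laurentR H : CoordRing g₂ g₃ →+* LaurentSeries ℂ) (connSeries H) *
      expS ℂ (zetaHat L))).coeff (-1) = if n = 1 then 1 else 0 := by
  set Q := map (laurentR H : CoordRing g₂ g₃ →+* LaurentSeries ℂ) (connSeries H) *
      expS ℂ (zetaHat L) with hQ
  have hE : sigmaQuotSeries L * (sigmaQuotSeries L)⁻¹ = 1 := PowerSeries.mul_inv_cancel _ (by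
    rw [sigmaQuotSeries, constantCoeff_odeSol]; exact one_ne_zero)
  have h1 : Q * C (sigmaHat L) = flow (k := ℂ) derivAlg (sigmaHat L) *
      map HahnSeries.C (sigmaQuotSeries L)⁻¹ := by
    rw [← conn_mul_exp_eq H, ← hQ, mul_assoc, mul_assoc, ← map_mul, hE, map_one, mul_one]
  have h2 : coeff n Q * sigmaHat L = ∑ p ∈ Finset.HasAntidiagonal.antidiagonal n,
      coeff p.1 (flow (k := ℂ) derivAlg (sigmaHat L)) *
        coeff p.2 (map HahnSeries.C (sigmaQuotSeries L)⁻¹) := by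
    rw [← coeff_mul_C, h1, coeff_mul]
  obtain ⟨hs, hs1⟩ := ordGE_sigmaHat (L := L)
  have hne : sigmaHat L ≠ 0 := fun h => by rw [h] at hs1; simp at hs1
  obtain ⟨hi, hi1⟩ := ordGE_inv hs (by rw [hs1]; exact one_ne_zero)
  rw [(eq_mul_inv_iff_mul_eq₀ hne).mpr h2]
  have ht (p : ℕ × ℕ) : OrdGE 0 (coeff p.1 (flow (k := ℂ) derivAlg (sigmaHat L)) *
        coeff p.2 (map HahnSeries.C (sigmaQuotSeries L)⁻¹)) ∧
      (coeff p.1 (flow (k := ℂ) derivAlg (sigmaHat L)) *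
        coeff p.2 (map HahnSeries.C (sigmaQuotSeries L)⁻¹)).coeff 0 =
      coeff p.1 (X * sigmaQuotSeries L) * coeff p.2 (sigmaQuotSeries L)⁻¹ := by
    obtain ⟨a1, a2⟩ := coeff_flow_ofPowerSeries (X * sigmaQuotSeries L) p.1
    rw [coeff_map]
    have b := ordGE_C (coeff p.2 (sigmaQuotSeries L)⁻¹)
    have c := coeff_mul_of_ordGE a1 b
    rw [zero_add, a2, HahnSeries.C_apply, HahnSeries.coeff_single_same] at c
    exact ⟨a1.mul b, c⟩
  have hsum : OrdGE 0 (∑ p ∈ Finset.HasAntidiagonal.antidiagonal n,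
      coeff p.1 (flow (k := ℂ) derivAlg (sigmaHat L)) *
        coeff p.2 (map HahnSeries.C (sigmaQuotSeries L)⁻¹)) := OrdGE.sum fun p _ => (ht p).1
  have hm := coeff_mul_of_ordGE hsum hi
  rw [hi1, hs1, inv_one, mul_one, HahnSeries.coeff_sum, Finset.sum_congr rfl fun p _ => (ht p).2,
    ← coeff_mul n (X * sigmaQuotSeries L), mul_assoc, hE, mul_one, coeff_X, zero_add] at hm
  exact ⟨by simpa using hsum.mul hi, hm⟩

theorem laurent_coeff (P : PowerSeries (FunField g₂ g₃)) (n : ℕ) : laurent H (coeff n P) =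
    coeff n (map (laurent H : FunField g₂ g₃ →+* LaurentSeries ℂ) P) := by
  rw [coeff_map]; rfl

/-- Here ζ is replaced by f = ζ + v with v of order at least 1. The coefficients of exp(vw) − 1 have
order at least 1, so they absorb the simple poles and do not affect the residues. -/
theorem coeff_map_expS_mul {f : FunField g₂ g₃} (hf : OrdGE 1 (laurent H f - zetaHat L)) (n : ℕ) :
    OrdGE (-1) (laurent H (coeff n (expS k f *
      map (algebraMap (CoordRing g₂ g₃) (FunField g₂ g₃)) (connSeries H)))) ∧
    (laurent H (coeff n (expS k f *
      map (algebraMap (CoordRing g₂ g₃) (FunField g₂ g₃)) (connSeries H)))).coeff (-1) =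
        if n = 1 then 1 else 0 := by
  obtain ⟨v, hv⟩ : ∃ v, v = laurent H f - zetaHat L := ⟨_, rfl⟩
  obtain ⟨Q, hQ⟩ : ∃ Q, Q = map (laurentR H : CoordRing g₂ g₃ →+* LaurentSeries ℂ) (connSeries H) *
      expS ℂ (zetaHat L) := ⟨_, rfl⟩
  have hexp : map (laurent H : FunField g₂ g₃ →+* LaurentSeries ℂ) (expS k f) =
      expS ℂ (zetaHat L) * expS ℂ v := by
    rw [map_expS (k' := ℂ), ← expS_add, hv, add_sub_cancel]
    rfl
  have hmap : map (laurent H : FunField g₂ g₃ →+* LaurentSeries ℂ)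
      (map (algebraMap (CoordRing g₂ g₃) (FunField g₂ g₃)) (connSeries H)) =
      map (laurentR H : CoordRing g₂ g₃ →+* LaurentSeries ℂ) (connSeries H) := by
    rw [PowerSeries.map_map]
    congr 1
    exact congrArg _ (RingHom.ext fun r => laurent_algebraMap H r)
  have e : map (laurent H : FunField g₂ g₃ →+* LaurentSeries ℂ) (expS k f *
      map (algebraMap (CoordRing g₂ g₃) (FunField g₂ g₃)) (connSeries H)) = Q * expS ℂ v := by
    rw [RingHom.map_mul, hexp, hmap, hQ]
    ring
  rw [laurent_coeff, e]
  rw [← hv] at hf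
  have hcoeff := coeff_conn_mul_exp H
  rw [← hQ] at hcoeff
  have hexp0 : expS ℂ v = 1 + (expS ℂ v - 1) := by ring
  have hc (j : ℕ) : OrdGE 1 (coeff j (expS ℂ v - 1)) := by
    rcases j with _ | j
    · rw [map_sub, coeff_zero_eq_constantCoeff_apply, constantCoeff_odeSol]
      simp only [coeff_zero_eq_constantCoeff, map_one, sub_self]
      exact ordGE_zero _
    · rw [map_sub, coeff_expS, coeff_one, if_neg (Nat.succ_ne_zero j), sub_zero, algebraMap_eq_C]
      have h1 := (ordGE_C ((algebraMap ℂ ℂ) ((j + 1)! : ℂ)⁻¹)).mul (ordGE_pow hf (j + 1)).1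
      exact h1.mono (by push_cast; omega)
  have h2 : OrdGE 0 (coeff n (Q * (expS ℂ v - 1))) := by
    rw [coeff_mul]
    refine OrdGE.sum fun p _ => ?_
    have := (hcoeff p.1).1.mul (hc p.2)
    simpa using this
  obtain ⟨h3, h4⟩ := hcoeff n
  rw [hexp0, mul_add, mul_one, map_add]
  refine ⟨h3.add (h2.mono (by norm_num)), ?_⟩
  rw [HahnSeries.coeff_add, h4, h2 (-1) (by norm_num), add_zero]

end Pole

end EllPolylog

namespace EllPolylog

open MvPolynomial

/-! ### The polynomials of the polylogarithm -/

section Bold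

variable (k : Type*) [Field k] {A : Type*} [CommRing A] [Algebra k A]

/-- The divided power `p ^ n / n!`. -/
def dp (n : ℕ) (p : SymAlg3 A) : SymAlg3 A := C (algebraMap k A (n ! : k)⁻¹) * p ^ n

variable (A) in
/-- The polynomial `X₀ ^ a X₁ ^ m X₂ ^ n / a!` with `a = N - m - n`. -/
def wPoly (N m n : ℕ) : SymAlg3 A :=
  C (algebraMap k A ((N - m - n)! : k)⁻¹) * (X 0 ^ (N - m - n) * X 1 ^ m * X 2 ^ n)

theorem isHomogeneous_wPoly {N m n : ℕ} (h : m + n ≤ N) : (wPoly k A N m n).IsHomogeneous N := by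
  have := (isHomogeneous_C (Fin 3) (algebraMap k A ((N - m - n)! : k)⁻¹)).mul
    ((((isHomogeneous_X A (0 : Fin 3)).pow (N - m - n)).mul
      ((isHomogeneous_X A (1 : Fin 3)).pow m)).mul ((isHomogeneous_X A (2 : Fin 3)).pow n))
  rw [show 0 + (1 * (N - m - n) + 1 * m + 1 * n) = N by omega] at this
  exact this

theorem ofSymPow_toSymPow_of_isHomogeneous {N : ℕ} {p : SymAlg3 A} (hp : p.IsHomogeneous N) :
    ofSymPow A N (toSymPow A N p) = p :=
  (homogeneousComponent_of_mem hp).trans (if_pos rfl)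

theorem toSymPow_of_isHomogeneous_of_ne {M N : ℕ} {p : SymAlg3 A} (hp : p.IsHomogeneous M)
    (h : M ≠ N) : toSymPow A N p = 0 :=
  Subtype.ext ((homogeneousComponent_of_mem hp).trans (if_neg h.symm))

theorem toSymPow_ofSymPow {N : ℕ} (p : SymPow A N) : toSymPow A N (ofSymPow A N p) = p :=
  Subtype.ext (ofSymPow_toSymPow_of_isHomogeneous p.2)

theorem isHomogeneous_ofSymPow {N : ℕ} (p : SymPow A N) : (ofSymPow A N p).IsHomogeneous N := p.2

theorem ofSymPow_injective (N : ℕ) : Function.Injective (ofSymPow A N) := Subtype.val_injective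

theorem ofSymPow_wBasis {N m n : ℕ} (h : m + n ≤ N) :
    ofSymPow A N (wBasis k A N m n) = wPoly k A N m n :=
  ofSymPow_toSymPow_of_isHomogeneous (isHomogeneous_wPoly k h)

theorem wBasis_eq_zero {N m n : ℕ} (h : N < m + n) : wBasis k A N m n = 0 := by
  refine toSymPow_of_isHomogeneous_of_ne (M := (N - m - n) + m + n) ?_ (by omega)
  have := (isHomogeneous_C (Fin 3) (algebraMap k A ((N - m - n)! : k)⁻¹)).mul
    ((((isHomogeneous_X A (0 : Fin 3)).pow (N - m - n)).mul
      ((isHomogeneous_X A (1 : Fin 3)).pow m)).mul ((isHomogeneous_X A (2 : Fin 3)).pow n))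
  rw [show 0 + (1 * (N - m - n) + 1 * m + 1 * n) = N - m - n + m + n by omega] at this
  exact this

theorem map_wPoly (N m n : ℕ) : map (algebraMap k A) (wPoly k k N m n) = wPoly k A N m n := by
  simp [wPoly]

theorem map_algebraMap_wPoly {B : Type*} [CommRing B] [Algebra k B] [Algebra A B]
    [IsScalarTower k A B] (N m n : ℕ) :
    map (algebraMap A B) (wPoly k A N m n) = wPoly k B N m n := by
  simp only [wPoly, map_mul, map_C, map_pow, map_X, ← IsScalarTower.algebraMap_apply]

/-- The coefficient of `ω` in `boldEta`, for the coefficients `c` instead of `(-1)ⁿ Lₙ`. -/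
def etPoly (c : PowerSeries A) (N : ℕ) : SymAlg3 A :=
  -∑ n ∈ Finset.range (N + 1), C (PowerSeries.coeff n c) * wPoly k A N 0 n

/-- The coefficient of `ω` in `boldOmega`, for the coefficients `c` instead of `(-1)ⁿ Lₙ` and the
form `a ω` instead of `η`. -/
def omPoly (a : A) (c : PowerSeries A) (N : ℕ) : SymAlg3 A :=
  C a * wPoly k A N 0 0 -
    ∑ n ∈ Finset.Icc 1 N, C (PowerSeries.coeff n c) * wPoly k A N 1 (n - 1)

theorem map_etPoly {B : Type*} [CommRing B] [Algebra k B] [Algebra A B]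
    [IsScalarTower k A B] (c : PowerSeries A) (N : ℕ) :
    map (algebraMap A B) (etPoly k c N) = etPoly k (PowerSeries.map (algebraMap A B) c) N := by
  simp only [etPoly, map_neg, map_sum, map_mul, map_C, map_algebraMap_wPoly, PowerSeries.coeff_map]

theorem map_omPoly {B : Type*} [CommRing B] [Algebra k B] [Algebra A B]
    [IsScalarTower k A B] (a : A) (c : PowerSeries A) (N : ℕ) :
    map (algebraMap A B) (omPoly k a c N) =
      omPoly k (algebraMap A B a) (PowerSeries.map (algebraMap A B) c) N := by
  simp only [omPoly, map_sub, map_sum, map_mul, map_C, map_algebraMap_wPoly, PowerSeries.coeff_map]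

/-- Termwise, X₂ ω^{1,n−1} = X₁ ω^{0,n} for n ≥ 1. The term n = 0 of `etPoly`, where the coefficient
is 1, is balanced by X₁ X₀^N/N!. The first summand on the right is ∇ of X₀^{N+1}/(N+1)!, so up to an
exact form the two sections are proportional. -/
theorem X_two_mul_omPoly (a : A) {c : PowerSeries A} (hc : PowerSeries.constantCoeff c = 1) (N : ℕ) :
    X 2 * omPoly k a c N = dp k N (X 0) * (X 1 + C a * X 2) + X 1 * etPoly k c N := by
  have h0 : wPoly k A N 0 0 = dp k N (X 0) := by simp [wPoly, dp]
  have hn (n : ℕ) (hn : n ∈ Finset.range N) : C (PowerSeries.coeff (n + 1) c) *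
      wPoly k A N 0 (n + 1) * X 1 = X 2 * (C (PowerSeries.coeff (1 + n) c) *
        wPoly k A N 1 (1 + n - 1)) := by
    rw [wPoly, wPoly, add_tsub_cancel_left, add_comm 1 n,
      show N - 0 - (n + 1) = N - 1 - n by omega]
    ring
  have hI : Finset.Icc 1 N = Finset.Ico 1 (N + 1) := rfl
  rw [omPoly, etPoly, Finset.sum_range_succ', PowerSeries.coeff_zero_eq_constantCoeff_apply, hc, h0,
    hI, Finset.sum_Ico_eq_sum_range, Nat.add_sub_cancel, mul_sub, Finset.mul_sum,
    ← Finset.sum_congr rfl hn, ← Finset.sum_mul, map_one]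
  ring

variable [CharZero k]

/-- The generating series of the polynomials `etPoly`, up to sign. -/
def psi (c : PowerSeries A) : PowerSeries (SymAlg3 A) :=
  PowerSeries.expS k (X 0 : SymAlg3 A) * PowerSeries.rescale (X 2) (PowerSeries.map C c)

theorem coeff_expS_eq_dp (p : SymAlg3 A) (n : ℕ) :
    PowerSeries.coeff n (PowerSeries.expS k p) = dp k n p := by
  rw [PowerSeries.coeff_expS]; rfl

theorem coeff_psi (c : PowerSeries A) (N : ℕ) : PowerSeries.coeff N (psi k c) = -etPoly k c N := by
  rw [psi, mul_comm, PowerSeries.coeff_mul, etPoly, neg_neg,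
    Finset.Nat.sum_antidiagonal_eq_sum_range_succ (fun i j =>
      PowerSeries.coeff i (PowerSeries.rescale (X 2) (PowerSeries.map C c)) *
        PowerSeries.coeff j (PowerSeries.expS k (X 0 : SymAlg3 A)))]
  refine Finset.sum_congr rfl fun n _ => ?_
  rw [PowerSeries.coeff_rescale, PowerSeries.coeff_map, coeff_expS_eq_dp, dp, wPoly, Nat.sub_zero]
  ring

/-- The substitution multiplies exp(X₀w) by exp(f X₂w), and this factor is absorbed by the other
one, which is a series in X₂w. -/
theorem map_shift_psi (f : A) (c : PowerSeries A) :
    PowerSeries.map (shift 0 f : SymAlg3 A →+* SymAlg3 A) (psi k c) =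
      psi k (PowerSeries.expS k f * c) := by
  have h1 : PowerSeries.map (shift 0 f : SymAlg3 A →+* SymAlg3 A)
      (PowerSeries.rescale (X 2) (PowerSeries.map C c)) =
        PowerSeries.rescale (X 2) (PowerSeries.map C c) := by
    ext1 n
    rw [PowerSeries.coeff_map, PowerSeries.coeff_rescale, PowerSeries.coeff_map, RingHom.coe_coe,
      map_mul, map_pow, shift_X_two, shift_C]
  have h2 : (shift 0 f : SymAlg3 A →+* SymAlg3 A) (X 0) = X 0 + X 2 * C f := by
    rw [RingHom.coe_coe, shift_X_zero, map_zero]; ring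
  rw [psi, RingHom.map_mul, PowerSeries.map_expS (k' := k), h1, h2, PowerSeries.expS_add,
    ← PowerSeries.rescale_expS, ← PowerSeries.map_expS (k := k) (k' := k) (C : A →+* SymAlg3 A),
    mul_assoc, ← map_mul, ← map_mul, psi]

theorem shift_etPoly (f : A) (c : PowerSeries A) (N : ℕ) :
    shift 0 f (etPoly k c N) = etPoly k (PowerSeries.expS k f * c) N := by
  have h := congrArg (PowerSeries.coeff N) (map_shift_psi k f c)
  rw [PowerSeries.coeff_map, coeff_psi, coeff_psi, RingHom.coe_coe, map_neg] at h
  exact neg_injective h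

theorem nabla_dp (d : Derivation k A A) (a : A) (p : SymAlg3 A) (N : ℕ) :
    nabla d a (dp k (N + 1) p) = dp k N p * nabla d a p := by
  have h := PowerSeries.algebraMap_inv_mul_cast (k := k) (S := A) N
  rw [dp, dp, Derivation.leibniz, Derivation.leibniz_pow, nabla_C, Derivation.map_algebraMap,
    map_zero, smul_zero, add_zero, Nat.add_sub_cancel, nsmul_eq_mul, smul_eq_mul, smul_eq_mul,
    Nat.factorial_succ, Nat.cast_mul, mul_inv, map_mul, map_mul, Nat.cast_succ, Nat.cast_succ]
  have h' : C (algebraMap k A ((N : k) + 1)⁻¹) * ((N : SymAlg3 A) + 1) = 1 := by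
    have := congrArg (C : A → SymAlg3 A) h
    rwa [map_mul, map_add, map_natCast, map_one] at this
  linear_combination C (algebraMap k A (N ! : k)⁻¹) * p ^ N * nabla d a p * h'

omit [CharZero k] in
theorem shift_dp (a b : A) (n : ℕ) (p : SymAlg3 A) :
    shift a b (dp k n p) = dp k n (shift a b p) := by
  rw [dp, dp, map_mul, map_pow, shift_C]

omit [CharZero k] in
theorem X_two_mul_cancel {p q : SymAlg3 A} (h : X 2 * p = X 2 * q) : p = q := by
  ext m
  rw [← coeff_X_mul m 2 p, h, coeff_X_mul]

-- With e_i = e + fη^∨, α is the quotient of (e_i^{N+1} − e^{N+1})/(N+1)! by η^∨. It will be the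
-- Čech correction α_i.
omit [CharZero k] in
theorem exists_X_two_mul_eq (f : A) (N : ℕ) : ∃ α : SymAlg3 A, α.IsHomogeneous N ∧
    X 2 * α = dp k (N + 1) (X 0 + C f * X 2) - dp k (N + 1) (X 0) := by
  obtain ⟨q, hq⟩ : X 2 ∣ dp k (N + 1) (X 0 + C f * X 2) - dp k (N + 1) (X 0) := by
    rw [dp, dp, ← mul_sub]
    refine Dvd.dvd.mul_left (Dvd.dvd.trans ?_ (sub_dvd_pow_sub_pow _ _ _)) _
    rw [add_sub_cancel_left]
    exact Dvd.intro_left _ rfl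
  refine ⟨q, fun m hm => ?_, hq.symm⟩
  have hdp (p : SymAlg3 A) (hp : p.IsHomogeneous 1) : (dp k (N + 1) p).IsHomogeneous (N + 1) := by
    have := (isHomogeneous_C (Fin 3) (algebraMap k A ((N + 1)! : k)⁻¹)).mul (hp.pow (N + 1))
    rwa [zero_add, one_mul] at this
  have h2 : (C f * X 2 : SymAlg3 A).IsHomogeneous 1 := by
    simpa using (isHomogeneous_C (Fin 3) f).mul (isHomogeneous_X A 2)
  have h := (hdp _ ((isHomogeneous_X A 0).add h2)).sub (hdp _ (isHomogeneous_X A 0))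
  rw [hq] at h
  have := h (d := Finsupp.single 2 1 + m) (by rw [coeff_X_mul]; exact hm)
  rw [map_add, Finsupp.weight_single] at this
  simp only [Pi.one_apply, smul_eq_mul, mul_one] at this
  omega

/-- After multiplication by X₂, which can be cancelled, the left side is ∇(e_i^{N+1}/(N+1)!) + X₁ ·
`etPoly` before the change of frame: the exact term in e has been replaced by the one in e_i. In the
chart frame e_i is X₀, so `X_two_mul_omPoly` applies again, with η replaced by η + df. -/
theorem shift_omPoly_add_nabla (d : Derivation k A A) (a f : A) {c : PowerSeries A}
    (hc : PowerSeries.constantCoeff c = 1) (N : ℕ) {α : SymAlg3 A}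
    (hα : X 2 * α = dp k (N + 1) (X 0 + C f * X 2) - dp k (N + 1) (X 0)) :
    shift 0 (-f) (omPoly k a c N + nabla d a α) =
      omPoly k (a + d f) (PowerSeries.expS k (-f) * c) N := by
  have h1 : X 2 * nabla d a α = dp k N (X 0 + C f * X 2) * (X 1 + C (a + d f) * X 2) -
      dp k N (X 0) * (X 1 + C a * X 2) := by
    have h := congrArg (nabla d a) hα
    have h2 : nabla d a (X 2) = 0 := nabla_X_of_ne _ _ (by decide)
    rw [Derivation.leibniz, h2, smul_zero, add_zero, map_sub, nabla_dp,
      nabla_dp, map_add, Derivation.leibniz, h2, nabla_X_zero, nabla_C,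
      smul_zero, zero_add, smul_eq_mul, smul_eq_mul] at h
    rw [h, map_add]
    ring
  have hs : shift 0 (-f) (X 0 + C f * X 2) = X 0 := by
    rw [map_add, map_mul, shift_X_zero, shift_C, shift_X_two, map_neg, map_zero]; ring
  have hc' : PowerSeries.constantCoeff (PowerSeries.expS k (-f) * c) = 1 := by
    rw [map_mul, hc, PowerSeries.constantCoeff_odeSol, one_mul]
  apply X_two_mul_cancel
  rw [X_two_mul_omPoly k _ hc', ← shift_etPoly, ← shift_X_two 0 (-f), ← map_mul, mul_add, h1,
    X_two_mul_omPoly k _ hc, shift_X_two]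
  have e : dp k N (X 0) * (X 1 + C a * X 2) + X 1 * etPoly k c N +
      (dp k N (X 0 + C f * X 2) * (X 1 + C (a + d f) * X 2) - dp k N (X 0) * (X 1 + C a * X 2)) =
      dp k N (X 0 + C f * X 2) * (X 1 + C (a + d f) * X 2) + X 1 * etPoly k c N := by ring
  rw [e, map_add, map_mul, shift_dp, hs, map_mul, map_add, map_mul, shift_X_one, shift_C,
    shift_X_two]

end Bold

/-! ### Polynomials with coefficients in a subring -/

section PolyIn

variable {k : Type*} [Field k] {A : Type*} [CommRing A] [Algebra k A] (S : Subalgebra k A)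

/-- The polynomials all of whose coefficients are in `S`. -/
def polyIn : Subalgebra k (SymAlg3 A) where
  carrier := {p | ∀ m, p.coeff m ∈ S}
  mul_mem' hp hq m := by
    classical
    rw [coeff_mul]
    exact sum_mem fun _ _ => mul_mem (hp _) (hq _)
  add_mem' hp hq m := by rw [coeff_add]; exact add_mem (hp m) (hq m)
  algebraMap_mem' c m := by
    classical
    rw [MvPolynomial.algebraMap_apply, coeff_C]
    split_ifs
    · exact S.algebraMap_mem c
    · exact zero_mem _

variable {S}

theorem C_mem_polyIn {a : A} (ha : a ∈ S) : C a ∈ polyIn S := fun m => by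
  classical
  rw [coeff_C]
  split_ifs
  · exact ha
  · exact zero_mem _

theorem X_mem_polyIn (i : Fin 3) : X i ∈ polyIn S := fun m => by
  classical
  rw [coeff_X]
  split_ifs
  · exact one_mem _
  · exact zero_mem _

theorem mem_polyIn_of_X_two_mul {p : SymAlg3 A} (h : X 2 * p ∈ polyIn S) : p ∈ polyIn S := fun m => by
  rw [← coeff_X_mul m 2 p]; exact h _

theorem dp_mem_polyIn {p : SymAlg3 A} (hp : p ∈ polyIn S) (n : ℕ) : dp k n p ∈ polyIn S :=
  mul_mem (C_mem_polyIn (S.algebraMap_mem _)) (pow_mem hp n)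

theorem wPoly_mem_polyIn (N m n : ℕ) : wPoly k A N m n ∈ polyIn S :=
  mul_mem (C_mem_polyIn (S.algebraMap_mem _)) (mul_mem (mul_mem (pow_mem (X_mem_polyIn 0) _)
    (pow_mem (X_mem_polyIn 1) _)) (pow_mem (X_mem_polyIn 2) _))

theorem etPoly_mem_polyIn {c : PowerSeries A} (hc : ∀ n, PowerSeries.coeff n c ∈ S) (N : ℕ) :
    etPoly k c N ∈ polyIn S :=
  neg_mem (sum_mem fun n _ => mul_mem (C_mem_polyIn (hc n)) (wPoly_mem_polyIn N 0 n))

theorem omPoly_mem_polyIn {a : A} (ha : a ∈ S) {c : PowerSeries A}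
    (hc : ∀ n, PowerSeries.coeff n c ∈ S) (N : ℕ) : omPoly k a c N ∈ polyIn S :=
  sub_mem (mul_mem (C_mem_polyIn ha) (wPoly_mem_polyIn N 0 0))
    (sum_mem fun n _ => mul_mem (C_mem_polyIn (hc n)) (wPoly_mem_polyIn N 1 (n - 1)))

theorem coeff_expS_mem [CharZero k] {a : A} (ha : a ∈ S) {c : PowerSeries A}
    (hc : ∀ n, PowerSeries.coeff n c ∈ S) (n : ℕ) :
    PowerSeries.coeff n (PowerSeries.expS k a * c) ∈ S := by
  rw [PowerSeries.coeff_mul]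
  refine sum_mem fun p _ => mul_mem ?_ (hc _)
  rw [PowerSeries.coeff_expS]
  exact mul_mem (S.algebraMap_mem _) (pow_mem ha _)

end PolyIn

end EllPolylog

/-! ### Residues of the two forms, linearity and uniqueness of residues. -/

namespace EllPolylog

open MvPolynomial LaurentSeries

section Homog

variable (k : Type*) [Field k] {A : Type*} [CommRing A] [Algebra k A]

theorem isHomogeneous_C_mul {p : SymAlg3 A} {N : ℕ} (a : A) (hp : p.IsHomogeneous N) :
    (C a * p).IsHomogeneous N := by
  simpa using (isHomogeneous_C (Fin 3) a).mul hp

theorem isHomogeneous_etPoly (c : PowerSeries A) (N : ℕ) : (etPoly k c N).IsHomogeneous N :=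
  (IsHomogeneous.sum _ _ _ fun n hn => isHomogeneous_C_mul _ (isHomogeneous_wPoly k (by
    have := Finset.mem_range.mp hn; omega))).neg

theorem isHomogeneous_omPoly (a : A) (c : PowerSeries A) (N : ℕ) :
    (omPoly k a c N).IsHomogeneous N :=
  (isHomogeneous_C_mul _ (isHomogeneous_wPoly k (by omega))).sub
    (IsHomogeneous.sum _ _ _ fun n hn => isHomogeneous_C_mul _ (isHomogeneous_wPoly k (by
      have := Finset.mem_Icc.mp hn; omega)))

end Homog

variable {k : Type u} [Field k] [CharZero k] [Algebra k ℂ] {g₂ g₃ : k} {L : PeriodPair}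
  (H : Uniformizes L g₂ g₃) {I : Type w} (𝔘 : LogCover g₂ g₃ L I)

/-- The series `∑ (-1)ⁿ Lₙ wⁿ`. -/
def connSeriesNeg : PowerSeries (CoordRing g₂ g₃) := PowerSeries.rescale (-1) (connSeries H)

theorem coeff_connSeriesNeg (n : ℕ) : PowerSeries.coeff n (connSeriesNeg H) =
    (-1) ^ n * PowerSeries.coeff n (connSeries H) := PowerSeries.coeff_rescale ..

theorem constantCoeff_connSeriesNeg : PowerSeries.constantCoeff (connSeriesNeg H) = 1 := by
  rw [← PowerSeries.coeff_zero_eq_constantCoeff_apply, coeff_connSeriesNeg,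
    PowerSeries.coeff_zero_eq_constantCoeff_apply, connSeries, PowerSeries.constantCoeff_odeSol,
    pow_zero, mul_one]

theorem boldOmega_eq (N : ℕ) : boldOmega (fun n => PowerSeries.coeff n (connSeries H)) N =
    toSymPow _ N (omPoly k (x g₂ g₃) (connSeriesNeg H) N) ⊗ₜ omega g₂ g₃ := by
  have h (a : CoordRing g₂ g₃) (m n : ℕ) : toSymPow _ N (C a * wPoly k _ N m n) =
      a • wBasis k (CoordRing g₂ g₃) N m n := by
    rw [← MvPolynomial.smul_eq_C_mul, map_smul]; rfl
  rw [boldOmega, omPoly, map_sub, map_sum, h, TensorProduct.sub_tmul, TensorProduct.sum_tmul, eta,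
    TensorProduct.tmul_smul, TensorProduct.smul_tmul']
  congr 1
  refine Finset.sum_congr rfl fun n _ => ?_
  rw [h, coeff_connSeriesNeg, TensorProduct.smul_tmul']

theorem boldEta_eq (N : ℕ) : boldEta (fun n => PowerSeries.coeff n (connSeries H)) N =
    toSymPow _ N (etPoly k (connSeriesNeg H) N) ⊗ₜ omega g₂ g₃ := by
  have h (a : CoordRing g₂ g₃) (m n : ℕ) : toSymPow _ N (C a * wPoly k _ N m n) =
      a • wBasis k (CoordRing g₂ g₃) N m n := by
    rw [← MvPolynomial.smul_eq_C_mul, map_smul]; rfl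
  rw [boldEta, etPoly, map_neg, map_sum, TensorProduct.neg_tmul, TensorProduct.sum_tmul]
  congr 1
  refine Finset.sum_congr rfl fun n _ => ?_
  rw [h, coeff_connSeriesNeg, TensorProduct.smul_tmul']

theorem logRegularAt_iff {f : FunField g₂ g₃} {P : Pt g₂ g₃} {s : RatLog g₂ g₃} :
    LogRegularAt f P s ↔ shift 0 (-f) s ∈ polyIn (localRing H P) := by
  rw [LogRegularAt, toChart_eq_shift]; rfl

/-- The substitution w ↦ −w. It turns the residue 1 at n = 1 into −1, which the signs in the
definitions of the two forms compensate. -/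
theorem coeff_exp_mul_connSeriesNeg (f : FunField g₂ g₃) (n : ℕ) :
    PowerSeries.coeff n (PowerSeries.expS k (-f) *
      PowerSeries.map (algebraMap (CoordRing g₂ g₃) (FunField g₂ g₃)) (connSeriesNeg H)) =
    (-1) ^ n * PowerSeries.coeff n (PowerSeries.expS k f *
      PowerSeries.map (algebraMap (CoordRing g₂ g₃) (FunField g₂ g₃)) (connSeries H)) := by
  rw [← PowerSeries.coeff_rescale, RingHom.map_mul, PowerSeries.rescale_expS, neg_one_mul]
  congr 2
  ext1 n
  rw [PowerSeries.coeff_map, coeff_connSeriesNeg, PowerSeries.coeff_rescale, PowerSeries.coeff_map,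
    map_mul, map_pow, map_neg, map_one]

theorem residue_coeff_exp_mul {f : FunField g₂ g₃} (hf : OrdGE 1 (laurent H f - zetaHat L)) (n : ℕ) :
    OrdGE (-1) (laurent H (PowerSeries.coeff n (PowerSeries.expS k (-f) *
      PowerSeries.map (algebraMap (CoordRing g₂ g₃) (FunField g₂ g₃)) (connSeriesNeg H)))) ∧
    (laurent H (PowerSeries.coeff n (PowerSeries.expS k (-f) *
      PowerSeries.map (algebraMap (CoordRing g₂ g₃) (FunField g₂ g₃)) (connSeriesNeg H)))).coeff (-1)
        = if n = 1 then -1 else 0 := by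
  obtain ⟨h1, h2⟩ := coeff_map_expS_mul H hf n
  have e : laurent H (PowerSeries.coeff n (PowerSeries.expS k (-f) *
      PowerSeries.map (algebraMap (CoordRing g₂ g₃) (FunField g₂ g₃)) (connSeriesNeg H))) =
      HahnSeries.C ((-1) ^ n) * laurent H (PowerSeries.coeff n (PowerSeries.expS k f *
      PowerSeries.map (algebraMap (CoordRing g₂ g₃) (FunField g₂ g₃)) (connSeries H))) := by
    rw [coeff_exp_mul_connSeriesNeg, map_mul]
    simp only [map_pow, map_neg, map_one]
  have h3 := coeff_mul_of_ordGE (ordGE_C ((-1) ^ n)) h1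
  rw [zero_add, HahnSeries.C_apply, HahnSeries.coeff_single_same, h2] at h3
  rw [e]
  refine ⟨by simpa using (ordGE_C ((-1) ^ n)).mul h1, h3.trans ?_⟩
  split_ifs with h
  · rw [h]; norm_num
  · rw [mul_zero]

/-- The rational function `f` has at most a simple pole at `[0]`, with residue `c`. -/
def SimplePole (c : ℂ) (f : FunField g₂ g₃) : Prop :=
  OrdGE (-1) (laurent H f) ∧ (laurent H f).coeff (-1) = c

variable {H}

theorem SimplePole.add {c c' : ℂ} {f f' : FunField g₂ g₃} (h : SimplePole H c f)
    (h' : SimplePole H c' f') : SimplePole H (c + c') (f + f') := by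
  rw [SimplePole, map_add, HahnSeries.coeff_add, h.2, h'.2]
  exact ⟨h.1.add h'.1, rfl⟩

theorem SimplePole.mul_const {c : ℂ} {f : FunField g₂ g₃} (h : SimplePole H c f) (a : k) :
    SimplePole H (c * algebraMap k ℂ a) (f * algebraMap k _ a) := by
  rw [SimplePole, map_mul, laurent_const]
  have h3 := coeff_mul_of_ordGE h.1 (ordGE_C (algebraMap k ℂ a))
  rw [add_zero, HahnSeries.C_apply, HahnSeries.coeff_single_same, h.2] at h3
  exact ⟨by simpa using h.1.mul (ordGE_C (algebraMap k ℂ a)), h3⟩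

theorem SimplePole.neg {c : ℂ} {f : FunField g₂ g₃} (h : SimplePole H c f) :
    SimplePole H (-c) (-f) := by
  rw [SimplePole, map_neg, HahnSeries.coeff_neg, h.2]
  exact ⟨h.1.neg, rfl⟩

theorem simplePole_zero : SimplePole H 0 (0 : FunField g₂ g₃) := by
  rw [SimplePole, map_zero]; exact ⟨ordGE_zero _, rfl⟩

theorem SimplePole.sum {ι : Type*} {s : Finset ι} {c : ι → ℂ} {f : ι → FunField g₂ g₃}
    (h : ∀ i ∈ s, SimplePole H (c i) (f i)) : SimplePole H (∑ i ∈ s, c i) (∑ i ∈ s, f i) := by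
  classical
  induction s using Finset.induction_on with
  | empty => exact simplePole_zero
  | insert i s hi ih =>
    rw [Finset.sum_insert hi, Finset.sum_insert hi]
    exact (h i (Finset.mem_insert_self _ _)).add
      (ih fun j hj => h j (Finset.mem_insert_of_mem hj))

theorem SimplePole.coeff_C_mul_wPoly {c : ℂ} {f : FunField g₂ g₃} (h : SimplePole H c f)
    (N m n : ℕ) (s : Fin 3 →₀ ℕ) :
    SimplePole H (c * algebraMap k ℂ ((wPoly k k N m n).coeff s))
      ((C f * wPoly k (FunField g₂ g₃) N m n).coeff s) := by
  have e : (wPoly k (FunField g₂ g₃) N m n).coeff s =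
      algebraMap k _ ((wPoly k k N m n).coeff s) := by
    rw [← map_wPoly, coeff_map]
  rw [coeff_C_mul, e]
  exact h.mul_const _

theorem simplePole_etPoly {c : PowerSeries (FunField g₂ g₃)}
    (hc : ∀ n, SimplePole H (if n = 1 then -1 else 0) (PowerSeries.coeff n c)) (N : ℕ)
    (s : Fin 3 →₀ ℕ) : SimplePole H (algebraMap k ℂ ((ofSymPow k N (wBasis k k N 0 1)).coeff s))
      ((etPoly k c N).coeff s) := by
  rw [etPoly, coeff_neg, coeff_sum]
  convert (SimplePole.sum (s := Finset.range (N + 1)) fun n _ =>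
    (hc n).coeff_C_mul_wPoly N 0 n s).neg using 1
  simp only [ite_mul, zero_mul, neg_mul, one_mul, Finset.sum_ite_eq', Finset.mem_range]
  split_ifs with h
  · rw [ofSymPow_wBasis k (by omega), neg_neg]
  -- For N = 0 the index n = 1 does not occur in the sum, and the expected residue is 0 as well.
  · rw [wBasis_eq_zero k (by omega), map_zero, coeff_zero, map_zero, neg_zero]

theorem simplePole_omPoly {a : FunField g₂ g₃} (ha : OrdGE 0 (laurent H a))
    {c : PowerSeries (FunField g₂ g₃)}
    (hc : ∀ n, SimplePole H (if n = 1 then -1 else 0) (PowerSeries.coeff n c)) (N : ℕ)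
    (s : Fin 3 →₀ ℕ) : SimplePole H (algebraMap k ℂ ((ofSymPow k N (wBasis k k N 1 0)).coeff s))
      ((omPoly k a c N).coeff s) := by
  have ha' : SimplePole H 0 a := ⟨ha.mono (by norm_num), ha _ (by norm_num)⟩
  rw [omPoly, coeff_sub, coeff_sum, sub_eq_add_neg]
  convert (ha'.coeff_C_mul_wPoly N 0 0 s).add (SimplePole.sum (s := Finset.Icc 1 N) fun n _ =>
    (hc n).coeff_C_mul_wPoly N 1 (n - 1) s).neg using 1
  simp only [ite_mul, zero_mul, neg_mul, one_mul, Finset.sum_ite_eq', Finset.mem_Icc]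
  split_ifs with h
  · rw [ofSymPow_wBasis k (by omega), neg_neg, zero_add]
  · rw [wBasis_eq_zero k (by omega), map_zero, coeff_zero, map_zero, neg_zero, add_zero]

variable (H)

theorem eta_add_du (f : FunField g₂ g₃) : ratForm (eta g₂ g₃) + dRat k f =
    (algebraMap (CoordRing g₂ g₃) _ (x g₂ g₃) + dK H f) • omegaK g₂ g₃ := by
  rw [eta_eq, dRat, Derivation.coeFn_coe, (formGen_omegaK H).D_eq, add_smul]

theorem coeff_exp_mul_mem {f : FunField g₂ g₃} {P : Pt g₂ g₃} (hP : P ≠ none)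
    (hf : RegularAt P f) (n : ℕ) : PowerSeries.coeff n (PowerSeries.expS k (-f) *
      PowerSeries.map (algebraMap (CoordRing g₂ g₃) (FunField g₂ g₃)) (connSeriesNeg H)) ∈
        localRing H P := by
  obtain ⟨m, rfl⟩ := Option.ne_none_iff_exists'.mp hP
  refine coeff_expS_mem (neg_mem hf) (fun n => ?_) n
  rw [PowerSeries.coeff_map]
  exact regularAt_some_algebraMap m _

theorem ratMap_omPoly (N : ℕ) :
    ratMap g₂ g₃ (ofSymPow _ N (toSymPow _ N (omPoly k (x g₂ g₃) (connSeriesNeg H) N))) =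
      omPoly k (algebraMap _ _ (x g₂ g₃)) (PowerSeries.map (algebraMap _ _) (connSeriesNeg H)) N := by
  rw [ofSymPow_toSymPow_of_isHomogeneous (isHomogeneous_omPoly k _ _ N), ratMap, map_omPoly]

theorem ratMap_etPoly (N : ℕ) :
    ratMap g₂ g₃ (ofSymPow _ N (toSymPow _ N (etPoly k (connSeriesNeg H) N))) =
      etPoly k (PowerSeries.map (algebraMap _ _) (connSeriesNeg H)) N := by
  rw [ofSymPow_toSymPow_of_isHomogeneous (isHomogeneous_etPoly k _ N), ratMap, map_etPoly]

/-- No correction is needed. In the frame e_i the coefficients are those of exp(−u_i w) ∑ (−1)ⁿ L_n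
wⁿ, regular on U wherever u_i is, and with simple poles at [0]. -/
theorem hasResidue_boldEta (N : ℕ) : HasResidue 𝔘 N
    (omegaClass g₂ g₃ N (toSymPow _ N (etPoly k (connSeriesNeg H) N))) (wBasis k k N 0 1) := by
  refine (hasResidue_iff H 𝔘 N _ _).mpr ⟨_, 0, rfl, fun _ => isHomogeneous_zero _ _ _, ?_, ?_, ?_, ?_⟩
  · intro i P _ _
    rw [logRegularAt_iff H, Pi.zero_apply, map_zero]
    exact zero_mem _
  · intro i j P _ _
    rw [logRegularAt_iff H, Pi.zero_apply, Pi.zero_apply, sub_zero, map_zero]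
    exact zero_mem _
  · intro i P hP hn
    rw [logRegularAt_iff H, Pi.zero_apply, map_zero, add_zero, ratMap_etPoly, shift_etPoly]
    exact etPoly_mem_polyIn (coeff_exp_mul_mem H hn (𝔘.u_regular i P hP hn)) N
  · intro i hi s
    rw [Pi.zero_apply, map_zero, add_zero, ratMap_etPoly, toChart_eq_shift, shift_etPoly]
    exact simplePole_etPoly
      (residue_coeff_exp_mul H (ordGE_one_of_normalized H (𝔘.normalized i hi))) N s

/-- Since η has a double pole at [0], a Čech correction is unavoidable. Adding ∇(α_i) replaces η by
the regular form η_i, and the rest is as for the other form. -/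
theorem hasResidue_boldOmega (N : ℕ) : HasResidue 𝔘 N
    (omegaClass g₂ g₃ N (toSymPow _ N (omPoly k (x g₂ g₃) (connSeriesNeg H) N)))
      (wBasis k k N 1 0) := by
  choose α hα hα' using fun i => exists_X_two_mul_eq k (𝔘.u i) N
  have hc : PowerSeries.constantCoeff (PowerSeries.map
      (algebraMap (CoordRing g₂ g₃) (FunField g₂ g₃)) (connSeriesNeg H)) = 1 := by
    rw [PowerSeries.constantCoeff_map, constantCoeff_connSeriesNeg, map_one]
  have hs (f g : FunField g₂ g₃) : shift 0 (-f) (X 0 + C g * X 2) = X 0 + C (g - f) * X 2 := by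
    rw [map_add, map_mul, shift_X_zero, shift_C, shift_X_two, map_neg, map_zero, map_sub]; ring
  have hs0 (f : FunField g₂ g₃) : shift 0 (-f) (X 0) = X 0 + C (-f) * X 2 := by
    rw [shift_X_zero, map_zero]; ring
  have hmem {P : Pt g₂ g₃} {g : FunField g₂ g₃} (hg : RegularAt P g) :
      dp k (N + 1) (X 0 + C g * X 2) ∈ polyIn (localRing H P) :=
    dp_mem_polyIn (add_mem (X_mem_polyIn 0) (mul_mem (C_mem_polyIn hg) (X_mem_polyIn 2))) _
  have hmem0 {P : Pt g₂ g₃} : dp k (N + 1) (X 0) ∈ polyIn (localRing H P) :=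
    dp_mem_polyIn (X_mem_polyIn 0) _
  refine (hasResidue_iff H 𝔘 N _ _).mpr ⟨_, α, rfl, hα, ?_, ?_, ?_, ?_⟩
  · intro i P hP hn
    rw [logRegularAt_iff H]
    -- Only X₂ α is explicit. Multiplication by a variable merely moves coefficients, so regularity
    -- can be tested on the product.
    refine mem_polyIn_of_X_two_mul ?_
    rw [← shift_X_two 0 (-𝔘.u i), ← map_mul, hα', map_sub, shift_dp, shift_dp, hs, hs0, sub_self,
      map_zero, zero_mul, add_zero]
    exact sub_mem hmem0 (hmem (neg_mem (s := localRing H P) (𝔘.u_regular i P hP hn)))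
  · intro i j P hi hj
    rw [logRegularAt_iff H]
    -- In the chart i, the polynomial X₂(α_j − α_i) involves only u_j − u_i, which is regular on the
    -- intersection.
    refine mem_polyIn_of_X_two_mul ?_
    rw [← shift_X_two 0 (-𝔘.u i), ← map_mul, mul_sub, hα', hα', sub_sub_sub_cancel_right, map_sub,
      shift_dp, shift_dp, hs, hs, sub_self, map_zero, zero_mul, add_zero]
    exact sub_mem (hmem (𝔘.u_sub_regular i j P hi hj)) hmem0
  · intro i P hP hn
    rw [logRegularAt_iff H, ratMap_omPoly, shift_omPoly_add_nabla k _ _ _ hc N (hα' i)]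
    have h := 𝔘.eta_regular i P hP
    rw [eta_add_du H, smul_mem_stalkForm_iff H] at h
    exact omPoly_mem_polyIn (S := localRing H P) h
      (coeff_exp_mul_mem H hn (𝔘.u_regular i P hP hn)) N
  · intro i hi s
    rw [toChart_eq_shift, ratMap_omPoly, shift_omPoly_add_nabla k _ _ _ hc N (hα' i)]
    have h := 𝔘.eta_regular i none hi
    rw [eta_add_du H, smul_mem_stalkForm_iff H, regularAt_none_iff H] at h
    exact simplePole_omPoly h
      (residue_coeff_exp_mul H (ordGE_one_of_normalized H (𝔘.normalized i hi))) N s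

variable {𝔘}

include H in
theorem HasResidue.add {N : ℕ} {c c' : H1Log g₂ g₃ N} {r r' : SymPow k N}
    (h : HasResidue 𝔘 N c r) (h' : HasResidue 𝔘 N c' r') : HasResidue 𝔘 N (c + c') (r + r') := by
  rw [hasResidue_iff H] at *
  obtain ⟨p, α, h1, h2, h3, h4, h5, h6⟩ := h
  obtain ⟨p', α', h1', h2', h3', h4', h5', h6'⟩ := h'
  simp only [logRegularAt_iff H] at *
  have e (i) : ratMap g₂ g₃ (ofSymPow _ N (p + p')) + nablaK H ((α + α') i) =
      (ratMap g₂ g₃ (ofSymPow _ N p) + nablaK H (α i)) +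
        (ratMap g₂ g₃ (ofSymPow _ N p') + nablaK H (α' i)) := by
    rw [Pi.add_apply, map_add, map_add, map_add]; ring
  refine ⟨p + p', α + α', by rw [map_add, h1, h1'], fun i => (h2 i).add (h2' i), ?_, ?_, ?_, ?_⟩
  · intro i P hP hn
    rw [Pi.add_apply, map_add]
    exact add_mem (h3 i P hP hn) (h3' i P hP hn)
  · intro i j P hi hj
    rw [Pi.add_apply, Pi.add_apply, add_sub_add_comm, map_add]
    exact add_mem (h4 i j P hi hj) (h4' i j P hi hj)
  · intro i P hP hn
    rw [e, map_add]
    exact add_mem (h5 i P hP hn) (h5' i P hP hn)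
  · intro i hi m
    have hr : (ofSymPow k N (r + r')).coeff m =
      (ofSymPow k N r).coeff m + (ofSymPow k N r').coeff m := by rw [map_add, coeff_add]
    rw [e, map_add (toChart _), coeff_add, hr, map_add (algebraMap k ℂ)]
    exact SimplePole.add (H := H) (h6 i hi m) (h6' i hi m)

include H in
theorem HasResidue.smul {N : ℕ} {c : H1Log g₂ g₃ N} {r : SymPow k N} (a : k)
    (h : HasResidue 𝔘 N c r) : HasResidue 𝔘 N (a • c) (a • r) := by
  rw [hasResidue_iff H] at *
  obtain ⟨p, α, h1, h2, h3, h4, h5, h6⟩ := h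
  simp only [logRegularAt_iff H] at *
  set a' : FunField g₂ g₃ := algebraMap k _ a with ha'
  have hsm (q : RatLog g₂ g₃) : a • q = C a' * q := by
    rw [ha', ← MvPolynomial.smul_eq_C_mul, algebraMap_smul]
  have hmem {P : Pt g₂ g₃} {q : RatLog g₂ g₃} {f : FunField g₂ g₃}
      (hq : shift 0 f q ∈ polyIn (localRing H P)) : shift 0 f (a • q) ∈ polyIn (localRing H P) := by
    rw [hsm, map_mul, shift_C]
    exact mul_mem (C_mem_polyIn (regularAt_algebraMap H P a)) hq
  have e (i) : ratMap g₂ g₃ (ofSymPow _ N (a • p)) + nablaK H ((a • α) i) =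
      a • (ratMap g₂ g₃ (ofSymPow _ N p) + nablaK H (α i)) := by
    have h1 : ofSymPow (CoordRing g₂ g₃) N (a • p) = C (algebraMap k _ a) * ofSymPow _ N p := by
      rw [← MvPolynomial.smul_eq_C_mul, algebraMap_smul]
      exact LinearMap.map_smul_of_tower _ _ _
    rw [Pi.smul_apply, Derivation.map_smul, smul_add, h1, map_mul, hsm, hsm, ratMap, map_C,
      ← IsScalarTower.algebraMap_apply]
  refine ⟨a • p, a • α, by rw [map_smul, h1], fun i => ?_, ?_, ?_, ?_, ?_⟩
  · rw [Pi.smul_apply, hsm]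
    exact isHomogeneous_C_mul _ (h2 i)
  · intro i P hP hn
    exact hmem (h3 i P hP hn)
  · intro i j P hi hj
    rw [Pi.smul_apply, Pi.smul_apply, ← smul_sub]
    exact hmem (h4 i j P hi hj)
  · intro i P hP hn
    rw [e]
    exact hmem (h5 i P hP hn)
  · intro i hi m
    have hr : (ofSymPow k N (a • r)).coeff m = (ofSymPow k N r).coeff m * a := by
      rw [map_smul, coeff_smul, smul_eq_mul, mul_comm]
    rw [e, hsm, map_mul (toChart _), toChart_eq_shift, shift_C, coeff_C_mul, mul_comm, hr,
      map_mul (algebraMap k ℂ)]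
    have h := h6 i hi m
    rw [toChart_eq_shift] at h
    exact SimplePole.mul_const (H := H) h a

/-- Some chart contains [0], and there the residue is `resR` of the representative in the cocycle.
Another representative of the class differs by an exact form, which `resR` kills. So the residue is
a function of the class. -/
theorem HasResidue.resR_eq {N : ℕ} {p : LogU g₂ g₃ N} {r : SymPow k N}
    (h : HasResidue 𝔘 N (omegaClass g₂ g₃ N p) r) (s : Fin 3 →₀ ℕ) :
    resR H s (ofSymPow _ N p) = algebraMap k ℂ ((ofSymPow k N r).coeff s) := by
  obtain ⟨q, α, h1, -, -, -, -, h6⟩ := (hasResidue_iff H 𝔘 N _ _).mp h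
  obtain ⟨i, hi⟩ := 𝔘.covers none
  have hq := resR_eq_of_chart H (ordGE_one_of_normalized H (𝔘.normalized i hi))
    (ofSymPow _ N q) (α i) (h6 i hi) s
  rw [← hq]
  rw [omegaClass_apply, omegaClass_apply, Submodule.Quotient.eq, ← TensorProduct.sub_tmul] at h1
  obtain ⟨t, ht⟩ := h1
  have e : symPowConn (omega g₂ g₃) (eta g₂ g₃) N t =
      toSymPow _ N (nablaR H (ofSymPow _ N t)) ⊗ₜ omega g₂ g₃ := by
    change (toSymPow _ N).rTensor _ (symConn _ _ (ofSymPow _ N t)) = _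
    rw [eta, (formGen_omega H).symConn_eq, LinearMap.rTensor_tmul]
  have e2 := (formGen_omega H).tmul_injective (e.symm.trans ht)
  have e3 := congrArg (ofSymPow _ N) e2
  rw [ofSymPow_toSymPow_of_isHomogeneous (isHomogeneous_nabla _ _ (isHomogeneous_ofSymPow t)),
    map_sub] at e3
  have := congrArg (resR H s) e3
  rw [resR_nablaR, map_sub, eq_comm, sub_eq_zero] at this
  exact this.symm

include H in
theorem HasResidue.unique {N : ℕ} {c : H1Log g₂ g₃ N} {r r' : SymPow k N}
    (h : HasResidue 𝔘 N c r) (h' : HasResidue 𝔘 N c r') : r = r' := by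
  obtain ⟨p, -, rfl, -⟩ := (hasResidue_iff H 𝔘 N _ _).mp h
  refine ofSymPow_injective N (MvPolynomial.ext _ _ fun s => (algebraMap k ℂ).injective ?_)
  rw [← h.resR_eq H, ← h'.resR_eq H]

end EllPolylog

namespace EllPolylog

open MvPolynomial LaurentSeries

/-! ### The degree in the first variable -/

section LowX

variable {A : Type*} [CommRing A]

/-- The degree of `p` in the variable `X 0` is less than `c`. -/
def LowX (c : ℕ) (p : SymAlg3 A) : Prop := ∀ m : Fin 3 →₀ ℕ, c ≤ m 0 → p.coeff m = 0

variable {c d : ℕ} {p q : SymAlg3 A}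

theorem LowX.mono (h : LowX c p) (hcd : c ≤ d) : LowX d p := fun m hm => h m (hcd.trans hm)

theorem LowX.add (hp : LowX c p) (hq : LowX c q) : LowX c (p + q) := fun m hm => by
  rw [coeff_add, hp m hm, hq m hm, add_zero]

theorem LowX.neg (hp : LowX c p) : LowX c (-p) := fun m hm => by
  rw [coeff_neg, hp m hm, neg_zero]

theorem LowX.sub (hp : LowX c p) (hq : LowX c q) : LowX c (p - q) := by
  rw [sub_eq_add_neg]; exact hp.add hq.neg

theorem LowX.sum {ι : Type*} {s : Finset ι} {f : ι → SymAlg3 A} (h : ∀ i ∈ s, LowX c (f i)) :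
    LowX c (∑ i ∈ s, f i) := fun m hm => by
  rw [coeff_sum]; exact Finset.sum_eq_zero fun i hi => h i hi m hm

/-- The bounds are strict: degree at most c − 1 times degree at most d has degree at most c + d − 1.
-/
theorem LowX.mul (hp : LowX c p) (hq : LowX (d + 1) q) : LowX (c + d) (p * q) := fun m hm => by
  classical
  rw [coeff_mul]
  refine Finset.sum_eq_zero fun uv huv => ?_
  have e : uv.1 0 + uv.2 0 = m 0 := by rw [← Finset.HasAntidiagonal.mem_antidiagonal.mp huv]; rfl
  by_cases h : c ≤ uv.1 0
  · rw [hp _ h, zero_mul]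
  · rw [hq _ (by omega), mul_zero]

theorem LowX.mul_one (hp : LowX c p) (hq : LowX 1 q) : LowX c (p * q) := hp.mul hq

theorem lowX_monomial {m : Fin 3 →₀ ℕ} (h : m 0 < c) (a : A) : LowX c (monomial m a) :=
  fun n hn => by
    classical
    rw [coeff_monomial, if_neg]
    rintro rfl
    omega

theorem lowX_C (a : A) : LowX 1 (C a : SymAlg3 A) := lowX_monomial (by simp) a

theorem lowX_X {i : Fin 3} (hi : i ≠ 0) : LowX 1 (X i : SymAlg3 A) :=
  lowX_monomial (by simp [hi]) 1

theorem lowX_X_zero : LowX 2 (X 0 : SymAlg3 A) := lowX_monomial (by simp) 1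

theorem lowX_X_zero_pow (n : ℕ) : LowX (n + 1) (X 0 ^ n : SymAlg3 A) := by
  induction n with
  | zero => rw [pow_zero, ← map_one C]; exact lowX_C 1
  | succ n ih => rw [pow_succ]; exact ih.mul lowX_X_zero

theorem LowX.pderiv (hp : LowX (c + 1) p) : LowX c (pderiv 0 p) := fun m hm => by
  rw [coeff_pderiv, hp _ (by simpa using hm), zero_mul]

theorem LowX.pderiv_eq_zero (hp : LowX 1 p) : MvPolynomial.pderiv 0 p = 0 :=
  MvPolynomial.ext _ _ fun m => hp.pderiv m (Nat.zero_le _)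

theorem LowX.map {A' : Type*} [CommRing A'] (f : A →+* A') (hp : LowX c p) :
    LowX c (MvPolynomial.map f p) := fun m hm => by rw [coeff_map, hp m hm, map_zero]

theorem lowX_direction (a b : A) : LowX 1 (C a * X 1 + C b * X 2 : SymAlg3 A) :=
  ((lowX_C a).mul (lowX_X (by decide))).add ((lowX_C b).mul (lowX_X (by decide)))

theorem lowX_shift_X_zero_pow (a b : A) (n : ℕ) : LowX n (shift a b (X 0 ^ (n + 1)) - X 0 ^ (n + 1) -
    (C a * X 1 + C b * X 2) * pderiv 0 (X 0 ^ (n + 1))) := by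
  have hd (n : ℕ) : pderiv 0 (X 0 ^ (n + 1) : SymAlg3 A) = C (n + 1 : A) * X 0 ^ n := by
    rw [pderiv_pow, pderiv_X_self, mul_one, Nat.add_sub_cancel]
    push_cast
    rw [map_add, map_natCast, map_one]
  induction n with
  | zero =>
    rw [zero_add, pow_one, shift_X_zero, pderiv_X_self, mul_one, add_assoc, add_sub_cancel_left,
      sub_self]
    exact fun m _ => coeff_zero m
  | succ n ih =>
    rw [hd] at ih ⊢
    have e : shift a b (X 0 ^ (n + 1 + 1)) - X 0 ^ (n + 1 + 1) -
        (C a * X 1 + C b * X 2) * (C ((n + 1 : ℕ) + 1 : A) * X 0 ^ (n + 1)) =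
        (shift a b (X 0 ^ (n + 1)) - X 0 ^ (n + 1) -
          (C a * X 1 + C b * X 2) * (C (n + 1 : A) * X 0 ^ n)) * X 0 +
        (shift a b (X 0 ^ (n + 1)) - X 0 ^ (n + 1) -
          (C a * X 1 + C b * X 2) * (C (n + 1 : A) * X 0 ^ n)) * (C a * X 1 + C b * X 2) +
        C (n + 1 : A) * X 0 ^ n * (C a * X 1 + C b * X 2) * (C a * X 1 + C b * X 2) := by
      rw [map_pow, map_pow, shift_X_zero]
      push_cast
      simp only [map_add, map_one, map_natCast]
      ring
    rw [e]
    refine ((ih.mul lowX_X_zero).add ((ih.mul (lowX_direction a b)).mono (by omega))).add ?_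
    have h1 : LowX (n + 1) (C (n + 1 : A) * X 0 ^ n : SymAlg3 A) := by
      rw [mul_comm]; exact (lowX_X_zero_pow n).mul (lowX_C _)
    exact (h1.mul (lowX_direction a b)).mul (lowX_direction a b)

/-- Taylor's formula in X₀. Each factor aX₁ + bX₂ replaces one X₀, so the terms beyond first order
lose at least two degrees. -/
theorem LowX.shift_sub (a b : A) (hp : LowX (c + 2) p) :
    LowX c (shift a b p - p - (C a * X 1 + C b * X 2) * MvPolynomial.pderiv 0 p) := by
  have e : shift a b p - p - (C a * X 1 + C b * X 2) * MvPolynomial.pderiv 0 p =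
      ∑ m ∈ p.support, (shift a b (monomial m (p.coeff m)) - monomial m (p.coeff m) -
        (C a * X 1 + C b * X 2) * MvPolynomial.pderiv 0 (monomial m (p.coeff m))) := by
    rw [Finset.sum_sub_distrib, Finset.sum_sub_distrib, ← Finset.mul_sum, ← map_sum, ← map_sum,
      ← as_sum p]
  rw [e]
  refine LowX.sum fun m hm => ?_
  have hmc : m 0 < c + 2 := by
    by_contra h
    exact mem_support_iff.mp hm (hp m (by omega))
  set q : SymAlg3 A := C (p.coeff m) * (X 1 ^ m 1 * X 2 ^ m 2) with hq
  have em : monomial m (p.coeff m) = X 0 ^ m 0 * q := by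
    rw [monomial_eq, Finsupp.prod_fintype _ _ fun _ => pow_zero _, Fin.prod_univ_three, hq]
    ring
  have h1 : shift a b q = q := by
    rw [hq, map_mul, map_mul, map_pow, map_pow, shift_C, shift_X_one, shift_X_two]
  have h2 : MvPolynomial.pderiv 0 q = 0 := by
    rw [hq, pderiv_mul, pderiv_mul, pderiv_pow, pderiv_pow, pderiv_C, pderiv_X_of_ne (by decide),
      pderiv_X_of_ne (by decide)]
    ring
  have hX (i : Fin 3) (hi : i ≠ 0) (n : ℕ) : LowX 1 (X i ^ n : SymAlg3 A) := by
    induction n with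
    | zero => rw [pow_zero, ← map_one C]; exact lowX_C 1
    | succ n ih => rw [pow_succ]; exact ih.mul (lowX_X hi)
  have h3 : LowX 1 q := (lowX_C _).mul_one ((hX 1 (by decide) _).mul_one (hX 2 (by decide) _))
  clear_value q
  rw [em, map_mul, h1, pderiv_mul, h2, mul_zero, add_zero, ← mul_assoc, ← sub_mul, ← sub_mul]
  rcases h : m 0 with _ | n
  · rw [pow_zero, map_one, sub_self, pderiv_one, mul_zero, sub_zero, zero_mul]
    exact fun m _ => coeff_zero m
  · exact ((lowX_shift_X_zero_pow a b n).mono (by omega)).mul h3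

/-- Differentiating the coefficients preserves the degree in e, and the other part of ∇ lowers it by
one. -/
theorem lowX_nabla_sub {k : Type*} [CommRing k] [Algebra k A] (δ : Derivation k A A) (a : A)
    (hp : LowX (c + 1) p) : LowX c (nabla δ a p - coeffDer δ p) := by
  rw [nabla_apply, add_sub_cancel_left, mul_comm]
  refine hp.pderiv.mul (d := 0) ((lowX_X (by decide)).add ?_)
  exact (lowX_C a).mul (lowX_X (by decide))

theorem LowX.coeffDer {k : Type*} [CommRing k] [Algebra k A] (δ : Derivation k A A)
    (hp : LowX c p) : LowX c (coeffDer δ p) := fun m hm => by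
  rw [coeff_coeffDer, hp m hm, map_zero]

/-- The first two hypotheses are Euler's relation in X₀ for degree c + 1. As X₂ is prime and does
not divide X₁, it divides ∂q; writing ∂q = X₂ r gives ∂p = X₁ r. Integrating r twice, t = X₀² r /
((c+1)(c+2)) works. -/
theorem exists_pderiv_eq {k : Type*} [Field k] [CharZero k] {p q : SymAlg3 k} (c : ℕ)
    (hp : X 0 * MvPolynomial.pderiv 0 p = C (c + 1 : k) * p)
    (hq : X 0 * MvPolynomial.pderiv 0 q = C (c + 1 : k) * q)
    (h : X 1 * MvPolynomial.pderiv 0 q = X 2 * MvPolynomial.pderiv 0 p) :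
    ∃ t, p = X 1 * MvPolynomial.pderiv 0 t ∧ q = X 2 * MvPolynomial.pderiv 0 t := by
  obtain ⟨r, hr⟩ : X 2 ∣ MvPolynomial.pderiv 0 q := by
    refine (X_prime.dvd_mul.mp (Dvd.intro _ h.symm)).resolve_left fun h => ?_
    rw [X_dvd_X] at h
    exact absurd h (by decide)
  have hr' : MvPolynomial.pderiv 0 p = X 1 * r := by
    refine X_two_mul_cancel ?_
    rw [← h, hr]; ring
  have key {p : SymAlg3 k} {i : Fin 3} (hi : i ≠ 0)
      (hp : X 0 * MvPolynomial.pderiv 0 p = C (c + 1 : k) * p)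
      (hr : MvPolynomial.pderiv 0 p = X i * r) :
      p = X i * MvPolynomial.pderiv 0 (C ((c + 1 : k) * (c + 2))⁻¹ * (X 0 ^ 2 * r)) := by
    have e : X i * MvPolynomial.pderiv 0 (X 0 ^ 2 * r) =
        MvPolynomial.pderiv 0 (C (c + 1 : k) * (X 0 * p)) := by
      have : C (c + 1 : k) * (X 0 * p) = X i * (X 0 ^ 2 * r) := by
        linear_combination (-X 0) * hp + X 0 ^ 2 * hr
      rw [this, pderiv_mul (f := X i), pderiv_X_of_ne hi, zero_mul, zero_add]
    have h0 : ((c + 1 : k) * (c + 2)) ≠ 0 := by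
      have h1 : (c + 1 : k) ≠ 0 := by exact_mod_cast c.succ_ne_zero
      have h2 : (c + 2 : k) ≠ 0 := by exact_mod_cast (c + 1).succ_ne_zero
      exact mul_ne_zero h1 h2
    rw [pderiv_C_mul, mul_left_comm, e, pderiv_C_mul, pderiv_mul, pderiv_X_self, one_mul, hp]
    have : (C (c + 1 : k) * (p + C (c + 1 : k) * p) : SymAlg3 k) = C ((c + 1 : k) * (c + 2)) * p := by
      simp only [map_mul, map_add, map_one, map_natCast, map_ofNat]; ring
    rw [this, ← mul_assoc, ← C_mul, inv_mul_cancel₀ h0, map_one, _root_.one_mul]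
  exact ⟨_, key (by decide) hp hr', key (by decide) hq hr⟩

end LowX

/-! ### Residues at `[0]` of functions on `U` -/

variable {k : Type u} [Field k] [CharZero k] [Algebra k ℂ] {g₂ g₃ : k} {L : PeriodPair}
  (H : Uniformizes L g₂ g₃)

/-- The functions which differ from `a + b x` by a derivative. -/
def reducible : Submodule k (CoordRing g₂ g₃) :=
  Submodule.span k {1, x g₂ g₃} ⊔ LinearMap.range (dR H).toLinearMap

theorem dR_mem_reducible (r : CoordRing g₂ g₃) : dR H r ∈ reducible H :=
  Submodule.mem_sup_right ⟨r, rfl⟩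

/-- The derivative of xⁿy is (4n + 6) x^{n+2} plus lower powers of x, and 4n + 6 ≠ 0. -/
theorem x_pow_mem_reducible (n : ℕ) : x g₂ g₃ ^ n ∈ reducible H := by
  induction n using Nat.strong_induction_on with
  | _ n ih =>
    match n with
    | 0 => exact Submodule.mem_sup_left (Submodule.subset_span (by simp))
    | 1 => exact Submodule.mem_sup_left (Submodule.subset_span (by simp))
    | n + 2 =>
      -- For n = 0 the truncated exponent n − 1 is harmless, as its coefficient is g₃ · 0.
      have e : dR H (x g₂ g₃ ^ n * y g₂ g₃) = (4 * n + 6 : k) • x g₂ g₃ ^ (n + 2) -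
          (g₂ * (n + 2⁻¹)) • x g₂ g₃ ^ n - (g₃ * n) • x g₂ g₃ ^ (n - 1) := by
        have h2 : (algebraMap k (CoordRing g₂ g₃)) (g₂ / 2) = algebraMap k _ g₂ * algebraMap k _ 2⁻¹ := by
          rw [← map_mul, div_eq_mul_inv]
        rw [Derivation.leibniz, Derivation.leibniz_pow, dR_x, dR_y, h2, nsmul_eq_mul]
        simp only [smul_eq_mul, Algebra.smul_def, map_add, map_mul, map_natCast,
          map_ofNat]
        rcases n with _ | n
        · simp
        · rw [Nat.add_sub_cancel]
          linear_combination ((n + 1 : ℕ) : CoordRing g₂ g₃) * x g₂ g₃ ^ n * y_sq g₂ g₃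
      have h0 : (4 * n + 6 : k) ≠ 0 := by exact_mod_cast (show 4 * n + 6 ≠ 0 by omega)
      have h1 : (4 * n + 6 : k) • x g₂ g₃ ^ (n + 2) ∈ reducible H := by
        have : (4 * n + 6 : k) • x g₂ g₃ ^ (n + 2) = dR H (x g₂ g₃ ^ n * y g₂ g₃) +
          (g₂ * (n + 2⁻¹)) • x g₂ g₃ ^ n + (g₃ * n) • x g₂ g₃ ^ (n - 1) := by rw [e]; abel
        rw [this]
        exact add_mem (add_mem (dR_mem_reducible H _) (Submodule.smul_mem _ _ (ih n (by omega))))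
          (Submodule.smul_mem _ _ (ih (n - 1) (by omega)))
      have := Submodule.smul_mem _ (4 * n + 6 : k)⁻¹ h1
      rwa [smul_smul, inv_mul_cancel₀ h0, one_smul] at this

/-- Powers of x are covered by the recursion, and xⁿ y is the derivative of x^{n+1}/(n+1). -/
theorem mem_reducible (r : CoordRing g₂ g₃) : r ∈ reducible H := by
  obtain ⟨p, q, rfl⟩ := exists_eq_add_mul_y r
  refine add_mem ?_ ?_
  · rw [Polynomial.aeval_eq_sum_range]
    exact sum_mem fun n _ => Submodule.smul_mem _ _ (x_pow_mem_reducible H n)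
  · rw [Polynomial.aeval_eq_sum_range, Finset.sum_mul]
    refine sum_mem fun n _ => ?_
    rw [smul_mul_assoc]
    refine Submodule.smul_mem _ _ ?_
    have h0 : (n + 1 : k) ≠ 0 := by exact_mod_cast n.succ_ne_zero
    have := Submodule.smul_mem _ (n + 1 : k)⁻¹ (dR_mem_reducible H (x g₂ g₃ ^ (n + 1)))
    have e : dR H (x g₂ g₃ ^ (n + 1)) = (n + 1 : k) • (x g₂ g₃ ^ n * y g₂ g₃) := by
      rw [Derivation.leibniz_pow, dR_x, Nat.add_sub_cancel, smul_eq_mul, ← Nat.cast_smul_eq_nsmul k,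
        Nat.cast_succ]
    rwa [e, smul_smul, inv_mul_cancel₀ h0, one_smul] at this

/-- Every function on `U` differs from some `a + b x` by a derivative. -/
theorem exists_eq_add_dR (r : CoordRing g₂ g₃) : ∃ (a b : k) (s : CoordRing g₂ g₃),
    r = algebraMap k _ a + algebraMap k _ b * x g₂ g₃ + dR H s := by
  obtain ⟨u, hu, _, ⟨s, rfl⟩, rfl⟩ := Submodule.mem_sup.mp (mem_reducible H r)
  obtain ⟨a, b, rfl⟩ := Submodule.mem_span_pair.mp hu
  exact ⟨a, b, s, by rw [Algebra.smul_def, Algebra.smul_def, mul_one]; rfl⟩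

theorem coeff_neg_one_pHat : (pHat L).coeff (-1) = 0 := by
  have h := deriv_zetaHat (L := L)
  rw [← neg_neg (pHat L), ← h, HahnSeries.coeff_neg, coeff_neg_one_deriv, neg_zero]

theorem coeff_neg_one_C_mul (c : ℂ) (f : LaurentSeries ℂ) :
    (HahnSeries.C c * f).coeff (-1) = c * f.coeff (-1) := by
  rw [HahnSeries.C_mul_eq_smul, HahnSeries.coeff_smul, smul_eq_mul]

/-- The residue theorem for forms whose only pole is [0]. It is checked on a + bx and on
derivatives, and ℘ = −ζ' has no residue. -/
theorem coeff_neg_one_laurentR (r : CoordRing g₂ g₃) : (laurentR H r).coeff (-1) = 0 := by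
  obtain ⟨a, b, s, rfl⟩ := exists_eq_add_dR H r
  have h : (HahnSeries.C (algebraMap k ℂ a) : LaurentSeries ℂ).coeff (-1) = 0 :=
    ordGE_C _ _ (by norm_num)
  rw [map_add, map_add, map_mul, AlgHom.commutes, AlgHom.commutes, laurentR_x, laurentR_dR,
    algebraMap_eq_C, algebraMap_eq_C, HahnSeries.coeff_add, HahnSeries.coeff_add,
    coeff_neg_one_C_mul, coeff_neg_one_deriv, coeff_neg_one_pHat, h, mul_zero, add_zero, add_zero]

theorem coeff_neg_one_z : z.coeff (-1) = 0 := ordGE_z _ (by norm_num)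

theorem coeff_neg_one_z_mul_pHat : (z * pHat L).coeff (-1) = 1 := by
  rw [coeff_z_mul, show (-1 - 1 : ℤ) = -2 by norm_num, coeff_pHat]

theorem coeff_neg_one_zetaHat : (zetaHat L).coeff (-1) = 1 := by
  have h := coeff_z_pow_inv 1
  rw [pow_one, Nat.cast_one] at h
  rw [zetaHat, HahnSeries.coeff_add, h, ordGE_ofPowerSeries _ _ (by norm_num), add_zero]

/-- Because ζ℘ = −(ζ²)'/2. -/
theorem coeff_neg_one_zetaHat_mul_pHat : (zetaHat L * pHat L).coeff (-1) = 0 := by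
  have e : LaurentSeries.deriv (zetaHat L * zetaHat L) =
      -(zetaHat L * pHat L + zetaHat L * pHat L) := by
    rw [Derivation.leibniz, deriv_zetaHat, smul_eq_mul]; ring
  have h := coeff_neg_one_deriv (zetaHat L * zetaHat L)
  rw [e, HahnSeries.coeff_neg, HahnSeries.coeff_add, ← two_mul, neg_eq_zero] at h
  exact (mul_eq_zero.mp h).resolve_left two_ne_zero

/-! ### Forms without residues -/

/-- To first order, passing to the horizontal frame adds (zX₁ − ζX₂) ∂p. In degree c of X₀ only the
top part a + xb of p contributes to this term, and the residues of z, ζ, z℘, ζ℘ are 0, 1, 1, 0. The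
coefficients of p itself have no residue. -/
theorem resR_eq_coeff {c : ℕ} {p : SymAlg3 (CoordRing g₂ g₃)} (hp : LowX (c + 2) p)
    {a b : SymAlg3 k} (h : LowX (c + 1) (p - (MvPolynomial.map (algebraMap k _) a +
      C (x g₂ g₃) * MvPolynomial.map (algebraMap k _) b))) {s : Fin 3 →₀ ℕ} (hs : s 0 = c) :
    resR H s p = algebraMap k ℂ ((X 1 * pderiv 0 b - X 2 * pderiv 0 a).coeff s) := by
  set F : CoordRing g₂ g₃ →+* LaurentSeries ℂ := (laurentR H : CoordRing g₂ g₃ →+* LaurentSeries ℂ) with hF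
  set G : k →+* LaurentSeries ℂ := algebraMap k _ with hG
  have hFG (q : SymAlg3 k) : MvPolynomial.map F (MvPolynomial.map (algebraMap k _) q) =
      MvPolynomial.map G q := by
    rw [MvPolynomial.map_map]
    exact congrArg (fun f : k →+* LaurentSeries ℂ => MvPolynomial.map f q)
      (RingHom.ext fun c => (laurentR H).commutes c)
  have hx : F (x g₂ g₃) = pHat L := laurentR_x H
  have h1 := (hp.map F).shift_sub z (-zetaHat L) s hs.ge
  have h2 := ((h.map F).pderiv).mul_one (lowX_direction z (-zetaHat L)) s hs.ge
  rw [map_sub, map_add, map_mul, hFG, hFG, map_C, hx] at h2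
  have e : shift z (-zetaHat L) (MvPolynomial.map F p) = MvPolynomial.map F p +
      (C z * MvPolynomial.map G (X 1 * pderiv 0 a) - C (zetaHat L) * MvPolynomial.map G (X 2 * pderiv 0 a) +
        C (z * pHat L) * MvPolynomial.map G (X 1 * pderiv 0 b) -
        C (zetaHat L * pHat L) * MvPolynomial.map G (X 2 * pderiv 0 b)) +
      (shift z (-zetaHat L) (MvPolynomial.map F p) - MvPolynomial.map F p -
        (C z * X 1 + C (-zetaHat L) * X 2) * pderiv 0 (MvPolynomial.map F p)) +
      pderiv 0 (MvPolynomial.map F p - (MvPolynomial.map G a + C (pHat L) * MvPolynomial.map G b)) *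
        (C z * X 1 + C (-zetaHat L) * X 2) := by
    simp only [map_mul, map_sub, map_add, map_X, pderiv_C_mul, pderiv_map, map_neg]
    ring
  have hr (f : LaurentSeries ℂ) (q : SymAlg3 k) : ((C f * MvPolynomial.map G q).coeff s).coeff (-1) =
      f.coeff (-1) * algebraMap k ℂ (q.coeff s) := by
    rw [coeff_C_mul, coeff_map, hG, algebraMap_eq_C, mul_comm, coeff_neg_one_C_mul, mul_comm]
  change ((shift z (-zetaHat L) (MvPolynomial.map F p)).coeff s).coeff (-1) = _
  have hp0 : ((MvPolynomial.map F p).coeff s).coeff (-1) = 0 := by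
    rw [coeff_map]; exact coeff_neg_one_laurentR H _
  rw [e, coeff_add, coeff_add, h1, h2, add_zero, add_zero, coeff_add, coeff_sub, coeff_add,
    coeff_sub, HahnSeries.coeff_add, HahnSeries.coeff_sub, HahnSeries.coeff_add,
    HahnSeries.coeff_sub, hr, hr, hr, hr, coeff_neg_one_z, coeff_neg_one_zetaHat,
    coeff_neg_one_z_mul_pHat, coeff_neg_one_zetaHat_mul_pHat, hp0, coeff_sub, map_sub]
  ring

/-- One step of the descent in the degree of e. Modulo exact sections the coefficients of the top
part become a + bx, so the top part is u + xv with u and v constant. Vanishing residues force X₁ ∂v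
= X₂ ∂u, and then u + xv = (X₁ + xX₂) ∂w is ∇ of a constant section w. -/
theorem exists_lowX_sub_nabla {c : ℕ} {p : SymAlg3 (CoordRing g₂ g₃)} (hp : LowX (c + 2) p)
    (h : ∀ s, resR H s p = 0) : ∃ t, LowX (c + 1) (p - nablaR H t) := by
  classical
  choose a b r hr using exists_eq_add_dR H
  set t := ∑ m ∈ p.support, monomial m (r (p.coeff m)) with ht
  set S := p.support.filter (fun m => m 0 = c + 1) with hS
  set u : SymAlg3 k := ∑ m ∈ S, monomial m (a (p.coeff m)) with hu
  set v : SymAlg3 k := ∑ m ∈ S, monomial m (b (p.coeff m)) with hv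
  have hsum {A : Type _} [CommRing A] (T : Finset (Fin 3 →₀ ℕ)) (f : (Fin 3 →₀ ℕ) → A) (m) :
      (∑ n ∈ T, monomial n (f n)).coeff m = if m ∈ T then f m else 0 := by
    rw [coeff_sum]
    simp only [coeff_monomial]
    exact Finset.sum_ite_eq' T m f
  have hlt {m} (hm : m ∈ p.support) : m 0 < c + 2 := by
    by_contra h
    exact mem_support_iff.mp hm (hp m (by omega))
  have htl : LowX (c + 2) t := LowX.sum fun m hm => lowX_monomial (hlt hm) _
  have hpt : LowX (c + 2) (p - nablaR H t) := by
    rw [← add_sub_cancel (coeffDer (dR H) t) (nablaR H t)]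
    exact hp.sub ((htl.coeffDer _).add ((lowX_nabla_sub _ _ htl).mono (by omega)))
  have h1 : LowX (c + 1) (p - nablaR H t - (MvPolynomial.map (algebraMap k _) u +
      C (x g₂ g₃) * MvPolynomial.map (algebraMap k _) v)) := by
    have e : p - nablaR H t - (MvPolynomial.map (algebraMap k _) u +
      C (x g₂ g₃) * MvPolynomial.map (algebraMap k _) v) =
      (p - coeffDer (dR H) t - (MvPolynomial.map (algebraMap k _) u +
        C (x g₂ g₃) * MvPolynomial.map (algebraMap k _) v)) -
        (nablaR H t - coeffDer (dR H) t) := by ring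
    rw [e]
    refine LowX.sub (fun m hm => ?_) (lowX_nabla_sub _ _ htl)
    rw [coeff_sub, coeff_sub, coeff_coeffDer, coeff_add, coeff_C_mul, coeff_map, coeff_map, ht, hu,
      hv, hsum, hsum, hsum]
    by_cases hmp : m ∈ p.support
    · have : m ∈ S := Finset.mem_filter.mpr ⟨hmp, by have := hlt hmp; omega⟩
      rw [if_pos hmp, if_pos this, if_pos this]
      linear_combination hr (p.coeff m)
    · have : m ∉ S := fun h => hmp (Finset.mem_filter.mp h).1
      rw [if_neg hmp, if_neg this, if_neg this, notMem_support_iff.mp hmp]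
      simp
  have heuler (f : CoordRing g₂ g₃ → k) : X 0 * pderiv 0 (∑ m ∈ S, monomial m (f (p.coeff m))) =
      C (c + 1 : k) * ∑ m ∈ S, monomial m (f (p.coeff m)) := by
    rw [map_sum, Finset.mul_sum, Finset.mul_sum]
    refine Finset.sum_congr rfl fun m hm => ?_
    rw [X_mul_pderiv_monomial, (Finset.mem_filter.mp hm).2, ← Nat.cast_smul_eq_nsmul k,
      MvPolynomial.smul_eq_C_mul, Nat.cast_succ]
  have hs : X 1 * pderiv 0 v = X 2 * pderiv 0 u := by
    rw [← sub_eq_zero]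
    ext s
    by_cases hs : s 0 = c
    · refine (algebraMap k ℂ).injective ?_
      rw [← resR_eq_coeff H hpt h1 hs, map_sub, h, resR_nablaR, coeff_zero, map_zero, sub_zero]
    -- Outside degree c of X₀ there is nothing to prove: u and v are homogeneous of degree c + 1 in
    -- X₀.
    · have hz (f : CoordRing g₂ g₃ → k) {i : Fin 3} (hi : i ≠ 0) :
          (X i * pderiv 0 (∑ m ∈ S, monomial m (f (p.coeff m)))).coeff s = 0 := by
        have hm : s - Finsupp.single i 1 + Finsupp.single 0 1 ∉ S := fun h => hs (by
          simpa [hi] using (Finset.mem_filter.mp h).2)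
        rw [coeff_X_mul', coeff_pderiv, hsum]
        simp only [if_neg hm, zero_mul, ite_self]
      rw [coeff_sub, hz _ (by decide), hz _ (by decide), sub_zero, coeff_zero]
  obtain ⟨w, hw1, hw2⟩ := exists_pderiv_eq c (heuler a) (heuler b) hs
  refine ⟨t + MvPolynomial.map (algebraMap k _) w, ?_⟩
  have e : nablaR H (MvPolynomial.map (algebraMap k _) w) = MvPolynomial.map (algebraMap k _) u +
      C (x g₂ g₃) * MvPolynomial.map (algebraMap k _) v := by
    have h0 : coeffDer (dR H) (MvPolynomial.map (algebraMap k (CoordRing g₂ g₃)) w) = 0 := by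
      ext m
      rw [coeff_coeffDer, coeff_map, Derivation.map_algebraMap, coeff_zero]
    rw [nabla_apply, h0, zero_add, hu, hv, hw1, hw2, map_mul, map_mul, pderiv_map, map_X, map_X]
    ring
  rw [map_add, e, ← sub_sub]
  exact h1

theorem exists_lowX_one_sub_nabla (p : SymAlg3 (CoordRing g₂ g₃)) (h : ∀ s, resR H s p = 0) :
    ∃ t, LowX 1 (p - nablaR H t) := by
  have key (c : ℕ) (p : SymAlg3 (CoordRing g₂ g₃)) (hp : LowX (c + 1) p)
      (h : ∀ s, resR H s p = 0) : ∃ t, LowX 1 (p - nablaR H t) := by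
    induction c generalizing p with
    | zero => exact ⟨0, by rwa [map_zero, sub_zero]⟩
    | succ c ih =>
      obtain ⟨t, ht⟩ := exists_lowX_sub_nabla H hp h
      obtain ⟨t', ht'⟩ := ih _ ht fun s => by rw [map_sub, h, resR_nablaR, sub_zero]
      exact ⟨t + t', by rwa [map_add, ← sub_sub]⟩
  refine key (p.degreeOf 0) p (fun m hm => ?_) h
  by_contra h
  have := MvPolynomial.monomial_le_degreeOf 0 (mem_support_iff.mpr h)
  omega

end EllPolylog

namespace EllPolylog

open MvPolynomial

/-! ### The projection to the previous level -/

section Proj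

variable {k : Type*} [CommRing k] {A : Type*} [CommRing A] [Algebra k A] (δ : Derivation k A A) (a : A)

theorem homogeneousComponent_nabla (N : ℕ) (p : SymAlg3 A) :
    homogeneousComponent N (nabla δ a p) = nabla δ a (homogeneousComponent N p) := by
  induction p using MvPolynomial.induction_on' with
  | add p q hp hq => simp only [map_add, hp, hq]
  | monomial s b =>
    have h := isHomogeneous_monomial (d := s) b rfl
    rw [homogeneousComponent_of_mem h, homogeneousComponent_of_mem (isHomogeneous_nabla δ a h)]
    split_ifs
    · rfl
    · rw [map_zero]

/-- The coefficients of ∇(e) do not involve e, and the connection commutes with differentiation in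
e. So ∂/∂e carries exact sections to exact sections. -/
theorem pderiv_nabla (p : SymAlg3 A) : pderiv 0 (nabla δ a p) = nabla δ a (pderiv 0 p) := by
  have h : pderiv 0 (coeffDer δ p) = coeffDer δ (pderiv 0 p) := by
    ext m
    rw [coeff_pderiv, coeff_coeffDer, coeff_coeffDer, coeff_pderiv, Derivation.leibniz, map_add,
      Derivation.map_natCast, Derivation.map_one_eq_zero, add_zero, smul_zero, zero_add, smul_eq_mul,
      mul_comm]
  rw [nabla_apply, nabla_apply, map_add, h, pderiv_mul, map_add, pderiv_X_of_ne (by decide),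
    pderiv_C_mul, pderiv_X_of_ne (by decide)]
  ring

end Proj

section ProjW

variable {k : Type*} [Field k] [CharZero k] {A : Type*} [CommRing A] [Algebra k A]

theorem pderiv_wPoly {N m n : ℕ} (h : m + n ≤ N) :
    pderiv 0 (wPoly k A (N + 1) m n) = wPoly k A N m n := by
  obtain ⟨a, rfl⟩ := Nat.exists_eq_add_of_le h
  have e : algebraMap k A (((a + 1)! : ℕ) : k)⁻¹ * ((a + 1 : ℕ) : A) = algebraMap k A ((a ! : ℕ) : k)⁻¹ := by
    rw [← map_natCast (algebraMap k A) (a + 1), ← map_mul]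
    congr 1
    have : ((a + 1 : ℕ) : k) ≠ 0 := by exact_mod_cast a.succ_ne_zero
    rw [Nat.factorial_succ, Nat.cast_mul, mul_inv, mul_comm, ← mul_assoc, mul_inv_cancel₀ this,
      one_mul]
  have h1 : pderiv 0 (X 1 : SymAlg3 A) = 0 := pderiv_X_of_ne (by decide)
  have h2 : pderiv 0 (X 2 : SymAlg3 A) = 0 := pderiv_X_of_ne (by decide)
  rw [wPoly, wPoly, show m + n + a + 1 - m - n = a + 1 by omega, show m + n + a - m - n = a by omega,
    ← e, pderiv_C_mul, pderiv_mul, pderiv_mul, pderiv_pow, pderiv_pow, pderiv_pow, h1, h2,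
    pderiv_X_self, Nat.add_sub_cancel, map_mul, map_natCast C]
  ring

omit [CharZero k] in
theorem pderiv_wPoly_top {N m n : ℕ} (h : m + n = N) : pderiv 0 (wPoly k A N m n) = 0 := by
  rw [wPoly, show N - m - n = 0 by omega, pderiv_C_mul, pderiv_mul, pderiv_mul, pderiv_pow,
    pderiv_pow, pderiv_pow, pderiv_X_of_ne (i := 0) (j := 1) (by decide),
    pderiv_X_of_ne (i := 0) (j := 2) (by decide)]
  simp

theorem pderiv_etPoly (c : PowerSeries A) (N : ℕ) :
    pderiv 0 (etPoly k c (N + 1)) = etPoly k c N := by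
  rw [etPoly, etPoly, Finset.sum_range_succ, map_neg, map_add, map_sum, pderiv_C_mul,
    pderiv_wPoly_top (zero_add _), mul_zero, add_zero]
  congr 1
  refine Finset.sum_congr rfl fun n hn => ?_
  rw [pderiv_C_mul, pderiv_wPoly (by have := Finset.mem_range.mp hn; omega)]

theorem pderiv_omPoly (a : A) (c : PowerSeries A) (N : ℕ) :
    pderiv 0 (omPoly k a c (N + 1)) = omPoly k a c N := by
  rw [omPoly, omPoly, Finset.sum_Icc_succ_top (by omega), map_sub, map_add, map_sum, pderiv_C_mul,
    pderiv_C_mul, pderiv_wPoly (by omega), pderiv_wPoly_top (by omega), mul_zero, add_zero]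
  congr 1
  refine Finset.sum_congr rfl fun n hn => ?_
  rw [pderiv_C_mul, pderiv_wPoly (by have := Finset.mem_Icc.mp hn; omega)]

theorem symProj_toSymPow_apply (N : ℕ) (p : SymAlg3 A) :
    symProj A N (toSymPow A (N + 1) p) = toSymPow A N (pderiv 0 p) :=
  LinearMap.congr_fun (symProj_toSymPow N) p

end ProjW

/-! ### The splitting -/

section SplitHom

variable {k : Type*} [Field k] {V : Type*} [AddCommGroup V] [Module k V] (v w : V)

/-- The linear map `X₀ ^ a X₁ ^ m X₂ ^ n / a! ↦ v ^ m w ^ n` to the symmetric algebra of `V`. -/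
def splitHom : SymAlg3 k →ₗ[k] SymmetricAlgebra k V :=
  (basisMonomials (Fin 3) k).constr k fun m => ((m 0)! : k) •
    (SymmetricAlgebra.ι k V v ^ m 1 * SymmetricAlgebra.ι k V w ^ m 2)

theorem splitHom_apply (p : SymAlg3 k) : splitHom v w p = ∑ m ∈ p.support,
    (p.coeff m * ((m 0)! : k)) •
      (SymmetricAlgebra.ι k V v ^ m 1 * SymmetricAlgebra.ι k V w ^ m 2) := by
  rw [splitHom, Module.Basis.constr_apply]
  refine Finset.sum_congr rfl fun m _ => ?_
  exact smul_smul _ _ _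

theorem splitHom_monomial (m : Fin 3 →₀ ℕ) (c : k) : splitHom v w (monomial m c) =
    (c * ((m 0)! : k)) • (SymmetricAlgebra.ι k V v ^ m 1 * SymmetricAlgebra.ι k V w ^ m 2) := by
  have : monomial m c = c • basisMonomials (Fin 3) k m := by
    rw [coe_basisMonomials, smul_monomial, smul_eq_mul, mul_one]
  rw [this, map_smul, splitHom, Module.Basis.constr_basis, smul_smul]

variable [CharZero k]

theorem splitHom_wPoly (N m n : ℕ) : splitHom v w (wPoly k k N m n) =
    SymmetricAlgebra.ι k V v ^ m * SymmetricAlgebra.ι k V w ^ n := by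
  have e : wPoly k k N m n = monomial (Finsupp.single 0 (N - m - n) + Finsupp.single 1 m +
      Finsupp.single 2 n) (((N - m - n)! : k)⁻¹) := by
    rw [wPoly, X_pow_eq_monomial, X_pow_eq_monomial, X_pow_eq_monomial, monomial_mul, monomial_mul,
      C_mul_monomial, Algebra.algebraMap_self, RingHom.id_apply, mul_one, mul_one, mul_one]
  rw [e, splitHom_monomial]
  simp [Nat.factorial_ne_zero]

/-- In degree N the exponent of e is determined by those of ω^∨ and η^∨, so distinct monomials have
distinct images; the factorials are nonzero. -/
theorem splitHom_injOn (β : Module.Basis (Fin 2) k V) {N : ℕ} {p q : SymAlg3 k}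
    (hp : p.IsHomogeneous N) (hq : q.IsHomogeneous N)
    (h : splitHom (β 0) (β 1) p = splitHom (β 0) (β 1) q) : p = q := by
  classical
  let τ (m : Fin 3 →₀ ℕ) : Fin 2 →₀ ℕ := Finsupp.single 0 (m 1) + Finsupp.single 1 (m 2)
  have e (m : Fin 3 →₀ ℕ) : SymmetricAlgebra.equivMvPolynomial β
      (SymmetricAlgebra.ι k V (β 0) ^ m 1 * SymmetricAlgebra.ι k V (β 1) ^ m 2) =
        monomial (τ m) 1 := by
    rw [map_mul, map_pow, map_pow, SymmetricAlgebra.equivMvPolynomial_ι_apply,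
      SymmetricAlgebra.equivMvPolynomial_ι_apply, X_pow_eq_monomial, X_pow_eq_monomial,
      monomial_mul, mul_one]
  have h1 (m : Fin 3 →₀ ℕ) : τ m 0 = m 1 := by simp [τ]
  have h2 (m : Fin 3 →₀ ℕ) : τ m 1 = m 2 := by simp [τ]
  have hdeg (m : Fin 3 →₀ ℕ) : m.degree = m 0 + m 1 + m 2 := by
    rw [Finsupp.degree_eq_sum, Fin.sum_univ_three]
  have key {p : SymAlg3 k} (hp : p.IsHomogeneous N) (m : Fin 3 →₀ ℕ) (hm : m.degree = N) :
      (SymmetricAlgebra.equivMvPolynomial β (splitHom (β 0) (β 1) p)).coeff (τ m) =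
        p.coeff m * (m 0)! := by
    rw [splitHom_apply, map_sum, coeff_sum]
    simp only [map_smul, e, coeff_smul, coeff_monomial, smul_eq_mul, mul_ite, mul_one, mul_zero]
    rw [Finset.sum_eq_single m]
    · rw [if_pos rfl]
    · intro m' hm' hne
      refine if_neg fun h => hne ?_
      have hd : m'.degree = N := by
        by_contra hd
        exact mem_support_iff.mp hm' (hp.coeff_eq_zero hd)
      have e1 := DFunLike.congr_fun h 0
      have e2 := DFunLike.congr_fun h 1
      rw [h1, h1] at e1
      rw [h2, h2] at e2
      rw [hdeg] at hm hd
      ext i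
      fin_cases i
      · simp only [Fin.zero_eta]; omega
      · exact e1
      · exact e2
    · intro h
      rw [notMem_support_iff.mp h, zero_mul, ite_self]
  refine MvPolynomial.ext _ _ fun m => ?_
  by_cases hm : m.degree = N
  · have h1 := key hp m hm
    rw [h, key hq m hm] at h1
    exact mul_right_cancel₀ (Nat.cast_ne_zero.mpr (Nat.factorial_ne_zero _)) h1.symm
  · rw [hp.coeff_eq_zero hm, hq.coeff_eq_zero hm]

theorem splitHom_ofSymPow_injective {M : Type*} [AddCommGroup M] [Module k M]
    (b : Module.Basis (Fin 2) k M) {N : ℕ} {r r' : SymPow k N}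
    (h : splitHom (b.coord 0) (b.coord 1) (ofSymPow k N r) =
      splitHom (b.coord 0) (b.coord 1) (ofSymPow k N r')) : r = r' := by
  refine ofSymPow_injective N (splitHom_injOn b.dualBasis (isHomogeneous_ofSymPow r)
    (isHomogeneous_ofSymPow r') ?_)
  rwa [Module.Basis.coe_dualBasis]

omit [CharZero k] in
theorem splitHom_wBasis_zero (c d : k) :
    splitHom v w (ofSymPow k 0 (c • wBasis k k 0 1 0 + d • wBasis k k 0 0 1)) = 0 := by
  rw [wBasis_eq_zero k (by omega), wBasis_eq_zero k (by omega), smul_zero, smul_zero, add_zero,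
    map_zero, map_zero]

theorem splitHom_wBasis {N : ℕ} (h : N ≠ 0) (c d : k) :
    splitHom v w (ofSymPow k N (c • wBasis k k N 1 0 + d • wBasis k k N 0 1)) =
      SymmetricAlgebra.ι k V (c • v + d • w) := by
  rw [map_add, map_smul, map_smul, map_add, map_smul, map_smul, ofSymPow_wBasis k (by omega),
    ofSymPow_wBasis k (by omega), splitHom_wPoly, splitHom_wPoly,
    pow_one, pow_zero, pow_zero, pow_one, mul_one, one_mul, map_add, map_smul, map_smul]

end SplitHom

section Splitting

variable {k : Type u} [Field k] {g₂ g₃ : k} (b : Module.Basis (Fin 2) k (H1dR g₂ g₃))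

theorem splitting_eq (N : ℕ) (r : SymPow k N) :
    splitting b N r = splitHom (b.coord 0) (b.coord 1) (ofSymPow k N r) :=
  (splitHom_apply _ _ _).symm

theorem splitting_injective [CharZero k] (N : ℕ) : Function.Injective (splitting b N) :=
  fun r r' h => splitHom_ofSymPow_injective b (r := r) (r' := r')
    ((splitting_eq b N r).symm.trans (h.trans (splitting_eq b N r')))

theorem identityUpTo_zero (h : H g₂ g₃) : identityUpTo g₂ g₃ 0 h = 0 := by
  have : identityUpTo g₂ g₃ 0 = 0 := if_pos rfl
  rw [this]; rfl

theorem identityUpTo_of_ne {N : ℕ} (hN : N ≠ 0) (h : H g₂ g₃) :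
    identityUpTo g₂ g₃ N h = SymmetricAlgebra.ι k (H g₂ g₃) h := by
  have : identityUpTo g₂ g₃ N = SymmetricAlgebra.ι k (H g₂ g₃) := if_neg hN
  rw [this]

theorem splitting_wBasis [CharZero k] (N : ℕ) (c d : k) :
    splitting b N (c • wBasis k k N 1 0 + d • wBasis k k N 0 1) =
      identityUpTo g₂ g₃ N (c • b.coord 0 + d • b.coord 1) := by
  rw [splitting_eq]
  by_cases hN : N = 0
  · subst hN
    exact (splitHom_wBasis_zero _ _ c d).trans (identityUpTo_zero _).symm
  · exact (splitHom_wBasis _ _ hN c d).trans (identityUpTo_of_ne hN _).symm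

end Splitting

end EllPolylog

/-! ### Classes without residue and their projection to the previous level. -/

namespace EllPolylog

open MvPolynomial

variable {k : Type u} [Field k] [CharZero k] [Algebra k ℂ] {g₂ g₃ : k} {L : PeriodPair}
  (H : Uniformizes L g₂ g₃) {I : Type w} {𝔘 : LogCover g₂ g₃ L I}

omit [CharZero k] [Algebra k ℂ] in
theorem h1Proj_omegaClass (N : ℕ) (p : LogU g₂ g₃ (N + 1)) :
    h1Proj g₂ g₃ N (omegaClass g₂ g₃ (N + 1) p) =
      omegaClass g₂ g₃ N (symProj (CoordRing g₂ g₃) N p) := rfl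

include H in
theorem omegaClass_surjective (N : ℕ) (c : H1Log g₂ g₃ N) : ∃ p, omegaClass g₂ g₃ N p = c := by
  obtain ⟨ξ, rfl⟩ := Submodule.Quotient.mk_surjective _ c
  obtain ⟨p, rfl⟩ := (formGen_omega H).exists_eq_tmul ξ
  exact ⟨p, rfl⟩

theorem logConn_eq (N : ℕ) (t : LogU g₂ g₃ N) : logConn g₂ g₃ N t =
    toSymPow _ N (nablaR H (ofSymPow _ N t)) ⊗ₜ omega g₂ g₃ := by
  change (toSymPow _ N).rTensor _ (symConn _ _ (ofSymPow _ N t)) = _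
  rw [eta, (formGen_omega H).symConn_eq, LinearMap.rTensor_tmul]

theorem omegaClass_toSymPow_nablaR (N : ℕ) (t : SymAlg3 (CoordRing g₂ g₃)) :
    omegaClass g₂ g₃ N (toSymPow _ N (nablaR H t)) = 0 := by
  rw [omegaClass_apply, Submodule.Quotient.mk_eq_zero]
  refine ⟨toSymPow _ N t, (logConn_eq H N _).trans (congrArg (· ⊗ₜ omega g₂ g₃) (Subtype.ext ?_))⟩
  change homogeneousComponent N (nablaR H (homogeneousComponent N t)) =
    homogeneousComponent N (nablaR H t)
  rw [← homogeneousComponent_nabla, homogeneousComponent_of_mem (homogeneousComponent_mem N _),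
    if_pos rfl]

/-- A class without residue at level `N + 1` vanishes at level `N`. -/
theorem h1Proj_omegaClass_eq_zero (N : ℕ) (p : LogU g₂ g₃ (N + 1))
    (h : ∀ s, resR H s (ofSymPow _ _ p) = 0) :
    h1Proj g₂ g₃ N (omegaClass g₂ g₃ (N + 1) p) = 0 := by
  obtain ⟨t, ht⟩ := exists_lowX_one_sub_nabla H _ h
  -- The remainder p − ∇t does not involve e, and the projection is ∂/∂e.
  have h0 := ht.pderiv_eq_zero
  rw [map_sub, sub_eq_zero, pderiv_nabla] at h0
  rw [h1Proj_omegaClass]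
  have e : symProj (CoordRing g₂ g₃) N p = toSymPow _ N (pderiv 0 (ofSymPow _ (N + 1) p)) := rfl
  rw [e, h0, omegaClass_toSymPow_nablaR]

include H in
theorem h1Proj_eq_of_hasResidue {N : ℕ} {c c' : H1Log g₂ g₃ (N + 1)} {r : SymPow k (N + 1)}
    (h : HasResidue 𝔘 (N + 1) c r) (h' : HasResidue 𝔘 (N + 1) c' r) :
    h1Proj g₂ g₃ N c = h1Proj g₂ g₃ N c' := by
  have hd := h.add H (h'.smul H (-1))
  obtain ⟨p, hp⟩ := omegaClass_surjective H (N + 1) (c + (-1 : k) • c')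
  rw [← hp] at hd
  have h0 := h1Proj_omegaClass_eq_zero H N p fun s => by
    rw [hd.resR_eq H, neg_one_smul, add_neg_cancel, map_zero, coeff_zero, map_zero]
  rw [hp, map_add, map_smul, neg_one_smul, add_neg_eq_zero] at h0
  exact h0

/-! ### The polylogarithm class -/

variable (b : Module.Basis (Fin 2) k (H1dR g₂ g₃))

/-- The sections whose classes are the components of the polylogarithm class. -/
def polylogSection (N : ℕ) (h : EllPolylog.H g₂ g₃) : LogU g₂ g₃ N :=
  h (b 0) • toSymPow _ N (omPoly k (x g₂ g₃) (connSeriesNeg H) N) +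
    h (b 1) • toSymPow _ N (etPoly k (connSeriesNeg H) N)

theorem polylogForm_eq (N : ℕ) (h : EllPolylog.H g₂ g₃) :
    polylogForm (fun n => PowerSeries.coeff n (connSeries H)) b N h =
      polylogSection H b N h ⊗ₜ omega g₂ g₃ := by
  have e : polylogForm (fun n => PowerSeries.coeff n (connSeries H)) b N h =
      h (b 0) • boldOmega (fun n => PowerSeries.coeff n (connSeries H)) N +
        h (b 1) • boldEta (fun n => PowerSeries.coeff n (connSeries H)) N := rfl
  rw [e, boldOmega_eq, boldEta_eq, polylogSection, TensorProduct.add_tmul, TensorProduct.smul_tmul',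
    TensorProduct.smul_tmul']

theorem polylogClass_eq (N : ℕ) (h : EllPolylog.H g₂ g₃) :
    polylogClass (fun n => PowerSeries.coeff n (connSeries H)) b N h =
      omegaClass g₂ g₃ N (polylogSection H b N h) := by
  rw [polylogClass, LinearMap.comp_apply, polylogForm_eq H b N h]
  rfl

theorem hasResidue_polylogClass (𝔘 : LogCover g₂ g₃ L I) (N : ℕ) (h : EllPolylog.H g₂ g₃) :
    HasResidue 𝔘 N (polylogClass (fun n => PowerSeries.coeff n (connSeries H)) b N h)
      (h (b 0) • wBasis k k N 1 0 + h (b 1) • wBasis k k N 0 1) := by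
  rw [polylogClass_eq, polylogSection, map_add, map_smul, map_smul]
  exact ((hasResidue_boldOmega H 𝔘 N).smul H _).add H ((hasResidue_boldEta H 𝔘 N).smul H _)

theorem residueEq_polylogClass (𝔘 : LogCover g₂ g₃ L I) (N : ℕ) (h : EllPolylog.H g₂ g₃) :
    ResidueEq 𝔘 b N (polylogClass (fun n => PowerSeries.coeff n (connSeries H)) b N h)
      (identityUpTo g₂ g₃ N h) := by
  have hr := hasResidue_polylogClass H b 𝔘 N h
  refine ⟨_, fun r' => ⟨fun h' => h'.unique H hr, fun h' => h' ▸ hr⟩, ?_⟩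
  have e : h = h (b 0) • b.coord 0 + h (b 1) • b.coord 1 := by
    refine b.ext fun i => ?_
    fin_cases i <;> simp
  exact (splitting_wBasis b N _ _).trans (congrArg (identityUpTo g₂ g₃ N) e.symm)

theorem h1Proj_comp_polylogClass (N : ℕ) :
    h1Proj g₂ g₃ N ∘ₗ polylogClass (fun n => PowerSeries.coeff n (connSeries H)) b (N + 1) =
      polylogClass (fun n => PowerSeries.coeff n (connSeries H)) b N := by
  refine LinearMap.ext fun h => ?_
  rw [LinearMap.comp_apply, polylogClass_eq, polylogClass_eq, h1Proj_omegaClass, polylogSection,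
    polylogSection, map_add, LinearMap.map_smul_of_tower, LinearMap.map_smul_of_tower,
    symProj_toSymPow_apply, symProj_toSymPow_apply, pderiv_omPoly, pderiv_etPoly]

/-- The component of level N is the projection of the one of level N + 1. There the residue is
prescribed, and two classes with the same residue have the same projection. -/
theorem isPolylogClass_iff (𝔘 : LogCover g₂ g₃ L I)
    (c : ∀ N, EllPolylog.H g₂ g₃ →ₗ[k] H1Log g₂ g₃ N) : IsPolylogClass 𝔘 b c ↔
      c = polylogClass (fun n => PowerSeries.coeff n (connSeries H)) b := by
  constructor
  · rintro ⟨h1, h2⟩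
    refine funext fun N => LinearMap.ext fun h => ?_
    obtain ⟨r, hr, hs⟩ := h2 (N + 1) h
    obtain ⟨r', hr', hs'⟩ := residueEq_polylogClass H b 𝔘 (N + 1) h
    have e : r = r' := splitting_injective b (N + 1) (hs.trans hs'.symm)
    rw [← h1 N, ← h1Proj_comp_polylogClass H b N]
    exact h1Proj_eq_of_hasResidue H ((hr r).mpr rfl) (e ▸ (hr' r').mpr rfl)
  · rintro rfl
    exact ⟨h1Proj_comp_polylogClass H b, residueEq_polylogClass H b 𝔘⟩

end EllPolylog

namespace EllPolylog

open MvPolynomial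

/-! ### Extensions by a module with connection -/

section TwistedSum

variable {k : Type u} [Field k] {B : Type u} [CommRing B] [Algebra k B]
  {V : Type u} [AddCommGroup V] [Module k V]
  {M : Type u} [AddCommGroup M] [Module B M] [Module k M] [IsScalarTower k B M]
  (connM : M →ₗ[k] M ⊗[B] Ω[B⁄k]) (f : V →ₗ[k] M ⊗[B] Ω[B⁄k])

theorem constConn_tmul (r : B) (h : V) : constConn B V (r ⊗ₜ[k] h) =
    ((1 : B) ⊗ₜ[k] h) ⊗ₜ[B] KaehlerDifferential.D k B r := rfl

theorem constConn_smul (r : B) (q : B ⊗[k] V) :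
    constConn B V (r • q) = r • constConn B V q + q ⊗ₜ KaehlerDifferential.D k B r := by
  induction q using TensorProduct.induction_on with
  | zero => rw [smul_zero, map_zero, smul_zero, TensorProduct.zero_tmul, add_zero]
  | tmul a h =>
    have e : a ⊗ₜ[k] h = a • ((1 : B) ⊗ₜ[k] h) := by
      rw [TensorProduct.smul_tmul', smul_eq_mul, mul_one]
    rw [TensorProduct.smul_tmul', smul_eq_mul, constConn_tmul, constConn_tmul, Derivation.leibniz,
      TensorProduct.tmul_add, TensorProduct.tmul_smul, TensorProduct.tmul_smul, add_comm, e,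
      TensorProduct.smul_tmul' a, add_comm]
  | add q q' hq hq' =>
    rw [smul_add, map_add, map_add, hq, hq', smul_add, TensorProduct.add_tmul]
    abel

theorem twistedSum_conn (q : B ⊗[k] V) (m : M) : (twistedSum V connM f).conn (q, m) =
    (LinearMap.inl B (B ⊗[k] V) M).rTensor Ω[B⁄k] (constConn B V q) +
      (LinearMap.inr B (B ⊗[k] V) M).rTensor Ω[B⁄k] (f.liftBaseChange B q + connM m) := rfl

omit [Module k M] [IsScalarTower k B M] in
theorem ExtData.isomorphic_of_bijective {Q : Type u} [AddCommGroup Q] [Module B Q]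
    {P : ExtData.{u, v} k B M Q} {P' : ExtData.{u, w} k B M Q} (g : P'.carrier →ₗ[B] P.carrier)
    (hg : Function.Bijective g) (hi : ∀ m, g (P'.incl m) = P.incl m)
    (hp : ∀ q, P.proj (g q) = P'.proj q) (hc : ∀ q, P.conn (g q) = g.rTensor Ω[B⁄k] (P'.conn q)) :
    P.Isomorphic P' := by
  set e := LinearEquiv.ofBijective g hg with he
  have h (q) : e.symm (g q) = q := e.symm_apply_apply q
  refine ⟨e.symm, fun m => by rw [← hi, h], fun p => ?_, fun p => ?_⟩
  · obtain ⟨q, rfl⟩ := hg.2 p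
    rw [h, hp]
  · obtain ⟨q, rfl⟩ := hg.2 p
    have h1 : e.symm.toLinearMap ∘ₗ g = LinearMap.id := LinearMap.ext h
    rw [h, hc, ← LinearMap.rTensor_comp_apply, h1, LinearMap.rTensor_id, LinearMap.id_apply]

variable {connM}

theorem isExtension_twistedSum [Module.Finite k V] [Module.Finite B M] [Module.Projective B M]
    (hM : ∀ (r : B) (m : M), connM (r • m) = r • connM m + m ⊗ₜ KaehlerDifferential.D k B r) :
    (twistedSum V connM f).IsExtension connM (constConn B V) where
  finite := inferInstanceAs (Module.Finite B ((B ⊗[k] V) × M))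
  projective := inferInstanceAs (Module.Projective B ((B ⊗[k] V) × M))
  leibniz := by
    rintro r ⟨q, m⟩
    have e : (q, m) ⊗ₜ[B] KaehlerDifferential.D k B r =
        (LinearMap.inl B (B ⊗[k] V) M).rTensor Ω[B⁄k] (q ⊗ₜ KaehlerDifferential.D k B r) +
          (LinearMap.inr B (B ⊗[k] V) M).rTensor Ω[B⁄k] (m ⊗ₜ KaehlerDifferential.D k B r) := by
      rw [LinearMap.rTensor_tmul, LinearMap.rTensor_tmul, ← TensorProduct.add_tmul,
        LinearMap.inl_apply, LinearMap.inr_apply, Prod.mk_add_mk, add_zero, zero_add]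
    refine (twistedSum_conn connM f (r • q) (r • m)).trans ?_
    refine Eq.trans ?_ (congrArg₂ (· + ·) (congrArg (r • ·) (twistedSum_conn connM f q m).symm) e.symm)
    have hs := smul_add r ((LinearMap.inl B (B ⊗[k] V) M).rTensor Ω[B⁄k] (constConn B V q))
      ((LinearMap.inr B (B ⊗[k] V) M).rTensor Ω[B⁄k] (f.liftBaseChange B q + connM m))
    refine Eq.trans ?_ (congrArg₂ (· + ·) hs.symm rfl)
    rw [constConn_smul, hM, map_smul]
    simp only [map_add, map_smul, smul_add]
    abel
  incl_injective := LinearMap.inr_injective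
  exact := LinearMap.exact_of_comp_eq_zero_of_ker_le_range (by ext; rfl) (by
    rintro ⟨q, m⟩ h
    exact ⟨m, Prod.ext h.symm rfl⟩)
  proj_surjective := LinearMap.fst_surjective
  incl_horizontal m := by
    refine (twistedSum_conn connM f 0 m).trans ?_
    rw [map_zero, map_zero, map_zero, zero_add, zero_add]
    rfl
  proj_horizontal := by
    rintro ⟨q, m⟩
    refine Eq.trans ?_ (congrArg ((LinearMap.fst B (B ⊗[k] V) M).rTensor Ω[B⁄k])
      (twistedSum_conn connM f q m)).symm
    rw [map_add, ← LinearMap.rTensor_comp_apply, ← LinearMap.rTensor_comp_apply,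
      LinearMap.fst_comp_inl, LinearMap.fst_comp_inr, LinearMap.rTensor_id, LinearMap.rTensor_zero,
      LinearMap.zero_apply, add_zero, LinearMap.id_apply]
    rfl

/-- The chosen lifts of a basis define a B-linear section of the projection, and together with the
inclusion of M an isomorphism from the direct sum. By the Leibniz rule its compatibility with the
connections need only be known on the basis, where it is the hypothesis. -/
theorem ExtData.IsExtension.isomorphic_twistedSum {ι : Type*} [Fintype ι] (β : Module.Basis ι k V)
    {P : ExtData.{u, v} k B M (B ⊗[k] V)} (hP : P.IsExtension connM (constConn B V))
    (h : ∀ i, ∃ p, P.proj p = 1 ⊗ₜ β i ∧ P.conn p = P.incl.rTensor Ω[B⁄k] (f (β i))) :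
    P.Isomorphic (twistedSum V connM f) := by
  choose p hp hc using h
  set θ : B ⊗[k] V →ₗ[B] P.carrier := (β.baseChange B).constr B p with hθ
  have hθβ (i : ι) : θ (1 ⊗ₜ β i) = p i := by
    rw [← Module.Basis.baseChange_apply, hθ, Module.Basis.constr_basis]
  set g : (B ⊗[k] V) × M →ₗ[B] P.carrier := θ.coprod P.incl with hg
  have hproj (q : (B ⊗[k] V) × M) : P.proj (g q) = q.1 := by
    have h1 : P.proj ∘ₗ θ = LinearMap.id := (β.baseChange B).ext fun i => by
      rw [Module.Basis.baseChange_apply, LinearMap.comp_apply, hθβ, hp, LinearMap.id_apply]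
    have h2 : P.proj (θ q.1) = q.1 := LinearMap.congr_fun h1 q.1
    rw [hg, LinearMap.coprod_apply, map_add, h2, hP.exact.apply_apply_eq_zero, add_zero]
  have hbij : Function.Bijective g := by
    constructor
    · refine (injective_iff_map_eq_zero g).mpr fun q hq => ?_
      have h1 : q.1 = 0 := by rw [← hproj, hq, map_zero]
      rw [hg, LinearMap.coprod_apply, h1, map_zero, zero_add] at hq
      exact Prod.ext h1 (hP.incl_injective (hq.trans (map_zero _).symm))
    · intro p
      obtain ⟨m, hm⟩ := (hP.exact (p - g (P.proj p, 0))).mp (by rw [map_sub, hproj, sub_self])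
      refine ⟨(P.proj p, m), ?_⟩
      have : ((P.proj p, m) : (B ⊗[k] V) × M) = (P.proj p, 0) + (0, m) := by simp
      rw [this, map_add, hg, LinearMap.coprod_apply θ P.incl (0, m), map_zero, zero_add, hm, ← hg,
        add_sub_cancel]
  have hconn (q : (B ⊗[k] V) × M) : P.conn (g q) =
      g.rTensor Ω[B⁄k] ((twistedSum V connM f).conn q) := by
    obtain ⟨q, m⟩ := q
    have h1 : P.conn (θ q) = θ.rTensor Ω[B⁄k] (constConn B V q) +
        P.incl.rTensor Ω[B⁄k] (f.liftBaseChange B q) := by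
      rw [← (β.baseChange B).sum_repr q]
      simp only [map_sum]
      rw [← Finset.sum_add_distrib]
      refine Finset.sum_congr rfl fun i _ => ?_
      generalize (β.baseChange B).repr q i = a
      rw [Module.Basis.baseChange_apply, map_smul, hθβ, hP.leibniz, hc, constConn_smul,
        constConn_tmul, Derivation.map_one_eq_zero, TensorProduct.tmul_zero, smul_zero, zero_add,
        LinearMap.rTensor_tmul, hθβ, map_smul, LinearMap.liftBaseChange_tmul, one_smul, map_smul,
        add_comm]
    refine Eq.trans ?_ (congrArg (g.rTensor Ω[B⁄k]) (twistedSum_conn connM f q m)).symm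
    rw [map_add, ← LinearMap.rTensor_comp_apply, ← LinearMap.rTensor_comp_apply, hg,
      LinearMap.coprod_inl, LinearMap.coprod_inr, LinearMap.coprod_apply, map_add P.conn, h1,
      hP.incl_horizontal, map_add, add_assoc]
  refine ExtData.isomorphic_of_bijective (P' := twistedSum V connM f) g hbij (fun m => ?_) hproj hconn
  change θ 0 + P.incl m = P.incl m
  rw [map_zero, zero_add]

theorem twistedSum_exists_lift (h : V) : ∃ p, (twistedSum V connM f).proj p = 1 ⊗ₜ h ∧
    (twistedSum V connM f).conn p = (twistedSum V connM f).incl.rTensor Ω[B⁄k] (f h) := by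
  refine ⟨((1 : B) ⊗ₜ h, 0), rfl, (twistedSum_conn connM f _ _).trans ?_⟩
  rw [constConn_tmul, Derivation.map_one_eq_zero, TensorProduct.tmul_zero, map_zero, zero_add,
    map_zero, add_zero, LinearMap.liftBaseChange_tmul, one_smul]
  rfl

variable {f}

/-- Two representatives of a class differ by ∇s, and the lift is corrected by the image of s. So
every representative of the extension class is realized. -/
theorem ExtData.IsExtension.exists_lift {Q : Type u} [AddCommGroup Q] [Module B Q]
    {connQ : Q → Q ⊗[B] Ω[B⁄k]} {P : ExtData.{u, v} k B M Q} (hP : P.IsExtension connM connQ)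
    {q : Q} {p : P.carrier} {ξ ξ' : M ⊗[B] Ω[B⁄k]} (h1 : P.proj p = q)
    (h2 : P.conn p = P.incl.rTensor Ω[B⁄k] ξ)
    (h3 : (Submodule.Quotient.mk ξ : _ ⧸ LinearMap.range connM) = Submodule.Quotient.mk ξ') :
    ∃ p, P.proj p = q ∧ P.conn p = P.incl.rTensor Ω[B⁄k] ξ' := by
  obtain ⟨s, hs⟩ := (Submodule.Quotient.eq _).mp h3
  refine ⟨p - P.incl s, ?_, ?_⟩
  · rw [map_sub, h1, hP.exact.apply_apply_eq_zero, sub_zero]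
  · rw [map_sub, h2, hP.incl_horizontal, hs, map_sub, sub_sub_cancel]

theorem ExtData.IsExtension.isomorphic_twistedSum_of_class {ι : Type*} [Fintype ι]
    (β : Module.Basis ι k V) {P : ExtData.{u, v} k B M (B ⊗[k] V)}
    (hP : P.IsExtension connM (constConn B V))
    (h : ∀ v : V, ∃ (p : P.carrier) (ξ : M ⊗[B] Ω[B⁄k]), P.proj p = 1 ⊗ₜ v ∧
      P.conn p = P.incl.rTensor Ω[B⁄k] ξ ∧
        (Submodule.Quotient.mk ξ : _ ⧸ LinearMap.range connM) = Submodule.Quotient.mk (f v)) :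
    P.Isomorphic (twistedSum V connM f) :=
  hP.isomorphic_twistedSum f β fun i => by
    obtain ⟨p, ξ, h1, h2, h3⟩ := h (β i)
    exact hP.exists_lift h1 h2 h3

end TwistedSum

instance {B : Type v} [CommRing B] (N : ℕ) : Module.Projective B (SymPow B N) :=
  Module.Projective.of_split (ofSymPow B N) (toSymPow B N) (LinearMap.ext toSymPow_ofSymPow)

instance {B : Type v} [CommRing B] (N : ℕ) : Module.Finite B (SymPow B N) := by
  exact (Module.Finite.iff_fg (N := homogeneousSubmodule (Fin 3) B N)).mpr
    (homogeneousSubmodule_fg _ B N)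

end EllPolylog

namespace EllPolylog

open MvPolynomial

/-! ### The polylogarithm sheaf -/

variable {k : Type u} [Field k] [CharZero k] [Algebra k ℂ] {g₂ g₃ : k} {L : PeriodPair}
  (H : Uniformizes L g₂ g₃) {I : Type w} (𝔘 : LogCover g₂ g₃ L I)
  (b : Module.Basis (Fin 2) k (H1dR g₂ g₃))

include H in
theorem logConn_smul (N : ℕ) (r : CoordRing g₂ g₃) (m : LogU g₂ g₃ N) :
    logConn g₂ g₃ N (r • m) =
      r • logConn g₂ g₃ N m + m ⊗ₜ KaehlerDifferential.D k (CoordRing g₂ g₃) r := by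
  rw [logConn_eq H, logConn_eq H, (formGen_omega H).D_eq, TensorProduct.tmul_smul,
    TensorProduct.smul_tmul', TensorProduct.smul_tmul', ← TensorProduct.add_tmul, map_smul,
    MvPolynomial.smul_eq_C_mul, Derivation.leibniz, nabla_C, smul_eq_mul, smul_eq_mul, map_add,
    ← MvPolynomial.smul_eq_C_mul, mul_comm, ← MvPolynomial.smul_eq_C_mul, map_smul, map_smul,
    toSymPow_ofSymPow]

variable (ℓ : ℕ → CoordRing g₂ g₃)

include H in
theorem isExtension_polylogExt (N : ℕ) : (polylogExt ℓ b N).IsExtension (logConn g₂ g₃ N)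
    (constConn (CoordRing g₂ g₃) (EllPolylog.H g₂ g₃)) :=
  have : Module.Finite k (EllPolylog.H g₂ g₃) := Module.Finite.of_basis b.dualBasis
  isExtension_twistedSum (polylogForm ℓ b N) (logConn_smul H N)

omit [CharZero k] [Algebra k ℂ] in
theorem hasClass_polylogExt (N : ℕ) : HasClass (polylogExt ℓ b N) (polylogClass ℓ b N) := by
  intro h
  obtain ⟨p, h1, h2⟩ := twistedSum_exists_lift (connM := logConn g₂ g₃ N) (polylogForm ℓ b N) h
  exact ⟨p, polylogForm ℓ b N h, h1, h2, rfl⟩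

omit [CharZero k] [Algebra k ℂ] in
theorem isomorphic_polylogExt {N : ℕ} {P : PolylogData.{u, v} g₂ g₃ N}
    (hP : P.IsExtension (logConn g₂ g₃ N) (constConn (CoordRing g₂ g₃) (EllPolylog.H g₂ g₃)))
    (hc : HasClass P (polylogClass ℓ b N)) : P.Isomorphic (polylogExt ℓ b N) := by
  let β : Module.Basis (Fin 2) k (EllPolylog.H g₂ g₃) := b.dualBasis
  have h : ∀ v : EllPolylog.H g₂ g₃, ∃ (p : P.carrier) (ξ : LogUForm g₂ g₃ N), P.proj p = 1 ⊗ₜ v ∧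
      P.conn p = P.incl.rTensor Ω[CoordRing g₂ g₃⁄k] ξ ∧
        (Submodule.Quotient.mk ξ : H1Log g₂ g₃ N) =
          Submodule.Quotient.mk (polylogForm ℓ b N v) := hc
  exact ExtData.IsExtension.isomorphic_twistedSum_of_class β hP h

theorem isPolylogSheaf_polylogExt :
    IsPolylogSheaf 𝔘 b (polylogExt (fun n => PowerSeries.coeff n (connSeries H)) b) :=
  ⟨_, (isPolylogClass_iff H b 𝔘 _).mpr rfl, fun N =>
    ⟨isExtension_polylogExt H b _ N, hasClass_polylogExt b _ N⟩⟩

theorem IsPolylogSheaf.isomorphic {P : ∀ N, PolylogData.{u, v} g₂ g₃ N}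
    (hP : IsPolylogSheaf 𝔘 b P) (N : ℕ) :
    (P N).Isomorphic (polylogExt (fun n => PowerSeries.coeff n (connSeries H)) b N) := by
  obtain ⟨c, hc, h⟩ := hP
  rw [isPolylogClass_iff H b 𝔘] at hc
  subst hc
  exact isomorphic_polylogExt b _ (h N).1 (h N).2

end EllPolylog

namespace EllPolylog

/-! ### Decomposition of a rational function into its parts at the closed points -/

section Local

variable {A : Type u} [CommRing A] [Ring.DimensionLEOne A]

/-- The primes of the product are nonzero, hence maximal. Those contained in m are equal to m and
are collected in the power, the others in J. -/
theorem _root_.Ideal.exists_pow_mul_le_prod {m : Ideal A} [m.IsMaximal]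
    (Z : Multiset (PrimeSpectrum A)) (hZ : (Z.map PrimeSpectrum.asIdeal).prod ≠ ⊥) :
    ∃ (n : ℕ) (J : Ideal A), ¬ J ≤ m ∧ m ^ n * J ≤ (Z.map PrimeSpectrum.asIdeal).prod := by
  induction Z using Multiset.induction_on with
  | empty =>
    refine ⟨0, ⊤, fun h => Ideal.IsPrime.ne_top (I := m) inferInstance (top_le_iff.mp h), ?_⟩
    simp
  | cons p Z ih =>
    rw [Multiset.map_cons, Multiset.prod_cons] at hZ ⊢
    obtain ⟨n, J, hJ, h⟩ := ih (right_ne_zero_of_mul hZ)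
    by_cases hp : p.asIdeal ≤ m
    · have e : p.asIdeal = m := (p.2.isMaximal (left_ne_zero_of_mul hZ)).eq_of_le
        (Ideal.IsPrime.ne_top inferInstance) hp
      refine ⟨n + 1, J, hJ, ?_⟩
      rw [e, pow_succ', mul_assoc]
      exact Ideal.mul_mono_right h
    · refine ⟨n, p.asIdeal * J, fun hle => ?_, ?_⟩
      · exact ((Ideal.IsPrime.mul_le inferInstance).mp hle).elim hp hJ
      · rw [mul_left_comm]
        exact Ideal.mul_mono_right h

variable [IsNoetherianRing A]

theorem _root_.Ideal.exists_pow_mul_le [IsDomain A] (hA : ¬ IsField A) {c : A} (hc : c ≠ 0) (m : Ideal A) [m.IsMaximal] :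
    ∃ (n : ℕ) (J : Ideal A), ¬ J ≤ m ∧ m ^ n * J ≤ Ideal.span {c} := by
  obtain ⟨Z, hZ, hZ0⟩ := PrimeSpectrum.exists_primeSpectrum_prod_le_and_ne_bot_of_domain hA
    (I := Ideal.span {c}) (by simpa using hc)
  obtain ⟨n, J, hJ, h⟩ := Ideal.exists_pow_mul_le_prod (m := m) Z hZ0
  exact ⟨n, J, hJ, h.trans hZ⟩

/-- In dimension one the maximal ideals containing c ≠ 0 are minimal over (c), and a noetherian ring
has finitely many of these. -/
theorem _root_.MaximalSpectrum.finite_setOf_mem {c : A} (hc : c ≠ 0) :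
    {m : MaximalSpectrum A | c ∈ m.asIdeal}.Finite := by
  have h := Ideal.finite_minimalPrimes_of_isNoetherianRing A (Ideal.span {c})
  refine (h.preimage (f := MaximalSpectrum.asIdeal)
    (fun m _ m' _ e => MaximalSpectrum.ext e)).subset fun m hm => ?_
  refine ⟨⟨m.isMaximal.isPrime, (Ideal.span_singleton_le_iff_mem _).mpr hm⟩, fun p hp hpm => ?_⟩
  have hp0 : p ≠ ⊥ := fun h0 => hc (by
    have := hp.2 (Ideal.mem_span_singleton_self c); rwa [h0, Ideal.mem_bot] at this)
  exact ((hp.1.isMaximal hp0).eq_of_le m.isMaximal.ne_top hpm).ge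

end Local

variable {k : Type u} [Field k] [CharZero k] [Algebra k ℂ] {g₂ g₃ : k} {L : PeriodPair}

instance : Ring.DimensionLEOne (CoordRing g₂ g₃) := by
  have : Module.Finite (Polynomial k) (CoordRing g₂ g₃) :=
    Module.Finite.of_basis (WeierstrassCurve.Affine.CoordinateRing.basis (curve g₂ g₃))
  exact Ring.DimensionLEOne.of_isIntegral (Polynomial k) _

instance : IsNoetherianRing (CoordRing g₂ g₃) :=
  inferInstanceAs (IsNoetherianRing (AdjoinRoot _))

variable (H : Uniformizes L g₂ g₃)

include H in
theorem not_isField_coordRing : ¬ IsField (CoordRing g₂ g₃) := fun h => by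
  obtain ⟨r, hr⟩ := h.mul_inv_cancel (x_ne_zero (g₂ := g₂) (g₃ := g₃))
  have hr0 : r ≠ 0 := fun h0 => by simp [h0] at hr
  have e : (laurentR H (x g₂ g₃) * laurentR H r).orderTop = 0 := by
    rw [← map_mul, hr, map_one, HahnSeries.orderTop_one]
  rw [HahnSeries.orderTop_mul, laurentR_x, orderTop_pHat, orderTop_laurentR H hr0,
    ← WithTop.coe_add] at e
  have := WithTop.coe_eq_zero.mp e
  omega

-- Write f = a/c and choose mⁿJ ⊆ (c) with J not in m. Then 1 = u + e with u ∈ mⁿ and e ∈ J, and f'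
-- = ef. The difference uf becomes a function on U after multiplication by an element of J outside
-- m; and ef does so after multiplication by an element of mⁿ outside m', for each m' ≠ m.
include H in
theorem exists_regularAt_sub (f : FunField g₂ g₃) (m : MaximalSpectrum (CoordRing g₂ g₃)) :
    ∃ f' : FunField g₂ g₃, RegularAt (some m) (f - f') ∧
      ∀ m' : MaximalSpectrum (CoordRing g₂ g₃), m' ≠ m → RegularAt (some m') f' := by
  obtain ⟨a, c, hc, hf⟩ := exists_mul_eq f
  have hm := m.isMaximal
  obtain ⟨n, J, hJ, h⟩ := Ideal.exists_pow_mul_le (not_isField_coordRing H) hc m.asIdeal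
  have htop : m.asIdeal ^ n ⊔ J = ⊤ := by
    by_contra hne
    obtain ⟨m', hm', hle⟩ := Ideal.exists_le_maximal _ hne
    rcases n with _ | n
    · simp at hne
    have e : m.asIdeal = m' := hm.eq_of_le hm'.ne_top
      ((Ideal.IsPrime.pow_le_iff (hP := hm'.isPrime) (Nat.succ_ne_zero n)).mp (le_sup_left.trans hle))
    exact hJ (e ▸ le_sup_right.trans hle)
  obtain ⟨u, hu, e, he, hue⟩ := Submodule.mem_sup.mp (htop ▸ Submodule.mem_top : (1 : CoordRing g₂ g₃) ∈ _)
  have key (s t : CoordRing g₂ g₃) (hst : t * s ∈ m.asIdeal ^ n * J) :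
      ∃ r, algebraMap (CoordRing g₂ g₃) (FunField g₂ g₃) s * f * algebraMap _ _ t =
        algebraMap (CoordRing g₂ g₃) _ r := by
    obtain ⟨q, hq⟩ := Ideal.mem_span_singleton'.mp (h hst)
    refine ⟨q * a, ?_⟩
    have e1 := congrArg (algebraMap _ (FunField g₂ g₃)) hq
    rw [RingHom.map_mul, RingHom.map_mul] at e1
    rw [RingHom.map_mul, ← hf]
    linear_combination -f * e1
  refine ⟨algebraMap _ _ e * f, ?_, fun m' hm' => ?_⟩
  · obtain ⟨t, ht, htm⟩ := SetLike.not_le_iff_exists.mp hJ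
    obtain ⟨r, hr⟩ := key u t (by rw [mul_comm t u]; exact Ideal.mul_mem_mul hu ht)
    refine ⟨r, t, htm, ?_⟩
    rw [← hr]
    have e1 := congrArg (algebraMap _ (FunField g₂ g₃)) hue
    rw [RingHom.map_add, RingHom.map_one] at e1
    linear_combination -f * algebraMap _ _ t * e1
  · have : ¬ m.asIdeal ^ n ≤ m'.asIdeal := fun hle => hm' (MaximalSpectrum.ext
      (hm.eq_of_le m'.isMaximal.ne_top (Ideal.IsPrime.le_of_pow_le (hP := m'.isMaximal.isPrime) hle)).symm)
    obtain ⟨t, ht, htm⟩ := SetLike.not_le_iff_exists.mp this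
    obtain ⟨r, hr⟩ := key e t (Ideal.mul_mem_mul ht he)
    exact ⟨r, t, htm, hr⟩

/-- The ideal of the functions `s` on `U` such that `s f` is a function on `U`. -/
def denominators (f : FunField g₂ g₃) : Ideal (CoordRing g₂ g₃) where
  carrier := {s | ∃ r, f * algebraMap _ _ s = algebraMap (CoordRing g₂ g₃) _ r}
  add_mem' := by
    rintro s t ⟨r, hr⟩ ⟨q, hq⟩
    exact ⟨r + q, by rw [RingHom.map_add, RingHom.map_add, mul_add, hr, hq]⟩
  zero_mem' := ⟨0, by rw [RingHom.map_zero, mul_zero]⟩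
  smul_mem' := by
    rintro c s ⟨r, hr⟩
    exact ⟨c * r, by rw [smul_eq_mul, RingHom.map_mul, RingHom.map_mul, mul_left_comm, hr]⟩

omit [CharZero k] [Algebra k ℂ] in
theorem exists_eq_algebraMap_of_denominators_eq_top {f : FunField g₂ g₃}
    (h : denominators f = ⊤) : ∃ r, f = algebraMap (CoordRing g₂ g₃) _ r := by
  obtain ⟨r, hr⟩ := (Ideal.eq_top_iff_one _).mp h
  exact ⟨r, by rw [← hr, RingHom.map_one, mul_one]⟩

omit [CharZero k] [Algebra k ℂ] in
theorem exists_eq_algebraMap_of_regularAt {f : FunField g₂ g₃}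
    (h : ∀ m : MaximalSpectrum (CoordRing g₂ g₃), RegularAt (some m) f) :
    ∃ r, f = algebraMap (CoordRing g₂ g₃) _ r := by
  have hI : denominators f = ⊤ := by
    by_contra hne
    obtain ⟨m, hm, hle⟩ := Ideal.exists_le_maximal _ hne
    obtain ⟨a, b, hb, e⟩ := h ⟨m, hm⟩
    exact hb (hle ⟨a, e⟩)
  exact exists_eq_algebraMap_of_denominators_eq_top hI

omit [CharZero k] [Algebra k ℂ] in
theorem finite_not_regularAt (f : FunField g₂ g₃) :
    {m : MaximalSpectrum (CoordRing g₂ g₃) | ¬ RegularAt (some m) f}.Finite := by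
  obtain ⟨a, b, hb, e⟩ := exists_mul_eq f
  refine (MaximalSpectrum.finite_setOf_mem hb).subset fun m hm => ?_
  by_contra hbm
  exact hm ⟨a, b, hbm, e⟩

/-- Local primitives of the polar parts can be glued. -/
theorem exists_eq_add_dK {g : FunField g₂ g₃}
    (h : ∀ m : MaximalSpectrum (CoordRing g₂ g₃), ∃ f, RegularAt (some m) (g - dK H f)) :
    ∃ r f, g = algebraMap (CoordRing g₂ g₃) _ r + dK H f := by
  classical
  choose F hF using h
  choose G hG hG' using fun m => exists_regularAt_sub H (F m) m
  set T := (finite_not_regularAt g).toFinset with hT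
  suffices hreg : ∀ m : MaximalSpectrum (CoordRing g₂ g₃),
      RegularAt (some m) (g - dK H (∑ m' ∈ T, G m')) by
    obtain ⟨r, hr⟩ := exists_eq_algebraMap_of_regularAt hreg
    exact ⟨r, _, by rw [← hr, sub_add_cancel]⟩
  intro m
  have hsum : ∀ m, dK H (∑ m' ∈ T.erase m, G m') ∈ localRing H (some m) := fun m =>
    regularAt_dK H _ ((mem_localRing H).mp ((localRing H (some m)).sum_mem fun m' hm' =>
      hG' m' m (Finset.ne_of_mem_erase hm').symm))
  -- At m ∈ T only the primitive attached to m has a pole, and it removes the polar part of g. At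
  -- the other points g and all the primitives are regular.
  by_cases hm : m ∈ T
  · rw [← Finset.add_sum_erase _ _ hm, map_add]
    have e : g - (dK H (G m) + dK H (∑ m' ∈ T.erase m, G m')) =
        (g - dK H (F m)) + dK H (F m - G m) - dK H (∑ m' ∈ T.erase m, G m') := by
      rw [map_sub]; ring
    rw [e]
    exact (localRing H (some m)).sub_mem ((localRing H (some m)).add_mem (hF m)
      (regularAt_dK H _ (hG m))) (hsum m)
  · have := hsum m
    rw [Finset.erase_eq_of_notMem hm] at this
    exact (localRing H (some m)).sub_mem (by simpa [hT, mem_localRing] using hm) this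

/-- Membership in the space of differentials of the second kind. -/
theorem smul_mem_secondKind_iff {g : FunField g₂ g₃} : g • omegaK g₂ g₃ ∈ secondKind g₂ g₃ ↔
    ∀ P : Pt g₂ g₃, ∃ f, RegularAt P (g - dK H f) := by
  have hω := formGen_omegaK H
  have hd (f : FunField g₂ g₃) : dRat k f = dK H f • omegaK g₂ g₃ := hω.D_eq f
  rw [secondKind, Submodule.mem_iInf]
  refine forall_congr' fun P => ⟨fun h => ?_, fun ⟨f, hf⟩ => ?_⟩
  · obtain ⟨ξ, hξ, _, ⟨f, rfl⟩, e⟩ := Submodule.mem_sup.mp h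
    refine ⟨f, (smul_mem_stalkForm_iff H P _).mp ?_⟩
    rw [sub_smul, ← e, hd, add_sub_cancel_right]
    exact hξ
  · refine Submodule.mem_sup.mpr ⟨_, (smul_mem_stalkForm_iff H P _).mpr hf, _, ⟨f, rfl⟩, ?_⟩
    rw [hd, ← add_smul, sub_add_cancel]

end EllPolylog

/-! ### Ideals stable under a derivation -/

section Stable

variable {k : Type*} [Field k] [CharZero k] {A : Type*} [CommRing A] [Algebra k A]
  (D : Derivation k A A)

/-- The ring homomorphism `a ↦ ∑ Dⁿ(a) wⁿ / n!`. -/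
def PowerSeries.flowHom : A →+* PowerSeries A where
  toFun := flow D
  map_one' := by
    ext n
    rcases n with _ | n
    · simp [flow]
    · have h : ∀ n, D^[n + 1] 1 = 0 := fun n => by
        rw [Function.iterate_succ_apply, Derivation.map_one_eq_zero, iterate_map_zero]
      rw [flow, coeff_mk, h, mul_zero, coeff_one, if_neg n.succ_ne_zero]
  map_mul' := flow_mul D
  map_zero' := by
    ext n
    rw [flow, coeff_mk, iterate_map_zero, mul_zero, map_zero]
  map_add' := flow_add D

/-- A proper ideal which is stable under a derivation lies in a stable prime ideal. -/
theorem Ideal.exists_isPrime_of_stable {I : Ideal A} (hI : I ≠ ⊤) (h : ∀ a ∈ I, D a ∈ I) :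
    ∃ p : Ideal A, p.IsPrime ∧ I ≤ p ∧ ∀ a ∈ p, D a ∈ p := by
  obtain ⟨m, hm, hle⟩ := I.exists_le_maximal hI
  have := hm.isPrime
  -- The flow followed by reduction modulo m takes values in a domain, so its kernel is prime. It
  -- carries D to d/dw, so the kernel is stable.
  let Φ : A →+* PowerSeries (A ⧸ m) := (PowerSeries.map (Ideal.Quotient.mk m)).comp
    (PowerSeries.flowHom D)
  have hΦ (a : A) : Φ a = PowerSeries.map (Ideal.Quotient.mk m) (PowerSeries.flow D a) := rfl
  refine ⟨RingHom.ker Φ, RingHom.ker_isPrime Φ, fun a ha => ?_, fun a ha => ?_⟩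
  · have hn : ∀ n, D^[n] a ∈ I := fun n => by
      induction n with
      | zero => exact ha
      | succ n ih => rw [Function.iterate_succ_apply']; exact h _ ih
    rw [RingHom.mem_ker, hΦ]
    ext n
    rw [PowerSeries.coeff_map, PowerSeries.flow, PowerSeries.coeff_mk, map_zero,
      Ideal.Quotient.eq_zero_iff_mem]
    exact m.mul_mem_left _ (hle (hn n))
  · rw [RingHom.mem_ker, hΦ] at ha ⊢
    rw [← PowerSeries.derivative_flow, ← PowerSeries.derivative_map, ha, map_zero]

end Stable

/-! ### The classes of ω and η as a basis of the de Rham cohomology. -/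

namespace EllPolylog

open LaurentSeries

variable {k : Type u} [Field k] [CharZero k] [Algebra k ℂ] {g₂ g₃ : k} {L : PeriodPair}
  (H : Uniformizes L g₂ g₃)

omit [Algebra k ℂ] in
/-- The affine curve is smooth: the derivative `6x² - g₂/2` of `y` is invertible modulo `y`. -/
theorem exists_mul_y_add (hΔ : g₂ ^ 3 - 27 * g₃ ^ 2 ≠ 0) : ∃ r s : CoordRing g₂ g₃,
    r * y g₂ g₃ + s * (6 * x g₂ g₃ ^ 2 - algebraMap k _ (g₂ / 2)) = 1 := by
  have h2 : algebraMap k (CoordRing g₂ g₃) (g₂ / 2) * 2 = algebraMap k _ g₂ := by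
    rw [← map_ofNat (algebraMap k (CoordRing g₂ g₃)) 2, ← map_mul]; congr 1; field_simp
  have h0 : algebraMap k (CoordRing g₂ g₃) (g₂ ^ 3 - 27 * g₃ ^ 2)⁻¹ *
      (algebraMap k _ g₂ ^ 3 - 27 * algebraMap k _ g₃ ^ 2) = 1 := by
    rw [← map_pow, ← map_pow, ← map_ofNat (algebraMap k (CoordRing g₂ g₃)) 27, ← map_mul, ← map_sub,
      ← map_mul, inv_mul_cancel₀ hΔ, map_one]
  refine ⟨algebraMap k _ (g₂ ^ 3 - 27 * g₃ ^ 2)⁻¹ *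
      ((27 * algebraMap k _ g₃ - 18 * algebraMap k _ g₂ * x g₂ g₃) * y g₂ g₃),
    algebraMap k _ (g₂ ^ 3 - 27 * g₃ ^ 2)⁻¹ * (2 * (6 * algebraMap k _ g₂ * x g₂ g₃ ^ 2 -
      9 * algebraMap k _ g₃ * x g₂ g₃ - algebraMap k _ g₂ ^ 2)), ?_⟩
  linear_combination h0 + algebraMap k (CoordRing g₂ g₃) (g₂ ^ 3 - 27 * g₃ ^ 2)⁻¹ *
    ((27 * algebraMap k (CoordRing g₂ g₃) g₃ - 18 * algebraMap k _ g₂ * x g₂ g₃) * y_sq g₂ g₃ -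
      (6 * algebraMap k _ g₂ * x g₂ g₃ ^ 2 - 9 * algebraMap k _ g₃ * x g₂ g₃ -
          algebraMap k _ g₂ ^ 2) * h2)

/-- The nonzero ideals of the coordinate ring which are stable under `d/ω` are trivial. -/
theorem eq_top_of_dR_mem {I : Ideal (CoordRing g₂ g₃)} (h0 : I ≠ ⊥)
    (h : ∀ r ∈ I, dR H r ∈ I) : I = ⊤ := by
  by_contra hne
  obtain ⟨p, hp, hle, hd⟩ := Ideal.exists_isPrime_of_stable (dR H) hne h
  have hp0 : p ≠ ⊥ := fun hb => h0 (le_bot_iff.mp (hb ▸ hle))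
  -- By smoothness y and its derivative generate the unit ideal.
  have hy : y g₂ g₃ ∉ p := fun hy => by
    obtain ⟨r, s, e⟩ := exists_mul_y_add H.disc_ne_zero
    refine hp.ne_top (p.eq_top_of_isUnit_mem (x := 1) ?_ isUnit_one)
    rw [← e, ← dR_y H]
    exact p.add_mem (p.mul_mem_left _ hy) (p.mul_mem_left _ (hd _ hy))
  -- The derivative of q(x) is q'(x) y, and y ∉ p, so q'(x) would also lie in p. The degree drops
  -- down to a nonzero constant.
  have key : ∀ n (q : Polynomial k), q ≠ 0 → q.natDegree ≤ n →
      Polynomial.aeval (x g₂ g₃) q ∉ p := by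
    intro n
    induction n with
    | zero =>
      intro q hq hn hmem
      rw [Polynomial.eq_C_of_natDegree_le_zero hn, Polynomial.aeval_C] at hmem
      have hc : q.coeff 0 ≠ 0 := fun hc => hq (by
        rw [Polynomial.eq_C_of_natDegree_le_zero hn, hc, map_zero])
      exact hp.ne_top (p.eq_top_of_isUnit_mem hmem ((IsUnit.mk0 _ hc).map _))
    | succ n ih =>
      intro q hq hn hmem
      rcases Nat.eq_zero_or_pos q.natDegree with h | h
      · exact ih q hq (by omega) hmem
      have hd' := hd _ hmem
      rw [Derivation.map_aeval, dR_x, smul_eq_mul] at hd'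
      have hlt := Polynomial.natDegree_derivative_lt h.ne'
      refine ih _ (fun hz => ?_) (by omega) ((hp.mem_or_mem hd').resolve_right hy)
      exact h.ne' (Polynomial.derivative_eq_zero.mp hz)
  have : Module.Finite (Polynomial k) (CoordRing g₂ g₃) :=
    Module.Finite.of_basis (WeierstrassCurve.Affine.CoordinateRing.basis (curve g₂ g₃))
  -- The coordinate ring is integral over k[x], so a nonzero ideal meets k[x].
  obtain ⟨q, hq, hq0⟩ := Submodule.exists_mem_ne_zero_of_ne_bot
    (Ideal.IsIntegral.comap_ne_bot (Polynomial k) hp0)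
  refine key _ q hq0 le_rfl ?_
  rw [aeval_x]
  exact hq

/-- A rational function whose derivative is regular on `U` is regular on `U`. -/
theorem exists_eq_algebraMap_of_dK {f : FunField g₂ g₃} {r : CoordRing g₂ g₃}
    (h : dK H f = algebraMap _ _ r) : ∃ s, f = algebraMap (CoordRing g₂ g₃) _ s := by
  refine exists_eq_algebraMap_of_denominators_eq_top (eq_top_of_dR_mem H ?_ ?_)
  · obtain ⟨a, b, hb, e⟩ := exists_mul_eq f
    exact fun hbot => hb ((Submodule.eq_bot_iff _).mp hbot b ⟨a, e⟩)
  -- From fs = t follows f · ds = dt − s · df, so the ideal of denominators is stable under the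
  -- derivation.
  · rintro s ⟨t, ht⟩
    refine ⟨dR H t - s * r, ?_⟩
    have e := congrArg (dK H) ht
    rw [Derivation.leibniz, smul_eq_mul, smul_eq_mul, dK_algebraMap, dK_algebraMap, h] at e
    rw [map_sub, RingHom.map_mul, ← e]
    ring

/-- A function on `U` whose derivative is `a + b x` is constant. -/
theorem eq_zero_of_dR_eq {s : CoordRing g₂ g₃} {a b : k}
    (h : dR H s = algebraMap k _ a + algebraMap k _ b * x g₂ g₃) : dR H s = 0 := by
  by_cases hs : s = 0
  · rw [hs, map_zero]
  have e : LaurentSeries.deriv (laurentR H s) =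
      HahnSeries.C (algebraMap k ℂ a) + HahnSeries.C (algebraMap k ℂ b) * pHat L := by
    rw [← laurentR_dR, h, map_add, map_mul, laurentR_x, AlgHom.commutes, AlgHom.commutes,
      algebraMap_eq_C, algebraMap_eq_C]
  have h2 : OrdGE (-2) (LaurentSeries.deriv (laurentR H s)) := by
    rw [e]
    exact ((ordGE_C _).mono (by norm_num)).add (((ordGE_C _).mul (ordGE_pHat L)).mono (by norm_num))
  -- Integration lowers the pole order from 2 to 1. The norm formula shows that a function on U with
  -- at most a simple pole at [0] is constant.
  have h1 : OrdGE (-1) (laurentR H s) := fun n hn => by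
    have := h2 (n - 1) (by omega)
    rw [coeff_deriv, sub_add_cancel] at this
    refine (mul_eq_zero.mp this).resolve_left ?_
    have : (n : ℂ) ≠ 0 := by exact_mod_cast (by omega : n ≠ 0)
    simpa using this
  have hp : poleOrder s ≤ 1 := by
    rw [ordGE_iff, orderTop_laurentR H hs] at h1
    have := WithTop.coe_le_coe.mp h1
    omega
  obtain ⟨p, q, rfl⟩ := exists_eq_add_mul_y s
  have hd := degree_norm_add_mul_y (g₂ := g₂) (g₃ := g₃) p q
  have hd1 : max (2 • p.degree) (2 • q.degree + 3) ≤ 1 := by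
    rw [← hd]
    exact Polynomial.natDegree_le_iff_degree_le.mp hp
  obtain ⟨hd2, hd3⟩ := max_le_iff.mp hd1
  have hq : q = 0 := by
    by_contra hq
    rw [Polynomial.degree_eq_natDegree hq, two_nsmul] at hd3
    have : q.natDegree + q.natDegree + 3 ≤ 1 := by exact_mod_cast hd3
    omega
  have hp0 : p.natDegree ≤ 0 := by
    by_cases hp : p = 0
    · simp [hp]
    rw [Polynomial.degree_eq_natDegree hp, two_nsmul] at hd2
    have : p.natDegree + p.natDegree ≤ 1 := by exact_mod_cast hd2
    omega
  rw [hq, Polynomial.eq_C_of_natDegree_le_zero hp0, map_zero, zero_mul, add_zero,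
    Polynomial.aeval_C, Derivation.map_algebraMap]

/-- The differentials `ω` and `η` are independent modulo exact ones. -/
theorem eq_zero_of_dK_eq {f : FunField g₂ g₃} {a b : k}
    (h : dK H f = algebraMap _ _ (algebraMap k (CoordRing g₂ g₃) a + algebraMap k _ b * x g₂ g₃)) :
    a = 0 ∧ b = 0 := by
  obtain ⟨s, rfl⟩ := exists_eq_algebraMap_of_dK H h
  rw [dK_algebraMap] at h
  have e := IsFractionRing.injective (CoordRing g₂ g₃) (FunField g₂ g₃) h
  rw [eq_zero_of_dR_eq H e] at e
  have := add_mul_y_eq_zero (g₂ := g₂) (g₃ := g₃)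
    (p := Polynomial.C a + Polynomial.C b * Polynomial.X) (q := 0) (by simpa using e.symm)
  have h0 := congrArg (Polynomial.coeff · 0) this.1
  have h1 := congrArg (Polynomial.coeff · 1) this.1
  exact ⟨by simpa using h0, by simpa using h1⟩

include H in
theorem omegaK_mem_secondKind : omegaK g₂ g₃ ∈ secondKind g₂ g₃ := by
  rw [← one_smul (FunField g₂ g₃) (omegaK g₂ g₃), smul_mem_secondKind_iff H]
  exact fun P => ⟨0, by rw [map_zero, sub_zero]; exact (localRing H P).one_mem⟩

/-- At [0] the function y/(2x) = −z⁻¹ + ⋯ has derivative z⁻² + ⋯, which removes the double pole of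
x. A term in z⁻¹ occurs neither in ℘ nor in a derivative. -/
theorem exists_regularAt_x_sub_dK (P : Pt g₂ g₃) :
    ∃ f, RegularAt P (algebraMap (CoordRing g₂ g₃) _ (x g₂ g₃) - dK H f) := by
  match P with
  | some m =>
    exact ⟨0, by rw [map_zero, sub_zero]; exact regularAt_some_algebraMap m _⟩
  | none =>
    have hi := ordGE_inv (ordGE_pHat L) (by rw [coeff_pHat]; exact one_ne_zero)
    rw [coeff_pHat, inv_one] at hi
    have hd : OrdGE (-3) (LaurentSeries.deriv (pHat L)) := (ordGE_pHat L).deriv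
    have hu := hd.mul hi.1
    have hc := coeff_mul_of_ordGE hd hi.1
    rw [coeff_deriv_pHat, hi.2] at hc
    norm_num at hu hc
    refine ⟨algebraMap k _ 2⁻¹ * (algebraMap (CoordRing g₂ g₃) _ (y g₂ g₃) *
      (algebraMap (CoordRing g₂ g₃) _ (x g₂ g₃))⁻¹), (regularAt_none_iff H).mpr fun n hn => ?_⟩
    have e : laurent H (algebraMap k _ 2⁻¹ * (algebraMap (CoordRing g₂ g₃) _ (y g₂ g₃) *
        (algebraMap (CoordRing g₂ g₃) _ (x g₂ g₃))⁻¹)) = HahnSeries.C (algebraMap k ℂ 2⁻¹) *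
          (LaurentSeries.deriv (pHat L) * (pHat L)⁻¹) := by
      rw [map_mul, map_mul, map_inv₀ (laurent H), laurent_algebraMap, laurent_algebraMap,
        laurentR_x, laurentR_y, laurent_const]
    rw [map_sub, laurent_dK, e, laurent_algebraMap, laurentR_x, HahnSeries.coeff_sub, coeff_deriv,
      HahnSeries.C_mul_eq_smul, HahnSeries.coeff_smul]
    rcases eq_or_ne n (-1) with rfl | h1
    · simp [coeff_neg_one_pHat]
    rcases eq_or_ne n (-2) with rfl | h2
    · norm_num [coeff_pHat, hc, map_ofNat]
    · rw [ordGE_pHat L n (by omega), hu _ (by omega)]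
      simp

include H in
theorem eta_mem_secondKind : ratForm (eta g₂ g₃) ∈ secondKind g₂ g₃ := by
  rw [eta_eq, smul_mem_secondKind_iff H]
  exact exists_regularAt_x_sub_dK H

-- Gluing primitives of the polar parts leaves a function on U times ω, and modulo derivatives such
-- a function is a + bx.
include H in
theorem exists_eq_of_mem_secondKind {ξ : RatForm g₂ g₃} (hξ : ξ ∈ secondKind g₂ g₃) :
    ∃ (a b : k) (f : FunField g₂ g₃),
      ξ = a • omegaK g₂ g₃ + b • ratForm (eta g₂ g₃) + dRat k f := by
  have hω := formGen_omegaK H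
  rw [← hω.lift_smul ξ] at hξ ⊢
  obtain ⟨r, f, e⟩ := exists_eq_add_dK H fun m => (smul_mem_secondKind_iff H).mp hξ (some m)
  obtain ⟨a, b, s, rfl⟩ := exists_eq_add_dR H r
  refine ⟨a, b, algebraMap _ _ s + f, ?_⟩
  have hd (f : FunField g₂ g₃) : dRat k f = dK H f • omegaK g₂ g₃ := hω.D_eq f
  rw [hd, e, eta_eq, map_add (dK H), dK_algebraMap, ← algebraMap_smul (FunField g₂ g₃) a,
    ← algebraMap_smul (FunField g₂ g₃) b, smul_smul, ← add_smul, ← add_smul,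
    IsScalarTower.algebraMap_apply k (CoordRing g₂ g₃) (FunField g₂ g₃),
    IsScalarTower.algebraMap_apply k (CoordRing g₂ g₃) (FunField g₂ g₃)]
  congr 1
  rw [map_add, map_add, RingHom.map_mul]
  ring

omit [CharZero k] [Algebra k ℂ] in
/-- A basis of the image of a submodule in a quotient, from two generators. -/
theorem _root_.Submodule.exists_basis_map_mkQ {V : Type*} [AddCommGroup V] [Module k V]
    (N S : Submodule k V) {v w : V} (hv : v ∈ S) (hw : w ∈ S)
    (hspan : ∀ ξ ∈ S, ∃ (a b : k), ∃ n ∈ N, ξ = a • v + b • w + n)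
    (hind : ∀ a b : k, a • v + b • w ∈ N → a = 0 ∧ b = 0) :
    ∃ b : Module.Basis (Fin 2) k (S.map N.mkQ), (b 0).1 = N.mkQ v ∧ (b 1).1 = N.mkQ w := by
  let e : Fin 2 → S.map N.mkQ :=
    ![⟨N.mkQ v, Submodule.mem_map_of_mem hv⟩, ⟨N.mkQ w, Submodule.mem_map_of_mem hw⟩]
  have hli : LinearIndependent k e := by
    rw [LinearIndependent.pair_iff]
    intro a b h
    have h1 := congrArg Subtype.val h
    refine hind a b ((Submodule.Quotient.mk_eq_zero N).mp ?_)
    rw [← Submodule.mkQ_apply, map_add, map_smul, map_smul]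
    exact h1
  have hsp : ⊤ ≤ Submodule.span k (Set.range e) := by
    rintro ⟨_, ξ, hξ, rfl⟩ -
    obtain ⟨a, b, n, hn, rfl⟩ := hspan ξ hξ
    rw [Matrix.range_cons_cons_empty, Submodule.mem_span_pair]
    refine ⟨a, b, Subtype.ext ?_⟩
    have h0 : N.mkQ n = 0 := (Submodule.Quotient.mk_eq_zero N).mpr hn
    have h1 : N.mkQ (a • v + b • w + n) = a • N.mkQ v + b • N.mkQ w := by
      rw [map_add, h0, add_zero, map_add, map_smul, map_smul]
    exact h1.symm
  refine ⟨Module.Basis.mk hli hsp, ?_, ?_⟩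
  · rw [Module.Basis.mk_apply]; rfl
  · rw [Module.Basis.mk_apply]; rfl

include H in
/-- The classes of `ω` and `η` form a basis of the first de Rham cohomology. -/
theorem exists_basis_H1dR : ∃ b : Module.Basis (Fin 2) k (H1dR g₂ g₃),
    (b 0).1 = formClass g₂ g₃ (omega g₂ g₃) ∧ (b 1).1 = formClass g₂ g₃ (eta g₂ g₃) := by
  refine Submodule.exists_basis_map_mkQ (LinearMap.range (dRat k (g₂ := g₂) (g₃ := g₃)))
    (secondKind g₂ g₃) (omegaK_mem_secondKind H) (eta_mem_secondKind H) (fun ξ hξ => ?_) ?_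
  · obtain ⟨a, b, f, e⟩ := exists_eq_of_mem_secondKind H hξ
    exact ⟨a, b, _, ⟨f, rfl⟩, e⟩
  · rintro a b ⟨f, hf⟩
    refine eq_zero_of_dK_eq H (f := f) ((formGen_omegaK H).smul_injective ?_)
    refine ((formGen_omegaK H).D_eq f).symm.trans (hf.trans ?_)
    rw [eta_eq, ← algebraMap_smul (FunField g₂ g₃) a, ← algebraMap_smul (FunField g₂ g₃) b,
      smul_smul, ← add_smul, IsScalarTower.algebraMap_apply k (CoordRing g₂ g₃) (FunField g₂ g₃),
      IsScalarTower.algebraMap_apply k (CoordRing g₂ g₃) (FunField g₂ g₃), map_add,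
      RingHom.map_mul]

end EllPolylog

/-! ### Assembly of the theorem. -/

namespace EllPolylog

/-- The theorem for a field of definition with an embedding in `ℂ`. -/
theorem exists_basis_and_polylog {k : Type u} [Field k] [CharZero k] [Algebra k ℂ] {g₂ g₃ : k}
    {L : PeriodPair} (H : Uniformizes L g₂ g₃) :
    (∃! ℓ : ℕ → CoordRing g₂ g₃, ∀ n, ∀ z ∉ L.lattice,
        pullback L (ℓ n) z = KroneckerTheta.connFun L n z) ∧
    ∃ b : Module.Basis (Fin 2) k (H1dR g₂ g₃),
      (b 0).1 = formClass g₂ g₃ (omega g₂ g₃) ∧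
      (b 1).1 = formClass g₂ g₃ (eta g₂ g₃) ∧
      ∀ ℓ : ℕ → CoordRing g₂ g₃,
        (∀ n, ∀ z ∉ L.lattice,
          pullback L (ℓ n) z = KroneckerTheta.connFun L n z) →
        ∀ (I : Type w) (𝔘 : LogCover g₂ g₃ L I),
          (∀ N h, ResidueEq 𝔘 b N (polylogClass ℓ b N h)
            (identityUpTo g₂ g₃ N h)) ∧
          (∀ c, IsPolylogClass 𝔘 b c ↔ c = polylogClass ℓ b) ∧
          IsPolylogSheaf 𝔘 b (polylogExt ℓ b) ∧
          ∀ P : ∀ N, PolylogData.{u, v} g₂ g₃ N, IsPolylogSheaf 𝔘 b P →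
            ∀ N, (P N).Isomorphic (polylogExt ℓ b N) := by
  refine ⟨⟨fun n => PowerSeries.coeff n (connSeries H),
    fun n z hz => pullback_coeff_connSeries H n hz,
    fun ℓ hℓ => eq_coeff_connSeries H hℓ⟩, ?_⟩
  obtain ⟨b, hb₀, hb₁⟩ := exists_basis_H1dR H
  refine ⟨b, hb₀, hb₁, fun ℓ hℓ I 𝔘 => ?_⟩
  obtain rfl := eq_coeff_connSeries H hℓ
  refine ⟨?_, ?_, ?_, ?_⟩
  · exact residueEq_polylogClass H b 𝔘
  · exact isPolylogClass_iff H b 𝔘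
  · exact isPolylogSheaf_polylogExt H 𝔘 b
  · exact fun _ hP N => IsPolylogSheaf.isomorphic H 𝔘 b hP N

end EllPolylog

end

theorem mainTheorem3 (F : Subfield ℂ) (g₂ g₃ : F) (hΔ : g₂ ^ 3 - 27 * g₃ ^ 2 ≠ 0)
    (L : PeriodPair) (h₂ : L.g₂ = (g₂ : ℂ)) (h₃ : L.g₃ = (g₃ : ℂ)) :
    (∃! ℓ : ℕ → EllPolylog.CoordRing g₂ g₃, ∀ n, ∀ z ∉ L.lattice,
        EllPolylog.pullback L (ℓ n) z = KroneckerTheta.connFun L n z) ∧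
    ∃ b : Module.Basis (Fin 2) F (EllPolylog.H1dR g₂ g₃),
      (b 0).1 = EllPolylog.formClass g₂ g₃ (EllPolylog.omega g₂ g₃) ∧
      (b 1).1 = EllPolylog.formClass g₂ g₃ (EllPolylog.eta g₂ g₃) ∧
      ∀ ℓ : ℕ → EllPolylog.CoordRing g₂ g₃,
        (∀ n, ∀ z ∉ L.lattice,
          EllPolylog.pullback L (ℓ n) z = KroneckerTheta.connFun L n z) →
        ∀ (I : Type w) (𝔘 : EllPolylog.LogCover g₂ g₃ L I),
          (∀ N h, EllPolylog.ResidueEq 𝔘 b N (EllPolylog.polylogClass ℓ b N h)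
            (EllPolylog.identityUpTo g₂ g₃ N h)) ∧
          (∀ c, EllPolylog.IsPolylogClass 𝔘 b c ↔ c = EllPolylog.polylogClass ℓ b) ∧
          EllPolylog.IsPolylogSheaf 𝔘 b (EllPolylog.polylogExt ℓ b) ∧
          ∀ P : ∀ N, EllPolylog.PolylogData.{0, v} g₂ g₃ N, EllPolylog.IsPolylogSheaf 𝔘 b P →
            ∀ N, (P N).Isomorphic (EllPolylog.polylogExt ℓ b N) := by
  exact EllPolylog.exists_basis_and_polylog ⟨hΔ, h₂, h₃⟩
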